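/- Let $N\ge 1$ and let $(A_m)_{m\in\mathbb Z}$ be complex $N\times N$ matrices with $\sum_m\|A_m\|<\infty$ and $A_{-m}=A_m^*$ for all $m$. Put $h(p)=\sum_{m\in\mathbb Z}A_me^{imp}$, $p\in\mathbb R$, and assume that, as a function of $e^{ip}$, $h$ extends holomorphically to an annulus $\{1/r<|z|<r\}$ for some $r>1$. Let $H_0$ be the bounded self-adjoint block Laurent operator on $\mathcal H=\ell^2(\mathbb Z,\mathbb C^N)$ given by $(H_0\psi)_n=\sum_{m\in\mathbb Z}A_{n-m}\psi_m$. Let $\lambda_1,\dots,\lambda_N:\mathbb R\to\mathbb R$ be the $2\pi$-periodic functions such that, for every $p$, $\lambda_1(p),\dots,\lambda_N(p)$ are the eigenvalues of $h(p)$ repeated according to multiplicity, and such that each $\lambda_j$ is real analytic on $[-\pi,\pi)$ (from the right at $-\pi$); such functions exist and are unique up to their order, and they need not be continuous or differentiable at the points of $\pi+2\pi\mathbb Z$. Let $$\kappa(\lambda_j)=\{\lambda_j(p): p\in\mathbb R,\ \lambda_j\text{ is not differentiable at }p\text{ or }\lambda_j'(p)=0\},\qquad \kappa(h)=\bigcup_{j=1}^N\kappa(\lambda_j).$$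 Let $\xi\in C^\infty(\mathbb R)$ be real-valued with $\xi=0$ in a neighbourhood of $0$ and $\xi(x)=1$ for $|x|>a$, for some $a>0$, and let $\xi(\mathbf N/r)$ be the operator $(\xi(\mathbf N/r)\psi)_n=\xi(n/r)\psi_n$ on $\mathcal H$. Let $V$ be a bounded symmetric operator on $\mathcal H$ with $$\lim_{r\to+\infty}r\,\|\xi(\mathbf N/r)V\|=0 .$$ Then every eigenvalue of $H=H_0+V$ that lies outside $\kappa(h)$ has finite multiplicity, and every accumulation point of the set of eigenvalues of $H$ belongs to $\kappa(h)$. -/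

import Mathlib

open Filter Topology
open scoped ENNReal ContDiff

noncomputable section

namespace BlockLaurent

/-- The Hilbert space `ℓ²(ℤ, ℂ^N)`. -/
abbrev Hilb (N : ℕ) : Type := lp (fun _ : ℤ => EuclideanSpace ℂ (Fin N)) 2

/-- The bounded operator on `ℂ^N` (Euclidean norm) given by a matrix. -/
abbrev matOp {N : ℕ} (M : Matrix (Fin N) (Fin N) ℂ) :
    EuclideanSpace ℂ (Fin N) →L[ℂ] EuclideanSpace ℂ (Fin N) :=
  Matrix.toEuclideanCLM (n := Fin N) (𝕜 := ℂ) M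

/-- If the fibre maps `a n` are bounded by `C` and `e` is a permutation of `ℤ`, then
`n ↦ a n (ψ (e n))` is square summable, with norm at most `C ‖ψ‖`. -/
theorem memℓp_fibre {N : ℕ} (a : ℤ → EuclideanSpace ℂ (Fin N) →L[ℂ] EuclideanSpace ℂ (Fin N))
    (C : ℝ) (hC : 0 ≤ C) (ha : ∀ n, ‖a n‖ ≤ C) (e : ℤ ≃ ℤ) (ψ : Hilb N) :
    ∃ h : Memℓp (fun n => a n (ψ (e n))) (2 : ℝ≥0∞),
      ‖(⟨_, h⟩ : Hilb N)‖ ≤ C * ‖ψ‖ := by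
  have h2 : (0 : ℝ) < (2 : ℝ≥0∞).toReal := by norm_num
  have hs : HasSum (fun n => (C * ‖ψ (e n)‖) ^ (2 : ℝ≥0∞).toReal)
      ((C * ‖ψ‖) ^ (2 : ℝ≥0∞).toReal) := by
    have h0 := (e.hasSum_iff (f := fun n => ‖ψ n‖ ^ (2 : ℝ≥0∞).toReal)).mpr
      (lp.hasSum_norm h2 ψ)
    have h1 := h0.mul_left (C ^ (2 : ℝ≥0∞).toReal)
    rw [← Real.mul_rpow hC (norm_nonneg _)] at h1
    refine h1.congr_fun ?_
    intro n
    simp only [Function.comp]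
    rw [Real.mul_rpow hC (norm_nonneg _)]
  have hle : ∀ n, ‖a n (ψ (e n))‖ ^ (2 : ℝ≥0∞).toReal
      ≤ (C * ‖ψ (e n)‖) ^ (2 : ℝ≥0∞).toReal := fun n =>
    Real.rpow_le_rpow (norm_nonneg _)
      (((a n).le_opNorm _).trans (mul_le_mul_of_nonneg_right (ha n) (norm_nonneg _))) h2.le
  have hsum : Summable fun n => ‖a n (ψ (e n))‖ ^ (2 : ℝ≥0∞).toReal :=
    Summable.of_nonneg_of_le (fun n => Real.rpow_nonneg (norm_nonneg _) _) hle hs.summable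
  refine ⟨memℓp_gen hsum, ?_⟩
  refine lp.norm_le_of_tsum_le h2 (by positivity) ?_
  rw [← hs.tsum_eq]
  exact hsum.tsum_le_tsum hle hs.summable

/-- The bounded operator `(T ψ)_n = a_n ψ_{e n}` for uniformly bounded fibre maps `a_n` and a
permutation `e` of `ℤ`. -/
def fibreOp {N : ℕ} (a : ℤ → EuclideanSpace ℂ (Fin N) →L[ℂ] EuclideanSpace ℂ (Fin N))
    (C : ℝ) (hC : 0 ≤ C) (ha : ∀ n, ‖a n‖ ≤ C) (e : ℤ ≃ ℤ) : Hilb N →L[ℂ] Hilb N :=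
  LinearMap.mkContinuous
    { toFun := fun ψ => ⟨fun n => a n (ψ (e n)), (memℓp_fibre a C hC ha e ψ).choose⟩
      map_add' := fun ψ φ => by
        ext1; funext n; exact map_add (a n) (ψ (e n)) (φ (e n))
      map_smul' := fun c ψ => by
        ext1; funext n; exact map_smul (a n) c (ψ (e n)) }
    C (fun ψ => (memℓp_fibre a C hC ha e ψ).choose_spec)

theorem fibreOp_apply {N : ℕ} (a : ℤ → EuclideanSpace ℂ (Fin N) →L[ℂ] EuclideanSpace ℂ (Fin N))
    (C : ℝ) (hC : 0 ≤ C) (ha : ∀ n, ‖a n‖ ≤ C) (e : ℤ ≃ ℤ) (ψ : Hilb N) (n : ℤ) :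
    fibreOp a C hC ha e ψ n = a n (ψ (e n)) := rfl

/-- The operator `ψ ↦ (M ψ_{n-m})_n`: shift by `m` followed by the matrix `M` in each fibre. -/
def shiftOp {N : ℕ} (M : Matrix (Fin N) (Fin N) ℂ) (m : ℤ) : Hilb N →L[ℂ] Hilb N :=
  fibreOp (fun _ => matOp M) ‖matOp M‖ (norm_nonneg _) (fun _ => le_rfl) (Equiv.subRight m)

theorem norm_shiftOp_le {N : ℕ} (M : Matrix (Fin N) (Fin N) ℂ) (m : ℤ) :
    ‖shiftOp M m‖ ≤ ‖matOp M‖ :=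
  ContinuousLinearMap.opNorm_le_bound _ (norm_nonneg _) fun ψ =>
    (memℓp_fibre (fun _ => matOp M) _ (norm_nonneg _) (fun _ => le_rfl)
      (Equiv.subRight m) ψ).choose_spec

/-- The block Laurent operator `H₀ = ∑ₘ Aₘ Sᵐ` on `ℓ²(ℤ, ℂ^N)` (`S` the shift), a norm convergent
series as soon as `∑ ‖Aₘ‖ < ∞`. -/
def laurent {N : ℕ} (A : ℤ → Matrix (Fin N) (Fin N) ℂ) : Hilb N →L[ℂ] Hilb N :=
  ∑' m : ℤ, shiftOp (A m) m

/-- Coordinatewise, `(H₀ ψ)_n = ∑ₘ A_{n-m} ψ_m`. -/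
theorem laurent_apply {N : ℕ} (A : ℤ → Matrix (Fin N) (Fin N) ℂ)
    (hA : Summable fun m => ‖matOp (A m)‖) (ψ : Hilb N) (n : ℤ) :
    HasSum (fun m : ℤ => matOp (A (n - m)) (ψ m)) (laurent A ψ n) := by
  have h0 : HasSum (fun m : ℤ => shiftOp (A m) m) (laurent A) :=
    (Summable.of_norm_bounded hA fun m => norm_shiftOp_le (A m) m).hasSum
  have h1 := h0.mapL (ContinuousLinearMap.apply ℂ (Hilb N) ψ)
  have h2 := h1.mapL (lp.evalCLM ℂ (fun _ : ℤ => EuclideanSpace ℂ (Fin N)) 2 n)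
  have h3 := ((Equiv.subLeft n).hasSum_iff).mpr h2
  refine h3.congr_fun ?_
  intro m
  change _ = matOp (A (n - m)) (ψ (n - (n - m)))
  rw [sub_sub_cancel]

/-- The symbol `h(p) = ∑ₘ Aₘ e^{imp}`. -/
def symbol {N : ℕ} (A : ℤ → Matrix (Fin N) (Fin N) ℂ) (p : ℝ) : Matrix (Fin N) (Fin N) ℂ :=
  Matrix.of fun i j => ∑' m : ℤ, A m i j * Complex.exp (Complex.I * m * p)

/-- The symbol, as a function of `e^{ip}` on the unit circle, extends holomorphically to an
annulus `1/r < |z| < r` with `r > 1`. -/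
def HolomorphicSymbol {N : ℕ} (A : ℤ → Matrix (Fin N) (Fin N) ℂ) : Prop :=
  ∃ r : ℝ, 1 < r ∧ ∃ g : ℂ → Matrix (Fin N) (Fin N) ℂ,
    (∀ i j, DifferentiableOn ℂ (fun z => g z i j) {z : ℂ | 1 / r < ‖z‖ ∧ ‖z‖ < r}) ∧
    ∀ p : ℝ, g (Complex.exp (Complex.I * p)) = symbol A p

/-- `l 0, …, l (N-1)` are `2π`-periodic real functions which list, at each `p`, the eigenvalues of
the matrix `h p` repeated according to multiplicity, and which are real analytic on `[-π, π)`
(at the left end point: from the right). The periodic functions may fail to be smooth, or even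
continuous, at the points of `π + 2πℤ`. -/
structure IsEigenvalueFamily {N : ℕ} (h : ℝ → Matrix (Fin N) (Fin N) ℂ) (l : Fin N → ℝ → ℝ) :
    Prop where
  periodic : ∀ j, Function.Periodic (l j) (2 * Real.pi)
  analytic : ∀ j, AnalyticOn ℝ (l j) (Set.Ico (-Real.pi) Real.pi)
  eigenvalues : ∀ p, (h p).charpoly.roots = Finset.univ.val.map fun j => (l j p : ℂ)

/-- The critical values of a real function: its values at the points where it is not
differentiable or has derivative zero. -/
def criticalValues (f : ℝ → ℝ) : Set ℝ :=
  {x | ∃ p, f p = x ∧ (¬ DifferentiableAt ℝ f p ∨ HasDerivAt f 0 p)}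

/-- The critical set `κ(h) = ⋃ⱼ κ(λⱼ)`. The eigenvalue family `λ₁, …, λ_N` of an analytic Hermitian
symbol exists and is unique up to the order of its members, so that it may be taken with an
existential quantifier. -/
def criticalSet {N : ℕ} (h : ℝ → Matrix (Fin N) (Fin N) ℂ) : Set ℝ :=
  {x | ∃ l : Fin N → ℝ → ℝ, IsEigenvalueFamily h l ∧ ∃ j, x ∈ criticalValues (l j)}

/-- Smooth functions on `ℝ` that vanish near `0` and equal `1` for `|x| > a`, for some `a > 0`. -/
structure Cutoff where
  toFun : ℝ → ℝ
  smooth : ContDiff ℝ ∞ toFun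
  zero_near : ∀ᶠ x in 𝓝 (0 : ℝ), toFun x = 0
  one_far : ∃ a : ℝ, 0 < a ∧ ∀ x, a < |x| → toFun x = 1

theorem Cutoff.bounded (ξ : Cutoff) : ∃ C : ℝ, 0 ≤ C ∧ ∀ x, |ξ.toFun x| ≤ C := by
  obtain ⟨a, ha, h⟩ := ξ.one_far
  obtain ⟨C, hC⟩ := (isCompact_Icc (a := -a) (b := a)).exists_bound_of_continuousOn
    ξ.smooth.continuous.continuousOn
  refine ⟨max C 1, le_max_of_le_right zero_le_one, fun x => ?_⟩
  by_cases hx : a < |x|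
  · rw [h x hx, abs_one]; exact le_max_right _ _
  · exact (hC x (abs_le.mp (not_lt.mp hx))).trans (le_max_left _ _)

theorem norm_smul_id_le {N : ℕ} (c : ℝ) :
    ‖(c : ℂ) • ContinuousLinearMap.id ℂ (EuclideanSpace ℂ (Fin N))‖ ≤ |c| := by
  refine ContinuousLinearMap.opNorm_le_bound _ (abs_nonneg _) fun v => ?_
  change ‖(c : ℂ) • v‖ ≤ _
  rw [norm_smul, Complex.norm_real, Real.norm_eq_abs]

/-- The bounded operator `ξ(𝐍/r)`: multiplication of `ψ_n` by `ξ(n/r)`. -/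
def Cutoff.op (ξ : Cutoff) (N : ℕ) (r : ℝ) : Hilb N →L[ℂ] Hilb N :=
  fibreOp (fun n => (ξ.toFun (n / r) : ℂ) • ContinuousLinearMap.id ℂ _)
    ξ.bounded.choose ξ.bounded.choose_spec.1
    (fun _ => (norm_smul_id_le _).trans (ξ.bounded.choose_spec.2 _)) (Equiv.refl ℤ)

theorem Cutoff.op_apply (ξ : Cutoff) (N : ℕ) (r : ℝ) (ψ : Hilb N) (n : ℤ) :
    ξ.op N r ψ n = (ξ.toFun (n / r) : ℂ) • ψ n := rfl

/-- The set of (real) eigenvalues of an operator. -/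
def pointSpectrum {N : ℕ} (T : Hilb N →L[ℂ] Hilb N) : Set ℝ :=
  {E | Module.End.HasEigenvalue (T : Hilb N →ₗ[ℂ] Hilb N) (E : ℂ)}

end BlockLaurent

end

noncomputable section

/-! ### Schur test, dyadic shells and weighted square norms -/

section

namespace BlockLaurent

open scoped NNReal

/-! Fix `E` outside the critical set. Rellich's theorem gives analytic eigenvalue branches of the
symbol, and each branch that reaches an energy `x` near `E` crosses it with speed bounded below.
Hence the resolvent of the symbol, as a function of `z = e^{ip}` near the unit circle, has boundedly
many poles, all on the circle and simple, with bounded residues, uniformly in `x`. Its Laurent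
coefficients on a circle of radius `ρ > 1` and on the circle of radius `ρ⁻¹` are two inverses of `H₀
- x` under convolution. One decays exponentially to the right, the other to the left, and they
differ by residues, so both are bounded. Using the first on the right half line and the second on
the left, `u n` is bounded by the values of `(H₀ - x) u` farther out plus an exponentially localized
term. The Schur test turns this into a Hardy inequality, `u` in `ℓ²` against `(1 + |n|) (H₀ - x) u`
in `ℓ²`, uniform in `x` and valid with weights (`exists_hardyBound`).

The hypothesis makes `V` of size `o(1/|n|)`, exactly what the Hardy inequality can absorb. It does
so on every dyadic shell separately, without summability over shells. For this reason the argument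
runs in weighted spaces: the weight `Wo j` is `1` up to shell `j` and loses a factor `3/4` per shell
beyond, and the sequences `u = U φ` with `φ` in `ℓ²` may grow by the corresponding factor. This has
two consequences. A solution of `(H - x) u = 0` has little mass near a far shell `j` compared with
its mass up to that shell (`concentration`). The kernel of `H - E` in the weighted space is finite
dimensional, and `H - E` is coercive on its orthogonal complement (`res_gap`).

Finite multiplicity follows, since `ℓ²` eigenvectors lie in the weighted kernel. For isolation let
`ψ` be an eigenvector for `E + l` with `l ≠ 0` small, and take `j` with `2^j` comparable to `1/|l|`.
Choose `φ` in the weighted kernel such that the cutoff of `ψ - φ` at shell `j` is orthogonal to that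
kernel. Applying `H - E` to this cutoff leaves a commutator and `l` times the cutoff of `ψ`; both
live near shell `j`, where there is little mass, so coercivity makes the truncations of `ψ` and `φ`
nearly equal. On the other hand, symmetry of `H` gives `l ⟨ψ, χφ⟩ = ⟨ψ, (H - E) χφ⟩`, again a
commutator that is small compared with `|l|`, so the truncations are nearly orthogonal. Nearly equal
and nearly orthogonal vectors vanish, a contradiction (`finite_and_isolated`). -/

theorem ennreal_tsum_mul_sq_le {κ : Type*} (f g : κ → ℝ≥0∞) :
    (∑' j, f j * g j) ^ 2 ≤ (∑' j, f j ^ 2) * ∑' j, g j ^ 2 := by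
  -- Sums are integrals for the counting measure on the discrete σ-algebra, so Hölder with exponents
  -- 2 and 2 applies.
  let _ : MeasurableSpace κ := ⊤
  have h := ENNReal.lintegral_mul_le_Lp_mul_Lq (MeasureTheory.Measure.count (α := κ))
    (Real.HolderConjugate.two_two) (f := f) (g := g) measurable_from_top.aemeasurable
    measurable_from_top.aemeasurable
  simp only [MeasureTheory.lintegral_count, Pi.mul_apply] at h
  calc (∑' j, f j * g j) ^ 2
      ≤ ((∑' j, f j ^ (2 : ℝ)) ^ (1 / 2 : ℝ) * (∑' j, g j ^ (2 : ℝ)) ^ (1 / 2 : ℝ)) ^ 2 := by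
        gcongr
    _ = _ := by
        rw [mul_pow, ← ENNReal.rpow_natCast, ← ENNReal.rpow_natCast, ← ENNReal.rpow_mul,
          ← ENNReal.rpow_mul]
        norm_num

/-- The Schur test. -/
theorem schur_test {ι κ : Type*} (k : ι → κ → ℝ≥0∞) (x : κ → ℝ≥0∞) (p : ι → ℝ≥0∞) (q : κ → ℝ≥0)
    (C : ℝ≥0∞) (hq : ∀ j, q j ≠ 0) (h1 : ∀ i, ∑' j, k i j * q j ≤ C * p i)
    (h2 : ∀ j, ∑' i, k i j * p i ≤ C * q j) :
    ∑' i, (∑' j, k i j * x j) ^ 2 ≤ C ^ 2 * ∑' j, x j ^ 2 := by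
  have hq' : ∀ j, (q j : ℝ≥0∞) ≠ 0 := fun j => by exact_mod_cast hq j
  have key : ∀ i, (∑' j, k i j * x j) ^ 2
      ≤ C * p i * ∑' j, k i j * (x j ^ 2 / q j) := by
    intro i
    -- Cauchy–Schwarz for the splitting `k x = (k q)^{1/2} · (k / q)^{1/2} x`. The first factor is
    -- summed by `h1`; after exchanging the sums, `h2` handles the second.
    have hcs := ennreal_tsum_mul_sq_le (fun j => (k i j * q j) ^ (1 / 2 : ℝ))
      (fun j => (k i j / q j) ^ (1 / 2 : ℝ) * x j)
    have e1 : ∀ j, (k i j * q j) ^ (1 / 2 : ℝ) * ((k i j / q j) ^ (1 / 2 : ℝ) * x j)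
        = k i j * x j := by
      intro j
      rw [← mul_assoc, ← ENNReal.mul_rpow_of_nonneg _ _ (by norm_num : (0 : ℝ) ≤ 1 / 2)]
      have : k i j * q j * (k i j / q j) = k i j ^ (2 : ℝ) := by
        rw [div_eq_mul_inv, mul_mul_mul_comm, ENNReal.mul_inv_cancel (hq' j) ENNReal.coe_ne_top,
          mul_one, ENNReal.rpow_two, sq]
      rw [this, ← ENNReal.rpow_mul]; norm_num
    have e2 : ∀ y : ℝ≥0∞, (y ^ (1 / 2 : ℝ)) ^ 2 = y := by
      intro y
      rw [← ENNReal.rpow_natCast, ← ENNReal.rpow_mul]; norm_num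
    simp only [e1, mul_pow, e2] at hcs
    refine hcs.trans ?_
    refine mul_le_mul' (h1 i) (le_of_eq (tsum_congr fun j => ?_))
    rw [div_eq_mul_inv, div_eq_mul_inv]; ring
  calc ∑' i, (∑' j, k i j * x j) ^ 2
      ≤ ∑' i, C * p i * ∑' j, k i j * (x j ^ 2 / q j) := ENNReal.tsum_le_tsum key
    _ = ∑' j, ∑' i, C * p i * (k i j * (x j ^ 2 / q j)) := by
        rw [ENNReal.tsum_comm]; simp only [ENNReal.tsum_mul_left]
    _ = ∑' j, C * (x j ^ 2 / q j) * ∑' i, k i j * p i := by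
        refine tsum_congr fun j => ?_
        rw [← ENNReal.tsum_mul_left]
        exact tsum_congr fun i => by ring
    _ ≤ ∑' j, C * (x j ^ 2 / q j) * (C * q j) := by
        gcongr with j; exact h2 j
    _ = ∑' j, C ^ 2 * x j ^ 2 := by
        refine tsum_congr fun j => ?_
        calc C * (x j ^ 2 / q j) * (C * q j) = C ^ 2 * (x j ^ 2 / q j * q j) := by ring
          _ = _ := by rw [ENNReal.div_mul_cancel (hq' j) ENNReal.coe_ne_top]
    _ = _ := ENNReal.tsum_mul_left

/-- With truncated subtraction `(k - l) + (l - k)` is `|k - l|`, the form in which distances between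
shells appear throughout. The two one-sided geometric series both count the diagonal. -/
theorem tsum_geometric_dist_le (θ : ℝ≥0) (k : ℕ) :
    ∑' l : ℕ, (θ : ℝ≥0∞) ^ ((k - l) + (l - k)) ≤ 2 * (1 - θ : ℝ≥0∞)⁻¹ := by
  have h : ∀ l : ℕ, (θ : ℝ≥0∞) ^ ((k - l) + (l - k)) ≤
      (if l ≤ k then (θ : ℝ≥0∞) ^ (k - l) else 0) + (if k ≤ l then (θ : ℝ≥0∞) ^ (l - k) else 0) := by
    intro l
    rcases le_total l k with h | h
    · rw [if_pos h, Nat.sub_eq_zero_of_le h, add_zero]; exact le_self_add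
    · rw [if_pos h, Nat.sub_eq_zero_of_le h, zero_add]; exact le_add_self
  refine (ENNReal.tsum_le_tsum h).trans ?_
  rw [ENNReal.tsum_add, two_mul]
  refine add_le_add ?_ ?_
  · have : ∑' l : ℕ, (if l ≤ k then (θ : ℝ≥0∞) ^ (k - l) else 0)
        = ∑ l ∈ Finset.range (k + 1), (θ : ℝ≥0∞) ^ (k - l) := by
      rw [tsum_eq_sum (s := Finset.range (k + 1))]
      · exact Finset.sum_congr rfl fun l hl => if_pos (by simpa [Nat.lt_succ_iff] using hl)
      · intro l hl; exact if_neg (by simpa [Nat.lt_succ_iff] using hl)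
    have h2 := Finset.sum_range_reflect (fun l => (θ : ℝ≥0∞) ^ l) (k + 1)
    simp only [Nat.add_sub_cancel] at h2
    rw [this, h2, ← ENNReal.tsum_geometric]
    exact ENNReal.sum_le_tsum _
  · rw [← ENNReal.tsum_geometric]
    have h0 : ∑' l : ℕ, (if k ≤ l then (θ : ℝ≥0∞) ^ (l - k) else 0) =
        ∑' l : {l : ℕ // k ≤ l}, (θ : ℝ≥0∞) ^ ((l : ℕ) - k) := by
      rw [← tsum_subtype_eq_of_support_subset (s := {l | k ≤ l})]
      · refine tsum_congr fun l => if_pos l.2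
      · intro l hl
        by_contra h
        exact hl (if_neg h)
    rw [h0]
    exact ENNReal.tsum_comp_le_tsum_of_injective (f := fun l : {l : ℕ // k ≤ l} => (l : ℕ) - k)
      (fun x y hxy => Subtype.ext (by
        have := x.2; have := y.2; simp only at hxy; omega)) _

/-- Young's inequality for a geometrically decaying kernel on `ℕ`. -/
theorem geometric_kernel_le (θ : ℝ≥0) (M : ℝ≥0∞) (b a : ℕ → ℝ≥0∞)
    (h : ∀ k, b k ≤ ∑' l, M * (θ : ℝ≥0∞) ^ ((k - l) + (l - k)) * a l) :
    ∑' k, b k ^ 2 ≤ (M * (2 * (1 - θ : ℝ≥0∞)⁻¹)) ^ 2 * ∑' l, a l ^ 2 := by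
  calc ∑' k, b k ^ 2 ≤ ∑' k, (∑' l, M * (θ : ℝ≥0∞) ^ ((k - l) + (l - k)) * a l) ^ 2 := by
        gcongr with k; exact h k
    _ ≤ _ := by
        refine schur_test _ a (fun _ => 1) (fun _ => 1) _ (fun _ => one_ne_zero) ?_ ?_
        · intro i
          simp only [ENNReal.coe_one, mul_one, ENNReal.tsum_mul_left]
          gcongr
          exact tsum_geometric_dist_le θ i
        · intro j
          simp only [ENNReal.coe_one, mul_one, ENNReal.tsum_mul_left]
          gcongr
          simp_rw [add_comm (_ - j) (j - _)]
          exact tsum_geometric_dist_le θ j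

/-- `1 + |n|`. -/
def jb (n : ℤ) : ℕ := n.natAbs + 1

/-- The number of the dyadic shell of `n`. -/
def sh (n : ℤ) : ℕ := Nat.log 2 (jb n)

theorem jb_pos (n : ℤ) : 0 < jb n := Nat.succ_pos _

theorem one_le_jb (n : ℤ) : 1 ≤ jb n := jb_pos n

theorem jb_neg (n : ℤ) : jb (-n) = jb n := by simp [jb]

theorem jb_sub_comm (n m : ℤ) : jb (n - m) = jb (m - n) := by rw [← jb_neg, neg_sub]

/-- Peetre's inequality: polynomial weights pass through a convolution at the price of a power of
`jb (n - m)`. Its logarithm is `sh_le_add`. -/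
theorem jb_le_mul (n m : ℤ) : jb n ≤ jb m * jb (n - m) := by
  have h : n.natAbs ≤ m.natAbs + (n - m).natAbs := by omega
  unfold jb
  nlinarith [Nat.zero_le (m.natAbs * (n - m).natAbs)]

theorem jb_le_add (n m : ℤ) : jb n ≤ jb m + (n - m).natAbs := by
  unfold jb; omega

theorem two_pow_sh_le (n : ℤ) : 2 ^ sh n ≤ jb n := Nat.pow_log_le_self 2 (jb_pos n).ne'

theorem jb_lt_two_pow (n : ℤ) : jb n < 2 ^ (sh n + 1) := Nat.lt_pow_succ_log_self one_lt_two _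

theorem sh_le_add (n m : ℤ) : sh n ≤ sh m + sh (n - m) + 1 := by
  have h1 : 2 ^ sh n < 2 ^ (sh m + 1 + (sh (n - m) + 1)) :=
    (two_pow_sh_le n).trans_lt ((jb_le_mul n m).trans_lt (by
      rw [pow_add]
      exact Nat.mul_lt_mul'' (jb_lt_two_pow m) (jb_lt_two_pow (n - m))))
  have := (Nat.pow_lt_pow_iff_right (a := 2) one_lt_two).mp h1
  omega

theorem sh_sub_comm (n m : ℤ) : sh (n - m) = sh (m - n) := by rw [sh, jb_sub_comm]; rfl

theorem sh_dist_le (n m : ℤ) : (sh n - sh m) + (sh m - sh n) ≤ sh (n - m) + 1 := by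
  have h1 := sh_le_add n m
  have h2 := sh_le_add m n
  rw [sh_sub_comm m n] at h2
  omega

theorem two_pow_sh_succ_le (n : ℤ) : 2 ^ (sh n + 1) ≤ 2 * jb n := by
  rw [pow_succ, mul_comm]; exact Nat.mul_le_mul_left 2 (two_pow_sh_le n)

theorem finite_sh_le (k : ℕ) : {n : ℤ | sh n ≤ k}.Finite := by
  refine (Set.finite_Icc (-(2 ^ (k + 1) : ℤ)) (2 ^ (k + 1))).subset fun n hn => ?_
  have h1 : jb n < 2 ^ (k + 1) := (jb_lt_two_pow n).trans_le
    (Nat.pow_le_pow_right two_pos (Nat.succ_le_succ hn))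
  unfold jb at h1
  have h2 : (n.natAbs : ℤ) < 2 ^ (k + 1) := by exact_mod_cast Nat.lt_of_succ_lt h1
  generalize (2 : ℤ) ^ (k + 1) = P at h2 ⊢
  rw [Set.mem_Icc]
  constructor <;> omega

/-- A positive weight on the dyadic shells that changes at most by a factor two from one shell to
the next. -/
structure Doubling (W : ℕ → ℝ≥0) : Prop where
  pos : ∀ k, W k ≠ 0
  up : ∀ k, W (k + 1) ≤ 2 * W k
  down : ∀ k, W k ≤ 2 * W (k + 1)

theorem Doubling.le_pow {W : ℕ → ℝ≥0} (hW : Doubling W) (k l : ℕ) :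
    W k ≤ 2 ^ ((k - l) + (l - k)) * W l := by
  rcases le_total k l with h | h
  · obtain ⟨d, rfl⟩ := Nat.exists_eq_add_of_le h
    rw [show k - (k + d) + (k + d - k) = d by omega]
    clear h
    induction d with
    | zero => simp
    | succ d ih =>
      calc W k ≤ 2 ^ d * W (k + d) := ih
        _ ≤ 2 ^ d * (2 * W (k + d + 1)) := by gcongr; exact hW.down _
        _ = _ := by rw [pow_succ]; simp only [mul_assoc, add_assoc]
  · obtain ⟨d, rfl⟩ := Nat.exists_eq_add_of_le h
    rw [show l + d - l + (l - (l + d)) = d by omega]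
    clear h
    induction d with
    | zero => simp
    | succ d ih =>
      calc W (l + (d + 1)) ≤ 2 * W (l + d) := hW.up _
        _ ≤ 2 * (2 ^ d * W l) := by gcongr
        _ = _ := by rw [pow_succ]; ring

/-- The shells of `n` and `m` differ by at most `sh (n - m) + 1`, so moving a doubling weight from
one point to the other costs a single factor `jb (n - m)`. This reduces weighted bounds for
convolutions to a moment of the kernel. -/
theorem Doubling.le_jb {W : ℕ → ℝ≥0} (hW : Doubling W) (n m : ℤ) :
    W (sh n) ≤ 2 * jb (n - m) * W (sh m) := by
  refine (hW.le_pow _ (sh m)).trans ?_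
  gcongr
  calc (2 : ℝ≥0) ^ ((sh n - sh m) + (sh m - sh n)) ≤ 2 ^ (sh (n - m) + 1) :=
        pow_le_pow_right₀ one_le_two (sh_dist_le n m)
    _ ≤ 2 * jb (n - m) := by exact_mod_cast two_pow_sh_succ_le (n - m)

section Weighted

variable {F : Type*} [NormedAddCommGroup F]

/-- The square of the weighted `ℓ²` norm of a sequence. -/
def S (W : ℕ → ℝ≥0) (u : ℤ → F) : ℝ≥0∞ := ∑' n, ((W (sh n) : ℝ≥0∞) * ‖u n‖ₑ) ^ 2

theorem S_mono {W₁ W₂ : ℕ → ℝ≥0} {u v : ℤ → F} (M : ℝ≥0∞)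
    (h : ∀ n, (W₁ (sh n) : ℝ≥0∞) * ‖u n‖ₑ ≤ M * (W₂ (sh n) * ‖v n‖ₑ)) :
    S W₁ u ≤ M ^ 2 * S W₂ v := by
  unfold S
  rw [← ENNReal.tsum_mul_left]
  refine ENNReal.tsum_le_tsum fun n => ?_
  rw [← mul_pow]
  exact pow_le_pow_left' (h n) 2

theorem S_mono_weight {W₁ W₂ : ℕ → ℝ≥0} (u : ℤ → F) (M : ℝ≥0) (h : ∀ k, W₁ k ≤ M * W₂ k) :
    S W₁ u ≤ M ^ 2 * S W₂ u := by
  refine S_mono _ fun n => ?_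
  rw [← mul_assoc]
  gcongr
  exact_mod_cast h _

theorem S_mono_fun {W : ℕ → ℝ≥0} {u v : ℤ → F} (h : ∀ n, ‖u n‖ ≤ ‖v n‖) : S W u ≤ S W v := by
  have := S_mono (W₁ := W) (W₂ := W) (u := u) (v := v) 1 (fun n => by
    rw [one_mul]; gcongr; rw [enorm_le_iff_norm_le]; exact h n)
  simpa using this

theorem ennreal_add_sq_le (a b : ℝ≥0∞) : (a + b) ^ 2 ≤ 2 * (a ^ 2 + b ^ 2) := by
  have := ENNReal.rpow_add_le_mul_rpow_add_rpow a b (p := 2) one_le_two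
  norm_num at this
  exact this

theorem S_add_le (W : ℕ → ℝ≥0) (u v : ℤ → F) :
    S W (fun n => u n + v n) ≤ 2 * (S W u + S W v) := by
  unfold S
  rw [← ENNReal.tsum_add, ← ENNReal.tsum_mul_left]
  refine ENNReal.tsum_le_tsum fun n => ?_
  refine le_trans ?_ (ennreal_add_sq_le _ _)
  rw [← mul_add]
  gcongr
  exact enorm_add_le _ _

theorem S_neg (W : ℕ → ℝ≥0) (u : ℤ → F) : S W (fun n => - u n) = S W u := by
  simp [S]

theorem S_sub_le (W : ℕ → ℝ≥0) (u v : ℤ → F) :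
    S W (fun n => u n - v n) ≤ 2 * (S W u + S W v) := by
  have := S_add_le W u (fun n => - v n)
  rw [S_neg] at this
  simpa [sub_eq_add_neg] using this

theorem S_le_of_kernel {G : Type*} [NormedAddCommGroup G] {W₁ W₂ : ℕ → ℝ≥0} {y : ℤ → G} {u : ℤ → F}
    (k : ℤ → ℤ → ℝ≥0∞) (t : ℤ → ℝ≥0) (C : ℝ≥0∞) (ht : ∀ j, t j ≠ 0)
    (h1 : ∀ i, ∑' j, k i j * t j ≤ C * t i) (h2 : ∀ j, ∑' i, k i j * t i ≤ C * t j)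
    (h : ∀ n, (W₁ (sh n) : ℝ≥0∞) * ‖y n‖ₑ ≤ ∑' m, k n m * (W₂ (sh m) * ‖u m‖ₑ)) :
    S W₁ y ≤ C ^ 2 * S W₂ u := by
  refine le_trans (ENNReal.tsum_le_tsum fun n => ?_)
    (schur_test k (fun m => (W₂ (sh m) : ℝ≥0∞) * ‖u m‖ₑ) (fun i => t i) t C ht h1 h2)
  gcongr
  exact h n

/-- A moment of an operator valued sequence. -/
def mom {R : Type*} [NormedAddCommGroup R] (a : ℤ → R) : ℝ≥0∞ := ∑' m, ‖a m‖ₑ * (jb m : ℝ≥0∞) ^ 8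

/-- Schur test with constant test weights. The factor `D` will be `1` or an increment of a cutoff.
The eighth power in `mom` is generous: the kernels below need at most the fifth. -/
theorem weighted_convolution_le {R : Type*} [NormedAddCommGroup R]
    {W₁ W₂ : ℕ → ℝ≥0} {u : ℤ → F} (a : ℤ → R) (D : ℤ → ℤ → ℝ≥0∞) (M : ℝ≥0∞)
    (hD : ∀ n m, (W₁ (sh n) : ℝ≥0∞) * D n m ≤ M * (jb (n - m) : ℝ≥0∞) ^ 8 * W₂ (sh m)) :
    ∑' n, ((W₁ (sh n) : ℝ≥0∞) * ∑' m, ‖a (n - m)‖ₑ * D n m * ‖u m‖ₑ) ^ 2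
      ≤ (M * mom a) ^ 2 * S W₂ u := by
  refine le_trans (ENNReal.tsum_le_tsum fun n => ?_)
    (schur_test (fun n m => M * (‖a (n - m)‖ₑ * (jb (n - m) : ℝ≥0∞) ^ 8))
      (fun m => (W₂ (sh m) : ℝ≥0∞) * ‖u m‖ₑ) (fun _ => 1) (fun _ => 1) (M * mom a)
      (fun _ => one_ne_zero) ?_ ?_)
  · refine pow_le_pow_left' ?_ 2
    calc (W₁ (sh n) : ℝ≥0∞) * ∑' m, ‖a (n - m)‖ₑ * D n m * ‖u m‖ₑ
      _ = ∑' m, ‖a (n - m)‖ₑ * (W₁ (sh n) * D n m) * ‖u m‖ₑ := by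
          rw [← ENNReal.tsum_mul_left]; exact tsum_congr fun m => by ring
      _ ≤ ∑' m, ‖a (n - m)‖ₑ * (M * (jb (n - m) : ℝ≥0∞) ^ 8 * W₂ (sh m)) * ‖u m‖ₑ := by
          refine ENNReal.tsum_le_tsum fun m => ?_
          exact mul_le_mul_left (mul_le_mul_right (hD n m) _) _
      _ = _ := tsum_congr fun m => by ring
  · intro i
    simp only [ENNReal.coe_one, mul_one, ENNReal.tsum_mul_left]
    exact le_of_eq (congrArg (M * ·)
      ((Equiv.subLeft i).tsum_eq (fun m => ‖a m‖ₑ * (jb m : ℝ≥0∞) ^ 8)))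
  · intro j
    simp only [ENNReal.coe_one, mul_one, ENNReal.tsum_mul_left]
    exact le_of_eq (congrArg (M * ·)
      ((Equiv.subRight j).tsum_eq (fun m => ‖a m‖ₑ * (jb m : ℝ≥0∞) ^ 8)))

theorem S_le_of_convolution {G R : Type*} [NormedAddCommGroup G] [NormedAddCommGroup R]
    {W₁ W₂ : ℕ → ℝ≥0} {y : ℤ → G} {u : ℤ → F} (a : ℤ → R) (D : ℤ → ℤ → ℝ≥0∞) (M : ℝ≥0∞)
    (hD : ∀ n m, (W₁ (sh n) : ℝ≥0∞) * D n m ≤ M * (jb (n - m) : ℝ≥0∞) ^ 8 * W₂ (sh m))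
    (h : ∀ n, ‖y n‖ₑ ≤ ∑' m, ‖a (n - m)‖ₑ * D n m * ‖u m‖ₑ) :
    S W₁ y ≤ (M * mom a) ^ 2 * S W₂ u :=
  (ENNReal.tsum_le_tsum fun n => pow_le_pow_left' (mul_le_mul_right (h n) _) 2).trans
    (weighted_convolution_le a D M hD)

theorem tsum_shell_eq (f : ℤ → ℝ≥0∞) :
    ∑' n, f n = ∑' k : ℕ, ∑' n : ↑(sh ⁻¹' {k}), f n := (ENNReal.tsum_fiberwise f sh).symm

/-- Shell `k` contains at most `2^(k+1)` integers, because `jb` takes `2^k` values there and each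
comes from at most two signs. -/
theorem tsum_sh_le (g : ℕ → ℝ≥0∞) : ∑' n : ℤ, g (sh n) ≤ ∑' k, 2 ^ (k + 1) * g k := by
  rw [tsum_shell_eq]
  refine ENNReal.tsum_le_tsum fun k => ?_
  have hf : (sh ⁻¹' {k} : Set ℤ).Finite :=
    (finite_sh_le k).subset fun n hn => le_of_eq (by simpa using hn)
  have hc : (sh ⁻¹' {k} : Set ℤ).ncard ≤ 2 ^ (k + 1) := by
    have hsub : (sh ⁻¹' {k} : Set ℤ) ⊆
        ↑((Finset.Ico (2 ^ k) (2 ^ (k + 1))).image (fun j : ℕ => (j : ℤ) - 1) ∪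
          (Finset.Ico (2 ^ k) (2 ^ (k + 1))).image (fun j : ℕ => 1 - (j : ℤ))) := by
      intro n hn
      have hn : sh n = k := by simpa using hn
      have h1 := two_pow_sh_le n
      have h2 := jb_lt_two_pow n
      rw [hn] at h1 h2
      simp only [Finset.coe_union, Finset.coe_image, Set.mem_union, Set.mem_image, Finset.coe_Ico,
        Set.mem_Ico]
      rcases le_total 0 n with h | h
      · left; exact ⟨jb n, ⟨h1, h2⟩, by unfold jb; push_cast; rw [abs_of_nonneg h]; ring⟩
      · right; exact ⟨jb n, ⟨h1, h2⟩, by unfold jb; push_cast; rw [abs_of_nonpos h]; ring⟩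
    refine (Set.ncard_le_ncard hsub (Finset.finite_toSet _)).trans ?_
    rw [Set.ncard_coe_finset]
    refine (Finset.card_union_le _ _).trans ?_
    have h3 : ∀ f : ℕ → ℤ, ((Finset.Ico (2 ^ k) (2 ^ (k + 1))).image f).card ≤ 2 ^ k := fun f =>
      Finset.card_image_le.trans (by rw [Nat.card_Ico, pow_succ]; omega)
    exact (add_le_add (h3 _) (h3 _)).trans (by rw [pow_succ, mul_two])
  have h1 : ∀ n : ↑(sh ⁻¹' {k}), g (sh n) = g k := fun n => by
    have : sh n = k := n.2
    rw [this]
  rw [tsum_congr h1]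
  have := hf.fintype
  rw [tsum_fintype, Finset.sum_const, nsmul_eq_mul, Finset.card_univ, ← Nat.card_eq_fintype_card,
    Nat.card_coe_set_eq]
  gcongr
  exact_mod_cast hc

end Weighted

end BlockLaurent

end

/-! ### The weights, logarithmic cutoffs and their commutators with convolutions -/

section

namespace BlockLaurent

open scoped NNReal

/-- The weight that is `1` up to shell `j` and decays like `(3/4)^(k - j)` beyond. -/
def Wo (j k : ℕ) : ℝ≥0 := (3 / 4) ^ (k - j)

/-- A weight concentrated at shell `j`. -/
def Wt (j k : ℕ) : ℝ≥0 := (2 / 3) ^ (j - k) * (3 / 4) ^ (k - j)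

/-- The weight that is `1` up to shell `j` and grows like `(3/2)^(k - j)` beyond. -/
def Ws (j k : ℕ) : ℝ≥0 := (3 / 2) ^ (k - j)

theorem pow_sub_doubling {x : ℝ≥0} (h1 : 1 / 2 ≤ x) (h2 : x ≤ 2) (j : ℕ) :
    Doubling fun k => x ^ (k - j) := by
  have hx : x ≠ 0 := by
    rintro rfl
    exact absurd h1 (by norm_num)
  have h1' : 1 ≤ 2 * x := by
    calc (1 : ℝ≥0) = 2 * (1 / 2) := by norm_num
      _ ≤ 2 * x := by gcongr
  refine ⟨fun k => pow_ne_zero _ hx, fun k => ?_, fun k => ?_⟩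
  · rcases lt_or_ge k j with h | h
    · rw [Nat.sub_eq_zero_of_le h, Nat.sub_eq_zero_of_le h.le]; norm_num
    · rw [Nat.succ_sub h, pow_succ, mul_comm]; gcongr
  · rcases lt_or_ge k j with h | h
    · rw [Nat.sub_eq_zero_of_le h, Nat.sub_eq_zero_of_le h.le]; norm_num
    · rw [Nat.succ_sub h, pow_succ, mul_left_comm]
      exact le_mul_of_one_le_right' h1'

theorem doubling_Wo (j : ℕ) : Doubling (Wo j) := by
  have h1 : (1 / 2 : ℝ≥0) ≤ 3 / 4 := by rw [← NNReal.coe_le_coe]; norm_num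
  have h2 : (3 / 4 : ℝ≥0) ≤ 2 := by rw [← NNReal.coe_le_coe]; norm_num
  exact pow_sub_doubling h1 h2 j

theorem doubling_Ws (j : ℕ) : Doubling (Ws j) := by
  have h1 : (1 / 2 : ℝ≥0) ≤ 3 / 2 := by rw [← NNReal.coe_le_coe]; norm_num
  have h2 : (3 / 2 : ℝ≥0) ≤ 2 := by rw [← NNReal.coe_le_coe]; norm_num
  exact pow_sub_doubling h1 h2 j

theorem doubling_tent {x y : ℝ≥0} (hx1 : 1 / 2 ≤ x) (hx2 : x ≤ 1) (hy1 : 1 / 2 ≤ y) (hy2 : y ≤ 1)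
    (j : ℕ) : Doubling fun k => x ^ (j - k) * y ^ (k - j) := by
  have hx : x ≠ 0 := by
    rintro rfl
    exact absurd hx1 (by norm_num)
  have hd := pow_sub_doubling hy1 (hy2.trans one_le_two) j
  have hx1' : 1 ≤ 2 * x := by
    calc (1 : ℝ≥0) = 2 * (1 / 2) := by norm_num
      _ ≤ 2 * x := by gcongr
  refine ⟨fun k => mul_ne_zero (pow_ne_zero _ hx) (hd.pos k), fun k => ?_, fun k => ?_⟩
  · rcases lt_or_ge k j with h | h
    · rw [show k + 1 - j = 0 by omega, show k - j = 0 by omega, show j - k = j - (k + 1) + 1 by omega,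
        pow_succ, pow_zero, mul_one, mul_one, mul_left_comm]
      exact le_mul_of_one_le_right' hx1'
    · rw [show j - (k + 1) = 0 by omega, show j - k = 0 by omega, pow_zero, one_mul, one_mul]
      exact hd.up k
  · rcases lt_or_ge k j with h | h
    · rw [show k + 1 - j = 0 by omega, show k - j = 0 by omega, show j - k = j - (k + 1) + 1 by omega,
        pow_succ, pow_zero, mul_one, mul_one, mul_comm]
      gcongr
      exact hx2.trans one_le_two
    · rw [show j - (k + 1) = 0 by omega, show j - k = 0 by omega, pow_zero, one_mul, one_mul]
      exact hd.down k

theorem doubling_Wt (j : ℕ) : Doubling (Wt j) := by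
  have h1 : (1 / 2 : ℝ≥0) ≤ 3 / 4 := by rw [← NNReal.coe_le_coe]; norm_num
  have h2 : (3 / 4 : ℝ≥0) ≤ 1 := by rw [← NNReal.coe_le_coe]; norm_num
  have h3 : (1 / 2 : ℝ≥0) ≤ 2 / 3 := by rw [← NNReal.coe_le_coe]; norm_num
  have h4 : (2 / 3 : ℝ≥0) ≤ 1 := by rw [← NNReal.coe_le_coe]; norm_num
  exact doubling_tent h3 h4 h1 h2 j

/-- The logarithmic cutoff that rises from `0` to `1` between `2^x` and `2^(x + L)`. -/
def cut (x L : ℕ) (n : ℤ) : ℝ := max 0 (min 1 ((Real.logb 2 (jb n) - x) / L))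

theorem cut_nonneg (x L : ℕ) (n : ℤ) : 0 ≤ cut x L n := le_max_left _ _

theorem cut_le_one (x L : ℕ) (n : ℤ) : cut x L n ≤ 1 := max_le zero_le_one (min_le_left _ _)

theorem cut_eq_zero {x L : ℕ} {n : ℤ} (h : sh n < x) : cut x L n = 0 := by
  refine max_eq_left ((min_le_right _ _).trans ?_)
  refine div_nonpos_of_nonpos_of_nonneg ?_ (Nat.cast_nonneg _)
  rw [sub_nonpos, Real.logb_le_iff_le_rpow one_lt_two (by exact_mod_cast jb_pos n),
    Real.rpow_natCast]
  have := (jb_lt_two_pow n).le.trans (Nat.pow_le_pow_right two_pos h)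
  exact_mod_cast this

theorem cut_eq_one {x L : ℕ} (hL : 0 < L) {n : ℤ} (h : x + L ≤ sh n) : cut x L n = 1 := by
  have hL' : (0 : ℝ) < L := by exact_mod_cast hL
  have : (1 : ℝ) ≤ (Real.logb 2 (jb n) - x) / L := by
    rw [le_div_iff₀ hL', one_mul, le_sub_iff_add_le, Real.le_logb_iff_rpow_le one_lt_two
      (by exact_mod_cast jb_pos n)]
    have h2 := (Nat.pow_le_pow_right two_pos h).trans (two_pow_sh_le n)
    have h3 : ((L : ℝ) + x) = ((x + L : ℕ) : ℝ) := by push_cast; ring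
    rw [h3, Real.rpow_natCast]
    exact_mod_cast h2
  unfold cut
  rw [min_eq_left this, max_eq_right zero_le_one]

/-- The mean value bound has the smaller of `jb n` and `jb m` in the denominator. If that is `jb m`,
then `jb n ≤ jb m * jb (n - m)` replaces it by `jb n` at the price of a second factor `jb (n - m)`.
-/
theorem abs_log_jb_sub_le (n m : ℤ) :
    |Real.log (jb n) - Real.log (jb m)| ≤ (jb (n - m) : ℝ) ^ 2 / jb n := by
  have hn : (0 : ℝ) < jb n := by exact_mod_cast jb_pos n
  have hm : (0 : ℝ) < jb m := by exact_mod_cast jb_pos m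
  have hd : (1 : ℝ) ≤ jb (n - m) := by exact_mod_cast one_le_jb (n - m)
  have hnm : (jb n : ℝ) ≤ jb m * jb (n - m) := by exact_mod_cast jb_le_mul n m
  have h1 : (jb n : ℝ) - jb m ≤ jb (n - m) := by
    have : jb n ≤ jb m + jb (n - m) := (jb_le_add n m).trans (by unfold jb; omega)
    have : (jb n : ℝ) ≤ jb m + jb (n - m) := by exact_mod_cast this
    linarith
  have h2 : (jb m : ℝ) - jb n ≤ jb (n - m) := by
    have : jb m ≤ jb n + jb (n - m) := by
      rw [jb_sub_comm]; exact (jb_le_add m n).trans (by unfold jb; omega)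
    have : (jb m : ℝ) ≤ jb n + jb (n - m) := by exact_mod_cast this
    linarith
  have key : ∀ x y : ℝ, 0 < x → 0 < y → Real.log x - Real.log y ≤ (x - y) / y := by
    intro x y hx hy
    rw [← Real.log_div hx.ne' hy.ne', sub_div, div_self hy.ne']
    exact Real.log_le_sub_one_of_pos (div_pos hx hy)
  rw [abs_le']
  constructor
  · refine (key _ _ hn hm).trans ?_
    rw [div_le_div_iff₀ hm hn]
    nlinarith [mul_nonneg hn.le hm.le]
  · rw [neg_sub]
    refine (key _ _ hm hn).trans ?_
    gcongr
    nlinarith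

/-- The logarithmic profile has slope of order `1/(L |n|)`. After multiplication by the Hardy weight
`2^sh n` the increments are still `O(1/L)`, small for a cutoff spread over many shells. The factor 2
comes from `log 2 ≥ 1/2`. -/
theorem cut_sub_le (x L : ℕ) (n m : ℤ) :
    |cut x L m - cut x L n| ≤ 2 / L * ((jb (n - m) : ℝ) ^ 2 / jb n) := by
  have hb : |cut x L m - cut x L n| ≤ |(Real.logb 2 (jb m) - x) / L - (Real.logb 2 (jb n) - x) / L| := by
    unfold cut
    rw [max_comm 0, max_comm 0, min_comm 1, min_comm 1]
    exact (abs_sup_sub_sup_le_abs _ _ _).trans (abs_inf_sub_inf_le_abs _ _ _)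
  refine hb.trans ?_
  rw [← sub_div, abs_div, sub_sub_sub_cancel_right, Real.logb, Real.logb, ← sub_div, abs_div,
    Nat.abs_cast, abs_sub_comm, abs_of_pos (Real.log_pos one_lt_two)]
  have h2 : (1 / 2 : ℝ) ≤ Real.log 2 := by linarith [Real.log_two_gt_d9]
  have h3 := abs_log_jb_sub_le n m
  rw [div_mul_eq_mul_div]
  refine div_le_div_of_nonneg_right ?_ (Nat.cast_nonneg L)
  rw [div_le_iff₀ (by linarith)]
  have h4 : (0 : ℝ) ≤ (jb (n - m) : ℝ) ^ 2 / jb n := by positivity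
  nlinarith

theorem two_pow_mul_cut_sub_le (x L : ℕ) (n m : ℤ) :
    2 ^ sh n * ‖cut x L m - cut x L n‖₊ ≤ 2 / L * (jb (n - m) : ℝ≥0) ^ 2 := by
  rw [← NNReal.coe_le_coe]
  push_cast
  rw [Real.norm_eq_abs]
  have hn : (0 : ℝ) < jb n := by exact_mod_cast jb_pos n
  have h1 : (2 : ℝ) ^ sh n ≤ jb n := by exact_mod_cast two_pow_sh_le n
  calc (2 : ℝ) ^ sh n * |cut x L m - cut x L n|
      ≤ jb n * (2 / L * ((jb (n - m) : ℝ) ^ 2 / jb n)) := by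
        gcongr; exact cut_sub_le x L n m
    _ = _ := by field_simp

theorem cut_kernel_le {W : ℕ → ℝ≥0} (hW : Doubling W) (x L : ℕ) (n m : ℤ) :
    2 ^ sh n * W (sh n) * ‖cut x L m - cut x L n‖₊
      ≤ 4 / L * (jb (n - m) : ℝ≥0) ^ 8 * W (sh m) := by
  have hd : (1 : ℝ≥0) ≤ jb (n - m) := by exact_mod_cast one_le_jb (n - m)
  calc 2 ^ sh n * W (sh n) * ‖cut x L m - cut x L n‖₊
      = (2 ^ sh n * ‖cut x L m - cut x L n‖₊) * W (sh n) := by ring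
    _ ≤ (2 / L * (jb (n - m) : ℝ≥0) ^ 2) * (2 * jb (n - m) * W (sh m)) := by
        exact mul_le_mul' (two_pow_mul_cut_sub_le x L n m) (hW.le_jb n m)
    _ = 4 / L * (jb (n - m) : ℝ≥0) ^ 3 * W (sh m) := by ring
    _ ≤ _ := by
        exact mul_le_mul_left (mul_le_mul_right (pow_le_pow_right₀ hd (by norm_num)) _) _

theorem cut_one_sub_eq_zero {j : ℕ} {n m : ℤ} (h : (sh n < j ∧ sh m < j) ∨ (j < sh n ∧ j < sh m)) :
    cut j 1 m - cut j 1 n = 0 := by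
  rcases h with ⟨h1, h2⟩ | ⟨h1, h2⟩
  · rw [cut_eq_zero h1, cut_eq_zero h2, sub_zero]
  · rw [cut_eq_one one_pos (Nat.succ_le_of_lt h1), cut_eq_one one_pos (Nat.succ_le_of_lt h2),
      sub_self]

/-- The increments of `cut j 1` live near shell `j`. -/
theorem cut_kernel_local_le {W₁ W₂ : ℕ → ℝ≥0} (h1 : Doubling W₁) (h2 : Doubling W₂) {j : ℕ}
    (hj1 : W₁ j = 1) (hj2 : W₂ j = 1) (n m : ℤ) :
    W₁ (sh n) * ‖cut j 1 m - cut j 1 n‖₊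
      ≤ 16 * (1 / 2) ^ j * (jb (n - m) : ℝ≥0) ^ 8 * W₂ (sh m) := by
  by_cases h : (sh n < j ∧ sh m < j) ∨ (j < sh n ∧ j < sh m)
  · rw [cut_one_sub_eq_zero h, nnnorm_zero, mul_zero]; exact zero_le
  -- Otherwise `n` and `m` do not lie strictly on the same side of shell `j`, so both shells are
  -- within `t` of `j`. Each passage to shell `j` costs `2^t ≤ 2 jb (n - m)`, and `2^j` is
  -- comparable to `2^sh n` up to the same factor.
  set t := sh (n - m) + 1 with ht
  have hdist := sh_dist_le n m
  have htn : (sh n - j) + (j - sh n) ≤ t := by omega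
  have htm : (sh m - j) + (j - sh m) ≤ t := by omega
  have hd : (1 : ℝ≥0) ≤ jb (n - m) := by exact_mod_cast one_le_jb (n - m)
  have h2t : (2 : ℝ≥0) ^ t ≤ 2 * jb (n - m) := by exact_mod_cast two_pow_sh_succ_le (n - m)
  have e1 : W₁ (sh n) ≤ 2 * jb (n - m) := by
    refine (h1.le_pow (sh n) j).trans ?_
    rw [hj1, mul_one]
    exact (pow_le_pow_right₀ one_le_two htn).trans h2t
  have e2 : 1 ≤ 2 * jb (n - m) * W₂ (sh m) := by
    rw [← hj2]
    refine (h2.le_pow j (sh m)).trans ?_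
    gcongr
    refine (pow_le_pow_right₀ one_le_two ?_).trans h2t
    omega
  have e3 : (1 : ℝ≥0) ≤ 2 * jb (n - m) * ((1 / 2) ^ j * 2 ^ sh n) := by
    have : (2 : ℝ≥0) ^ j ≤ 2 ^ t * 2 ^ sh n := by
      rw [← pow_add]; exact pow_le_pow_right₀ one_le_two (by omega)
    calc (1 : ℝ≥0) = (1 / 2) ^ j * 2 ^ j := by rw [← mul_pow]; norm_num
      _ ≤ (1 / 2) ^ j * (2 ^ t * 2 ^ sh n) := by gcongr
      _ ≤ (1 / 2) ^ j * (2 * jb (n - m) * 2 ^ sh n) := by gcongr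
      _ = _ := by ring
  have e4 := two_pow_mul_cut_sub_le j 1 n m
  rw [Nat.cast_one, div_one] at e4
  calc W₁ (sh n) * ‖cut j 1 m - cut j 1 n‖₊
      ≤ 2 * jb (n - m) * ‖cut j 1 m - cut j 1 n‖₊ * 1 * 1 := by
        rw [mul_one, mul_one]; gcongr
    _ ≤ 2 * jb (n - m) * ‖cut j 1 m - cut j 1 n‖₊ * (2 * jb (n - m) * ((1 / 2) ^ j * 2 ^ sh n)) *
        (2 * jb (n - m) * W₂ (sh m)) := by gcongr
    _ = 8 * (1 / 2) ^ j * jb (n - m) ^ 3 * (2 ^ sh n * ‖cut j 1 m - cut j 1 n‖₊) * W₂ (sh m) := by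
        ring
    _ ≤ 8 * (1 / 2) ^ j * jb (n - m) ^ 3 * (2 * jb (n - m) ^ 2) * W₂ (sh m) := by gcongr
    _ = 16 * (1 / 2) ^ j * (jb (n - m) : ℝ≥0) ^ 5 * W₂ (sh m) := by ring
    _ ≤ _ := by
        exact mul_le_mul_left (mul_le_mul_right (pow_le_pow_right₀ hd (by norm_num)) _) _

/-- The fibre space. -/
abbrev Vec (N : ℕ) : Type := EuclideanSpace ℂ (Fin N)

/-- The operators on a fibre. -/
abbrev Op (N : ℕ) : Type := Vec N →L[ℂ] Vec N

/-- Convolution of a sequence of vectors with a sequence of operators. -/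
def lau {N : ℕ} (a : ℤ → Op N) (u : ℤ → Vec N) (n : ℤ) : Vec N := ∑' m, a (n - m) (u m)

section Conv

variable {N : ℕ} {a : ℤ → Op N}

theorem tsum_enorm_ne_top (ha : mom a ≠ ⊤) {W : ℕ → ℝ≥0} (hW : Doubling W) {u : ℤ → Vec N}
    (hu : S W u ≠ ⊤) (n : ℤ) : ∑' m, ‖a (n - m)‖ₑ * ‖u m‖ₑ ≠ ⊤ := by
  have h := weighted_convolution_le (W₁ := W) (W₂ := W) (u := u) a (fun _ _ => 1) 2 (by
    intro n m
    rw [mul_one]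
    have hd : (1 : ℝ≥0) ≤ jb (n - m) := by exact_mod_cast one_le_jb (n - m)
    have := (hW.le_jb n m).trans (mul_le_mul_left (mul_le_mul_right
      (le_self_pow₀ hd (by norm_num : 8 ≠ 0)) 2) _)
    exact_mod_cast this)
  have h2 : (2 * mom a) ^ 2 * S W u ≠ ⊤ :=
    ENNReal.mul_ne_top (ENNReal.pow_ne_top (ENNReal.mul_ne_top (by norm_num) ha)) hu
  have h3 := (ENNReal.le_tsum n).trans h
  intro htop
  simp only [mul_one, htop] at h3
  rw [ENNReal.mul_top (by exact_mod_cast hW.pos _)] at h3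
  exact h2 (top_le_iff.mp (by simpa using h3))

theorem summable_lau (ha : mom a ≠ ⊤) {W : ℕ → ℝ≥0} (hW : Doubling W) {u : ℤ → Vec N}
    (hu : S W u ≠ ⊤) (n : ℤ) : Summable fun m => a (n - m) (u m) := by
  refine Summable.of_enorm (ne_top_of_le_ne_top (tsum_enorm_ne_top ha hW hu n) ?_)
  refine ENNReal.tsum_le_tsum fun m => ?_
  exact ContinuousLinearMap.le_opENorm _ _

theorem lau_smul_sub (ha : mom a ≠ ⊤) {W : ℕ → ℝ≥0} (hW : Doubling W) {u : ℤ → Vec N}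
    (hu : S W u ≠ ⊤) {c : ℤ → ℝ} (hc : ∀ n, |c n| ≤ 1) (n : ℤ) :
    lau a (fun m => (c m : ℂ) • u m) n - (c n : ℂ) • lau a u n
      = ∑' m, ((c m - c n : ℝ) : ℂ) • a (n - m) (u m) := by
  have hcu : S W (fun m => (c m : ℂ) • u m) ≠ ⊤ := by
    refine ne_top_of_le_ne_top hu (S_mono_fun fun m => ?_)
    rw [norm_smul, Complex.norm_real]
    exact mul_le_of_le_one_left (norm_nonneg _) (hc m)
  unfold lau
  rw [← (summable_lau ha hW hu n).tsum_const_smul, ← (summable_lau ha hW hcu n).tsum_sub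
    ((summable_lau ha hW hu n).const_smul _)]
  refine tsum_congr fun m => ?_
  rw [map_smul, Complex.ofReal_sub, sub_smul]

theorem enorm_lau_smul_sub_le (ha : mom a ≠ ⊤) {W : ℕ → ℝ≥0} (hW : Doubling W) {u : ℤ → Vec N}
    (hu : S W u ≠ ⊤) {c : ℤ → ℝ} (hc : ∀ n, |c n| ≤ 1) (n : ℤ) :
    ‖lau a (fun m => (c m : ℂ) • u m) n - (c n : ℂ) • lau a u n‖ₑ
      ≤ ∑' m, ‖a (n - m)‖ₑ * (‖c m - c n‖₊ : ℝ≥0∞) * ‖u m‖ₑ := by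
  rw [lau_smul_sub ha hW hu hc]
  refine enorm_tsum_le_tsum_enorm.trans (ENNReal.tsum_le_tsum fun m => ?_)
  rw [enorm_smul, mul_comm (‖a (n - m)‖ₑ), mul_assoc]
  have e : ‖((c m - c n : ℝ) : ℂ)‖ₑ = (‖c m - c n‖₊ : ℝ≥0∞) := by
    rw [← ofReal_norm, Complex.norm_real, ← coe_nnnorm, ENNReal.ofReal_coe_nnreal]
  rw [e]
  gcongr
  exact ContinuousLinearMap.le_opENorm _ _

theorem abs_cut_le_one (x L : ℕ) (n : ℤ) : |cut x L n| ≤ 1 :=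
  abs_le.mpr ⟨by linarith [cut_nonneg x L n], cut_le_one x L n⟩

/-- The commutator gains the full Hardy weight `2^k` and carries the factor `4/L`. This is the small
term in `concentration`. -/
theorem S_commutator_cut_le (ha : mom a ≠ ⊤) {W : ℕ → ℝ≥0} (hW : Doubling W) {u : ℤ → Vec N}
    (hu : S W u ≠ ⊤) (x L : ℕ) :
    S (fun k => 2 ^ k * W k) (fun n => lau a (fun m => (cut x L m : ℂ) • u m) n
      - (cut x L n : ℂ) • lau a u n) ≤ (((4 / L : ℝ≥0) : ℝ≥0∞) * mom a) ^ 2 * S W u := by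
  refine S_le_of_convolution a (fun n m => (‖cut x L m - cut x L n‖₊ : ℝ≥0∞)) _ ?_
    (fun n => enorm_lau_smul_sub_le ha hW hu (abs_cut_le_one x L) n)
  intro n m
  exact_mod_cast cut_kernel_le hW x L n m

/-- For the cutoff inside a single shell there is no small factor `1/L`. Instead the commutator is
localized: it only sees `u` in a weight that may decay away from shell `j`, it may be measured in a
weight that grows away from it, and it gains `2^(-j)`. -/
theorem S_commutator_cut_local_le (ha : mom a ≠ ⊤) {W : ℕ → ℝ≥0} (hW : Doubling W) {u : ℤ → Vec N}
    (hu : S W u ≠ ⊤) {W₁ W₂ : ℕ → ℝ≥0} (h1 : Doubling W₁) (h2 : Doubling W₂) {j : ℕ}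
    (hj1 : W₁ j = 1) (hj2 : W₂ j = 1) :
    S W₁ (fun n => lau a (fun m => (cut j 1 m : ℂ) • u m) n
      - (cut j 1 n : ℂ) • lau a u n) ≤ (((16 * (1 / 2) ^ j : ℝ≥0) : ℝ≥0∞) * mom a) ^ 2 * S W₂ u := by
  refine S_le_of_convolution a (fun n m => (‖cut j 1 m - cut j 1 n‖₊ : ℝ≥0∞)) _ ?_
    (fun n => enorm_lau_smul_sub_le ha hW hu (abs_cut_le_one j 1) n)
  intro n m
  exact_mod_cast cut_kernel_local_le h1 h2 hj1 hj2 n m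

end Conv

end BlockLaurent

end

/-! ### The Hardy inequality for sequences that are not finitely supported -/

section

namespace BlockLaurent

open scoped NNReal

section Extension

variable {N : ℕ} {a : ℤ → Op N}

/-- The weight `(2/3)^|k - j|`. -/
def Wd (j k : ℕ) : ℝ≥0 := (2 / 3) ^ (j - k) * (2 / 3) ^ (k - j)

theorem doubling_Wd (j : ℕ) : Doubling (Wd j) := by
  have h3 : (1 / 2 : ℝ≥0) ≤ 2 / 3 := by rw [← NNReal.coe_le_coe]; norm_num
  have h4 : (2 / 3 : ℝ≥0) ≤ 1 := by rw [← NNReal.coe_le_coe]; norm_num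
  exact doubling_tent h3 h4 h3 h4 j

/-- A variant of `cut_kernel_local_le` that keeps an arbitrary background weight `W` and the gain
`2^sh n`; it controls the error of truncating at shell `j`. -/
theorem cut_kernel_tent_le {W W' : ℕ → ℝ≥0} (hW : Doubling W) (hW' : Doubling W') {j : ℕ}
    (hj : W' j = 1) (n m : ℤ) :
    2 ^ sh n * W (sh n) * ‖cut j 1 m - cut j 1 n‖₊
      ≤ 8 * (jb (n - m) : ℝ≥0) ^ 8 * (W (sh m) * W' (sh m)) := by
  by_cases h : (sh n < j ∧ sh m < j) ∨ (j < sh n ∧ j < sh m)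
  · rw [cut_one_sub_eq_zero h, nnnorm_zero, mul_zero]; exact zero_le
  have hdist := sh_dist_le n m
  have hd : (1 : ℝ≥0) ≤ jb (n - m) := by exact_mod_cast one_le_jb (n - m)
  have h2t : (2 : ℝ≥0) ^ (sh (n - m) + 1) ≤ 2 * jb (n - m) := by
    exact_mod_cast two_pow_sh_succ_le (n - m)
  have e2 : 1 ≤ 2 * jb (n - m) * W' (sh m) := by
    rw [← hj]
    refine (hW'.le_pow j (sh m)).trans ?_
    gcongr
    refine (pow_le_pow_right₀ one_le_two ?_).trans h2t
    omega
  have e4 := two_pow_mul_cut_sub_le j 1 n m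
  rw [Nat.cast_one, div_one] at e4
  calc 2 ^ sh n * W (sh n) * ‖cut j 1 m - cut j 1 n‖₊
      = (2 ^ sh n * ‖cut j 1 m - cut j 1 n‖₊) * W (sh n) * 1 := by ring
    _ ≤ (2 * (jb (n - m) : ℝ≥0) ^ 2) * (2 * jb (n - m) * W (sh m)) *
        (2 * jb (n - m) * W' (sh m)) := mul_le_mul' (mul_le_mul' e4 (hW.le_jb n m)) e2
    _ = 8 * (jb (n - m) : ℝ≥0) ^ 4 * (W (sh m) * W' (sh m)) := by ring
    _ ≤ _ := mul_le_mul_left (mul_le_mul_right (pow_le_pow_right₀ hd (by norm_num)) _) _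

theorem S_commutator_cut_tent_le (ha : mom a ≠ ⊤) {W : ℕ → ℝ≥0} (hW : Doubling W) {u : ℤ → Vec N}
    (hu : S W u ≠ ⊤) (j : ℕ) :
    S (fun k => 2 ^ k * W k) (fun n => lau a (fun m => (cut j 1 m : ℂ) • u m) n
      - (cut j 1 n : ℂ) • lau a u n) ≤ (8 * mom a) ^ 2 * S (fun k => W k * Wd j k) u := by
  refine S_le_of_convolution a (fun n m => (‖cut j 1 m - cut j 1 n‖₊ : ℝ≥0∞)) _ ?_
    (fun n => enorm_lau_smul_sub_le ha hW hu (abs_cut_le_one j 1) n)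
  intro n m
  exact_mod_cast cut_kernel_tent_le hW (doubling_Wd j) (by simp [Wd]) n m

/-- For each `k` the squares `Wd j k ^ 2` have a sum over `j` bounded independently of `k`. Hence
the quantities on the left are summable in `j` and tend to zero. -/
theorem tendsto_S_mul_Wd {W : ℕ → ℝ≥0} {u : ℤ → Vec N} (hu : S W u ≠ ⊤) :
    Tendsto (fun j => S (fun k => W k * Wd j k) u) atTop (𝓝 0) := by
  rw [← Nat.cofinite_eq_atTop]
  refine ENNReal.tendsto_cofinite_zero_of_tsum_ne_top ?_
  have h1 : ∀ k : ℕ, ∑' j, (Wd j k : ℝ≥0∞) ^ 2 ≤ 2 * (1 - ((2 / 3) ^ 2 : ℝ≥0) : ℝ≥0∞)⁻¹ := by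
    intro k
    refine le_trans (le_of_eq (tsum_congr fun j => ?_)) (tsum_geometric_dist_le ((2 / 3) ^ 2) k)
    rw [Wd, ← pow_add, ENNReal.coe_pow, ENNReal.coe_pow, ← pow_mul, ← pow_mul]
    congr 1; ring
  have h2 : 2 * (1 - ((2 / 3) ^ 2 : ℝ≥0) : ℝ≥0∞)⁻¹ ≠ ⊤ := by
    refine ENNReal.mul_ne_top (by norm_num) (ENNReal.inv_ne_top.mpr ?_)
    have h3 : ((2 / 3) ^ 2 : ℝ≥0) < 1 := by rw [← NNReal.coe_lt_coe]; norm_num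
    exact (tsub_pos_of_lt (by exact_mod_cast h3)).ne'
  refine ne_top_of_le_ne_top (ENNReal.mul_ne_top h2 hu) ?_
  unfold S
  rw [ENNReal.tsum_comm, ← ENNReal.tsum_mul_left]
  refine ENNReal.tsum_le_tsum fun n => ?_
  calc ∑' j, (((W (sh n) * Wd j (sh n) : ℝ≥0) : ℝ≥0∞) * ‖u n‖ₑ) ^ 2
      = ∑' j, (Wd j (sh n) : ℝ≥0∞) ^ 2 * (W (sh n) * ‖u n‖ₑ) ^ 2 := by
        refine tsum_congr fun j => ?_
        rw [ENNReal.coe_mul]; ring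
    _ ≤ _ := by rw [ENNReal.tsum_mul_right]; gcongr; exact h1 _

/-- The weighted Hardy inequality for `H₀ - λ`, `λ` near `E`, on finitely supported sequences. -/
def HardyBound (a : ℤ → Op N) (E δ : ℝ) (C : ℝ≥0) : Prop :=
  ∀ x : ℝ, |x - E| ≤ δ → ∀ (j : ℕ) (u : ℤ → Vec N), {n | u n ≠ 0}.Finite →
    S (Wo j) u ≤ C * S (fun k => 2 ^ k * Wo j k) (fun n => lau a u n - (x : ℂ) • u n)

/-- Apply the inequality to `u` truncated at shell `R`. The commutator with the truncation is
controlled by the mass of `u` near shell `R`, which tends to zero. Splitting off this error costs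
the factor 2. The sequences `U φ` used later need not be square summable, so this extension is
essential. -/
theorem HardyBound.extend (ha : mom a ≠ ⊤) {E δ : ℝ} {C : ℝ≥0} (h : HardyBound a E δ C) {x : ℝ}
    (hx : |x - E| ≤ δ) (j : ℕ) {u : ℤ → Vec N} (hu : S (Wo j) u ≠ ⊤) :
    S (Wo j) u ≤ 2 * C * S (fun k => 2 ^ k * Wo j k) (fun n => lau a u n - (x : ℂ) • u n) := by
  set f : ℤ → Vec N := fun n => lau a u n - (x : ℂ) • u n with hf
  set uR : ℕ → ℤ → Vec N := fun R n => u n - (cut R 1 n : ℂ) • u n with huR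
  have hfin : ∀ R, {n | uR R n ≠ 0}.Finite := by
    intro R
    refine (finite_sh_le R).subset fun n hn => ?_
    by_contra hlt
    rw [Set.mem_ofPred_eq, not_le] at hlt
    exact hn (by simp only [uR]; rw [cut_eq_one one_pos hlt, Complex.ofReal_one, one_smul, sub_self])
  have hcu : ∀ R, S (Wo j) (fun n => (cut R 1 n : ℂ) • u n) ≠ ⊤ := by
    intro R
    refine ne_top_of_le_ne_top hu (S_mono_fun fun m => ?_)
    rw [norm_smul, Complex.norm_real]
    exact mul_le_of_le_one_left (norm_nonneg _) (abs_cut_le_one _ _ _)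
  have hlau : ∀ R n, lau a (uR R) n - (x : ℂ) • uR R n
      = ((1 - cut R 1 n : ℝ) : ℂ) • f n - (lau a (fun m => (cut R 1 m : ℂ) • u m) n
        - (cut R 1 n : ℂ) • lau a u n) := by
    intro R n
    have e : lau a (uR R) n = lau a u n - lau a (fun m => (cut R 1 m : ℂ) • u m) n := by
      unfold lau
      rw [← (summable_lau ha (doubling_Wo j) hu n).tsum_sub
        (summable_lau ha (doubling_Wo j) (hcu R) n)]
      exact tsum_congr fun m => map_sub _ _ _
    rw [e]
    simp only [hf, uR]
    push_cast
    module
  have hbound : ∀ R, S (Wo j) (uR R) ≤ C * (2 * (S (fun k => 2 ^ k * Wo j k) f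
      + (8 * mom a) ^ 2 * S (fun k => Wo j k * Wd R k) u)) := by
    intro R
    refine (h x hx j (uR R) (hfin R)).trans ?_
    simp_rw [hlau R]
    gcongr
    refine (S_sub_le _ _ _).trans ?_
    gcongr
    · refine S_mono_fun fun n => ?_
      rw [norm_smul, Complex.norm_real]
      refine mul_le_of_le_one_left (norm_nonneg _) ?_
      rw [Real.norm_eq_abs, abs_le]
      constructor <;> linarith [cut_nonneg R 1 n, cut_le_one R 1 n]
    · exact S_commutator_cut_tent_le ha (doubling_Wo j) hu R
  have hlim : Tendsto (fun R => (C : ℝ≥0∞) * (2 * (S (fun k => 2 ^ k * Wo j k) f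
      + (8 * mom a) ^ 2 * S (fun k => Wo j k * Wd R k) u))) atTop
      (𝓝 (2 * C * S (fun k => 2 ^ k * Wo j k) f)) := by
    have h1 := ENNReal.Tendsto.const_mul (tendsto_S_mul_Wd hu) (a := (8 * mom a) ^ 2)
      (Or.inr (ENNReal.pow_ne_top (ENNReal.mul_ne_top (by norm_num) ha)))
    have h2 := (tendsto_const_nhds (x := S (fun k => 2 ^ k * Wo j k) f)).add h1
    have h3 := ENNReal.Tendsto.const_mul h2 (a := 2) (Or.inr (by norm_num))
    have h4 := ENNReal.Tendsto.const_mul h3 (a := C) (Or.inr ENNReal.coe_ne_top)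
    convert h4 using 2
    rw [mul_zero, add_zero]; ring
  -- Lower semicontinuity: on a finite set the truncation agrees with `u` once `R` is large, so
  -- every finite partial sum obeys the limiting bound.
  rw [S, ENNReal.tsum_eq_iSup_sum]
  refine iSup_le fun F => ?_
  obtain ⟨R0, hR0⟩ : ∃ R0, ∀ n ∈ F, sh n < R0 :=
    ⟨F.sup sh + 1, fun n hn => Nat.lt_succ_of_le (Finset.le_sup hn)⟩
  refine ge_of_tendsto hlim ((eventually_ge_atTop R0).mono fun R hR => ?_)
  refine le_trans ?_ (hbound R)
  refine le_trans (le_of_eq (Finset.sum_congr rfl fun n hn => ?_)) (ENNReal.sum_le_tsum F)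
  simp only [uR]
  rw [cut_eq_zero ((hR0 n hn).trans_le hR), Complex.ofReal_zero, zero_smul, sub_zero]

end Extension

end BlockLaurent

end

/-! ### Operators on `ℓ²`, the weighted sequences `U φ`, and the extension of `V` to them -/

section

namespace BlockLaurent

open scoped NNReal

variable {N : ℕ}

/-- Multiplication by a real function bounded by one. -/
def mulOp (N : ℕ) (c : ℤ → ℝ) (h : ∀ n, |c n| ≤ 1) : Hilb N →L[ℂ] Hilb N :=
  fibreOp (fun n => (c n : ℂ) • ContinuousLinearMap.id ℂ _) 1 zero_le_one
    (fun n => (norm_smul_id_le _).trans (h n)) (Equiv.refl ℤ)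

theorem mulOp_apply (c : ℤ → ℝ) (h : ∀ n, |c n| ≤ 1) (ψ : Hilb N) (n : ℤ) :
    mulOp N c h ψ n = (c n : ℂ) • ψ n := rfl

theorem enorm_sq_eq_tsum (ψ : Hilb N) : ‖ψ‖ₑ ^ 2 = ∑' n, ‖ψ n‖ₑ ^ 2 := by
  have h := lp.hasSum_norm (p := 2) (by norm_num) ψ
  have h2 : HasSum (fun n => ‖ψ n‖ ^ 2) (‖ψ‖ ^ 2) := by
    convert h using 2 <;> simp
  have e : ∀ (x : ℝ), ENNReal.ofReal (x ^ 2) = ENNReal.ofReal |x| ^ 2 := fun x => by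
    rw [← ENNReal.ofReal_pow (abs_nonneg x), sq_abs]
  rw [← ofReal_norm, ← ENNReal.ofReal_pow (norm_nonneg _), ← h2.tsum_eq,
    ENNReal.ofReal_tsum_of_nonneg (fun n => by positivity) h2.summable]
  refine tsum_congr fun n => ?_
  rw [ENNReal.ofReal_pow (norm_nonneg _), ofReal_norm]

theorem S_one_eq (ψ : Hilb N) : S (fun _ => 1) (fun n => ψ n) = ‖ψ‖ₑ ^ 2 := by
  rw [enorm_sq_eq_tsum]; simp [S]

theorem memℓp_of_S_ne_top {u : ℤ → Vec N} (h : S (fun _ => 1) u ≠ ⊤) : Memℓp u 2 := by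
  refine memℓp_gen ?_
  have h2 : Summable fun n => ‖u n‖ ^ 2 := by
    refine Summable.of_enorm ?_
    refine ne_top_of_le_ne_top h (ENNReal.tsum_le_tsum fun n => ?_)
    rw [ENNReal.coe_one, one_mul, enorm_pow, enorm_norm]
  simpa using h2

theorem enorm_mulOp_le (c : ℤ → ℝ) (h : ∀ n, |c n| ≤ 1) (ψ : Hilb N) :
    ‖mulOp N c h ψ‖ₑ ≤ ‖ψ‖ₑ := by
  rw [← (ENNReal.pow_right_strictMono two_ne_zero).le_iff_le]
  simp only [← S_one_eq]
  refine S_mono_fun fun n => ?_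
  rw [mulOp_apply, norm_smul, Complex.norm_real]
  exact mul_le_of_le_one_left (norm_nonneg _) (h n)

theorem inner_mulOp_left (c : ℤ → ℝ) (h : ∀ n, |c n| ≤ 1) (φ ψ : Hilb N) :
    inner ℂ (mulOp N c h φ) ψ = inner ℂ φ (mulOp N c h ψ) := by
  rw [lp.inner_eq_tsum, lp.inner_eq_tsum]
  refine tsum_congr fun n => ?_
  rw [mulOp_apply, mulOp_apply, inner_smul_left, inner_smul_right, Complex.conj_ofReal]

open Classical in
theorem abs_indicator_le (s : Set ℕ) (n : ℤ) : |(if sh n ∈ s then (1 : ℝ) else 0)| ≤ 1 := by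
  split_ifs <;> simp

open Classical in
/-- The projection to a set of shells. -/
def Pr (N : ℕ) (s : Set ℕ) : Hilb N →L[ℂ] Hilb N :=
  mulOp N (fun n => if sh n ∈ s then 1 else 0) (abs_indicator_le s)

theorem Pr_apply_of_mem {s : Set ℕ} {n : ℤ} (h : sh n ∈ s) (ψ : Hilb N) : Pr N s ψ n = ψ n := by
  rw [Pr, mulOp_apply, if_pos h, Complex.ofReal_one, one_smul]

theorem Pr_apply_of_notMem {s : Set ℕ} {n : ℤ} (h : sh n ∉ s) (ψ : Hilb N) : Pr N s ψ n = 0 := by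
  rw [Pr, mulOp_apply, if_neg h, Complex.ofReal_zero, zero_smul]

theorem enorm_Pr_le (s : Set ℕ) (ψ : Hilb N) : ‖Pr N s ψ‖ₑ ≤ ‖ψ‖ₑ := enorm_mulOp_le _ _ _

theorem Pr_Pr_of_subset {s t : Set ℕ} (h : s ⊆ t) (ψ : Hilb N) :
    Pr N s (Pr N t ψ) = Pr N s ψ := by
  ext1; funext n
  by_cases hn : sh n ∈ s
  · rw [Pr_apply_of_mem hn, Pr_apply_of_mem (h hn), Pr_apply_of_mem hn]
  · rw [Pr_apply_of_notMem hn, Pr_apply_of_notMem hn]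

theorem Pr_Pr_of_subset' {s t : Set ℕ} (h : s ⊆ t) (ψ : Hilb N) :
    Pr N t (Pr N s ψ) = Pr N s ψ := by
  ext1; funext n
  by_cases hn : sh n ∈ t
  · rw [Pr_apply_of_mem hn]
  · rw [Pr_apply_of_notMem hn, Pr_apply_of_notMem (fun h' => hn (h h'))]

theorem S_eq_tsum_shell (W : ℕ → ℝ≥0) (ψ : Hilb N) :
    S W (fun n => ψ n) = ∑' k, ((W k : ℝ≥0∞) * ‖Pr N {k} ψ‖ₑ) ^ 2 := by
  have h : ∀ k, ((W k : ℝ≥0∞) * ‖Pr N {k} ψ‖ₑ) ^ 2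
      = ∑' n : ℤ, if sh n = k then ((W (sh n) : ℝ≥0∞) * ‖ψ n‖ₑ) ^ 2 else 0 := by
    intro k
    rw [mul_pow, enorm_sq_eq_tsum, ← ENNReal.tsum_mul_left]
    refine tsum_congr fun n => ?_
    split_ifs with hn
    · rw [Pr_apply_of_mem (by simpa using hn), hn, mul_pow]
    · rw [Pr_apply_of_notMem (by simpa using hn)]; simp
  simp_rw [h]
  rw [ENNReal.tsum_comm]
  refine tsum_congr fun n => ?_
  rw [tsum_eq_single (sh n) (fun k hk => if_neg hk.symm), if_pos rfl]

theorem tendsto_Pr_Ici (ψ : Hilb N) : Tendsto (fun R => Pr N (Set.Ici R) ψ) atTop (𝓝 0) := by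
  have h0 : ∑' k, ‖Pr N {k} ψ‖ₑ ^ 2 ≠ ⊤ := by
    have := S_eq_tsum_shell (fun _ => 1) ψ
    simp only [ENNReal.coe_one, one_mul] at this
    rw [← this, S_one_eq]
    exact ENNReal.pow_ne_top enorm_ne_top
  have h1 : ∀ R, ‖Pr N (Set.Ici R) ψ‖ₑ ^ 2 = ∑' k, ‖Pr N {k + R} ψ‖ₑ ^ 2 := by
    intro R
    have := S_eq_tsum_shell (fun _ => 1) (Pr N (Set.Ici R) ψ)
    simp only [ENNReal.coe_one, one_mul] at this
    rw [← S_one_eq, this, ← Summable.sum_add_tsum_nat_add' (k := R) ENNReal.summable]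
    rw [Finset.sum_eq_zero, zero_add]
    · refine tsum_congr fun k => ?_
      rw [Pr_Pr_of_subset (by simp)]
    · intro k hk
      have : Pr N {k} (Pr N (Set.Ici R) ψ) = 0 := by
        ext1; funext n
        by_cases hn : sh n = k
        · rw [Pr_apply_of_mem (by simpa using hn), Pr_apply_of_notMem]
          · rfl
          · simpa [hn] using hk
        · rw [Pr_apply_of_notMem (by simpa using hn)]; rfl
      rw [this, enorm_zero, zero_pow two_ne_zero]
  have h2 : Tendsto (fun R => ‖Pr N (Set.Ici R) ψ‖ₑ ^ 2) atTop (𝓝 0) := by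
    simp_rw [h1]
    exact ENNReal.tendsto_sum_nat_add _ h0
  rw [tendsto_zero_iff_norm_tendsto_zero]
  have h3 : Tendsto (fun R => (‖Pr N (Set.Ici R) ψ‖ₑ ^ 2).toReal) atTop (𝓝 0) := by
    exact (ENNReal.tendsto_toReal ENNReal.zero_ne_top).comp h2
  have h4 := (Real.continuous_sqrt.tendsto 0).comp h3
  rw [Real.sqrt_zero] at h4
  refine h4.congr fun R => ?_
  simp only [Function.comp]
  rw [ENNReal.toReal_pow, toReal_enorm, Real.sqrt_sq (norm_nonneg _)]

/-- The restriction to shell `l` of the sequence `(4/3)^(sh n) φ n`. -/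
def sv (N l : ℕ) : Hilb N →L[ℂ] Hilb N := (((4 / 3) ^ l : ℝ) : ℂ) • Pr N {l}

/-- The sequence `(4/3)^(sh n) φ n`. -/
def U (φ : Hilb N) (n : ℤ) : Vec N := (((4 / 3) ^ sh n : ℝ) : ℂ) • φ n

theorem sv_apply_of_eq {l : ℕ} {n : ℤ} (h : sh n = l) (φ : Hilb N) : sv N l φ n = U φ n := by
  change (((4 / 3) ^ l : ℝ) : ℂ) • Pr N {l} φ n = _
  rw [Pr_apply_of_mem (by simpa using h), U, h]

theorem sv_apply_of_ne {l : ℕ} {n : ℤ} (h : sh n ≠ l) (φ : Hilb N) : sv N l φ n = 0 := by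
  change (((4 / 3) ^ l : ℝ) : ℂ) • Pr N {l} φ n = _
  rw [Pr_apply_of_notMem (by simpa using h), smul_zero]

theorem enorm_ofReal_coe (r : ℝ≥0) : ‖(((r : ℝ)) : ℂ)‖ₑ = r := by
  rw [← ofReal_norm, Complex.norm_real, Real.norm_of_nonneg r.coe_nonneg, ENNReal.ofReal_coe_nnreal]

theorem enorm_four_thirds (l : ℕ) : ‖(((4 / 3) ^ l : ℝ) : ℂ)‖ₑ = ((4 / 3 : ℝ≥0) ^ l : ℝ≥0) := by
  rw [← enorm_ofReal_coe]; norm_num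

theorem enorm_sv (l : ℕ) (φ : Hilb N) :
    ‖sv N l φ‖ₑ = ((4 / 3 : ℝ≥0) ^ l : ℝ≥0) * ‖Pr N {l} φ‖ₑ := by
  rw [← enorm_four_thirds, ← enorm_smul]; rfl

theorem S_U_eq (W : ℕ → ℝ≥0) (φ : Hilb N) :
    S W (U φ) = ∑' k, ((W k : ℝ≥0∞) * ‖sv N k φ‖ₑ) ^ 2 := by
  have := S_eq_tsum_shell (fun k => W k * (4 / 3) ^ k) φ
  simp only [enorm_sv]
  calc S W (U φ) = S (fun k => W k * (4 / 3) ^ k) (fun n => φ n) := by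
        refine tsum_congr fun n => ?_
        rw [U, enorm_smul, enorm_four_thirds, ENNReal.coe_mul, mul_assoc]
    _ = _ := by
        rw [this]
        refine tsum_congr fun k => ?_
        rw [ENNReal.coe_mul, mul_assoc]

theorem Wo_mul_pow (k : ℕ) : Wo 0 k * (4 / 3) ^ k = 1 := by
  rw [Wo, Nat.sub_zero, ← mul_pow]
  rw [show (3 / 4 * (4 / 3) : ℝ≥0) = 1 by rw [← NNReal.coe_inj]; norm_num, one_pow]

/-- `φ ↦ U φ` identifies `ℓ²` isometrically with the space of growing sequences normed by `S (Wo
0)`. Kernels, projections and orthogonality can thus be taken in `Hilb N` itself. -/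
theorem S_Wo_zero_U (φ : Hilb N) : S (Wo 0) (U φ) = ‖φ‖ₑ ^ 2 := by
  rw [← S_one_eq]
  refine tsum_congr fun n => ?_
  rw [U, enorm_smul, enorm_four_thirds, ← mul_assoc, ← ENNReal.coe_mul, Wo_mul_pow]

/-- Quantitative decay of an operator in both indices. -/
structure VBound (V : Hilb N →L[ℂ] Hilb N) (ν : ℝ≥0) (k₀ : ℕ) : Prop where
  left : ∀ k, k₀ ≤ k → ∀ ψ, ‖Pr N (Set.Ici k) (V ψ)‖ₑ ≤ ((ν * (1 / 2) ^ k : ℝ≥0) : ℝ≥0∞) * ‖ψ‖ₑ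
  right : ∀ k, k₀ ≤ k → ∀ ψ, ‖V (Pr N (Set.Ici k) ψ)‖ₑ ≤ ((ν * (1 / 2) ^ k : ℝ≥0) : ℝ≥0∞) * ‖ψ‖ₑ

section VExt

variable {V : Hilb N →L[ℂ] Hilb N} {ν : ℝ≥0} {k₀ : ℕ}

theorem VBound.mono (h : VBound V ν k₀) {k₁ : ℕ} (hk : k₀ ≤ k₁) : VBound V ν k₁ :=
  ⟨fun k h1 => h.left k (hk.trans h1), fun k h1 => h.right k (hk.trans h1)⟩

theorem VBound.shell_left (h : VBound V ν k₀) {k : ℕ} (hk : k₀ ≤ k) (ψ : Hilb N) :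
    ‖Pr N {k} (V ψ)‖ₑ ≤ ((ν * (1 / 2) ^ k : ℝ≥0) : ℝ≥0∞) * ‖ψ‖ₑ := by
  rw [← Pr_Pr_of_subset (t := Set.Ici k) (by simp)]
  exact (enorm_Pr_le _ _).trans (h.left k hk ψ)

theorem VBound.sv_right (h : VBound V ν k₀) {l : ℕ} (hl : k₀ ≤ l) (φ : Hilb N) :
    ‖V (sv N l φ)‖ₑ ≤ ((ν * (1 / 2) ^ l : ℝ≥0) : ℝ≥0∞) * ‖sv N l φ‖ₑ := by
  have : sv N l φ = Pr N (Set.Ici l) (sv N l φ) := by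
    change (((4 / 3) ^ l : ℝ) : ℂ) • Pr N {l} φ = Pr N (Set.Ici l) ((((4 / 3) ^ l : ℝ) : ℂ) • Pr N {l} φ)
    rw [map_smul, Pr_Pr_of_subset' (by simp)]
  conv_lhs => rw [this]
  exact h.right l hl _

/-- The extension of `V` to weighted sequences. -/
def Vext (V : Hilb N →L[ℂ] Hilb N) : Hilb N →L[ℂ] Hilb N := ∑' l, V.comp (sv N l)

/-- The decay `(1/2)^l` of `V` on shell `l` beats the growth `(4/3)^l` allowed by `U`, leaving a
convergent series of ratio `2/3`. -/
theorem VBound.hasSum_Vext (h : VBound V ν 0) :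
    HasSum (fun l => V.comp (sv N l)) (Vext V) := by
  have h1 : ∀ l, ‖V.comp (sv N l)‖ ≤ ν * (2 / 3) ^ l := by
    intro l
    refine ContinuousLinearMap.opNorm_le_bound _ (by positivity) fun φ => ?_
    have h2 : ‖V (sv N l φ)‖ₑ ≤ ((ν * (2 / 3) ^ l : ℝ≥0) : ℝ≥0∞) * ‖φ‖ₑ := by
      refine (h.sv_right (Nat.zero_le l) φ).trans ?_
      rw [enorm_sv, ← mul_assoc, ← ENNReal.coe_mul]
      have e : ν * (1 / 2) ^ l * (4 / 3) ^ l = ν * (2 / 3) ^ l := by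
        rw [mul_assoc, ← mul_pow]; congr 2; rw [← NNReal.coe_inj]; norm_num
      rw [e]
      gcongr
      exact enorm_Pr_le _ _
    rw [enorm_eq_nnnorm, enorm_eq_nnnorm, ← ENNReal.coe_mul, ENNReal.coe_le_coe,
      ← NNReal.coe_le_coe] at h2
    push_cast at h2
    exact h2
  refine (Summable.of_norm_bounded ?_ h1).hasSum
  exact (summable_geometric_of_lt_one (by norm_num) (by norm_num)).mul_left _

theorem VBound.hasSum_Vext_apply (h : VBound V ν 0) (φ : Hilb N) :
    HasSum (fun l => V (sv N l φ)) (Vext V φ) :=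
  h.hasSum_Vext.mapL (ContinuousLinearMap.apply ℂ (Hilb N) φ)

theorem VBound.enorm_map_Vext_le (h : VBound V ν 0) (T : Hilb N →L[ℂ] Hilb N) (φ : Hilb N) :
    ‖T (Vext V φ)‖ₑ ≤ ∑' l, ‖T (V (sv N l φ))‖ₑ := by
  rw [← ((h.hasSum_Vext_apply φ).mapL T).tsum_eq]
  exact enorm_tsum_le_tsum_enorm

theorem abs_pow_le_one (n : ℤ) : |((3 / 4 : ℝ)) ^ sh n| ≤ 1 := by
  rw [abs_of_nonneg (by positivity)]
  exact pow_le_one₀ (by norm_num) (by norm_num)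

/-- Multiplication by `(3/4)^(sh n)`. -/
def wOp (N : ℕ) : Hilb N →L[ℂ] Hilb N := mulOp N (fun n => (3 / 4) ^ sh n) abs_pow_le_one

theorem U_wOp (ψ : Hilb N) (n : ℤ) : U (wOp N ψ) n = ψ n := by
  rw [U, wOp, mulOp_apply, smul_smul, ← Complex.ofReal_mul, ← mul_pow]
  norm_num

theorem sum_range_sv (φ ψ : Hilb N) (R : ℕ) (h : ∀ n, sh n < R → U φ n = ψ n)
    (h' : ∀ n, R ≤ sh n → ψ n = 0) : ∑ l ∈ Finset.range R, sv N l φ = ψ := by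
  ext1; funext n
  rw [lp.coeFn_sum, Finset.sum_apply]
  by_cases hn : sh n < R
  · rw [Finset.sum_eq_single (sh n) (fun l _ hl => sv_apply_of_ne hl.symm φ)
      (fun hl => absurd (Finset.mem_range.mpr hn) hl), sv_apply_of_eq rfl, h n hn]
  · rw [h' n (not_lt.mp hn)]
    refine Finset.sum_eq_zero fun l hl => sv_apply_of_ne ?_ φ
    rintro rfl
    exact hn (Finset.mem_range.mp hl)

/-- Consistency on `ℓ²`: the sequence `U (wOp N ψ)` is `ψ`, and the partial sums of `Vext` are `V`
applied to truncations of `ψ`. -/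
theorem VBound.Vext_wOp (h : VBound V ν 0) (ψ : Hilb N) : Vext V (wOp N ψ) = V ψ := by
  have h1 := (h.hasSum_Vext_apply (wOp N ψ)).tendsto_sum_nat
  have h2 : ∀ R, ∑ l ∈ Finset.range R, V (sv N l (wOp N ψ)) = V ψ - V (Pr N (Set.Ici R) ψ) := by
    intro R
    rw [← map_sum, ← map_sub, sum_range_sv _ (ψ - Pr N (Set.Ici R) ψ) R]
    · intro n hn
      rw [U_wOp, lp.coeFn_sub, Pi.sub_apply, Pr_apply_of_notMem (by simpa using hn), sub_zero]
    · intro n hn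
      rw [lp.coeFn_sub, Pi.sub_apply, Pr_apply_of_mem (by simpa using hn), sub_self]
  simp_rw [h2] at h1
  have h3 : Tendsto (fun R => V ψ - V (Pr N (Set.Ici R) ψ)) atTop (𝓝 (V ψ - V 0)) :=
    tendsto_const_nhds.sub ((V.continuous.tendsto 0).comp (tendsto_Pr_Ici ψ))
  rw [map_zero, sub_zero] at h3
  exact tendsto_nhds_unique h1 h3

/-- If `U φ` is square summable, then `Vext φ` is `V` applied to it. -/
theorem VBound.Vext_eq_of_eq_U (h : VBound V ν 0) {φ ψ : Hilb N} (hψ : ∀ n, ψ n = U φ n) : Vext V φ = V ψ := by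
  rw [← h.Vext_wOp]
  congr 1
  ext1; funext n
  rw [wOp, mulOp_apply, hψ, U, smul_smul, ← Complex.ofReal_mul, ← mul_pow]
  norm_num

/-- The truncation of `U φ` to the shells below `R`. -/
def Utr (φ : Hilb N) (R : ℕ) : Hilb N := ∑ l ∈ Finset.range R, sv N l φ

theorem Utr_apply_of_lt (φ : Hilb N) {R : ℕ} {n : ℤ} (h : sh n < R) : Utr φ R n = U φ n := by
  rw [Utr, lp.coeFn_sum, Finset.sum_apply,
    Finset.sum_eq_single (sh n) (fun l _ hl => sv_apply_of_ne hl.symm φ)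
      (fun hl => absurd (Finset.mem_range.mpr h) hl), sv_apply_of_eq rfl]

theorem Utr_apply_of_le (φ : Hilb N) {R : ℕ} {n : ℤ} (h : R ≤ sh n) : Utr φ R n = 0 := by
  rw [Utr, lp.coeFn_sum, Finset.sum_apply]
  refine Finset.sum_eq_zero fun l hl => sv_apply_of_ne ?_ φ
  rintro rfl
  exact absurd (Finset.mem_range.mp hl) (not_lt.mpr h)

theorem VBound.Vext_Pr_Iio (h : VBound V ν 0) (φ : Hilb N) (R : ℕ) :
    Vext V (Pr N (Set.Iio R) φ) = V (Utr φ R) := by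
  refine h.Vext_eq_of_eq_U fun n => ?_
  rcases lt_or_ge (sh n) R with hn | hn
  · rw [Utr_apply_of_lt φ hn, U, U, Pr_apply_of_mem (by simpa using hn)]
  · rw [Utr_apply_of_le φ hn, U, Pr_apply_of_notMem (by simpa using hn), smul_zero]

theorem enorm_Utr_sq_le (φ : Hilb N) {j R : ℕ} (hR : R ≤ j + 1) :
    ‖Utr φ R‖ₑ ^ 2 ≤ S (Wo j) (U φ) := by
  rw [← S_one_eq]
  refine ENNReal.tsum_le_tsum fun n => ?_
  beta_reduce
  rcases lt_or_ge (sh n) R with hn | hn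
  · rw [Utr_apply_of_lt φ hn, Wo, show sh n - j = 0 by omega, pow_zero]
  · rw [Utr_apply_of_le φ hn]; simp

/-- Off-diagonal decay of `V` between shells in the weight `2^k * Wo j k`. For `k ≤ l` the gain
`1/2` per shell is below `(3/4)²`: one factor `3/4` is the decay, the other pays for the change of
`Wo`. For `k ≥ l` the powers of two cancel and the decay comes from `Wo` itself; here `j ≤ l` is
needed. -/
theorem pow_aux1 {j k l : ℕ} (hl : j ≤ l) :
    2 ^ k * Wo j k * (1 / 2) ^ (max k l) ≤ (3 / 4) ^ ((k - l) + (l - k)) * Wo j l := by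
  unfold Wo
  rcases le_total k l with h | h
  · rw [max_eq_right h, Nat.sub_eq_zero_of_le h, zero_add]
    obtain ⟨d, rfl⟩ := Nat.exists_eq_add_of_le h
    rw [show k + d - k = d by omega]
    have e : (2 : ℝ≥0) ^ k * (3 / 4) ^ (k - j) * (1 / 2) ^ (k + d)
        = (1 / 2) ^ d * (3 / 4) ^ (k - j) := by
      rw [pow_add]
      calc _ = (2 * (1 / 2) : ℝ≥0) ^ k * ((1 / 2) ^ d * (3 / 4) ^ (k - j)) := by
            rw [mul_pow]; ring
        _ = _ := by norm_num
    rw [e]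
    have h1 : (3 / 4 : ℝ≥0) ≤ 1 := by rw [← NNReal.coe_le_coe]; norm_num
    have h2 : (1 / 2 : ℝ≥0) ≤ (3 / 4) * (3 / 4) := by rw [← NNReal.coe_le_coe]; norm_num
    calc (1 / 2 : ℝ≥0) ^ d * (3 / 4) ^ (k - j)
        ≤ ((3 / 4) * (3 / 4)) ^ d * (3 / 4) ^ (k - j) := by gcongr
      _ = (3 / 4) ^ d * (3 / 4) ^ (d + (k - j)) := by rw [mul_pow, pow_add]; ring
      _ ≤ _ := by
          gcongr (3 / 4) ^ d * ?_
          exact pow_le_pow_of_le_one zero_le h1 (by omega)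
  · rw [max_eq_left h, Nat.sub_eq_zero_of_le h, add_zero, ← pow_add,
      show k - l + (l - j) = k - j by omega]
    have : (2 : ℝ≥0) ^ k * (1 / 2) ^ k = 1 := by rw [← mul_pow]; norm_num
    rw [mul_right_comm, this, one_mul]

/-- The part of `φ` outside the shells below `j` contributes little to `Vext φ`. -/
theorem VBound.S_Vext_le (h0 : VBound V ν 0) {μ : ℝ≥0} (h : VBound V μ k₀) {φ : Hilb N} {j : ℕ}
    (hφ : ∀ n, sh n < j → φ n = 0) :
    S (fun k => if k₀ ≤ k then 2 ^ k * Wo j k else 0) (fun n => Vext V φ n)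
      ≤ (8 * μ) ^ 2 * S (Wo j) (U φ) := by
  rw [S_eq_tsum_shell, S_U_eq]
  refine (geometric_kernel_le (3 / 4) μ _ (fun l => (Wo j l : ℝ≥0∞) * ‖sv N l φ‖ₑ) ?_).trans ?_
  · intro k
    split_ifs with hk
    swap
    · simp
    calc ((2 ^ k * Wo j k : ℝ≥0) : ℝ≥0∞) * ‖Pr N {k} (Vext V φ)‖ₑ
        ≤ ((2 ^ k * Wo j k : ℝ≥0) : ℝ≥0∞) * ∑' l, ‖Pr N {k} (V (sv N l φ))‖ₑ := by
          gcongr; exact h0.enorm_map_Vext_le _ _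
      _ = ∑' l, ((2 ^ k * Wo j k : ℝ≥0) : ℝ≥0∞) * ‖Pr N {k} (V (sv N l φ))‖ₑ :=
          ENNReal.tsum_mul_left.symm
      _ ≤ _ := by
          refine ENNReal.tsum_le_tsum fun l => ?_
          rcases lt_or_ge l j with hl | hl
          · have : sv N l φ = 0 := by
              ext1; funext n
              by_cases hn : sh n = l
              · rw [sv_apply_of_eq hn, U, hφ n (hn ▸ hl), smul_zero]; rfl
              · rw [sv_apply_of_ne hn]; rfl
            rw [this]; simp
          -- `V` is small from the left by `2^(-k)` and from the right by `2^(-l)`; the better of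
          -- the two is used.
          have h1 : ‖Pr N {k} (V (sv N l φ))‖ₑ
              ≤ ((μ * (1 / 2) ^ (max k l) : ℝ≥0) : ℝ≥0∞) * ‖sv N l φ‖ₑ := by
            rcases le_total k l with hkl | hkl
            · rw [max_eq_right hkl]
              exact (enorm_Pr_le _ _).trans (h.sv_right (hk.trans hkl) φ)
            · rw [max_eq_left hkl]
              exact h.shell_left hk _
          calc ((2 ^ k * Wo j k : ℝ≥0) : ℝ≥0∞) * ‖Pr N {k} (V (sv N l φ))‖ₑ
              ≤ ((2 ^ k * Wo j k : ℝ≥0) : ℝ≥0∞) *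
                (((μ * (1 / 2) ^ (max k l) : ℝ≥0) : ℝ≥0∞) * ‖sv N l φ‖ₑ) := by gcongr
            _ = ((μ * (2 ^ k * Wo j k * (1 / 2) ^ (max k l)) : ℝ≥0) : ℝ≥0∞) * ‖sv N l φ‖ₑ := by
                rw [← mul_assoc, ← ENNReal.coe_mul]; congr 2; ring
            _ ≤ ((μ * ((3 / 4) ^ ((k - l) + (l - k)) * Wo j l) : ℝ≥0) : ℝ≥0∞) * ‖sv N l φ‖ₑ := by
                exact mul_le_mul_left (ENNReal.coe_le_coe.mpr (mul_le_mul_right (pow_aux1 hl) _)) _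
            _ = _ := by push_cast; ring
  · rw [mul_comm (8 : ℝ≥0∞)]
    refine mul_le_mul_left (pow_le_pow_left' (mul_le_mul_right ?_ _) 2) _
    have : (1 - ((3 / 4 : ℝ≥0) : ℝ≥0∞)) = ((1 / 4 : ℝ≥0) : ℝ≥0∞) := by
      rw [← ENNReal.coe_one, ← ENNReal.coe_sub]
      congr 1
      rw [tsub_eq_iff_eq_add_of_le (by rw [← NNReal.coe_le_coe]; norm_num), ← NNReal.coe_inj]
      norm_num
    rw [this, ← ENNReal.coe_inv (by norm_num)]
    have e : ((2 : ℝ≥0∞) * ((1 / 4 : ℝ≥0)⁻¹ : ℝ≥0)) = ((2 * (1 / 4)⁻¹ : ℝ≥0) : ℝ≥0∞) := by push_cast; rfl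
    rw [e, show (8 : ℝ≥0∞) = ((8 : ℝ≥0) : ℝ≥0∞) by norm_num, ENNReal.coe_le_coe]
    norm_num

theorem VBound.S_V_le (h : VBound V ν k₀) (W : ℕ → ℝ≥0) (ψ : Hilb N) :
    S (fun k => if k₀ ≤ k then W k else 0) (fun n => V ψ n)
      ≤ (∑' k, if k₀ ≤ k then ((W k * (ν * (1 / 2) ^ k) : ℝ≥0) : ℝ≥0∞) ^ 2 else 0) * ‖ψ‖ₑ ^ 2 := by
  rw [S_eq_tsum_shell, ← ENNReal.tsum_mul_right]
  refine ENNReal.tsum_le_tsum fun k => ?_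
  split_ifs with hk
  · rw [← mul_pow, ENNReal.coe_mul, mul_assoc]
    exact pow_le_pow_left' (mul_le_mul_right (h.shell_left hk ψ) _) 2
  · simp

/-- Write `1/2 = 2/3 · 3/4`. Beyond shell `j` the factor `3/4` is absorbed by `Wo j`, and `2/3`
leaves a geometric series for Cauchy–Schwarz, with square sum `9/5 ≤ 2`. -/
theorem VBound.enorm_Vext_sq_le (h0 : VBound V ν 0) {μ : ℝ≥0} {j : ℕ} (h : VBound V μ j)
    {φ : Hilb N} (hφ : ∀ n, sh n < j → φ n = 0) :
    ‖Vext V φ‖ₑ ^ 2 ≤ ((2 * (μ * (1 / 2) ^ j) ^ 2 : ℝ≥0) : ℝ≥0∞) * S (Wo j) (U φ) := by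
  have h1 := h0.enorm_map_Vext_le (ContinuousLinearMap.id ℂ _) φ
  simp only [ContinuousLinearMap.id_apply] at h1
  have h2 : ∑' l, ‖V (sv N l φ)‖ₑ ≤ ∑' l, (((μ * (1 / 2) ^ j) * (if j ≤ l then (2 / 3) ^ (l - j) else 0)
      : ℝ≥0) : ℝ≥0∞) * ((Wo j l : ℝ≥0∞) * ‖sv N l φ‖ₑ) := by
    refine ENNReal.tsum_le_tsum fun l => ?_
    rcases lt_or_ge l j with hl | hl
    · have : sv N l φ = 0 := by
        ext1; funext n
        by_cases hn : sh n = l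
        · rw [sv_apply_of_eq hn, U, hφ n (hn ▸ hl), smul_zero]; rfl
        · rw [sv_apply_of_ne hn]; rfl
      rw [this]; simp
    · refine (h.sv_right hl φ).trans ?_
      rw [if_pos hl, ← mul_assoc, ← ENNReal.coe_mul]
      refine mul_le_mul_left (ENNReal.coe_le_coe.mpr ?_) _
      rw [mul_assoc, mul_assoc, Wo, ← mul_pow]
      refine mul_le_mul_right ?_ _
      obtain ⟨d, rfl⟩ := Nat.exists_eq_add_of_le hl
      rw [pow_add, Nat.add_sub_cancel_left]
      gcongr
      rw [← NNReal.coe_le_coe]; norm_num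
  refine (pow_le_pow_left' (h1.trans h2) 2).trans ?_
  refine (ennreal_tsum_mul_sq_le _ _).trans ?_
  rw [S_U_eq]
  gcongr
  have h3 : ∀ l, ((((μ * (1 / 2) ^ j) * (if j ≤ l then (2 / 3) ^ (l - j) else 0) : ℝ≥0) : ℝ≥0∞)) ^ 2
      = (((μ * (1 / 2) ^ j) ^ 2 : ℝ≥0) : ℝ≥0∞) * (if j ≤ l then ((4 / 9 : ℝ≥0) : ℝ≥0∞) ^ (l - j) else 0) := by
    intro l
    rw [← ENNReal.coe_pow, mul_pow, ENNReal.coe_mul]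
    congr 1
    split_ifs
    · rw [← ENNReal.coe_pow, ← pow_mul, mul_comm, pow_mul]; congr 2; norm_num
    · simp
  simp_rw [h3]
  rw [ENNReal.tsum_mul_left, mul_comm 2, ENNReal.coe_mul]
  gcongr
  rw [← Summable.sum_add_tsum_nat_add' (k := j) ENNReal.summable, Finset.sum_eq_zero, zero_add]
  · simp only [Nat.le_add_left, if_true, Nat.add_sub_cancel]
    rw [ENNReal.tsum_geometric]
    have : (1 - ((4 / 9 : ℝ≥0) : ℝ≥0∞)) = ((5 / 9 : ℝ≥0) : ℝ≥0∞) := by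
      rw [← ENNReal.coe_one, ← ENNReal.coe_sub]
      congr 1
      rw [tsub_eq_iff_eq_add_of_le (by rw [← NNReal.coe_le_coe]; norm_num), ← NNReal.coe_inj]
      norm_num
    rw [this, ← ENNReal.coe_inv (by norm_num), ENNReal.coe_le_coe, ← NNReal.coe_le_coe]
    norm_num
  · intro l hl
    exact if_neg (not_le.mpr (Finset.mem_range.mp hl))

end VExt

end BlockLaurent

end

/-! ### Concentration of weighted solutions and the commutator of `H` with a cutoff -/

section

namespace BlockLaurent

open scoped NNReal

variable {N : ℕ} {a : ℤ → Op N} {V : Hilb N →L[ℂ] Hilb N}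

/-- `((H₀ + V - x) u)_n` for the weighted sequence `u = U φ`. -/
def res (a : ℤ → Op N) (V : Hilb N →L[ℂ] Hilb N) (x : ℝ) (φ : Hilb N) (n : ℤ) : Vec N :=
  lau a (U φ) n - (x : ℂ) • U φ n + Vext V φ n

theorem Wo_le (j k : ℕ) : Wo j k ≤ (4 / 3) ^ j * Wo 0 k := by
  rw [Wo, Wo, Nat.sub_zero]
  have h1 : (3 / 4 : ℝ≥0) ≤ 1 := by rw [← NNReal.coe_le_coe]; norm_num
  have h2 : (4 / 3 * (3 / 4) : ℝ≥0) = 1 := by rw [← NNReal.coe_inj]; norm_num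
  calc (3 / 4 : ℝ≥0) ^ (k - j) = (4 / 3 * (3 / 4)) ^ j * (3 / 4) ^ (k - j) := by
        rw [h2, one_pow, one_mul]
    _ = (4 / 3) ^ j * (3 / 4) ^ (j + (k - j)) := by rw [mul_pow, pow_add, mul_assoc]
    _ ≤ _ := mul_le_mul_right (pow_le_pow_of_le_one zero_le h1 (by omega)) _

theorem S_Wo_U_ne_top (j : ℕ) (φ : Hilb N) : S (Wo j) (U φ) ≠ ⊤ := by
  refine ne_top_of_le_ne_top ?_ (S_mono_weight (U φ) ((4 / 3) ^ j) (Wo_le j))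
  rw [S_Wo_zero_U]
  exact ENNReal.mul_ne_top (ENNReal.pow_ne_top ENNReal.coe_ne_top) (ENNReal.pow_ne_top enorm_ne_top)

/-- The terms from `k₀` up to `j` equal one, which gives `j - k₀`. The rest is bounded by the
two-sided series `2 (1 - 3/4)⁻¹ = 8`. -/
theorem tsum_Ici_geometric_le (j k₀ : ℕ) :
    ∑' k, (if k₀ ≤ k then ((3 / 4 : ℝ≥0) : ℝ≥0∞) ^ (k - j) else 0) ≤ ((j - k₀ + 8 : ℕ) : ℝ≥0∞) := by
  have h : ∀ k, (if k₀ ≤ k then ((3 / 4 : ℝ≥0) : ℝ≥0∞) ^ (k - j) else 0)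
      ≤ (if k ∈ Finset.Ico k₀ j then 1 else 0) + ((3 / 4 : ℝ≥0) : ℝ≥0∞) ^ ((j - k) + (k - j)) := by
    intro k
    split_ifs with h1 h2 h2
    · rw [Finset.mem_Ico] at h2
      rw [Nat.sub_eq_zero_of_le h2.2.le, pow_zero]; exact le_self_add
    · rw [Finset.mem_Ico, not_and, not_lt] at h2
      rw [Nat.sub_eq_zero_of_le (h2 h1), zero_add, zero_add]
    · exact zero_le
    · exact zero_le
  refine (ENNReal.tsum_le_tsum h).trans ?_
  rw [ENNReal.tsum_add, Nat.cast_add]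
  refine add_le_add ?_ ?_
  · rw [tsum_eq_sum (s := Finset.Ico k₀ j) (fun k hk => if_neg hk),
      Finset.sum_congr rfl (fun k hk => if_pos hk)]
    simp
  · refine (tsum_geometric_dist_le _ _).trans ?_
    have : (1 - ((3 / 4 : ℝ≥0) : ℝ≥0∞)) = ((1 / 4 : ℝ≥0) : ℝ≥0∞) := by
      rw [← ENNReal.coe_one, ← ENNReal.coe_sub]
      congr 1
      rw [tsub_eq_iff_eq_add_of_le (by rw [← NNReal.coe_le_coe]; norm_num), ← NNReal.coe_inj]
      norm_num
    rw [this, ← ENNReal.coe_inv (by norm_num)]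
    have e : ((2 : ℝ≥0∞) * ((1 / 4 : ℝ≥0)⁻¹ : ℝ≥0)) = ((2 * (1 / 4)⁻¹ : ℝ≥0) : ℝ≥0∞) := by
      push_cast; rfl
    rw [e, show ((8 : ℕ) : ℝ≥0∞) = ((8 : ℝ≥0) : ℝ≥0∞) by norm_num, ENNReal.coe_le_coe]
    norm_num

theorem U_mulOp (c : ℤ → ℝ) (h : ∀ n, |c n| ≤ 1) (φ : Hilb N) (n : ℤ) :
    U (mulOp N c h φ) n = (c n : ℂ) • U φ n := by
  rw [U, mulOp_apply, U, smul_comm]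

theorem S_U_mulOp_le (W : ℕ → ℝ≥0) (c : ℤ → ℝ) (h : ∀ n, |c n| ≤ 1) (φ : Hilb N) :
    S W (U (mulOp N c h φ)) ≤ S W (U φ) := by
  refine S_mono_fun fun n => ?_
  rw [U_mulOp, norm_smul, Complex.norm_real]
  exact mul_le_of_le_one_left (norm_nonneg _) (h n)

theorem Pr_Iio_add_Pr_Ici (j : ℕ) (φ : Hilb N) : Pr N (Set.Iio j) φ + Pr N (Set.Ici j) φ = φ := by
  ext1; funext n
  rw [lp.coeFn_add, Pi.add_apply]
  rcases lt_or_ge (sh n) j with h | h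
  · rw [Pr_apply_of_mem (by simpa using h), Pr_apply_of_notMem (by simpa using h), add_zero]
  · rw [Pr_apply_of_notMem (by simpa using h), Pr_apply_of_mem (by simpa using h), zero_add]

/-- Split `φ` at shell `j`. The inner part is an honest `ℓ²` vector, and every shell of its image
counts once, which gives `j - k₀ + 8`. The outer part is bounded through off-diagonal decay by `8² =
64`. The bound grows only linearly with the number of shells between `k₀` and `j`, and `μ` can be
taken small afterwards. -/
theorem VBound.S_Vext_tail_le {ν μ : ℝ≥0} {k₀ : ℕ} (h0 : VBound V ν 0) (h : VBound V μ k₀)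
    (j : ℕ) (φ : Hilb N) :
    S (fun k => if k₀ ≤ k then 2 ^ k * Wo j k else 0) (fun n => Vext V φ n)
      ≤ 2 * ((j - k₀ + 72 : ℕ) * (μ : ℝ≥0∞) ^ 2) * S (Wo j) (U φ) := by
  have h1 : ∀ n, Vext V φ n = V (Utr φ j) n + Vext V (Pr N (Set.Ici j) φ) n := by
    intro n
    rw [← h0.Vext_Pr_Iio, ← Pi.add_apply, ← lp.coeFn_add, ← map_add, Pr_Iio_add_Pr_Ici]
  simp_rw [h1]
  refine (S_add_le _ _ _).trans ?_
  rw [mul_assoc]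
  gcongr
  have e1 := h.S_V_le (fun k => 2 ^ k * Wo j k) (Utr φ j)
  have e2 := h0.S_Vext_le h (φ := Pr N (Set.Ici j) φ) (j := j)
    (fun n hn => Pr_apply_of_notMem (by simpa using hn) φ)
  have e3 : S (Wo j) (U (Pr N (Set.Ici j) φ)) ≤ S (Wo j) (U φ) := S_U_mulOp_le _ _ _ _
  have e4 : (∑' k, if k₀ ≤ k then (((2 ^ k * Wo j k) * (μ * (1 / 2) ^ k) : ℝ≥0) : ℝ≥0∞) ^ 2 else 0)
      ≤ (μ : ℝ≥0∞) ^ 2 * ((j - k₀ + 8 : ℕ) : ℝ≥0∞) := by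
    refine le_trans ?_ (mul_le_mul_right (tsum_Ici_geometric_le j k₀) _)
    rw [← ENNReal.tsum_mul_left]
    refine ENNReal.tsum_le_tsum fun k => ?_
    split_ifs
    · have e : (2 ^ k * Wo j k) * (μ * (1 / 2) ^ k) = μ * (3 / 4) ^ (k - j) := by
        rw [Wo]
        calc _ = (2 * (1 / 2) : ℝ≥0) ^ k * (μ * (3 / 4) ^ (k - j)) := by rw [mul_pow]; ring
          _ = _ := by norm_num
      rw [e, ENNReal.coe_mul, mul_pow]
      refine mul_le_mul_right ?_ _
      rw [ENNReal.coe_pow]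
      refine pow_le_of_le_one zero_le (pow_le_one₀ zero_le ?_) two_ne_zero
      have h1 : (3 / 4 : ℝ≥0) ≤ 1 := by rw [← NNReal.coe_le_coe]; norm_num
      exact_mod_cast h1
    · simp
  calc S (fun k => if k₀ ≤ k then 2 ^ k * Wo j k else 0) (fun n => V (Utr φ j) n)
      + S (fun k => if k₀ ≤ k then 2 ^ k * Wo j k else 0) (fun n => Vext V (Pr N (Set.Ici j) φ) n)
      ≤ (μ : ℝ≥0∞) ^ 2 * ((j - k₀ + 8 : ℕ) : ℝ≥0∞) * S (Wo j) (U φ)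
        + (8 * μ) ^ 2 * S (Wo j) (U φ) := by
        refine add_le_add (e1.trans (mul_le_mul' e4 (enorm_Utr_sq_le φ (Nat.le_succ j))))
          (e2.trans (mul_le_mul_right e3 _))
    _ = _ := by
        rw [← add_mul]
        congr 1
        push_cast
        ring

/-- Solutions of `(H - x) u = 0` have little mass near shell `j`, compared to their mass in all
the shells up to `j`. -/
theorem concentration (ha : mom a ≠ ⊤) {E δ : ℝ} {C B : ℝ≥0} (hH : HardyBound a E δ C)
    (h0 : VBound V B 0) (hV : ∀ ε : ℝ≥0, 0 < ε → ∃ k₀, VBound V ε k₀) {η : ℝ≥0} (hη : 0 < η) :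
    ∃ J : ℕ, ∀ j, J ≤ j → ∀ x : ℝ, |x - E| ≤ δ → ∀ φ, (∀ n, res a V x φ n = 0) →
      S (Wt j) (U φ) ≤ η * S (Wo j) (U φ) := by
  obtain ⟨m, hm⟩ : ∃ m : ℝ≥0, mom a = m := ⟨(mom a).toNNReal, (ENNReal.coe_toNNReal ha).symm⟩
  -- The width `L` is fixed first, to make the commutator and the inner tail of `Wt` small. The size
  -- `ε` of `V` is chosen afterwards, against the factor `2 L + 72`.
  obtain ⟨L, hL1, hL⟩ : ∃ L : ℕ, 1 ≤ L ∧
      4 * C * (4 / L * m) ^ 2 + ((2 / 3) ^ L) ^ 2 ≤ η / 2 := by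
    have t1 : Tendsto (fun L : ℕ => (4 : ℝ≥0) / L) atTop (𝓝 0) :=
      NNReal.tendsto_coe.mp (by simpa using tendsto_const_div_atTop_nhds_zero_nat (4 : ℝ))
    have t2 : Tendsto (fun L : ℕ => (2 / 3 : ℝ≥0) ^ L) atTop (𝓝 0) :=
      NNReal.tendsto_pow_atTop_nhds_zero_of_lt_one (by rw [← NNReal.coe_lt_coe]; norm_num)
    have t3 := (((t1.mul_const m).pow 2).const_mul (4 * C)).add (t2.pow 2)
    simp only [zero_mul, ne_eq, OfNat.ofNat_ne_zero, not_false_eq_true, zero_pow, mul_zero,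
      add_zero] at t3
    obtain ⟨L, h1, h2⟩ := ((eventually_ge_atTop 1).and (t3.eventually (gt_mem_nhds (half_pos hη)))).exists
    exact ⟨L, h1, h2.le⟩
  obtain ⟨ε, hε, hε2⟩ : ∃ ε : ℝ≥0, 0 < ε ∧ 8 * C * ((2 * L + 72 : ℕ) * ε ^ 2) ≤ η / 2 := by
    have t1 : Tendsto (fun ε : ℝ≥0 => 8 * C * ((2 * L + 72 : ℕ) * ε ^ 2)) (𝓝[>] 0) (𝓝 0) := by
      have : Tendsto (fun ε : ℝ≥0 => 8 * C * ((2 * L + 72 : ℕ) * ε ^ 2)) (𝓝 0)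
          (𝓝 (8 * C * ((2 * L + 72 : ℕ) * 0 ^ 2))) := by
        refine Continuous.tendsto ?_ 0
        fun_prop
      rw [zero_pow two_ne_zero, mul_zero, mul_zero] at this
      exact this.mono_left nhdsWithin_le_nhds
    obtain ⟨ε, h1, h2⟩ := ((t1.eventually (gt_mem_nhds (half_pos hη))).and self_mem_nhdsWithin).exists
    exact ⟨ε, h2, h1.le⟩
  obtain ⟨k₀, hk₀⟩ := hV ε hε
  refine ⟨k₀ + 2 * L, fun j hj x hx φ hφ => ?_⟩
  -- The cutoff rises on the shells from `i` to `i + L`; the `L` shells from there to `j` are a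
  -- buffer on which it already equals one.
  obtain ⟨i, rfl⟩ : ∃ i, j = i + 2 * L := ⟨j - 2 * L, by omega⟩
  set j := i + 2 * L with hjdef
  have hV' : VBound V ε i := hk₀.mono (by omega)
  set c : ℤ → ℝ := cut i L with hc
  set φ' : Hilb N := mulOp N c (abs_cut_le_one i L) φ with hφ'
  have hU' : U φ' = fun n => (c n : ℂ) • U φ n := funext fun n => U_mulOp _ _ _ _
  have e1 := hH.extend ha hx j (S_Wo_U_ne_top j φ')
  have e2 : ∀ n, lau a (U φ') n - (x : ℂ) • U φ' n = (lau a (fun m => (c m : ℂ) • U φ m) n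
      - (c n : ℂ) • lau a (U φ) n) - (c n : ℂ) • Vext V φ n := by
    intro n
    have h := hφ n
    rw [res, add_eq_zero_iff_eq_neg, sub_eq_iff_eq_add] at h
    rw [hU', h]
    module
  simp_rw [e2] at e1
  have e3 := S_commutator_cut_le ha (doubling_Wo j) (S_Wo_U_ne_top j φ) i L
  have e4 : S (fun k => 2 ^ k * Wo j k) (fun n => (c n : ℂ) • Vext V φ n)
      ≤ 2 * ((2 * L + 72 : ℕ) * (ε : ℝ≥0∞) ^ 2) * S (Wo j) (U φ) := by
    have h1 := h0.S_Vext_tail_le hV' j φ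
    rw [show j - i = 2 * L by omega] at h1
    refine le_trans (ENNReal.tsum_le_tsum fun n => pow_le_pow_left' ?_ 2) h1
    beta_reduce
    rcases lt_or_ge (sh n) i with hn | hn
    · rw [hc, cut_eq_zero hn]; simp
    · rw [if_pos hn]
      gcongr
      rw [enorm_le_iff_norm_le, norm_smul, Complex.norm_real]
      exact mul_le_of_le_one_left (norm_nonneg _) (abs_cut_le_one i L n)
  have e5 : S (Wo j) (U φ') ≤ 2 * C * (2 * (((4 / L : ℝ≥0) * m : ℝ≥0∞) ^ 2 * S (Wo j) (U φ)
      + 2 * ((2 * L + 72 : ℕ) * (ε : ℝ≥0∞) ^ 2) * S (Wo j) (U φ))) := by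
    refine e1.trans ?_
    gcongr
    refine (S_sub_le _ _ _).trans ?_
    gcongr
    rw [hm] at e3
    exact e3
  -- Below shell `i + L` the tent is at most `(2/3)^L` times `Wo j`. From there on the cutoff is one
  -- and the tent is at most `Wo j`.
  have e6 : S (Wt j) (U φ) ≤ S (Wo j) (U φ') + (((2 / 3 : ℝ≥0) ^ L : ℝ≥0) : ℝ≥0∞) ^ 2 * S (Wo j) (U φ) := by
    unfold S
    rw [← ENNReal.tsum_mul_left, ← ENNReal.tsum_add]
    refine ENNReal.tsum_le_tsum fun n => ?_
    have hle : (2 / 3 : ℝ≥0) ≤ 1 := by rw [← NNReal.coe_le_coe]; norm_num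
    rcases lt_or_ge (sh n) (i + L) with hn | hn
    · refine le_trans ?_ le_add_self
      rw [← mul_pow, ← mul_assoc, ← ENNReal.coe_mul]
      refine pow_le_pow_left' (mul_le_mul_left (ENNReal.coe_le_coe.mpr ?_) _) 2
      rw [Wt, Wo]
      refine mul_le_mul_left ?_ _
      exact pow_le_pow_of_le_one zero_le hle (by omega)
    · refine le_trans ?_ le_self_add
      rw [hU']
      beta_reduce
      rw [hc, cut_eq_one hL1 hn, Complex.ofReal_one, one_smul]
      refine pow_le_pow_left' (mul_le_mul_left (ENNReal.coe_le_coe.mpr ?_) _) 2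
      rw [Wt, Wo]
      exact mul_le_of_le_one_left zero_le (pow_le_one₀ zero_le hle)
  refine e6.trans ((add_le_add_left e5 _).trans ?_)
  have e7 : 2 * C * (2 * (((4 / L : ℝ≥0) * m : ℝ≥0∞) ^ 2 * S (Wo j) (U φ)
      + 2 * ((2 * L + 72 : ℕ) * (ε : ℝ≥0∞) ^ 2) * S (Wo j) (U φ)))
      + (((2 / 3 : ℝ≥0) ^ L : ℝ≥0) : ℝ≥0∞) ^ 2 * S (Wo j) (U φ)
      = ((4 * C * (4 / L * m) ^ 2 + ((2 / 3) ^ L) ^ 2 + 8 * C * ((2 * L + 72 : ℕ) * ε ^ 2) : ℝ≥0) : ℝ≥0∞)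
        * S (Wo j) (U φ) := by
    simp only [ENNReal.coe_add, ENNReal.coe_mul, ENNReal.coe_pow, ENNReal.coe_natCast,
      ENNReal.coe_ofNat]
    ring
  rw [e7]
  gcongr
  calc _ ≤ η / 2 + η / 2 := add_le_add hL hε2
    _ = η := add_halves η

theorem abs_one_sub_cut_le (j : ℕ) (n : ℤ) : |1 - cut j 1 n| ≤ 1 :=
  abs_le.mpr ⟨by linarith [cut_le_one j 1 n], by linarith [cut_nonneg j 1 n]⟩

/-- Multiplication by the cutoff to the shells up to `j`. -/
def chi (N j : ℕ) : Hilb N →L[ℂ] Hilb N := mulOp N (fun n => 1 - cut j 1 n) (abs_one_sub_cut_le j)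

theorem chi_apply (j : ℕ) (φ : Hilb N) (n : ℤ) :
    chi N j φ n = ((1 - cut j 1 n : ℝ) : ℂ) • φ n := rfl

theorem U_chi (j : ℕ) (φ : Hilb N) (n : ℤ) :
    U (chi N j φ) n = ((1 - cut j 1 n : ℝ) : ℂ) • U φ n := U_mulOp _ _ _ _

theorem chi_apply_of_lt {j : ℕ} {n : ℤ} (h : sh n < j) (φ : Hilb N) : chi N j φ n = φ n := by
  rw [chi_apply, cut_eq_zero h]; simp

theorem chi_apply_of_gt {j : ℕ} {n : ℤ} (h : j < sh n) (φ : Hilb N) : chi N j φ n = 0 := by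
  rw [chi_apply, cut_eq_one one_pos h]; simp

/-- The commutator of `H` with the cutoff is small and lives near shell `j`. -/
theorem S_commutator_chi_le (ha : mom a ≠ ⊤) {ν μ : ℝ≥0} (h0 : VBound V ν 0) {j : ℕ}
    (h : VBound V μ j) (x : ℝ) (φ : Hilb N) :
    S (Ws j) (fun n => res a V x (chi N j φ) n - ((1 - cut j 1 n : ℝ) : ℂ) • res a V x φ n)
      ≤ (((1 / 2) ^ j : ℝ≥0) : ℝ≥0∞) ^ 2 * (512 * mom a ^ 2 * S (Wt j) (U φ)
        + 40 * μ ^ 2 * S (Wo j) (U φ)) := by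
  set c : ℤ → ℝ := cut j 1 with hc
  set φ₁ := chi N j φ with hφ₁
  set φ₂ := mulOp N c (abs_cut_le_one j 1) φ with hφ₂
  have hsum : φ = φ₁ + φ₂ := by
    ext1; funext n
    rw [lp.coeFn_add, Pi.add_apply, hφ₁, hφ₂, chi_apply, mulOp_apply, ← add_smul, ← Complex.ofReal_add,
      sub_add_cancel, Complex.ofReal_one, one_smul]
  have hlau : ∀ n, lau a (U φ₁) n = lau a (U φ) n - lau a (fun m => (c m : ℂ) • U φ m) n := by
    intro n
    have hU2 : U φ₂ = fun m => (c m : ℂ) • U φ m := funext fun m => U_mulOp _ _ _ _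
    unfold lau
    rw [← hU2, ← (summable_lau ha (doubling_Wo 0) (S_Wo_U_ne_top 0 φ) n).tsum_sub
        (summable_lau ha (doubling_Wo 0) (S_Wo_U_ne_top 0 φ₂) n)]
    refine tsum_congr fun m => ?_
    rw [← map_sub, hU2, U_chi]
    congr 1
    push_cast
    module
  -- With `χ = 1 - c` the commutator with `V` is `c V χ - χ V c`, so only transitions across shell
  -- `j` remain. Decay of `V` from the left bounds the first term, whose output lies in shells at
  -- least `j`; decay from the right bounds the second, whose input does.
  have hdecomp : ∀ n, res a V x φ₁ n - ((1 - c n : ℝ) : ℂ) • res a V x φ n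
      = ((c n : ℂ) • Vext V φ₁ n - ((1 - c n : ℝ) : ℂ) • Vext V φ₂ n)
        - (lau a (fun m => (c m : ℂ) • U φ m) n - (c n : ℂ) • lau a (U φ) n) := by
    intro n
    have hVn : Vext V φ n = Vext V φ₁ n + Vext V φ₂ n := by
      conv_lhs => rw [hsum]
      rw [map_add, lp.coeFn_add, Pi.add_apply]
    rw [res, res, hlau, U_chi, hVn]
    push_cast
    module
  simp_rw [hdecomp]
  refine (S_sub_le _ _ _).trans ?_
  have e1 := S_commutator_cut_local_le ha (doubling_Wo j) (S_Wo_U_ne_top j φ) (doubling_Ws j)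
    (doubling_Wt j) (j := j) (by simp [Ws]) (by simp [Wt])
  have hφ₁supp : Pr N (Set.Iio (j + 1)) φ₁ = φ₁ := by
    ext1; funext n
    rcases lt_or_ge (sh n) (j + 1) with hn | hn
    · rw [Pr_apply_of_mem (by simpa using hn)]
    · rw [Pr_apply_of_notMem (by simpa using hn), hφ₁, chi_apply_of_gt hn]
  have e2 : S (Ws j) (fun n => (c n : ℂ) • Vext V φ₁ n)
      ≤ 8 * μ ^ 2 * (((1 / 2) ^ j : ℝ≥0) : ℝ≥0∞) ^ 2 * S (Wo j) (U φ) := by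
    have h1 := h.S_V_le (Ws j) (Utr φ₁ (j + 1))
    rw [← h0.Vext_Pr_Iio, hφ₁supp] at h1
    have h2 : S (Ws j) (fun n => (c n : ℂ) • Vext V φ₁ n)
        ≤ S (fun k => if j ≤ k then Ws j k else 0) (fun n => Vext V φ₁ n) := by
      refine ENNReal.tsum_le_tsum fun n => pow_le_pow_left' ?_ 2
      beta_reduce
      rcases lt_or_ge (sh n) j with hn | hn
      · rw [hc, cut_eq_zero hn]; simp
      · rw [if_pos hn]
        gcongr
        rw [enorm_le_iff_norm_le, norm_smul, Complex.norm_real]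
        exact mul_le_of_le_one_left (norm_nonneg _) (abs_cut_le_one j 1 n)
    refine h2.trans (h1.trans (mul_le_mul' ?_ ((enorm_Utr_sq_le φ₁ le_rfl).trans
      (S_U_mulOp_le _ _ _ _))))
    have h3 := tsum_Ici_geometric_le j j
    rw [Nat.sub_self, zero_add] at h3
    calc _ ≤ ∑' k, (μ ^ 2 * (((1 / 2) ^ j : ℝ≥0) : ℝ≥0∞) ^ 2) *
          (if j ≤ k then ((3 / 4 : ℝ≥0) : ℝ≥0∞) ^ (k - j) else 0) := by
          refine ENNReal.tsum_le_tsum fun k => ?_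
          split_ifs with hk
          -- The growth `3/2` of `Ws` against the decay `1/2` of `V` leaves the summable ratio
          -- `3/4`.
          · have e : Ws j k * (μ * (1 / 2) ^ k) = μ * (1 / 2) ^ j * (3 / 4) ^ (k - j) := by
              obtain ⟨d, rfl⟩ := Nat.exists_eq_add_of_le hk
              rw [Ws, pow_add, Nat.add_sub_cancel_left]
              calc _ = μ * (1 / 2) ^ j * ((3 / 2) * (1 / 2)) ^ d := by rw [mul_pow]; ring
                _ = _ := by congr 2; rw [← NNReal.coe_inj]; norm_num
            rw [e, ENNReal.coe_mul, ENNReal.coe_mul, mul_pow, mul_pow]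
            refine mul_le_mul_right ?_ _
            rw [ENNReal.coe_pow]
            refine pow_le_of_le_one zero_le (pow_le_one₀ zero_le ?_) two_ne_zero
            have h1 : (3 / 4 : ℝ≥0) ≤ 1 := by rw [← NNReal.coe_le_coe]; norm_num
            exact_mod_cast h1
          · simp
      _ ≤ (μ ^ 2 * (((1 / 2) ^ j : ℝ≥0) : ℝ≥0∞) ^ 2) * ((8 : ℕ) : ℝ≥0∞) := by
          rw [ENNReal.tsum_mul_left]
          gcongr
      _ = _ := by push_cast; ring
  have e3 : S (Ws j) (fun n => ((1 - c n : ℝ) : ℂ) • Vext V φ₂ n)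
      ≤ 2 * μ ^ 2 * (((1 / 2) ^ j : ℝ≥0) : ℝ≥0∞) ^ 2 * S (Wo j) (U φ) := by
    have h1 := h0.enorm_Vext_sq_le h (φ := φ₂) (fun n hn => by
      rw [hφ₂, mulOp_apply, hc, cut_eq_zero hn]; simp)
    have h2 : S (Ws j) (fun n => ((1 - c n : ℝ) : ℂ) • Vext V φ₂ n) ≤ ‖Vext V φ₂‖ₑ ^ 2 := by
      rw [← S_one_eq]
      refine ENNReal.tsum_le_tsum fun n => pow_le_pow_left' ?_ 2
      beta_reduce
      rcases lt_or_ge j (sh n) with hn | hn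
      · rw [hc, cut_eq_one one_pos hn]; simp
      · rw [Ws, Nat.sub_eq_zero_of_le hn, pow_zero]
        gcongr
        rw [enorm_le_iff_norm_le, norm_smul, Complex.norm_real]
        exact mul_le_of_le_one_left (norm_nonneg _) (abs_one_sub_cut_le j n)
    refine h2.trans (h1.trans (mul_le_mul' (le_of_eq ?_) (S_U_mulOp_le _ _ _ _)))
    simp only [ENNReal.coe_mul, ENNReal.coe_pow, ENNReal.coe_ofNat]
    ring
  calc _ ≤ 2 * (2 * (8 * μ ^ 2 * (((1 / 2) ^ j : ℝ≥0) : ℝ≥0∞) ^ 2 * S (Wo j) (U φ)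
        + 2 * μ ^ 2 * (((1 / 2) ^ j : ℝ≥0) : ℝ≥0∞) ^ 2 * S (Wo j) (U φ))
        + (((16 * (1 / 2) ^ j : ℝ≥0) : ℝ≥0∞) * mom a) ^ 2 * S (Wt j) (U φ)) := by
        gcongr
        exact (S_sub_le _ _ _).trans (by gcongr)
    _ = _ := by
        simp only [ENNReal.coe_mul, ENNReal.coe_pow, ENNReal.coe_ofNat]
        ring

end BlockLaurent

end

/-! ### Finite dimensional kernel and coercivity in the weighted space -/

section

namespace BlockLaurent

open scoped NNReal

section Gap

variable {X F : Type*} [NormedAddCommGroup X] [InnerProductSpace ℂ X] [CompleteSpace X]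
  [NormedAddCommGroup F] [NormedSpace ℂ F] [FiniteDimensional ℂ F]

/-- A coercivity estimate modulo a finite rank map gives a finite dimensional kernel and a coercivity
estimate on its orthogonal complement. -/
theorem gap_of_coercive_mod_finite (R : X →L[ℂ] X) (π : X →L[ℂ] F) (q : X → ℝ≥0∞) (c M : ℝ≥0)
    (hq : ∀ φ ψ, q (φ - ψ) ≤ 2 * (q φ + q ψ)) (hsmul : ∀ (t : ℂ) φ, q (t • φ) = ‖t‖ₑ ^ 2 * q φ)
    (hR : ∀ φ, ‖R φ‖ₑ ^ 2 ≤ q φ) (hker : ∀ φ, R φ = 0 → q φ = 0)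
    (h : ∀ φ, ‖φ‖ₑ ^ 2 ≤ c * q φ + M * ‖π φ‖ₑ ^ 2) :
    FiniteDimensional ℂ R.ker ∧ ∃ C : ℝ≥0, ∀ φ ∈ R.kerᗮ, ‖φ‖ₑ ^ 2 ≤ C * q φ := by
  constructor
  -- On the kernel `q` vanishes, so the estimate makes `π` injective there.
  · refine FiniteDimensional.of_injective
      ((π : X →ₗ[ℂ] F).comp R.ker.subtype) ?_
    rw [← LinearMap.ker_eq_bot, LinearMap.ker_eq_bot']
    intro φ hφ
    have h1 := h φ
    have h2 : π φ = 0 := hφ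
    rw [hker φ φ.2, h2] at h1
    simpa using h1
  -- If no constant works, there are unit vectors orthogonal to the kernel with `q → 0`. Their
  -- images under `π` converge along a subsequence, the estimate makes that subsequence Cauchy, and
  -- the limit is a unit vector both in the kernel and orthogonal to it.
  by_contra! hcon
  have hseq : ∀ n : ℕ, ∃ φ ∈ R.kerᗮ, ‖φ‖ = 1 ∧ q φ ≤ ((n : ℝ≥0∞) + 1)⁻¹ := by
    intro n
    obtain ⟨φ, h1, h2⟩ := hcon (n + 1)
    have h3 : φ ≠ 0 := by
      rintro rfl
      simp at h2
    have h4 : ‖φ‖ₑ ≠ 0 := by simpa using h3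
    refine ⟨((‖φ‖⁻¹ : ℝ) : ℂ) • φ, Submodule.smul_mem _ _ h1, ?_, ?_⟩
    · rw [norm_smul, Complex.norm_real, norm_inv, norm_norm, inv_mul_cancel₀ (by simpa using h3)]
    · rw [hsmul]
      have h5 : ‖((‖φ‖⁻¹ : ℝ) : ℂ)‖ₑ = ‖φ‖ₑ⁻¹ := by
        rw [← ofReal_norm, Complex.norm_real, norm_inv, norm_norm,
          ENNReal.ofReal_inv_of_pos (by simpa using h3), ofReal_norm]
      rw [h5, ENNReal.le_inv_iff_mul_le, mul_assoc, ← ENNReal.inv_pow, mul_comm, ← div_eq_mul_inv]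
      refine ENNReal.div_le_of_le_mul ?_
      rw [one_mul, mul_comm]
      exact_mod_cast h2.le
  choose φ hperp hnorm hqφ using hseq
  have hbdd : Bornology.IsBounded (Metric.closedBall (0 : F) ‖π‖) := Metric.isBounded_closedBall
  have : ProperSpace F := FiniteDimensional.proper ℂ F
  obtain ⟨y, -, s, hs, hy⟩ := tendsto_subseq_of_bounded hbdd (x := fun n => π (φ n)) (fun n => by
    rw [mem_closedBall_zero_iff]
    simpa [hnorm n] using π.le_opNorm (φ n))
  have hq0 : Tendsto (fun n => q (φ (s n))) atTop (𝓝 0) := by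
    have h1 : Tendsto (fun n : ℕ => ((n : ℝ≥0∞) + 1)⁻¹) atTop (𝓝 0) := by
      rw [← ENNReal.inv_top]
      refine tendsto_inv_iff.mpr ?_
      have := ENNReal.tendsto_nat_nhds_top.comp (tendsto_add_atTop_nat 1)
      simpa [Function.comp_def] using this
    exact (tendsto_of_tendsto_of_tendsto_of_le_of_le tendsto_const_nhds h1 (fun _ => zero_le)
      hqφ).comp hs.tendsto_atTop
  have hcau : CauchySeq (fun n => φ (s n)) := by
    rw [cauchySeq_iff_tendsto_dist_atTop_0]
    have h1 : Tendsto (fun p : ℕ × ℕ => (c : ℝ≥0∞) * (2 * (q (φ (s p.1)) + q (φ (s p.2))))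
        + M * ‖π (φ (s p.1)) - π (φ (s p.2))‖ₑ ^ 2) atTop (𝓝 0) := by
      rw [← prod_atTop_atTop_eq]
      have e1 : Tendsto (fun p : ℕ × ℕ => q (φ (s p.1)) + q (φ (s p.2))) (atTop ×ˢ atTop) (𝓝 (0 + 0)) :=
        (hq0.comp tendsto_fst).add (hq0.comp tendsto_snd)
      have e2 := ENNReal.Tendsto.const_mul (a := (c : ℝ≥0∞)) (ENNReal.Tendsto.const_mul (a := 2) e1
        (Or.inr (by norm_num))) (Or.inr ENNReal.coe_ne_top)
      have e3 : Tendsto (fun p : ℕ × ℕ => π (φ (s p.1)) - π (φ (s p.2))) (atTop ×ˢ atTop)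
          (𝓝 (y - y)) := (hy.comp tendsto_fst).sub (hy.comp tendsto_snd)
      have e4 := ENNReal.Tendsto.const_mul (a := (M : ℝ≥0∞)) ((ENNReal.continuous_pow 2).tendsto _ |>.comp
        ((continuous_enorm.tendsto _).comp e3)) (Or.inr ENNReal.coe_ne_top)
      convert e2.add e4 using 2
      · rfl
      · rw [sub_self, enorm_zero, add_zero, zero_pow two_ne_zero, mul_zero, mul_zero, mul_zero, add_zero]
    have h2 : Tendsto (fun p : ℕ × ℕ => ‖φ (s p.1) - φ (s p.2)‖ₑ ^ 2) atTop (𝓝 0) := by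
      refine tendsto_of_tendsto_of_tendsto_of_le_of_le tendsto_const_nhds h1 (fun _ => zero_le)
        fun p => (h _).trans ?_
      rw [map_sub]
      gcongr
      exact hq _ _
    have h3 : Tendsto (fun p : ℕ × ℕ => (‖φ (s p.1) - φ (s p.2)‖ₑ ^ 2).toReal) atTop (𝓝 0) := by
      have := (ENNReal.tendsto_toReal ENNReal.zero_ne_top).comp h2
      rwa [ENNReal.toReal_zero] at this
    have h4 := (Real.continuous_sqrt.tendsto 0).comp h3
    rw [Real.sqrt_zero] at h4
    refine h4.congr fun p => ?_
    simp [dist_eq_norm]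
  obtain ⟨ψ, hψ⟩ := cauchySeq_tendsto_of_complete hcau
  have h1 : ‖ψ‖ = 1 := tendsto_nhds_unique hψ.norm (by simp [hnorm])
  have h2 : ψ ∈ R.kerᗮ := R.ker.isClosed_orthogonal.mem_of_tendsto hψ
    (Eventually.of_forall fun n => hperp _)
  have h3 : R ψ = 0 := by
    have e1 : Tendsto (fun n => ‖R (φ (s n))‖ₑ ^ 2) atTop (𝓝 0) :=
      tendsto_of_tendsto_of_tendsto_of_le_of_le tendsto_const_nhds hq0 (fun _ => zero_le)
        fun n => hR _
    have e2 := (ENNReal.continuous_pow 2).tendsto _ |>.comp ((continuous_enorm.tendsto _).comp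
      ((R.continuous.tendsto ψ).comp hψ))
    have e3 := tendsto_nhds_unique e1 e2
    simpa using e3.symm
  have h4 : inner ℂ ψ ψ = (0 : ℂ) := h2 ψ h3
  rw [inner_self_eq_zero] at h4
  rw [h4, norm_zero] at h1
  exact zero_ne_one h1

end Gap

variable {N : ℕ} {a : ℤ → Op N} {V : Hilb N →L[ℂ] Hilb N}

theorem S_smul {W : ℕ → ℝ≥0} (t : ℂ) (u : ℤ → Vec N) :
    S W (fun n => t • u n) = ‖t‖ₑ ^ 2 * S W u := by
  unfold S
  rw [← ENNReal.tsum_mul_left]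
  refine tsum_congr fun n => ?_
  rw [enorm_smul]; ring

theorem S_lau_le {W : ℕ → ℝ≥0} (hW : Doubling W) (u : ℤ → Vec N) :
    S W (lau a u) ≤ (2 * mom a) ^ 2 * S W u := by
  refine S_le_of_convolution a (fun _ _ => 1) 2 (fun n m => ?_) (fun n => ?_)
  · rw [mul_one]
    have hd : (1 : ℝ≥0) ≤ jb (n - m) := by exact_mod_cast one_le_jb (n - m)
    have := (hW.le_jb n m).trans (mul_le_mul_left (mul_le_mul_right
      (le_self_pow₀ hd (by norm_num : 8 ≠ 0)) 2) _)
    exact_mod_cast this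
  · refine enorm_tsum_le_tsum_enorm.trans (ENNReal.tsum_le_tsum fun m => ?_)
    rw [mul_one]
    exact ContinuousLinearMap.le_opENorm _ _

theorem U_inj {φ ψ : Hilb N} (h : ∀ n, U φ n = U ψ n) : φ = ψ := by
  ext1; funext n
  have := h n
  unfold U at this
  exact smul_right_injective _ (by norm_cast; positivity) this

theorem U_add (φ ψ : Hilb N) (n : ℤ) : U (φ + ψ) n = U φ n + U ψ n := by
  simp [U]

theorem U_sub (φ ψ : Hilb N) (n : ℤ) : U (φ - ψ) n = U φ n - U ψ n := by
  simp [U, smul_sub]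

theorem U_smul (t : ℂ) (φ : Hilb N) (n : ℤ) : U (t • φ) n = t • U φ n := by
  simp only [U, lp.coeFn_smul, Pi.smul_apply]
  rw [smul_comm]

theorem smul_U_inv (v : ℤ → Vec N) (n : ℤ) :
    (((4 / 3) ^ sh n : ℝ) : ℂ) • (((3 / 4) ^ sh n : ℝ) : ℂ) • v n = v n := by
  rw [smul_smul, ← Complex.ofReal_mul, ← mul_pow]
  norm_num

/-- `H₀` acts boundedly on the weighted space because `Wo 0` is doubling; conjugation with `U` makes
it a bounded operator on `ℓ²`. -/
theorem exists_lauOp (ha : mom a ≠ ⊤) :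
    ∃ T : Hilb N →L[ℂ] Hilb N, ∀ φ n, U (T φ) n = lau a (U φ) n := by
  have hS : ∀ φ : Hilb N, S (fun _ => 1) (fun n => (((3 / 4) ^ sh n : ℝ) : ℂ) • lau a (U φ) n)
      ≤ (2 * mom a) ^ 2 * ‖φ‖ₑ ^ 2 := by
    intro φ
    rw [← S_Wo_zero_U]
    refine le_trans (ENNReal.tsum_le_tsum fun n => pow_le_pow_left' ?_ 2) (S_lau_le (doubling_Wo 0) _)
    rw [enorm_smul, ENNReal.coe_one, one_mul]
    refine mul_le_mul_left (le_of_eq ?_) _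
    rw [Wo, Nat.sub_zero, ← enorm_ofReal_coe]
    norm_num
  have hfin : (2 * mom a) ≠ ⊤ := ENNReal.mul_ne_top (by norm_num) ha
  have hmem : ∀ φ : Hilb N, Memℓp (fun n => (((3 / 4) ^ sh n : ℝ) : ℂ) • lau a (U φ) n) 2 := fun φ =>
    memℓp_of_S_ne_top (ne_top_of_le_ne_top (ENNReal.mul_ne_top (ENNReal.pow_ne_top hfin)
      (ENNReal.pow_ne_top enorm_ne_top)) (hS φ))
  have hs : ∀ (φ : Hilb N) n, Summable fun m => a (n - m) (U φ m) :=
    fun φ n => summable_lau ha (doubling_Wo 0) (S_Wo_U_ne_top 0 φ) n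
  let T : Hilb N →ₗ[ℂ] Hilb N :=
    { toFun := fun φ => ⟨_, hmem φ⟩
      map_add' := fun φ ψ => by
        ext1; funext n
        change (((3 / 4) ^ sh n : ℝ) : ℂ) • lau a (U (φ + ψ)) n = (((3 / 4) ^ sh n : ℝ) : ℂ) • lau a (U φ) n
          + (((3 / 4) ^ sh n : ℝ) : ℂ) • lau a (U ψ) n
        rw [← smul_add]
        refine congrArg _ ?_
        unfold lau
        rw [← (hs φ n).tsum_add (hs ψ n)]
        exact tsum_congr fun m => by rw [U_add, map_add]
      map_smul' := fun t φ => by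
        ext1; funext n
        change (((3 / 4) ^ sh n : ℝ) : ℂ) • lau a (U (t • φ)) n
          = t • ((((3 / 4) ^ sh n : ℝ) : ℂ) • lau a (U φ) n)
        rw [smul_comm]
        refine congrArg _ ?_
        unfold lau
        rw [← tsum_const_smul'']
        exact tsum_congr fun m => by rw [U_smul, map_smul] }
  refine ⟨T.mkContinuous (2 * mom a).toReal fun φ => ?_, fun φ n => smul_U_inv _ n⟩
  have h1 : ‖T φ‖ₑ ^ 2 ≤ ((2 * mom a) * ‖φ‖ₑ) ^ 2 := by
    rw [← S_one_eq, mul_pow]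
    exact hS φ
  have h2 := (ENNReal.pow_right_strictMono two_ne_zero).le_iff_le.mp h1
  have h3 := ENNReal.toReal_mono (ENNReal.mul_ne_top hfin enorm_ne_top) h2
  rw [ENNReal.toReal_mul, toReal_enorm, toReal_enorm] at h3
  exact h3

theorem exists_resOp (ha : mom a ≠ ⊤) (V : Hilb N →L[ℂ] Hilb N) (x : ℝ) :
    ∃ T : Hilb N →L[ℂ] Hilb N, ∀ φ n, U (T φ) n = res a V x φ n := by
  obtain ⟨T, hT⟩ := exists_lauOp ha
  refine ⟨T - (x : ℂ) • ContinuousLinearMap.id ℂ _ + (wOp N).comp (Vext V), fun φ n => ?_⟩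
  rw [add_apply, sub_apply, U_add, U_sub, hT, res,
    smul_apply, U_smul, ContinuousLinearMap.comp_apply, U_wOp]
  rfl

theorem one_le_two_pow_nnreal (k : ℕ) : (1 : ℝ≥0) ≤ 2 ^ k := one_le_pow₀ one_le_two

/-- The kernel of `H - E` in the weighted space is finite dimensional, and `H - E` is coercive on its
orthogonal complement. -/
theorem res_gap (ha : mom a ≠ ⊤) {E δ : ℝ} (hδ : 0 ≤ δ) {C B : ℝ≥0} (hH : HardyBound a E δ C)
    (h0 : VBound V B 0) (hV : ∀ ε : ℝ≥0, 0 < ε → ∃ k₀, VBound V ε k₀) :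
    ∃ T : Hilb N →L[ℂ] Hilb N, (∀ φ n, U (T φ) n = res a V E φ n) ∧
      FiniteDimensional ℂ T.ker ∧ ∃ C' : ℝ≥0, ∀ φ ∈ T.kerᗮ,
        ‖φ‖ₑ ^ 2 ≤ C' * S (fun k => 2 ^ k * Wo 0 k) (res a V E φ) := by
  obtain ⟨T, hT⟩ := exists_resOp ha V E
  refine ⟨T, hT, ?_⟩
  have hT' : ∀ φ, U (T φ) = res a V E φ := fun φ => funext (hT φ)
  -- The Hardy constant `2 C`, one splitting and the tail bound `144 = 2 · 72` multiply to `576`;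
  -- with this `ε` the tail of `V` is absorbed into half of the left side.
  obtain ⟨ε, hε, hε2⟩ : ∃ ε : ℝ≥0, 0 < ε ∧ 576 * C * ε ^ 2 ≤ 1 / 2 := by
    have t1 : Tendsto (fun ε : ℝ≥0 => 576 * C * ε ^ 2) (𝓝[>] 0) (𝓝 0) := by
      have : Tendsto (fun ε : ℝ≥0 => 576 * C * ε ^ 2) (𝓝 0) (𝓝 (576 * C * 0 ^ 2)) := by
        refine Continuous.tendsto ?_ 0
        fun_prop
      rw [zero_pow two_ne_zero, mul_zero] at this
      exact this.mono_left nhdsWithin_le_nhds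
    obtain ⟨ε, h1, h2⟩ := ((t1.eventually (gt_mem_nhds (half_pos one_pos))).and self_mem_nhdsWithin).exists
    exact ⟨ε, h2, h1.le⟩
  obtain ⟨R, hR⟩ := hV ε hε
  let s : Set ℤ := {n | sh n ≤ R}
  have : Fintype s := (finite_sh_le R).fintype
  -- On low shells `V` is not small, but there only finitely many coordinates of `Vext V φ` occur.
  -- They form the finite rank map.
  let π : Hilb N →L[ℂ] (s → Vec N) :=
    (ContinuousLinearMap.pi fun n : s => lp.evalCLM ℂ (fun _ : ℤ => Vec N) 2 n).comp (Vext V)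
  have hπ : ∀ φ, S (fun k => 2 ^ k * Wo 0 k) (fun n => Vext V φ n)
      ≤ ((Fintype.card s : ℝ≥0) * (2 ^ R) ^ 2 : ℝ≥0) * ‖π φ‖ₑ ^ 2 + 144 * ε ^ 2 * ‖φ‖ₑ ^ 2 := by
    intro φ
    have e1 := h0.S_Vext_tail_le hR 0 φ
    have e2 : S (fun k => 2 ^ k * Wo 0 k) (fun n => Vext V φ n)
        ≤ ∑' n : ℤ, (if n ∈ s then ((2 ^ R : ℝ≥0) * ‖π φ‖ₑ) ^ 2 else 0)
          + S (fun k => if R ≤ k then 2 ^ k * Wo 0 k else 0) (fun n => Vext V φ n) := by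
      unfold S
      rw [← ENNReal.tsum_add]
      refine ENNReal.tsum_le_tsum fun n => ?_
      beta_reduce
      rcases le_total R (sh n) with hn | hn
      · rw [if_pos hn]; exact le_add_self
      · refine le_trans ?_ le_self_add
        rw [if_pos (show n ∈ s from hn)]
        refine pow_le_pow_left' (mul_le_mul' (ENNReal.coe_le_coe.mpr ?_) ?_) 2
        · refine (mul_le_of_le_one_right zero_le ?_).trans (pow_le_pow_right₀ one_le_two hn)
          exact pow_le_one₀ zero_le (by rw [← NNReal.coe_le_coe]; norm_num)
        · rw [enorm_le_iff_norm_le]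
          exact norm_le_pi_norm (π φ) ⟨n, hn⟩
    refine e2.trans (add_le_add ?_ (e1.trans (le_of_eq ?_)))
    · rw [tsum_eq_sum (s := (finite_sh_le R).toFinset) (fun n hn => if_neg (fun h => hn ((Set.Finite.mem_toFinset _).mpr h))),
        Finset.sum_congr rfl (fun n hn => if_pos ((Set.Finite.mem_toFinset _).mp hn)), Finset.sum_const,
        nsmul_eq_mul, mul_pow, ← mul_assoc]
      refine mul_le_mul_left (le_of_eq ?_) _
      rw [Set.Finite.card_toFinset]
      push_cast
      rfl
    · rw [S_Wo_zero_U, Nat.zero_sub]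
      push_cast
      ring
  have key := gap_of_coercive_mod_finite T π (fun φ => S (fun k => 2 ^ k * Wo 0 k) (res a V E φ))
    (8 * C) (8 * C * ((Fintype.card s : ℝ≥0) * (2 ^ R) ^ 2)) ?_ ?_ ?_ ?_ ?_
  · exact key
  · intro φ ψ
    rw [← hT', ← hT', ← hT', map_sub]
    simp_rw [show U (T φ - T ψ) = fun n => U (T φ) n - U (T ψ) n from funext (U_sub _ _)]
    exact S_sub_le _ _ _
  · intro t φ
    rw [← hT', ← hT', map_smul]
    rw [show U (t • T φ) = fun n => t • U (T φ) n from funext (U_smul _ _)]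
    exact S_smul _ _
  · intro φ
    rw [← S_Wo_zero_U, hT']
    have := S_mono_weight (W₁ := Wo 0) (W₂ := fun k => 2 ^ k * Wo 0 k) (res a V E φ) 1 (fun k => by
      rw [one_mul]; exact le_mul_of_one_le_left zero_le (one_le_two_pow_nnreal k))
    simpa using this
  · intro φ hφ
    rw [← hT', hφ]
    simp [S, U]
  · intro φ
    have e1 := hH.extend ha (x := E) (by simpa using hδ) 0 (S_Wo_U_ne_top 0 φ)
    rw [S_Wo_zero_U] at e1
    have e2 : ∀ n, lau a (U φ) n - (E : ℂ) • U φ n = res a V E φ n - Vext V φ n := by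
      intro n; rw [res]; abel
    simp_rw [e2] at e1
    have e3 : ‖φ‖ₑ ^ 2 ≤ (4 * C * S (fun k => 2 ^ k * Wo 0 k) (res a V E φ)
        + 4 * C * (((Fintype.card s : ℝ≥0) * (2 ^ R) ^ 2 : ℝ≥0) * ‖π φ‖ₑ ^ 2))
        + ((1 / 2 : ℝ≥0) : ℝ≥0∞) * ‖φ‖ₑ ^ 2 := by
      calc ‖φ‖ₑ ^ 2 ≤ 2 * C * (2 * (S (fun k => 2 ^ k * Wo 0 k) (res a V E φ)
            + (((Fintype.card s : ℝ≥0) * (2 ^ R) ^ 2 : ℝ≥0) * ‖π φ‖ₑ ^ 2 + 144 * ε ^ 2 * ‖φ‖ₑ ^ 2))) :=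
          e1.trans (mul_le_mul_right ((S_sub_le _ _ _).trans (by gcongr; exact hπ φ)) _)
        _ = (4 * C * S (fun k => 2 ^ k * Wo 0 k) (res a V E φ)
            + 4 * C * (((Fintype.card s : ℝ≥0) * (2 ^ R) ^ 2 : ℝ≥0) * ‖π φ‖ₑ ^ 2))
            + ((576 * C * ε ^ 2 : ℝ≥0) : ℝ≥0∞) * ‖φ‖ₑ ^ 2 := by
          simp only [ENNReal.coe_mul, ENNReal.coe_pow, ENNReal.coe_ofNat]
          ring
        _ ≤ _ := by
          refine add_le_add_right ?_ _
          exact mul_le_mul_left (ENNReal.coe_le_coe.mpr hε2) _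
    have hfin : ‖φ‖ₑ ^ 2 ≠ ⊤ := ENNReal.pow_ne_top enorm_ne_top
    have e4 : ∀ x y : ℝ≥0∞, x ≠ ⊤ → x ≤ y + ((1 / 2 : ℝ≥0) : ℝ≥0∞) * x → x ≤ 2 * y := by
      intro x y hx hxy
      rcases eq_or_ne y ⊤ with rfl | hy
      · simp
      lift x to ℝ≥0 using hx
      lift y to ℝ≥0 using hy
      norm_cast at hxy ⊢
      rw [← NNReal.coe_le_coe] at hxy ⊢
      push_cast at hxy ⊢
      linarith
    refine (e4 _ _ hfin e3).trans (le_of_eq ?_)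
    push_cast
    ring

end BlockLaurent

end

/-! ### Isolation of eigenvalues: nearly equal and nearly orthogonal truncations -/

section

namespace BlockLaurent

open scoped NNReal

variable {N : ℕ}

theorem inner_matOp_left (M : Matrix (Fin N) (Fin N) ℂ) (v w : Vec N) :
    inner ℂ (matOp M v) w = inner ℂ v (matOp M.conjTranspose w) := by
  have : matOp M.conjTranspose = ContinuousLinearMap.adjoint (matOp M) := by
    rw [← ContinuousLinearMap.star_eq_adjoint]
    exact map_star (Matrix.toEuclideanCLM (n := Fin N) (𝕜 := ℂ)) M
  rw [this, ContinuousLinearMap.adjoint_inner_right]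

theorem inner_shiftOp_left (M : Matrix (Fin N) (Fin N) ℂ) (m : ℤ) (ψ φ : Hilb N) :
    inner ℂ (shiftOp M m ψ) φ = inner ℂ ψ (shiftOp M.conjTranspose (-m) φ) := by
  rw [lp.inner_eq_tsum, lp.inner_eq_tsum, ← (Equiv.addRight m).tsum_eq]
  refine tsum_congr fun n => ?_
  change inner ℂ (matOp M (ψ (n + m - m))) (φ (n + m)) = inner ℂ (ψ n) (matOp _ (φ (n - (-m))))
  rw [add_sub_cancel_right, sub_neg_eq_add, inner_matOp_left]

theorem inner_laurent_left {A : ℤ → Matrix (Fin N) (Fin N) ℂ}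
    (hA : Summable fun m => ‖matOp (A m)‖) (hherm : ∀ m, A (-m) = (A m).conjTranspose)
    (ψ φ : Hilb N) : inner ℂ (laurent A ψ) φ = inner ℂ ψ (laurent A φ) := by
  have h0 : HasSum (fun m : ℤ => shiftOp (A m) m) (laurent A) :=
    (Summable.of_norm_bounded hA fun m => norm_shiftOp_le (A m) m).hasSum
  have h1 : HasSum (fun m : ℤ => inner ℂ (shiftOp (A m) m ψ) φ) (inner ℂ (laurent A ψ) φ) :=
    (h0.mapL (ContinuousLinearMap.apply ℂ (Hilb N) ψ)).mapL (innerSLFlip ℂ φ)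
  have h2 : HasSum (fun m : ℤ => inner ℂ ψ (shiftOp (A m) m φ)) (inner ℂ ψ (laurent A φ)) :=
    (h0.mapL (ContinuousLinearMap.apply ℂ (Hilb N) φ)).mapL (innerSL ℂ ψ)
  rw [← (Equiv.neg ℤ).hasSum_iff] at h2
  refine (h2.congr_fun fun m => ?_).unique h1 |>.symm
  simp only [Function.comp_apply, Equiv.neg_apply]
  rw [inner_shiftOp_left, hherm]

theorem lau_matOp_eq {A : ℤ → Matrix (Fin N) (Fin N) ℂ} (hA : Summable fun m => ‖matOp (A m)‖)
    (ψ : Hilb N) (n : ℤ) : lau (fun m => matOp (A m)) (fun n => ψ n) n = laurent A ψ n :=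
  (laurent_apply A hA ψ n).tsum_eq

/-- `3/4 · 3/2 ≥ 1`: `Ws` dominates the dual of `Wo`. A sequence known only in the weight `Wo j` can
therefore be paired with a commutator bounded in the weight `Ws j`. -/
theorem one_le_Wo_mul_Ws (j k : ℕ) : 1 ≤ Wo j k * Ws j k := by
  rw [Wo, Ws, ← mul_pow]
  exact one_le_pow₀ (by rw [← NNReal.coe_le_coe]; norm_num)

theorem enorm_inner_sq_le {W W' : ℕ → ℝ≥0} (hW : ∀ k, 1 ≤ W k * W' k) (ψ φ : Hilb N) :
    ‖inner ℂ ψ φ‖ₑ ^ 2 ≤ S W (fun n => ψ n) * S W' (fun n => φ n) := by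
  refine le_trans (pow_le_pow_left' ?_ 2) (ennreal_tsum_mul_sq_le _ _)
  rw [lp.inner_eq_tsum]
  refine enorm_tsum_le_tsum_enorm.trans (ENNReal.tsum_le_tsum fun n => ?_)
  calc ‖inner ℂ (ψ n) (φ n)‖ₑ ≤ ‖ψ n‖ₑ * ‖φ n‖ₑ := by
        rw [← enorm_norm (ψ n), ← enorm_norm (φ n), ← enorm_mul, enorm_le_iff_norm_le, norm_mul,
          norm_norm, norm_norm]
        exact norm_inner_le_norm _ _
    _ ≤ ((W (sh n) * W' (sh n) : ℝ≥0) : ℝ≥0∞) * (‖ψ n‖ₑ * ‖φ n‖ₑ) :=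
        le_mul_of_one_le_left zero_le (by exact_mod_cast hW _)
    _ = _ := by rw [ENNReal.coe_mul]; ring

/-- Below shell `j` the weight is one, from `j` on it coincides with `Wt j`. For concentrated
elements the truncation thus controls the whole of `S (Wo j)`. -/
theorem S_Wo_le_add (j : ℕ) (φ : Hilb N) :
    S (Wo j) (U φ) ≤ ‖Utr φ j‖ₑ ^ 2 + S (Wt j) (U φ) := by
  rw [← S_one_eq]
  unfold S
  rw [← ENNReal.tsum_add]
  refine ENNReal.tsum_le_tsum fun n => ?_
  beta_reduce
  rcases lt_or_ge (sh n) j with hn | hn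
  · refine le_trans (le_of_eq ?_) le_self_add
    rw [Utr_apply_of_lt φ hn, Wo, Nat.sub_eq_zero_of_le hn.le, pow_zero]
  · refine le_trans (le_of_eq ?_) le_add_self
    rw [Wo, Wt, Nat.sub_eq_zero_of_le hn, pow_zero, one_mul]

theorem enorm_Utr_le_chi (j : ℕ) (φ : Hilb N) :
    ‖Utr φ j‖ₑ ^ 2 ≤ (((4 / 3) ^ j : ℝ≥0) : ℝ≥0∞) ^ 2 * ‖chi N j φ‖ₑ ^ 2 := by
  rw [← S_one_eq, ← S_one_eq]
  refine S_mono _ fun n => ?_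
  rcases lt_or_ge (sh n) j with hn | hn
  · rw [Utr_apply_of_lt φ hn, chi_apply_of_lt hn, U, enorm_smul, enorm_four_thirds,
      ENNReal.coe_one, one_mul, one_mul]
    refine mul_le_mul_left (ENNReal.coe_le_coe.mpr (pow_le_pow_right₀ ?_ hn.le)) _
    rw [← NNReal.coe_le_coe]; norm_num
  · rw [Utr_apply_of_le φ hn]; simp

/-- The weight of the coercivity estimate is `(2 · 3/4)^k = (3/2)^k`. It has the same growth as `Ws`
beyond shell `j` and as `Wt` below it, so both contributions to `S_res_chi_le` are seen relative to
shell `j`. -/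
theorem two_pow_mul_Wo_le_Ws (j k : ℕ) : 2 ^ k * Wo 0 k ≤ (3 / 2) ^ j * Ws j k := by
  rw [Wo, Ws, Nat.sub_zero, ← mul_pow, ← pow_add,
    show (2 * (3 / 4) : ℝ≥0) = 3 / 2 by rw [← NNReal.coe_inj]; norm_num]
  exact pow_le_pow_right₀ (by rw [← NNReal.coe_le_coe]; norm_num) (by omega)

theorem two_pow_mul_Wo_eq_Wt {j k : ℕ} (h : k ≤ j) : 2 ^ k * Wo 0 k = (3 / 2) ^ j * Wt j k := by
  obtain ⟨d, rfl⟩ := Nat.exists_eq_add_of_le h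
  rw [Wo, Wt, Nat.sub_zero, ← mul_pow, Nat.add_sub_cancel_left, Nat.sub_eq_zero_of_le h, pow_zero,
    mul_one, pow_add, mul_assoc, ← mul_pow,
    show (3 / 2 * (2 / 3) : ℝ≥0) = 1 by rw [← NNReal.coe_inj]; norm_num, one_pow, mul_one,
    show (2 * (3 / 4) : ℝ≥0) = 3 / 2 by rw [← NNReal.coe_inj]; norm_num]

variable {a : ℤ → Op N} {V : Hilb N →L[ℂ] Hilb N}

/-- `(H - x) χ z` is a commutator plus `χ l ζ`. For the latter `|l| ≤ 2^(-j)` turns `(3/2)^k` into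
`(3/4)^j Wt j k` on the shells up to `j`. The common factor `(3/4)^j` cancels the `(4/3)^j` of
`enorm_Utr_le_chi`. -/
theorem S_res_chi_le (ha : mom a ≠ ⊤) {ν μ : ℝ≥0} (h0 : VBound V ν 0) {j : ℕ} (h : VBound V μ j)
    {x l : ℝ} (hl : |l| * 2 ^ j ≤ 1) {z ζ : Hilb N} (hz : ∀ n, res a V x z n = (l : ℂ) • U ζ n) :
    S (fun k => 2 ^ k * Wo 0 k) (res a V x (chi N j z))
      ≤ 2 * (((3 / 4) ^ j : ℝ≥0) : ℝ≥0∞) ^ 2 * (512 * mom a ^ 2 * S (Wt j) (U z)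
        + 40 * μ ^ 2 * S (Wo j) (U z) + S (Wt j) (U ζ)) := by
  have e1 := S_commutator_chi_le ha h0 h x z
  have e2 := S_mono_weight (W₁ := fun k => 2 ^ k * Wo 0 k) (W₂ := Ws j)
    (fun n => res a V x (chi N j z) n - ((1 - cut j 1 n : ℝ) : ℂ) • res a V x z n) ((3 / 2) ^ j)
    (two_pow_mul_Wo_le_Ws j)
  have e3 : S (fun k => 2 ^ k * Wo 0 k) (fun n => ((1 - cut j 1 n : ℝ) : ℂ) • res a V x z n)
      ≤ (((3 / 4) ^ j : ℝ≥0) : ℝ≥0∞) ^ 2 * S (Wt j) (U ζ) := by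
    refine S_mono _ fun n => ?_
    rcases lt_or_ge j (sh n) with hn | hn
    · rw [cut_eq_one one_pos hn]; simp
    · have e : ‖((1 - cut j 1 n : ℝ) : ℂ) • res a V x z n‖ₑ ≤ (((1 / 2) ^ j : ℝ≥0) : ℝ≥0∞) * ‖U ζ n‖ₑ := by
        rw [hz, enorm_smul, enorm_smul, ← mul_assoc]
        refine mul_le_mul_left ?_ _
        rw [← enorm_mul, ← enorm_ofReal_coe, enorm_le_iff_norm_le, norm_mul, Complex.norm_real,
          Complex.norm_real, Complex.norm_real, Real.norm_eq_abs, Real.norm_eq_abs, Real.norm_eq_abs]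
        calc |1 - cut j 1 n| * |l| ≤ 1 * (1 / 2) ^ j := by
              refine mul_le_mul (abs_one_sub_cut_le j n) ?_ (abs_nonneg _) zero_le_one
              rw [one_div, inv_pow, ← one_div, le_div_iff₀ (by positivity)]
              exact hl
          _ ≤ _ := by rw [one_mul]; push_cast; exact le_abs_self _
      refine (mul_le_mul_right e _).trans (le_of_eq ?_)
      rw [two_pow_mul_Wo_eq_Wt hn, ← mul_assoc, ← mul_assoc, ← ENNReal.coe_mul, ← ENNReal.coe_mul]
      congr 2
      rw [mul_right_comm, ← mul_pow]
      congr 2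
      rw [← NNReal.coe_inj]; norm_num
  have e4 : ∀ n, res a V x (chi N j z) n = (res a V x (chi N j z) n
      - ((1 - cut j 1 n : ℝ) : ℂ) • res a V x z n) + ((1 - cut j 1 n : ℝ) : ℂ) • res a V x z n :=
    fun n => (sub_add_cancel _ _).symm
  calc S (fun k => 2 ^ k * Wo 0 k) (res a V x (chi N j z))
      ≤ 2 * (S (fun k => 2 ^ k * Wo 0 k) (fun n => res a V x (chi N j z) n
        - ((1 - cut j 1 n : ℝ) : ℂ) • res a V x z n) + S (fun k => 2 ^ k * Wo 0 k)
          (fun n => ((1 - cut j 1 n : ℝ) : ℂ) • res a V x z n)) := by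
        exact le_trans (le_of_eq (congrArg _ (funext e4))) (S_add_le _ _ _)
    _ ≤ 2 * (((3 / 2) ^ j : ℝ≥0) ^ 2 * ((((1 / 2) ^ j : ℝ≥0) : ℝ≥0∞) ^ 2 * (512 * mom a ^ 2
        * S (Wt j) (U z) + 40 * μ ^ 2 * S (Wo j) (U z)))
        + (((3 / 4) ^ j : ℝ≥0) : ℝ≥0∞) ^ 2 * S (Wt j) (U ζ)) := by
        refine mul_le_mul_right (add_le_add (e2.trans (mul_le_mul_right e1 _)) e3) _
    _ = _ := by
        rw [← mul_assoc ((((3 / 2) ^ j : ℝ≥0) : ℝ≥0∞) ^ 2), ← mul_pow, ← ENNReal.coe_mul, ← mul_pow,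
          show (3 / 2 * (1 / 2) : ℝ≥0) = 3 / 4 by rw [← NNReal.coe_inj]; norm_num]
        ring

/-- Without mass below shell `j`, `S_Wo_le_add` bounds `S (Wo j)` by `S (Wt j)`, hence by `η < 1`
times itself; it is finite, so it vanishes. -/
theorem eq_zero_of_concentrated {j : ℕ} {η : ℝ≥0} (hη : η < 1) {φ : Hilb N}
    (h : S (Wt j) (U φ) ≤ η * S (Wo j) (U φ)) (h0 : ∀ n, sh n < j → φ n = 0) : φ = 0 := by
  have h1 : Utr φ j = 0 := by
    ext1; funext n
    rcases lt_or_ge (sh n) j with hn | hn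
    · rw [Utr_apply_of_lt φ hn, U, h0 n hn, smul_zero]; rfl
    · rw [Utr_apply_of_le φ hn]; rfl
  have h2 := (S_Wo_le_add j φ).trans (add_le_add_right h _)
  rw [h1, enorm_zero, zero_pow two_ne_zero, zero_add] at h2
  have h3 : S (Wo j) (U φ) = 0 := by
    have hf := S_Wo_U_ne_top j φ
    lift S (Wo j) (U φ) to ℝ≥0 using hf with s
    norm_cast at h2 ⊢
    by_contra hs
    exact absurd h2 (not_le.mpr (mul_lt_of_lt_one_left (pos_iff_ne_zero.mpr hs) hη))
  refine U_inj fun n => ?_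
  have h4 := ENNReal.tsum_eq_zero.mp h3 n
  have h5 : Wo j (sh n) ≠ 0 := pow_ne_zero _ (by norm_num)
  simpa [h5, U] using h4

theorem eq_zero_of_inner_chi {j : ℕ} {φ : Hilb N} (h : inner ℂ φ (chi N j φ) = (0 : ℂ)) {n : ℤ}
    (hn : sh n < j) : φ n = 0 := by
  have h1 := lp.hasSum_inner (𝕜 := ℂ) φ (chi N j φ)
  rw [h] at h1
  have h2 := (Complex.hasSum_re h1)
  have h3 : ∀ n, (inner ℂ (φ n) (chi N j φ n)).re = (1 - cut j 1 n) * ‖φ n‖ ^ 2 := by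
    intro n
    rw [chi_apply, inner_smul_right, inner_self_eq_norm_sq_to_K, Complex.re_ofReal_mul]
    norm_cast
  simp_rw [h3] at h2
  have h4 := (hasSum_zero_iff_of_nonneg (fun n => mul_nonneg (sub_nonneg.mpr (cut_le_one j 1 n))
    (sq_nonneg _))).mp h2
  have h5 := congrFun h4 n
  simpa [cut_eq_zero hn] using h5

/-- Given a finite dimensional space of concentrated elements, every `ζ` can be corrected so that
its cutoff is orthogonal to the space. -/
theorem exists_correction {K : Submodule ℂ (Hilb N)} [FiniteDimensional ℂ K] {j : ℕ} {η : ℝ≥0}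
    (hη : η < 1) (h : ∀ φ ∈ K, S (Wt j) (U φ) ≤ η * S (Wo j) (U φ)) (ζ : Hilb N) :
    ∃ φ ∈ K, chi N j (ζ - φ) ∈ Kᗮ := by
  -- The compression of the cutoff to `K` is injective: `⟨φ, χφ⟩ = 0` kills `φ` below shell `j`, and
  -- concentration does the rest. In finite dimension it is then onto.
  let P : K →ₗ[ℂ] K := (K.orthogonalProjectionOnto : Hilb N →ₗ[ℂ] K).comp
    ((chi N j : Hilb N →ₗ[ℂ] Hilb N).comp K.subtype)
  have hinj : Function.Injective P := by
    rw [← LinearMap.ker_eq_bot, LinearMap.ker_eq_bot']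
    intro φ hφ
    have h1 : chi N j (φ : Hilb N) ∈ Kᗮ := Submodule.orthogonalProjectionOnto_eq_zero_iff.mp hφ
    exact Subtype.ext (eq_zero_of_concentrated hη (h φ φ.2)
      fun n hn => eq_zero_of_inner_chi (h1 φ φ.2) hn)
  obtain ⟨φ, hφ⟩ := LinearMap.injective_iff_surjective.mp hinj
    (K.orthogonalProjectionOnto (chi N j ζ))
  refine ⟨φ, φ.2, ?_⟩
  rw [← Submodule.orthogonalProjectionOnto_eq_zero_iff, map_sub, map_sub, sub_eq_zero]
  exact hφ.symm


/-- By symmetry `l ⟨ψ, g⟩ = ⟨ψ, (H - E) g⟩` with `g = U (χφ)`, and since `(H - E) U φ = 0` the right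
side is a pure commutator of order `2^(-j)`. As `|l| > 2^(-j-1)`, division by `l` costs `2 · 2^j`,
which leaves the square `4`. -/
theorem inner_chi_bound {A : ℤ → Matrix (Fin N) (Fin N) ℂ}
    (hA : Summable fun m => ‖matOp (A m)‖) (hherm : ∀ m, A (-m) = (A m).conjTranspose)
    (hmom : mom (fun m => matOp (A m)) ≠ ⊤)
    (hV : (V : Hilb N →ₗ[ℂ] Hilb N).IsSymmetric) {ν μ : ℝ≥0} (h0 : VBound V ν 0) {j : ℕ}
    (h : VBound V μ j) {E l : ℝ} (hl : 1 < |l| * 2 ^ (j + 1)) {ψ φ : Hilb N}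
    (hψ : (laurent A + V) ψ = ((E + l : ℝ) : ℂ) • ψ)
    (hφ : ∀ n, res (fun m => matOp (A m)) V E φ n = 0) :
    ∃ g : Hilb N, (∀ n, g n = U (chi N j φ) n) ∧ ‖inner ℂ ψ g‖ₑ ^ 2 ≤ S (Wo j) (fun n => ψ n) *
      (4 * (512 * mom (fun m => matOp (A m)) ^ 2 * S (Wt j) (U φ) + 40 * μ ^ 2 * S (Wo j) (U φ))) := by
  set a : ℤ → Op N := fun m => matOp (A m) with ha
  have hg : ∀ n, Utr (chi N j φ) (j + 1) n = U (chi N j φ) n := by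
    intro n
    rcases lt_or_ge (sh n) (j + 1) with hn | hn
    · rw [Utr_apply_of_lt _ hn]
    · rw [Utr_apply_of_le _ hn, U, chi_apply_of_gt hn, smul_zero]
  set g : Hilb N := Utr (chi N j φ) (j + 1) with hgdef
  refine ⟨g, hg, ?_⟩
  set y : Hilb N := (laurent A + V) g - (E : ℂ) • g with hy
  have hyn : ∀ n, y n = res a V E (chi N j φ) n := by
    intro n
    rw [res, h0.Vext_eq_of_eq_U hg, ← show (fun n => g n) = U (chi N j φ) from funext hg,
      lau_matOp_eq hA, hy, lp.coeFn_sub, Pi.sub_apply, add_apply, lp.coeFn_add, Pi.add_apply,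
      lp.coeFn_smul, Pi.smul_apply]
    abel
  have hinner : (l : ℂ) * inner ℂ ψ g = inner ℂ ψ y := by
    have e1 : inner ℂ ((laurent A + V) ψ) g = inner ℂ ψ ((laurent A + V) g) := by
      rw [add_apply, add_apply, inner_add_left, inner_add_right, inner_laurent_left hA hherm]
      exact congrArg _ (hV ψ g)
    rw [hψ, inner_smul_left, Complex.conj_ofReal] at e1
    rw [hy, inner_sub_right, inner_smul_right, ← e1]
    push_cast
    ring
  have h1 := enorm_inner_sq_le (one_le_Wo_mul_Ws j) ψ y
  have h2 := S_commutator_chi_le (a := a) hmom h0 h E φ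
  simp_rw [hφ, smul_zero, sub_zero] at h2
  rw [← show (fun n => y n) = res a V E (chi N j φ) from funext hyn] at h2
  have h3 : ‖inner ℂ ψ g‖ₑ ≤ ((2 * 2 ^ j : ℝ≥0) : ℝ≥0∞) * ‖inner ℂ ψ y‖ₑ := by
    rw [← hinner, enorm_mul, ← mul_assoc]
    refine le_mul_of_one_le_left zero_le ?_
    rw [← enorm_ofReal_coe, ← enorm_mul, ← enorm_one (G := ℂ), enorm_le_iff_norm_le, norm_one,
      norm_mul, Complex.norm_real, Complex.norm_real, Real.norm_eq_abs, Real.norm_eq_abs,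
      abs_of_nonneg (NNReal.coe_nonneg _)]
    push_cast
    rw [pow_succ] at hl
    linarith
  refine (pow_le_pow_left' h3 2).trans ?_
  rw [mul_pow]
  refine (mul_le_mul_right (h1.trans (mul_le_mul_right h2 _)) _).trans (le_of_eq ?_)
  have e : ((2 * 2 ^ j : ℝ≥0) : ℝ≥0∞) ^ 2 * (((1 / 2) ^ j : ℝ≥0) : ℝ≥0∞) ^ 2 = 4 := by
    rw [← mul_pow, ← ENNReal.coe_mul, mul_assoc, ← mul_pow]
    norm_num
  rw [← e]
  ring

theorem mul_le_sq_add {s t c : ℝ} (hs : 0 ≤ s) (ht : 0 ≤ t) : s * (c ^ 2 * t) ≤ (c * (s + t)) ^ 2 := by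
  have h : (c * (s + t)) ^ 2 - s * (c ^ 2 * t) = c ^ 2 * (s ^ 2 + s * t + t ^ 2) := by ring
  have : 0 ≤ c ^ 2 * (s ^ 2 + s * t + t ^ 2) := by positivity
  linarith

theorem le_of_sq_le_mul {x s t c : ℝ} (hs : 0 ≤ s) (ht : 0 ≤ t) (hc : 0 ≤ c)
    (h : x ^ 2 ≤ s * (c ^ 2 * t)) : x ≤ c * (s + t) :=
  le_of_abs_le (abs_le_of_sq_le_sq (h.trans (mul_le_sq_add hs ht)) (by positivity))

set_option maxHeartbeats 800000 in
/-- The main abstract conclusion: an energy with uniform Hardy inequality near it has a finite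
dimensional eigenspace, and is not a limit of other eigenvalues. -/
theorem finite_and_isolated {A : ℤ → Matrix (Fin N) (Fin N) ℂ}
    (hA : Summable fun m => ‖matOp (A m)‖) (hherm : ∀ m, A (-m) = (A m).conjTranspose)
    (hmom : mom (fun m => matOp (A m)) ≠ ⊤)
    (hV : (V : Hilb N →ₗ[ℂ] Hilb N).IsSymmetric) {B : ℝ≥0} (h0 : VBound V B 0)
    (hVb : ∀ ε : ℝ≥0, 0 < ε → ∃ k₀, VBound V ε k₀) {E δ : ℝ} (hδ : 0 < δ) {C : ℝ≥0}
    (hH : HardyBound (fun m => matOp (A m)) E δ C) :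
    FiniteDimensional ℂ (Module.End.eigenspace
      ((laurent A + V : Hilb N →L[ℂ] Hilb N) : Hilb N →ₗ[ℂ] Hilb N) (E : ℂ)) ∧
    ∃ δ' : ℝ, 0 < δ' ∧ ∀ l : ℝ, l ≠ 0 → |l| < δ' → E + l ∉ pointSpectrum (laurent A + V) := by
  set a : ℤ → Op N := fun m => matOp (A m) with ha
  obtain ⟨T, hT, hfin, C', hgap⟩ := res_gap hmom hδ.le hH h0 hVb
  have hker : ∀ φ, φ ∈ T.ker ↔ ∀ n, res a V E φ n = 0 := by
    intro φ
    constructor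
    · intro h n
      rw [← hT, show T φ = 0 from h]; simp [U]
    · intro h
      refine U_inj (ψ := 0) fun n => ?_
      rw [show (T : Hilb N →ₗ[ℂ] Hilb N) φ = T φ from rfl, hT, h]; simp [U]
  have hres : ∀ (ψ : Hilb N) (x y : ℝ), (laurent A + V) ψ = (x : ℂ) • ψ →
      ∀ n, res a V y (wOp N ψ) n = ((x - y : ℝ) : ℂ) • ψ n := by
    intro ψ x y hψ n
    have h1 : laurent A ψ n + V ψ n = (x : ℂ) • ψ n := by
      rw [← Pi.smul_apply, ← lp.coeFn_smul, ← hψ]; rfl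
    rw [res, h0.Vext_wOp, U_wOp, show U (wOp N ψ) = fun n => ψ n from funext (U_wOp ψ),
      lau_matOp_eq hA, sub_add_eq_add_sub, h1]
    push_cast
    module
  constructor
  -- `wOp` embeds the `ℓ²` eigenspace into the weighted kernel, since `U (wOp N ψ) = ψ`.
  · refine FiniteDimensional.of_injective
      (((wOp N : Hilb N →ₗ[ℂ] Hilb N).comp (Submodule.subtype _)).codRestrict T.ker ?_) ?_
    · intro ψ
      rw [hker]
      intro n
      have h1 := Module.End.mem_eigenspace_iff.mp ψ.2
      refine (hres ψ E E h1 n).trans ?_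
      simp
    · intro ψ₁ ψ₂ h
      refine Subtype.ext ?_
      have h1 : wOp N ψ₁ = wOp N ψ₂ := congrArg Subtype.val h
      ext1; funext n
      rw [← U_wOp, h1, U_wOp]
  obtain ⟨m, hm⟩ : ∃ m : ℝ≥0, mom a = m := ⟨(mom a).toNNReal, (ENNReal.coe_toNNReal hmom).symm⟩
  -- The thresholds for `η` and `μ` are set so that, with `s` and `t` the weighted masses of `ψ` and
  -- `φ` up to shell `j`, the two main errors become `(s + t)/16` in `e7` and `(s + t)/8` in `r2`.
  obtain ⟨η, hη, hη1, hη2, hη3⟩ : ∃ η : ℝ≥0, 0 < η ∧ η ≤ 1 / 16 ∧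
      2 * C' * (1024 * m ^ 2 + 1) * η ≤ 1 / 32 ∧ 2048 * m ^ 2 * η ≤ 1 / 128 := by
    have t : ∀ M : ℝ≥0, Tendsto (fun η : ℝ≥0 => M * η) (𝓝[>] 0) (𝓝 0) := fun M => by
      have : Tendsto (fun η : ℝ≥0 => M * η) (𝓝 0) (𝓝 (M * 0)) := by
        refine Continuous.tendsto ?_ 0
        fun_prop
      rw [mul_zero] at this
      exact this.mono_left nhdsWithin_le_nhds
    obtain ⟨η, ⟨⟨h1, h2⟩, h3⟩, h4⟩ := ((((t 1).eventually (gt_mem_nhds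
      (show (0 : ℝ≥0) < 1 / 16 by positivity))).and ((t (2 * C' * (1024 * m ^ 2 + 1))).eventually
        (gt_mem_nhds (show (0 : ℝ≥0) < 1 / 32 by positivity)))).and
        ((t (2048 * m ^ 2)).eventually (gt_mem_nhds (show (0 : ℝ≥0) < 1 / 128 by positivity)))
        |>.and self_mem_nhdsWithin).exists
    rw [one_mul] at h1
    exact ⟨η, h4, h1.le, h2.le, h3.le⟩
  obtain ⟨μ, hμ, hμ1, hμ2⟩ : ∃ μ : ℝ≥0, 0 < μ ∧ 160 * C' * μ ^ 2 ≤ 1 / 32 ∧ 160 * μ ^ 2 ≤ 1 / 128 := by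
    have t : ∀ M : ℝ≥0, Tendsto (fun η : ℝ≥0 => M * η ^ 2) (𝓝[>] 0) (𝓝 0) := fun M => by
      have : Tendsto (fun η : ℝ≥0 => M * η ^ 2) (𝓝 0) (𝓝 (M * 0 ^ 2)) := by
        refine Continuous.tendsto ?_ 0
        fun_prop
      rw [zero_pow two_ne_zero, mul_zero] at this
      exact this.mono_left nhdsWithin_le_nhds
    obtain ⟨η, ⟨h1, h2⟩, h4⟩ := (((t (160 * C')).eventually (gt_mem_nhds
      (show (0 : ℝ≥0) < 1 / 32 by positivity))).and ((t 160).eventually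
        (gt_mem_nhds (show (0 : ℝ≥0) < 1 / 128 by positivity)))
        |>.and self_mem_nhdsWithin).exists
    exact ⟨η, h4, h1.le, h2.le⟩
  obtain ⟨k₀, hk₀⟩ := hVb μ hμ
  obtain ⟨J, hJ⟩ := concentration hmom hH h0 hVb hη
  refine ⟨min δ ((1 / 2) ^ (k₀ + J + 1)), lt_min hδ (by positivity), fun l hl0 hl hspec => ?_⟩
  obtain ⟨hl1, hl2⟩ := lt_min_iff.mp hl
  have hlpos : 0 < |l| := abs_pos.mpr hl0
  -- `2^j ≤ 1/|l| < 2^(j+1)`: the scale where the shift `l` becomes comparable to the Hardy weight.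
  -- Coercivity uses the upper bound for `|l|`, orthogonality the lower bound.
  obtain ⟨j, hj1, hj2⟩ := exists_nat_pow_near (x := |l|⁻¹) (y := 2)
    ((one_le_inv₀ hlpos).mpr (hl2.le.trans (pow_le_one₀ (by norm_num) (by norm_num)))) one_lt_two
  have hj1' : |l| * 2 ^ j ≤ 1 := by
    rwa [le_inv_comm₀ (by positivity) hlpos, ← one_div, le_div_iff₀ (by positivity)] at hj1
  have hj2' : 1 < |l| * 2 ^ (j + 1) := by
    rwa [inv_lt_comm₀ hlpos (by positivity), ← one_div, div_lt_iff₀ (by positivity)] at hj2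
  have hjJ : k₀ + J ≤ j := by
    by_contra! hcon
    have h1 : (2 : ℝ) ^ (j + 1) ≤ 2 ^ (k₀ + J + 1) := pow_le_pow_right₀ one_le_two (by omega)
    have h2 : |l| * 2 ^ (k₀ + J + 1) ≤ 1 := by
      calc _ ≤ (1 / 2 : ℝ) ^ (k₀ + J + 1) * 2 ^ (k₀ + J + 1) := by gcongr
        _ = 1 := by rw [← mul_pow]; norm_num
    have h3 : |l| * 2 ^ (j + 1) ≤ |l| * 2 ^ (k₀ + J + 1) := by gcongr
    linarith
  obtain ⟨ψ, hψ, hψ0⟩ := Module.End.HasEigenvalue.exists_hasEigenvector hspec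
  have hψ' : (laurent A + V) ψ = ((E + l : ℝ) : ℂ) • ψ := Module.End.mem_eigenspace_iff.mp hψ
  set ζ := wOp N ψ with hζ
  have hUζ : U ζ = fun n => ψ n := funext (U_wOp ψ)
  have hη1' : η < 1 := hη1.trans_lt (by rw [← NNReal.coe_lt_coe]; norm_num)
  have hK : ∀ φ ∈ T.ker, S (Wt j) (U φ) ≤ η * S (Wo j) (U φ) := fun φ hφ =>
    hJ j (by omega) E (by simpa using hδ.le) φ ((hker φ).mp hφ)
  obtain ⟨φ, hφ, hperp⟩ := exists_correction hη1' hK ζ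
  have hζc : S (Wt j) (U ζ) ≤ η * S (Wo j) (U ζ) := by
    refine hJ j (by omega) (E + l) (by simpa using hl1.le) ζ fun n => ?_
    rw [hres ψ (E + l) (E + l) hψ' n]
    simp
  have hφc := hK φ hφ
  have hφr := (hker φ).mp hφ
  have hVj : VBound V μ j := hk₀.mono (by omega)
  have hz : ∀ n, res a V E (ζ - φ) n = (l : ℂ) • U ζ n := by
    intro n
    rw [← hT, map_sub, U_sub, hT, hT, hφr, sub_zero, hres ψ (E + l) E hψ' n, hζ, U_wOp,
      add_sub_cancel_left]
  have e1 := S_res_chi_le hmom h0 hVj hj1' hz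
  have e2 := (enorm_Utr_le_chi j (ζ - φ)).trans (mul_le_mul_right ((hgap _ hperp).trans
    (mul_le_mul_right e1 _)) _)
  obtain ⟨g, hg, hg2⟩ := inner_chi_bound hA hherm hmom hV h0 hVj hj2' hψ' hφr
  rw [← hUζ] at hg2
  set p := Utr ζ j with hp
  set q := Utr φ j with hq
  have hpq : Utr (ζ - φ) j = p - q := by
    rw [hp, hq, Utr, Utr, Utr, ← Finset.sum_sub_distrib]
    exact Finset.sum_congr rfl fun _ _ => map_sub _ _ _
  rw [hpq] at e2
  have hSub : ∀ W : ℕ → ℝ≥0, S W (U (ζ - φ)) ≤ 2 * (S W (U ζ) + S W (U φ)) := fun W => by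
    rw [show U (ζ - φ) = fun n => U ζ n - U φ n from funext (U_sub _ _)]
    exact S_sub_le _ _ _
  -- The smooth and the sharp truncation of `φ` differ only on shell `j`, where `Wt j = 1` and
  -- concentration applies.
  have e3 : ‖inner ℂ ψ (g - q)‖ₑ ^ 2 ≤ S (Wt j) (U ζ) * S (Wt j) (U φ) := by
    have h1 : inner ℂ ψ (g - q) = inner ℂ (Pr N {j} ψ) (Pr N {j} (g - q)) := by
      rw [lp.inner_eq_tsum, lp.inner_eq_tsum]
      refine tsum_congr fun n => ?_
      rcases lt_trichotomy (sh n) j with hn | hn | hn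
      · rw [lp.coeFn_sub, Pi.sub_apply, hg, hq, Utr_apply_of_lt φ hn, U, U, chi_apply_of_lt hn, sub_self,
          inner_zero_right, Pr_apply_of_notMem (by simpa using hn.ne), inner_zero_left]
      · rw [Pr_apply_of_mem (by simpa using hn), Pr_apply_of_mem (by simpa using hn)]
      · rw [lp.coeFn_sub, Pi.sub_apply, hg, hq, Utr_apply_of_le φ hn.le, U, chi_apply_of_gt hn, smul_zero,
          sub_zero, inner_zero_right, Pr_apply_of_notMem (by simpa using hn.ne'), inner_zero_left]
    have h2 : ∀ n, sh n = j → Wt j (sh n) = 1 := fun n hn => by simp [hn, Wt]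
    rw [h1]
    refine (enorm_inner_sq_le (W := fun _ => 1) (W' := fun _ => 1) (by simp) _ _).trans
      (mul_le_mul' ?_ ?_)
    · refine ENNReal.tsum_le_tsum fun n => pow_le_pow_left' ?_ 2
      beta_reduce
      by_cases hn : sh n = j
      · rw [h2 n hn, Pr_apply_of_mem (by simpa using hn), hUζ]
      · rw [Pr_apply_of_notMem (by simpa using hn)]; simp
    · refine ENNReal.tsum_le_tsum fun n => pow_le_pow_left' ?_ 2
      beta_reduce
      by_cases hn : sh n = j
      · rw [h2 n hn, Pr_apply_of_mem (by simpa using hn), lp.coeFn_sub, Pi.sub_apply, hg, hq,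
          Utr_apply_of_le φ hn.ge, sub_zero, U_chi]
        refine mul_le_mul_right ?_ _
        rw [enorm_le_iff_norm_le, norm_smul, Complex.norm_real]
        exact mul_le_of_le_one_left (norm_nonneg _) (abs_one_sub_cut_le j n)
      · rw [Pr_apply_of_notMem (by simpa using hn)]; simp
  have e4 : inner ℂ p q = inner ℂ ψ g - inner ℂ ψ (g - q) := by
    rw [← inner_sub_right, sub_sub_cancel, lp.inner_eq_tsum, lp.inner_eq_tsum]
    refine tsum_congr fun n => ?_
    rcases lt_or_ge (sh n) j with hn | hn
    · rw [hp, Utr_apply_of_lt ζ hn, hUζ]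
    · rw [hq, Utr_apply_of_le φ hn, inner_zero_right, inner_zero_right]
  have e5 := S_Wo_le_add j ζ
  have e6 := S_Wo_le_add j φ
  have f1 := S_Wo_U_ne_top j ζ
  have f2 := S_Wo_U_ne_top j φ
  obtain ⟨s, hs⟩ : ∃ s : ℝ≥0, S (Wo j) (U ζ) = s := ⟨_, (ENNReal.coe_toNNReal f1).symm⟩
  obtain ⟨t, ht⟩ : ∃ t : ℝ≥0, S (Wo j) (U φ) = t := ⟨_, (ENNReal.coe_toNNReal f2).symm⟩
  obtain ⟨s', hs'⟩ : ∃ s' : ℝ≥0, S (Wt j) (U ζ) = s' := ⟨_, (ENNReal.coe_toNNReal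
    (ne_top_of_le_ne_top (ENNReal.mul_ne_top ENNReal.coe_ne_top f1) hζc)).symm⟩
  obtain ⟨t', ht'⟩ : ∃ t' : ℝ≥0, S (Wt j) (U φ) = t' := ⟨_, (ENNReal.coe_toNNReal
    (ne_top_of_le_ne_top (ENNReal.mul_ne_top ENNReal.coe_ne_top f2) hφc)).symm⟩
  -- Near equality of the truncations `p` of `ψ` and `q` of `φ`: coercivity applied to the cutoff of
  -- `ζ - φ`, with concentration of both.
  have e7 : ‖p - q‖ₑ ^ 2 ≤ (((s + t) / 16 : ℝ≥0) : ℝ≥0∞) := by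
    have g1 := hSub (Wt j)
    have g2 := hSub (Wo j)
    rw [hs, ht] at g2
    rw [hs', ht'] at g1
    rw [hs', hm] at e2
    rw [hs, hs'] at hζc
    rw [ht, ht'] at hφc
    have k0 : (((4 / 3) ^ j : ℝ≥0) : ℝ≥0∞) ^ 2 * (((3 / 4) ^ j : ℝ≥0) : ℝ≥0∞) ^ 2 = 1 := by
      rw [← mul_pow, ← ENNReal.coe_mul, ← mul_pow,
        show (4 / 3 * (3 / 4) : ℝ≥0) = 1 by rw [← NNReal.coe_inj]; norm_num]
      simp
    calc ‖p - q‖ₑ ^ 2 ≤ (((4 / 3) ^ j : ℝ≥0) : ℝ≥0∞) ^ 2 * (C' * (2 * (((3 / 4) ^ j : ℝ≥0) : ℝ≥0∞) ^ 2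
          * (512 * m ^ 2 * (2 * (s' + t')) + 40 * μ ^ 2 * (2 * (s + t)) + s'))) := by
          refine e2.trans ?_
          gcongr
      _ = ((2 * C' * (512 * m ^ 2 * (2 * (s' + t')) + 40 * μ ^ 2 * (2 * (s + t)) + s') : ℝ≥0) : ℝ≥0∞) := by
          rw [← one_mul ((2 * C' * (512 * m ^ 2 * (2 * (s' + t')) + 40 * μ ^ 2 * (2 * (s + t)) + s') : ℝ≥0) : ℝ≥0∞), ← k0]
          simp only [ENNReal.coe_add, ENNReal.coe_mul, ENNReal.coe_pow, ENNReal.coe_ofNat]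
          ring
      _ ≤ _ := by
          rw [ENNReal.coe_le_coe]
          have q1 : s' ≤ η * s := by exact_mod_cast hζc
          have q2 : t' ≤ η * t := by exact_mod_cast hφc
          calc 2 * C' * (512 * m ^ 2 * (2 * (s' + t')) + 40 * μ ^ 2 * (2 * (s + t)) + s')
              ≤ 2 * C' * (512 * m ^ 2 * (2 * (η * s + η * t)) + 40 * μ ^ 2 * (2 * (s + t)) + (η * s + η * t)) := by
                gcongr
                exact q1.trans le_self_add
            _ = (2 * C' * (1024 * m ^ 2 + 1) * η) * (s + t) + (160 * C' * μ ^ 2) * (s + t) := by ring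
            _ ≤ 1 / 32 * (s + t) + 1 / 32 * (s + t) := by gcongr
            _ = _ := by rw [← NNReal.coe_inj]; push_cast; ring
  have toR : ∀ (x : ℝ) (y : ℝ≥0), ‖x‖ₑ ^ 2 ≤ (y : ℝ≥0∞) → x ^ 2 ≤ y := by
    intro x y hxy
    have := ENNReal.toReal_mono ENNReal.coe_ne_top hxy
    rw [ENNReal.toReal_pow, toReal_enorm, ENNReal.coe_toReal, Real.norm_eq_abs, sq_abs] at this
    exact this
  have r1 : ‖p - q‖ ^ 2 ≤ (s + t : ℝ) / 16 := by
    have := toR ‖p - q‖ _ (by rw [enorm_norm]; exact e7)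
    exact_mod_cast this
  have hζc' : (s' : ℝ) ≤ η * s := by rw [hs, hs'] at hζc; exact_mod_cast hζc
  have hφc' : (t' : ℝ) ≤ η * t := by rw [ht, ht'] at hφc; exact_mod_cast hφc
  have hηr : (η : ℝ) ≤ 1 / 16 := by exact_mod_cast hη1
  have s0 := s.coe_nonneg
  have t0 := t.coe_nonneg
  have r2 : ‖inner ℂ ψ g‖ ≤ (s + t : ℝ) / 8 := by
    rw [hs, ht, ht', hm] at hg2
    have h1 := toR ‖inner ℂ ψ g‖ (s * (4 * (512 * m ^ 2 * t' + 40 * μ ^ 2 * t)))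
      (by rw [enorm_norm]; exact_mod_cast hg2)
    push_cast at h1
    have h2 : (4 * (512 * m ^ 2 * t' + 40 * μ ^ 2 * t) : ℝ) ≤ 1 / 64 * t := by
      have k1 : (2048 * m ^ 2 * η : ℝ) ≤ 1 / 128 := by exact_mod_cast hη3
      have k2 : (160 * μ ^ 2 : ℝ) ≤ 1 / 128 := by exact_mod_cast hμ2
      calc (4 * (512 * m ^ 2 * t' + 40 * μ ^ 2 * t) : ℝ)
          ≤ 4 * (512 * m ^ 2 * (η * t) + 40 * μ ^ 2 * t) := by gcongr
        _ = (2048 * m ^ 2 * η) * t + (160 * μ ^ 2) * t := by ring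
        _ ≤ 1 / 128 * t + 1 / 128 * t := by gcongr
        _ = _ := by ring
    rw [div_eq_inv_mul]
    refine le_of_sq_le_mul s0 t0 (by norm_num) (h1.trans ((mul_le_mul_of_nonneg_left h2 s0).trans
      (le_of_eq ?_)))
    norm_num
  have r3 : ‖inner ℂ ψ (g - q)‖ ≤ (s + t : ℝ) / 16 := by
    rw [hs', ht'] at e3
    have h1 := toR ‖inner ℂ ψ (g - q)‖ (s' * t') (by rw [enorm_norm]; exact_mod_cast e3)
    push_cast at h1
    have h2 : (s' : ℝ) ≤ 1 / 16 * s := hζc'.trans (by gcongr)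
    have h3 : (t' : ℝ) ≤ 1 / 16 * t := hφc'.trans (by gcongr)
    rw [div_eq_inv_mul]
    refine le_of_sq_le_mul s0 t0 (by norm_num) (h1.trans ((mul_le_mul h2 h3 t'.coe_nonneg
      (by positivity)).trans (le_of_eq ?_)))
    ring
  have toR2 : ∀ (x : Hilb N) (y z : ℝ≥0), (y : ℝ≥0∞) ≤ ‖x‖ₑ ^ 2 + z → (y : ℝ) ≤ ‖x‖ ^ 2 + z := by
    intro x y z h
    have := ENNReal.toReal_mono (ENNReal.add_ne_top.mpr
      ⟨ENNReal.pow_ne_top enorm_ne_top, ENNReal.coe_ne_top⟩) h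
    rwa [ENNReal.toReal_add (ENNReal.pow_ne_top enorm_ne_top) ENNReal.coe_ne_top,
      ENNReal.toReal_pow, toReal_enorm, ENNReal.coe_toReal, ENNReal.coe_toReal] at this
  have r4 : (s : ℝ) ≤ ‖p‖ ^ 2 + s' := toR2 _ _ _ (by rw [← hs, ← hs']; exact e5)
  have r5 : (t : ℝ) ≤ ‖q‖ ^ 2 + t' := toR2 _ _ _ (by rw [← ht, ← ht']; exact e6)
  have r6 := norm_sub_sq (𝕜 := ℂ) p q
  have r7 : RCLike.re (inner ℂ p q) ≤ (s + t : ℝ) / 8 + (s + t) / 16 := by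
    refine (RCLike.re_le_norm _).trans ?_
    rw [e4]
    exact (norm_sub_le _ _).trans (add_le_add r2 r3)
  have r8 : (η * s : ℝ) ≤ 1 / 16 * s := by gcongr
  have r9 : (η * t : ℝ) ≤ 1 / 16 * t := by gcongr
  -- `‖p‖² + ‖q‖² = ‖p - q‖² + 2 Re ⟨p, q⟩ ≤ (1/16 + 6/16)(s + t)`. Adding the tent masses, at most
  -- `(s + t)/16`, gives `s + t ≤ (s + t)/2`.
  have hs0 : s = 0 := by
    rw [← NNReal.coe_inj, NNReal.coe_zero]
    linarith
  refine hψ0 ?_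
  have hζ0 : ∀ n, U ζ n = 0 := by
    intro n
    rw [hs0, ENNReal.coe_zero] at hs
    have h4 := ENNReal.tsum_eq_zero.mp hs n
    have h5 : Wo j (sh n) ≠ 0 := pow_ne_zero _ (by norm_num)
    simpa [h5] using h4
  ext1; funext n
  rw [← U_wOp ψ n]
  exact hζ0 n

end BlockLaurent

end

/-! ### The decay hypothesis on `V` in terms of dyadic shells -/

section

namespace BlockLaurent

open scoped NNReal

variable {N : ℕ} {V : Hilb N →L[ℂ] Hilb N}

/-- By symmetry of `V` the right bound is the adjoint of the left one: for `x = V P ψ` one has `‖x‖²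
= ⟨ψ, P V x⟩`. -/
theorem VBound.of_left (hV : (V : Hilb N →ₗ[ℂ] Hilb N).IsSymmetric) {ν : ℝ≥0} {k₀ : ℕ}
    (h : ∀ k, k₀ ≤ k → ∀ ψ, ‖Pr N (Set.Ici k) (V ψ)‖ ≤ (ν * (1 / 2) ^ k : ℝ) * ‖ψ‖) :
    VBound V ν k₀ := by
  have conv : ∀ (x ψ : Hilb N) (k : ℕ), ‖x‖ ≤ (ν * (1 / 2) ^ k : ℝ) * ‖ψ‖ →
      ‖x‖ₑ ≤ ((ν * (1 / 2) ^ k : ℝ≥0) : ℝ≥0∞) * ‖ψ‖ₑ := by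
    intro x ψ k hx
    rw [← enorm_norm ψ, ← ENNReal.ofReal_coe_nnreal, ← ofReal_norm, ← ofReal_norm, norm_norm,
      ← ENNReal.ofReal_mul (NNReal.coe_nonneg _)]
    refine ENNReal.ofReal_le_ofReal ?_
    push_cast
    exact hx
  refine ⟨fun k hk ψ => conv _ _ _ (h k hk ψ), fun k hk ψ => conv _ _ _ ?_⟩
  set x := V (Pr N (Set.Ici k) ψ) with hx
  have h1 : inner ℂ x x = inner ℂ ψ (Pr N (Set.Ici k) (V x)) := by
    have e1 : inner ℂ (V (Pr N (Set.Ici k) ψ)) x = inner ℂ (Pr N (Set.Ici k) ψ) (V x) := hV _ _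
    exact e1.trans (inner_mulOp_left _ _ ψ (V x))
  have h2 : ‖x‖ * ‖x‖ ≤ ‖ψ‖ * ((ν * (1 / 2) ^ k : ℝ) * ‖x‖) := by
    have := norm_inner_le_norm (𝕜 := ℂ) ψ (Pr N (Set.Ici k) (V x))
    rw [← h1, inner_self_eq_norm_sq_to_K, norm_pow, RCLike.norm_ofReal, abs_norm, sq] at this
    exact this.trans (by gcongr; exact h k hk x)
  rcases eq_or_ne ‖x‖ 0 with h0 | h0
  · rw [h0]; positivity
  · have : 0 < ‖x‖ := lt_of_le_of_ne (norm_nonneg _) h0.symm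
    nlinarith

theorem two_pow_le_two_mul_abs {k : ℕ} (hk : 1 ≤ k) {n : ℤ} (hn : k ≤ sh n) :
    (2 : ℝ) ^ k ≤ 2 * |(n : ℝ)| := by
  have h1 : 2 ^ k ≤ jb n := (Nat.pow_le_pow_right two_pos hn).trans (two_pow_sh_le n)
  have h2 : 2 ^ 1 ≤ 2 ^ k := Nat.pow_le_pow_right two_pos hk
  have h3 : 2 ^ k ≤ 2 * n.natAbs := by unfold jb at h1; omega
  rw [← Int.cast_abs, Int.abs_eq_natAbs]
  exact_mod_cast h3

theorem exists_VBound (ξ : Cutoff) (hV : (V : Hilb N →ₗ[ℂ] Hilb N).IsSymmetric)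
    (hdecay : Tendsto (fun r : ℝ => r * ‖(ξ.op N r).comp V‖) atTop (𝓝 0)) {ε : ℝ≥0} (hε : 0 < ε) :
    ∃ k₀, VBound V ε k₀ := by
  obtain ⟨α, hα, hξ⟩ := ξ.one_far
  -- With `r = 2^k / (4 α)` every `n` in a shell from `k` on has `|n| ≥ 2^k / 2 > α r`, so `ξ(n/r) =
  -- 1` there and the projection may be preceded by `ξ(N/r)`.
  have h1 : Tendsto (fun k : ℕ => (2 : ℝ) ^ k / (4 * α)) atTop atTop :=
    (tendsto_pow_atTop_atTop_of_one_lt one_lt_two).atTop_div_const (by positivity)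
  have h2 := ((hdecay.comp h1).eventually (gt_mem_nhds
    (show (0 : ℝ) < ε / (4 * α) by positivity))).and (eventually_ge_atTop 1)
  obtain ⟨k₀, hk₀⟩ := eventually_atTop.mp h2
  refine ⟨k₀, VBound.of_left hV fun k hk ψ => ?_⟩
  obtain ⟨h3, h4⟩ := hk₀ k hk
  simp only [Function.comp_apply] at h3
  set r : ℝ := 2 ^ k / (4 * α) with hr
  have hrpos : 0 < r := by positivity
  have h5 : Pr N (Set.Ici k) (V ψ) = Pr N (Set.Ici k) (((ξ.op N r).comp V) ψ) := by
    ext1; funext n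
    rcases lt_or_ge (sh n) k with hn | hn
    · rw [Pr_apply_of_notMem (by simpa using hn), Pr_apply_of_notMem (by simpa using hn)]
    · rw [Pr_apply_of_mem (by simpa using hn), Pr_apply_of_mem (by simpa using hn),
        ContinuousLinearMap.comp_apply, Cutoff.op_apply, hξ, Complex.ofReal_one, one_smul]
      rw [abs_div, abs_of_pos hrpos, lt_div_iff₀ hrpos, hr, ← mul_div_assoc, div_lt_iff₀ (by positivity)]
      have := two_pow_le_two_mul_abs h4 hn
      have h6 : (0 : ℝ) < 2 ^ k := by positivity
      nlinarith
  rw [h5]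
  have h6 : ∀ x : Hilb N, ‖Pr N (Set.Ici k) x‖ ≤ ‖x‖ := fun x =>
    enorm_le_iff_norm_le.mp (enorm_Pr_le _ x)
  refine (h6 _).trans ((ContinuousLinearMap.le_opNorm _ ψ).trans ?_)
  gcongr
  have h7 : ‖(ξ.op N r).comp V‖ < ε / (4 * α) / r := by rwa [lt_div_iff₀' hrpos]
  refine h7.le.trans (le_of_eq ?_)
  rw [hr, one_div, inv_pow]
  field_simp

theorem VBound.exists_zero (hV : (V : Hilb N →ₗ[ℂ] Hilb N).IsSymmetric) {ν : ℝ≥0} {k₀ : ℕ}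
    (h : VBound V ν k₀) : ∃ B, VBound V B 0 := by
  refine ⟨max ν (2 ^ k₀ * ‖V‖₊), VBound.of_left hV fun k _ ψ => ?_⟩
  rw [← toReal_enorm]
  rcases le_total k₀ k with hk | hk
  · have := ENNReal.toReal_mono (ENNReal.mul_ne_top ENNReal.coe_ne_top enorm_ne_top) (h.left k hk ψ)
    rw [ENNReal.toReal_mul, toReal_enorm ψ, ENNReal.coe_toReal] at this
    refine this.trans ?_
    push_cast
    gcongr
    exact le_max_left _ _
  · rw [toReal_enorm]
    have h6 : ‖Pr N (Set.Ici k) (V ψ)‖ ≤ ‖V ψ‖ := enorm_le_iff_norm_le.mp (enorm_Pr_le _ _)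
    refine h6.trans ((V.le_opNorm ψ).trans ?_)
    gcongr
    calc ‖V‖ ≤ (2 ^ k₀ * (1 / 2) ^ k) * ‖V‖ := by
          refine le_mul_of_one_le_left (norm_nonneg _) ?_
          rw [one_div, inv_pow, ← div_eq_mul_inv, one_le_div (by positivity)]
          exact pow_le_pow_right₀ one_le_two hk
      _ = (2 ^ k₀ * ‖V‖) * (1 / 2) ^ k := by ring
      _ ≤ _ := by
          gcongr
          push_cast
          exact le_max_right _ _

end BlockLaurent

end

/-! ### The Hardy inequality from one-sided fundamental solutions -/

section

namespace BlockLaurent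

open scoped NNReal

theorem tsum_geometric_moment_ne_top {q : ℝ≥0} (h0 : 0 < q) (h1 : q < 1) (p : ℕ) :
    ∑' k : ℤ, (q : ℝ≥0∞) ^ k.natAbs * (jb k : ℝ≥0∞) ^ p ≠ ⊤ := by
  have hs : Summable fun n : ℕ => q ^ n * (n + 1 : ℝ≥0) ^ p := by
    have e1 := (summable_nat_add_iff 1).mpr (summable_pow_mul_geometric_of_norm_lt_one p (r := (q : ℝ))
      (by simpa using h1))
    rw [← NNReal.summable_coe]
    have e2 := e1.mul_left (q : ℝ)⁻¹
    refine e2.congr fun n => ?_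
    push_cast
    rw [pow_succ]
    have : (q : ℝ) ≠ 0 := by exact_mod_cast h0.ne'
    field_simp
  have hz : Summable fun k : ℤ => q ^ k.natAbs * (jb k : ℝ≥0) ^ p := by
    rw [← NNReal.summable_coe] at hs ⊢
    refine Summable.of_nat_of_neg ?_ ?_
    · simpa [jb] using hs
    · simpa [jb] using hs
  have := ENNReal.tsum_coe_ne_top_iff_summable.mpr hz
  simpa using this

theorem mom_ne_top {N : ℕ} {a : ℤ → Op N} {C q : ℝ≥0} (h0 : 0 < q) (h1 : q < 1)
    (h : ∀ m, ‖a m‖ ≤ C * q ^ m.natAbs) : mom a ≠ ⊤ := by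
  refine ne_top_of_le_ne_top (ENNReal.mul_ne_top (ENNReal.coe_ne_top (r := C))
    (tsum_geometric_moment_ne_top h0 h1 8)) ?_
  rw [← ENNReal.tsum_mul_left]
  refine ENNReal.tsum_le_tsum fun m => ?_
  rw [← mul_assoc]
  refine mul_le_mul_left ?_ _
  have : ‖a m‖₊ ≤ C * q ^ m.natAbs := by
    rw [← NNReal.coe_le_coe]; push_cast; exact h m
  rw [enorm_eq_nnnorm]
  exact_mod_cast this

variable {N : ℕ}

/-- A bounded fundamental solution of the convolution equation `K * (a - x) = 1`, exponentially
decaying on the set `P`. -/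
structure IsHalfKernel (a : ℤ → Op N) (x : ℝ) (C q : ℝ≥0) (P : Set ℤ) (K : ℤ → Op N) : Prop where
  bound : ∀ k, ‖K k‖ₑ ≤ C
  decay : ∀ k ∈ P, ‖K k‖ₑ ≤ C * (q : ℝ≥0∞) ^ k.natAbs
  inv : ∀ k, HasSum (fun m => (K (k - m)).comp (a m)) ((x : ℂ) • K k + if k = 0 then 1 else 0)

variable {a : ℤ → Op N} {x : ℝ} {C q : ℝ≥0} {P : Set ℤ} {K : ℤ → Op N}

/-- Convolving `K` with `(a - x) u` returns `u`. Finite support of `u` reduces the rearrangement to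
finitely many copies of `inv`, so no decay of `K` is needed. -/
theorem IsHalfKernel.enorm_le (hK : IsHalfKernel a x C q P K) {u : ℤ → Vec N}
    (hu : {n | u n ≠ 0}.Finite) (n : ℤ) :
    ‖u n‖ₑ ≤ ∑' m, ‖K (n - m)‖ₑ * ‖lau a u m - (x : ℂ) • u m‖ₑ := by
  set s := hu.toFinset with hs
  have hs' : ∀ l, l ∉ s → u l = 0 := fun l hl => by
    by_contra h
    exact hl (hu.mem_toFinset.mpr h)
  have hlau : ∀ m, lau a u m = ∑ l ∈ s, a (m - l) (u l) := fun m =>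
    tsum_eq_sum fun l hl => by rw [hs' l hl, map_zero]
  have h1 : ∀ l ∈ s, HasSum (fun m => K (n - m) (a (m - l) (u l)))
      (((x : ℂ) • K (n - l) + if n - l = 0 then 1 else 0) (u l)) := by
    intro l _
    have e1 := (hK.inv (n - l)).mapL (ContinuousLinearMap.apply ℂ (Vec N) (u l))
    rw [← (Equiv.subRight l).hasSum_iff] at e1
    refine e1.congr_fun fun m => ?_
    change _ = (K (n - l - (m - l))) (a (m - l) (u l))
    rw [sub_sub_sub_cancel_right]
  have h2 := hasSum_sum h1
  have h3 : HasSum (fun m => K (n - m) ((x : ℂ) • u m)) (∑ l ∈ s, (x : ℂ) • K (n - l) (u l)) := by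
    have : HasSum (fun m => K (n - m) ((x : ℂ) • u m)) (∑ l ∈ s, K (n - l) ((x : ℂ) • u l)) :=
      hasSum_sum_of_ne_finset_zero
      (fun l hl => by rw [hs' l hl, smul_zero, map_zero])
    simpa [map_smul] using this
  have h4 := h2.sub h3
  have h5 : ∑ l ∈ s, (((x : ℂ) • K (n - l) + if n - l = 0 then 1 else 0) (u l))
      - ∑ l ∈ s, (x : ℂ) • K (n - l) (u l) = u n := by
    rw [← Finset.sum_sub_distrib]
    have : ∀ l ∈ s, (((x : ℂ) • K (n - l) + if n - l = 0 then 1 else 0) (u l))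
        - (x : ℂ) • K (n - l) (u l) = if n = l then u l else 0 := by
      intro l _
      rw [add_apply, smul_apply, add_sub_cancel_left]
      by_cases h : n = l
      · rw [if_pos (by omega), if_pos h]; rfl
      · rw [if_neg (by omega), if_neg h]; rfl
    rw [Finset.sum_congr rfl this, Finset.sum_ite_eq]
    split_ifs with h
    · rfl
    · exact (hs' n h).symm
  rw [h5] at h4
  rw [← h4.tsum_eq]
  refine enorm_tsum_le_tsum_enorm.trans (ENNReal.tsum_le_tsum fun m => ?_)
  rw [← map_sum, ← hlau, ← map_sub]
  exact ContinuousLinearMap.le_opENorm _ _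

/-- For `n ≥ 0` use the kernel decaying to the right: where it fails to decay, `m > n ≥ 0`, so `m`
is in the same shell or farther out. For `n ≤ 0` argue symmetrically. Undamped contributions
therefore only come from outer shells, which is the structure of Hardy's inequality. -/
theorem enorm_le_of_halfKernels {Kp Km : ℤ → Op N} (hp : IsHalfKernel a x C q (Set.Ici 0) Kp)
    (hm : IsHalfKernel a x C q (Set.Iic 0) Km) {u : ℤ → Vec N}
    (hu : {n | u n ≠ 0}.Finite) (n : ℤ) :
    ‖u n‖ₑ ≤ ∑' m, C * ((if sh n ≤ sh m then 1 else 0) + (q : ℝ≥0∞) ^ (n - m).natAbs)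
      * ‖lau a u m - (x : ℂ) • u m‖ₑ := by
  have key : ∀ (K : ℤ → Op N) (P : Set ℤ), IsHalfKernel a x C q P K →
      (∀ m, n - m ∉ P → sh n ≤ sh m) → ∀ m,
      ‖K (n - m)‖ₑ ≤ C * ((if sh n ≤ sh m then 1 else 0) + (q : ℝ≥0∞) ^ (n - m).natAbs) := by
    intro K P hK hP m
    by_cases h : n - m ∈ P
    · exact (hK.decay _ h).trans (mul_le_mul_right le_add_self _)
    · rw [if_pos (hP m h)]
      exact (hK.bound _).trans (le_mul_of_one_le_right zero_le le_self_add)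
  rcases le_total 0 n with hn | hn
  · refine (hp.enorm_le hu n).trans (ENNReal.tsum_le_tsum fun m => mul_le_mul_left
      (key Kp _ hp (fun m hm => ?_) m) _)
    refine Nat.log_mono_right ?_
    rw [Set.mem_Ici, not_le] at hm
    unfold jb; omega
  · refine (hm.enorm_le hu n).trans (ENNReal.tsum_le_tsum fun m => mul_le_mul_left
      (key Km _ hm (fun m hm => ?_) m) _)
    refine Nat.log_mono_right ?_
    rw [Set.mem_Iic, not_le] at hm
    unfold jb; omega

theorem Wo_le_of_le (j : ℕ) {k l : ℕ} (h : k ≤ l) : Wo j k ≤ (4 / 3) ^ (l - k) * Wo j l := by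
  obtain ⟨d, rfl⟩ := Nat.exists_eq_add_of_le h
  have h1 : (3 / 4 : ℝ≥0) ≤ 1 := by rw [← NNReal.coe_le_coe]; norm_num
  have h2 : (4 / 3 * (3 / 4) : ℝ≥0) = 1 := by rw [← NNReal.coe_inj]; norm_num
  rw [Nat.add_sub_cancel_left, Wo, Wo]
  calc (3 / 4 : ℝ≥0) ^ (k - j) = (4 / 3 * (3 / 4)) ^ d * (3 / 4) ^ (k - j) := by
        rw [h2, one_pow, one_mul]
    _ = (4 / 3) ^ d * (3 / 4) ^ (d + (k - j)) := by rw [mul_pow, pow_add, mul_assoc]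
    _ ≤ _ := mul_le_mul_right (pow_le_pow_of_le_one zero_le h1 (by omega)) _

theorem tsum_geometric_ge_le (k : ℕ) :
    ∑' l : ℕ, ((20 / 21 : ℝ≥0) : ℝ≥0∞) ^ ((k - l) + (l - k)) ≤ 42 := by
  refine (tsum_geometric_dist_le _ _).trans ?_
  have : (1 - ((20 / 21 : ℝ≥0) : ℝ≥0∞)) = ((1 / 21 : ℝ≥0) : ℝ≥0∞) := by
    rw [← ENNReal.coe_one, ← ENNReal.coe_sub]
    congr 1
    rw [tsub_eq_iff_eq_add_of_le (by rw [← NNReal.coe_le_coe]; norm_num), ← NNReal.coe_inj]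
    norm_num
  rw [this, ← ENNReal.coe_inv (by norm_num)]
  have e : ((2 : ℝ≥0∞) * ((1 / 21 : ℝ≥0)⁻¹ : ℝ≥0)) = ((2 * (1 / 21)⁻¹ : ℝ≥0) : ℝ≥0∞) := by
    push_cast; rfl
  rw [e, show (42 : ℝ≥0∞) = ((42 : ℝ≥0) : ℝ≥0∞) by norm_num, ENNReal.coe_le_coe]
  norm_num

/-- The Hardy kernel between dyadic shells, the main part of the Schur test. -/
def hk (k l : ℕ) : ℝ≥0 := if k ≤ l then (4 / 3) ^ (l - k) * (1 / 2) ^ l else 0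

/-- The test weight `τ^sh` with `τ = 7/10`. The row sums need `(4/3) τ < 1`, the column sums in
`tsum_hk_left_le` need `(4/3)(1/2) < τ`, so `τ` must lie between `2/3` and `3/4`. Both resulting
ratios, `14/15` and `20/21`, are at most `20/21`. For a general decay rate `w` of `Wo` such a `τ`
exists only if `w² > 1/2`. -/
theorem tsum_hk_right_le (k : ℕ) :
    ∑' m : ℤ, (hk k (sh m) : ℝ≥0∞) * ((7 / 10) ^ sh m : ℝ≥0) ≤ 84 * ((7 / 10) ^ k : ℝ≥0) := by
  refine (tsum_sh_le (fun l => (hk k l : ℝ≥0∞) * ((7 / 10) ^ l : ℝ≥0))).trans ?_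
  calc _ ≤ ∑' l : ℕ, 2 * ((7 / 10) ^ k : ℝ≥0) * ((20 / 21 : ℝ≥0) : ℝ≥0∞) ^ ((k - l) + (l - k)) := by
        refine ENNReal.tsum_le_tsum fun l => ?_
        have : 2 ^ (l + 1) * (hk k l * (7 / 10) ^ l) ≤ 2 * (7 / 10) ^ k * (20 / 21) ^ ((k - l) + (l - k)) := by
          unfold hk
          split_ifs with h
          · obtain ⟨d, rfl⟩ := Nat.exists_eq_add_of_le h
            rw [Nat.add_sub_cancel_left, show k - (k + d) + d = d by omega]
            calc (2 : ℝ≥0) ^ (k + d + 1) * ((4 / 3) ^ d * (1 / 2) ^ (k + d) * (7 / 10) ^ (k + d))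
                = 2 * (7 / 10) ^ k * (2 * (1 / 2)) ^ (k + d) * ((4 / 3) * (7 / 10)) ^ d := by
                  rw [mul_pow, mul_pow, pow_add (7 / 10 : ℝ≥0), pow_succ]; ring
              _ = 2 * (7 / 10) ^ k * ((4 / 3) * (7 / 10)) ^ d := by norm_num
              _ ≤ _ := by
                  gcongr
                  rw [← NNReal.coe_le_coe]; norm_num
          · simp
        exact_mod_cast this
    _ ≤ 2 * ((7 / 10) ^ k : ℝ≥0) * 42 := by
        rw [ENNReal.tsum_mul_left]
        exact mul_le_mul_right (tsum_geometric_ge_le k) _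
    _ = _ := by ring

theorem tsum_hk_left_le (l : ℕ) :
    ∑' n : ℤ, (hk (sh n) l : ℝ≥0∞) * ((7 / 10) ^ sh n : ℝ≥0) ≤ 84 * ((7 / 10) ^ l : ℝ≥0) := by
  refine (tsum_sh_le (fun k => (hk k l : ℝ≥0∞) * ((7 / 10) ^ k : ℝ≥0))).trans ?_
  calc _ ≤ ∑' k : ℕ, 2 * ((7 / 10) ^ l : ℝ≥0) * ((20 / 21 : ℝ≥0) : ℝ≥0∞) ^ ((l - k) + (k - l)) := by
        refine ENNReal.tsum_le_tsum fun k => ?_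
        have : 2 ^ (k + 1) * (hk k l * (7 / 10) ^ k) ≤ 2 * (7 / 10) ^ l * (20 / 21) ^ ((l - k) + (k - l)) := by
          unfold hk
          split_ifs with h
          · obtain ⟨d, rfl⟩ := Nat.exists_eq_add_of_le h
            rw [Nat.add_sub_cancel_left, show d + (k - (k + d)) = d by omega]
            calc (2 : ℝ≥0) ^ (k + 1) * ((4 / 3) ^ d * (1 / 2) ^ (k + d) * (7 / 10) ^ k)
                = 2 * (7 / 10) ^ k * (2 * (1 / 2)) ^ k * ((4 / 3) * (1 / 2)) ^ d := by
                  rw [mul_pow, mul_pow, pow_add (1 / 2 : ℝ≥0), pow_succ]; ring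
              _ = 2 * (7 / 10) ^ k * ((7 / 10) * (20 / 21)) ^ d := by
                  rw [show (4 / 3 * (1 / 2) : ℝ≥0) = 7 / 10 * (20 / 21) by
                    rw [← NNReal.coe_inj]; norm_num]
                  norm_num
              _ ≤ _ := by rw [mul_pow, pow_add]; exact le_of_eq (by ring)
          · simp
        exact_mod_cast this
    _ ≤ 2 * ((7 / 10) ^ l : ℝ≥0) * 42 := by
        rw [ENNReal.tsum_mul_left]
        exact mul_le_mul_right (tsum_geometric_ge_le l) _
    _ = _ := by ring

/-- Fundamental solutions decaying in one direction and bounded in the other, uniformly near `E`,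
give the Hardy inequality. -/
theorem hardyBound_of_halfKernels {E δ : ℝ} (hq0 : 0 < q) (hq1 : q < 1)
    (h : ∀ x : ℝ, |x - E| ≤ δ → ∃ Kp Km, IsHalfKernel a x C q (Set.Ici 0) Kp ∧
      IsHalfKernel a x C q (Set.Iic 0) Km) : ∃ C', HardyBound a E δ C' := by
  obtain ⟨Q, hQ⟩ : ∃ Q : ℝ≥0, ∑' k : ℤ, (q : ℝ≥0∞) ^ k.natAbs * (jb k : ℝ≥0∞) ^ 2 = Q :=
    ⟨_, (ENNReal.coe_toNNReal (tsum_geometric_moment_ne_top hq0 hq1 2)).symm⟩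
  refine ⟨(C * (84 + 4 * Q)) ^ 2, fun x hx j u hu => ?_⟩
  obtain ⟨Kp, Km, hp, hm⟩ := h x hx
  have hτ : Doubling fun k => (7 / 10 : ℝ≥0) ^ k := by
    have := pow_sub_doubling (x := 7 / 10) (by rw [← NNReal.coe_le_coe]; norm_num)
      (by rw [← NNReal.coe_le_coe]; norm_num) 0
    simpa using this
  have hQ' : ∀ n : ℤ, ∑' m : ℤ, (q : ℝ≥0∞) ^ (n - m).natAbs * (2 * jb (n - m)) * ((7 / 10) ^ sh m : ℝ≥0)
      ≤ 4 * Q * ((7 / 10) ^ sh n : ℝ≥0) := by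
    intro n
    calc _ ≤ ∑' m : ℤ, 4 * ((q : ℝ≥0∞) ^ (n - m).natAbs * (jb (n - m) : ℝ≥0∞) ^ 2)
          * ((7 / 10) ^ sh n : ℝ≥0) := by
          refine ENNReal.tsum_le_tsum fun m => ?_
          have e1 : (((7 / 10) ^ sh m : ℝ≥0) : ℝ≥0∞) ≤ 2 * jb (n - m) * ((7 / 10) ^ sh n : ℝ≥0) := by
            have := hτ.le_jb m n
            rw [jb_sub_comm] at this
            exact_mod_cast this
          refine (mul_le_mul_right e1 _).trans (le_of_eq ?_)
          ring
      _ = _ := by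
          rw [ENNReal.tsum_mul_right, ENNReal.tsum_mul_left, ← hQ]
          congr 2
          exact (Equiv.subLeft n).tsum_eq (fun k => (q : ℝ≥0∞) ^ k.natAbs * (jb k : ℝ≥0∞) ^ 2)
  have key := S_le_of_kernel (W₁ := Wo j) (W₂ := fun k => 2 ^ k * Wo j k) (y := u)
    (u := fun n => lau a u n - (x : ℂ) • u n)
    (fun n m => C * ((hk (sh n) (sh m) : ℝ≥0∞) + (q : ℝ≥0∞) ^ (n - m).natAbs * (2 * jb (n - m))))
    (fun n => (7 / 10) ^ sh n) (C * (84 + 4 * Q)) (fun n => hτ.pos _) ?_ ?_ ?_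
  · refine key.trans (le_of_eq ?_)
    push_cast
    rfl
  · intro n
    simp_rw [mul_assoc (C : ℝ≥0∞), add_mul]
    rw [ENNReal.tsum_mul_left, ENNReal.tsum_add]
    exact mul_le_mul_right (add_le_add (tsum_hk_right_le _) (hQ' n)) _
  · intro m
    simp_rw [mul_assoc (C : ℝ≥0∞), add_mul]
    rw [ENNReal.tsum_mul_left, ENNReal.tsum_add]
    refine mul_le_mul_right (add_le_add (tsum_hk_left_le _) ?_) _
    have := hQ' m
    simp_rw [jb_sub_comm m, ← Int.natAbs_neg (m - _), neg_sub] at this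
    exact this
  · intro n
    refine (mul_le_mul_right (enorm_le_of_halfKernels hp hm hu n) _).trans ?_
    rw [← ENNReal.tsum_mul_left]
    refine ENNReal.tsum_le_tsum fun m => ?_
    -- The undamped part: moving `Wo` outwards costs `(4/3)^(sh m - sh n)`, and extracting the Hardy
    -- weight `2^sh m` gives `(1/2)^sh m`; together this is `hk`. For the localized part the Hardy
    -- weight is simply bounded below by one.
    suffices hmain : (Wo j (sh n) : ℝ≥0∞) * ((if sh n ≤ sh m then 1 else 0) + (q : ℝ≥0∞) ^ (n - m).natAbs)
        ≤ ((hk (sh n) (sh m) : ℝ≥0∞) + (q : ℝ≥0∞) ^ (n - m).natAbs * (2 * jb (n - m)))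
          * ((2 ^ sh m * Wo j (sh m) : ℝ≥0) : ℝ≥0∞) by
      refine le_trans (le_of_eq ?_) ((mul_le_mul' (mul_le_mul' (le_refl (C : ℝ≥0∞)) hmain)
        (le_refl ‖lau a u m - (x : ℂ) • u m‖ₑ)).trans (le_of_eq ?_))
      · ring
      · simp only [mul_assoc]
    rw [mul_add, add_mul]
    refine add_le_add ?_ ?_
    · split_ifs with h
      · have : Wo j (sh n) ≤ hk (sh n) (sh m) * (2 ^ sh m * Wo j (sh m)) := by
          rw [hk, if_pos h]
          refine (Wo_le_of_le j h).trans (le_of_eq ?_)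
          calc _ = (4 / 3) ^ (sh m - sh n) * (1 / 2 * 2) ^ sh m * Wo j (sh m) := by norm_num
            _ = _ := by rw [mul_pow]; ring
        rw [mul_one]
        exact_mod_cast this
      · rw [mul_zero]; exact zero_le
    · have : Wo j (sh n) ≤ 2 * jb (n - m) * (2 ^ sh m * Wo j (sh m)) :=
        ((doubling_Wo j).le_jb n m).trans (mul_le_mul_right
          (le_mul_of_one_le_left zero_le (one_le_two_pow_nnreal _)) _)
      have h2 : (Wo j (sh n) : ℝ≥0∞) ≤ 2 * jb (n - m) * ((2 ^ sh m * Wo j (sh m) : ℝ≥0) : ℝ≥0∞) := by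
        exact_mod_cast this
      rw [mul_comm, mul_assoc]
      exact mul_le_mul' le_rfl h2

end BlockLaurent

end

/-! ### Analytic families of monic polynomials and Hensel's lemma -/

section

namespace BlockLaurent

open Polynomial

/-- A family of monic complex polynomials of degree `n` with coefficients analytic at `0`. -/
structure AnalyticFamily (n : ℕ) (P : ℂ → ℂ[X]) : Prop where
  monic : ∀ z, (P z).Monic
  natDegree : ∀ z, (P z).natDegree = n
  analytic : ∀ k, AnalyticAt ℂ (fun z => (P z).coeff k) 0

/-- The polynomial of degree less than `n` with given coefficients. -/
def lowPoly (n : ℕ) : (Fin n → ℂ) →ₗ[ℂ] ℂ[X] :=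
  (degreeLT ℂ n).subtype ∘ₗ (degreeLTEquiv ℂ n).symm.toLinearMap

theorem degree_lowPoly_lt (n : ℕ) (c : Fin n → ℂ) : (lowPoly n c).degree < n :=
  mem_degreeLT.mp ((degreeLTEquiv ℂ n).symm c).2

theorem coeff_lowPoly (n : ℕ) (c : Fin n → ℂ) (i : Fin n) : (lowPoly n c).coeff i = c i :=
  congrFun ((degreeLTEquiv ℂ n).apply_symm_apply c) i

/-- The monic polynomial of degree `n` with given lower coefficients. -/
def monicPoly (n : ℕ) (c : Fin n → ℂ) : ℂ[X] := X ^ n + lowPoly n c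

theorem monic_monicPoly (n : ℕ) (c : Fin n → ℂ) : (monicPoly n c).Monic :=
  monic_X_pow_add (degree_lowPoly_lt n c)

theorem degree_monicPoly (n : ℕ) (c : Fin n → ℂ) : (monicPoly n c).degree = n := by
  rw [monicPoly, degree_add_eq_left_of_degree_lt, degree_X_pow]
  rw [degree_X_pow]
  exact degree_lowPoly_lt n c

theorem natDegree_monicPoly (n : ℕ) (c : Fin n → ℂ) : (monicPoly n c).natDegree = n :=
  natDegree_eq_of_degree_eq_some (degree_monicPoly n c)

theorem coeff_monicPoly (n : ℕ) (c : Fin n → ℂ) (i : Fin n) : (monicPoly n c).coeff i = c i := by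
  rw [monicPoly, coeff_add, coeff_lowPoly, coeff_X_pow, if_neg i.2.ne, zero_add]

theorem monic_ext {P Q : ℂ[X]} {n : ℕ} (hP : P.Monic) (hQ : Q.Monic) (hPn : P.natDegree = n)
    (hQn : Q.natDegree = n) (h : ∀ i : Fin n, P.coeff i = Q.coeff i) : P = Q := by
  ext k
  rcases lt_trichotomy k n with hk | rfl | hk
  · exact h ⟨k, hk⟩
  · rw [← hPn, hP.coeff_natDegree, hPn, ← hQn, hQ.coeff_natDegree]
  · rw [coeff_eq_zero_of_natDegree_lt (hPn ▸ hk), coeff_eq_zero_of_natDegree_lt (hQn ▸ hk)]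

theorem monicPoly_coeff {P : ℂ[X]} {n : ℕ} (hP : P.Monic) (hPn : P.natDegree = n) :
    monicPoly n (fun i => P.coeff i) = P :=
  monic_ext (monic_monicPoly _ _) hP (natDegree_monicPoly _ _) hPn fun i => coeff_monicPoly _ _ i

theorem analyticFamily_monicPoly {n : ℕ} {c : ℂ → Fin n → ℂ} (hc : AnalyticAt ℂ c 0) :
    AnalyticFamily n (fun z => monicPoly n (c z)) := by
  refine ⟨fun z => monic_monicPoly _ _, fun z => natDegree_monicPoly _ _, fun k => ?_⟩
  rcases lt_trichotomy k n with hk | rfl | hk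
  · have : (fun z => (monicPoly n (c z)).coeff k) = fun z => c z ⟨k, hk⟩ :=
      funext fun z => coeff_monicPoly n (c z) ⟨k, hk⟩
    rw [this]
    exact analyticAt_pi_iff.mp hc _
  · have : (fun z => (monicPoly k (c z)).coeff k) = fun _ => 1 := funext fun z => by
      have := (monic_monicPoly k (c z)).coeff_natDegree
      rwa [natDegree_monicPoly] at this
    rw [this]; exact analyticAt_const
  · have : (fun z => (monicPoly n (c z)).coeff k) = fun _ => 0 := funext fun z =>
      coeff_eq_zero_of_natDegree_lt (by rwa [natDegree_monicPoly])
    rw [this]; exact analyticAt_const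

/-- The coefficients of the product of two monic polynomials. -/
def mulCoeffs (a b : ℕ) (x : (Fin a → ℂ) × (Fin b → ℂ)) : Fin (a + b) → ℂ :=
  fun i => (monicPoly a x.1 * monicPoly b x.2).coeff i

theorem monicPoly_mulCoeffs (a b : ℕ) (x : (Fin a → ℂ) × (Fin b → ℂ)) :
    monicPoly (a + b) (mulCoeffs a b x) = monicPoly a x.1 * monicPoly b x.2 :=
  monicPoly_coeff ((monic_monicPoly _ _).mul (monic_monicPoly _ _)) (by
    rw [(monic_monicPoly _ _).natDegree_mul (monic_monicPoly _ _), natDegree_monicPoly,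
      natDegree_monicPoly])

theorem contDiff_coeff_monicPoly (n k : ℕ) : ContDiff ℂ ω fun c : Fin n → ℂ => (monicPoly n c).coeff k := by
  have : (fun c : Fin n → ℂ => (monicPoly n c).coeff k) = fun c => (X ^ n : ℂ[X]).coeff k
      + LinearMap.toContinuousLinearMap ((lcoeff ℂ k).comp (lowPoly n)) c := by
    funext c
    rw [monicPoly, coeff_add]; rfl
  rw [this]
  exact contDiff_const.add (ContinuousLinearMap.contDiff _)

theorem contDiff_mulCoeffs (a b : ℕ) : ContDiff ℂ ω (mulCoeffs a b) := by
  refine contDiff_pi.mpr fun i => ?_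
  simp only [mulCoeffs, coeff_mul]
  refine ContDiff.sum fun jk _ => ?_
  exact ((contDiff_coeff_monicPoly a jk.1).comp contDiff_fst).mul
    ((contDiff_coeff_monicPoly b jk.2).comp contDiff_snd)

/-- Along a line the product of two monic polynomials is quadratic in the parameter, and its linear
coefficient is the Leibniz expression. -/
theorem fderiv_mulCoeffs (a b : ℕ) (x v : (Fin a → ℂ) × (Fin b → ℂ)) (i : Fin (a + b)) :
    fderiv ℂ (mulCoeffs a b) x v i
      = (lowPoly a v.1 * monicPoly b x.2 + monicPoly a x.1 * lowPoly b v.2).coeff i := by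
  have h1 : HasFDerivAt (mulCoeffs a b) (fderiv ℂ (mulCoeffs a b) x) x :=
    ((contDiff_mulCoeffs a b).differentiable (by simp)).differentiableAt.hasFDerivAt
  have h2 : HasDerivAt (fun t : ℂ => x + t • v) v 0 := by
    simpa using ((hasDerivAt_id (0 : ℂ)).smul_const v).const_add x
  have h3 : HasDerivAt (fun t : ℂ => mulCoeffs a b (x + t • v)) (fderiv ℂ (mulCoeffs a b) x v) 0 := by
    have h1' : HasFDerivAt (mulCoeffs a b) (fderiv ℂ (mulCoeffs a b) x) (x + (0 : ℂ) • v) := by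
      simpa using h1
    exact h1'.comp_hasDerivAt (0 : ℂ) h2
  have h4 := (hasDerivAt_pi.mp h3) i
  have h5 : (fun t : ℂ => mulCoeffs a b (x + t • v) i) = fun t => mulCoeffs a b x i
      + t * (lowPoly a v.1 * monicPoly b x.2 + monicPoly a x.1 * lowPoly b v.2).coeff i
      + t ^ 2 * (lowPoly a v.1 * lowPoly b v.2).coeff i := by
    funext t
    have e : monicPoly a (x + t • v).1 * monicPoly b (x + t • v).2
        = monicPoly a x.1 * monicPoly b x.2
          + C t * (lowPoly a v.1 * monicPoly b x.2 + monicPoly a x.1 * lowPoly b v.2)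
          + C (t ^ 2) * (lowPoly a v.1 * lowPoly b v.2) := by
      simp only [monicPoly, Prod.fst_add, Prod.snd_add, Prod.smul_fst, Prod.smul_snd, map_add,
        map_smul, smul_eq_C_mul, map_pow]
      ring
    rw [mulCoeffs, e, coeff_add, coeff_add, coeff_C_mul, coeff_C_mul]; rfl
  rw [h5] at h4
  have h6 := (((hasDerivAt_id (0 : ℂ)).mul_const ((lowPoly a v.1 * monicPoly b x.2
    + monicPoly a x.1 * lowPoly b v.2).coeff i)).const_add (mulCoeffs a b x i)).add
    (((hasDerivAt_id (0 : ℂ)).pow 2).mul_const ((lowPoly a v.1 * lowPoly b v.2).coeff i))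
  have h7 := h4.unique h6
  simpa using h7

/-- If `v₁ R + Q v₂ = 0` with `Q`, `R` coprime, then `Q` divides `v₁`, which has smaller degree; so
`v₁ = 0` and then `v₂ = 0`. -/
theorem fderiv_mulCoeffs_injective {a b : ℕ} {x : (Fin a → ℂ) × (Fin b → ℂ)}
    (h : IsCoprime (monicPoly a x.1) (monicPoly b x.2)) :
    Function.Injective (fderiv ℂ (mulCoeffs a b) x) := by
  rw [injective_iff_map_eq_zero]
  intro v hv
  have e : lowPoly a v.1 * monicPoly b x.2 + monicPoly a x.1 * lowPoly b v.2 = 0 := by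
    ext k
    rw [coeff_zero]
    rcases lt_or_ge k (a + b) with hk | hk
    · have := fderiv_mulCoeffs a b x v ⟨k, hk⟩
      rw [hv] at this
      exact this.symm
    · refine coeff_eq_zero_of_degree_lt (lt_of_lt_of_le ?_ (Nat.cast_le.mpr hk))
      have da : (monicPoly a x.1).degree = a := degree_monicPoly _ _
      have db : (monicPoly b x.2).degree = b := degree_monicPoly _ _
      refine (degree_add_le _ _).trans_lt (max_lt ?_ ?_)
      · rw [degree_mul, db, Nat.cast_add]
        exact WithBot.add_lt_add_right (by simp) (degree_lowPoly_lt _ _)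
      · rw [degree_mul, da, Nat.cast_add]
        exact WithBot.add_lt_add_left (by simp) (degree_lowPoly_lt _ _)
  have h1 : monicPoly a x.1 ∣ lowPoly a v.1 := by
    refine h.dvd_of_dvd_mul_right ?_
    rw [eq_neg_of_add_eq_zero_left e]
    exact (dvd_mul_right _ _).neg_right
  have h2 : lowPoly a v.1 = 0 := by
    refine eq_zero_of_dvd_of_degree_lt h1 ?_
    rw [degree_monicPoly]
    exact degree_lowPoly_lt _ _
  rw [h2, zero_mul, zero_add] at e
  have h3 : lowPoly b v.2 = 0 := (mul_eq_zero.mp e).resolve_left (monic_monicPoly _ _).ne_zero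
  refine Prod.ext (funext fun i => ?_) (funext fun i => ?_)
  · rw [← coeff_lowPoly a v.1 i, h2]; rfl
  · rw [← coeff_lowPoly b v.2 i, h3]; rfl

/-- Hensel's lemma for analytic families: a coprime factorization at `0` extends to a neighbourhood. -/
theorem AnalyticFamily.exists_factorization {a b : ℕ} {P : ℂ → ℂ[X]} (hP : AnalyticFamily (a + b) P)
    {Q₀ R₀ : ℂ[X]} (hQ : Q₀.Monic) (hR : R₀.Monic) (hQa : Q₀.natDegree = a) (hRb : R₀.natDegree = b)
    (h0 : P 0 = Q₀ * R₀) (hcop : IsCoprime Q₀ R₀) :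
    ∃ Q R : ℂ → ℂ[X], AnalyticFamily a Q ∧ AnalyticFamily b R ∧ ∀ᶠ z in 𝓝 0, P z = Q z * R z := by
  set x : (Fin a → ℂ) × (Fin b → ℂ) := (fun i => Q₀.coeff i, fun i => R₀.coeff i) with hx
  have hx1 : monicPoly a x.1 = Q₀ := monicPoly_coeff hQ hQa
  have hx2 : monicPoly b x.2 = R₀ := monicPoly_coeff hR hRb
  have hinj : Function.Injective (fderiv ℂ (mulCoeffs a b) x) :=
    fderiv_mulCoeffs_injective (by rwa [hx1, hx2])
  -- Both sides have dimension `a + b`, so the injective derivative is invertible and the inverse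
  -- function theorem supplies analytic factors.
  let e : ((Fin a → ℂ) × (Fin b → ℂ)) ≃L[ℂ] (Fin (a + b) → ℂ) :=
    (LinearEquiv.ofInjectiveOfFinrankEq (fderiv ℂ (mulCoeffs a b) x : _ →ₗ[ℂ] _) hinj
      (by simp)).toContinuousLinearEquiv
  have hcd : ContDiffAt ℂ ω (mulCoeffs a b) x := (contDiff_mulCoeffs a b).contDiffAt
  have he : HasFDerivAt (mulCoeffs a b) (e : _ →L[ℂ] _) x := by
    have : (e : ((Fin a → ℂ) × (Fin b → ℂ)) →L[ℂ] (Fin (a + b) → ℂ)) = fderiv ℂ (mulCoeffs a b) x := by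
      exact ContinuousLinearMap.ext fun v => rfl
    rw [this]
    exact (hcd.differentiableAt (by simp)).hasFDerivAt
  have hω : (ω : WithTop ℕ∞) ≠ 0 := by simp
  set c : ℂ → Fin (a + b) → ℂ := fun z i => (P z).coeff i with hc
  have hcan : AnalyticAt ℂ c 0 := analyticAt_pi_iff.mpr fun i => hP.analytic i
  have hc0 : c 0 = mulCoeffs a b x := by
    funext i
    rw [hc, mulCoeffs, hx1, hx2, ← h0]
  have hinv := hcd.to_localInverse he hω
  rw [← hc0] at hinv
  have hψ : AnalyticAt ℂ (fun z => hcd.localInverse he hω (c z)) 0 :=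
    AnalyticAt.comp (g := hcd.localInverse he hω) (f := c) hinv.analyticAt hcan
  refine ⟨fun z => monicPoly a (hcd.localInverse he hω (c z)).1,
    fun z => monicPoly b (hcd.localInverse he hω (c z)).2,
    analyticFamily_monicPoly (analyticAt_fst.fun_comp hψ), analyticFamily_monicPoly (analyticAt_snd.fun_comp hψ), ?_⟩
  have h1 : ∀ᶠ y in 𝓝 (mulCoeffs a b x), mulCoeffs a b (hcd.localInverse he hω y) = y :=
    (hcd.hasStrictFDerivAt' he hω).eventually_right_inverse
  rw [← hc0] at h1
  filter_upwards [hcan.continuousAt.eventually h1] with z hz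
  rw [← monicPoly_mulCoeffs, hz]
  exact (monicPoly_coeff (hP.monic z) (hP.natDegree z)).symm

end BlockLaurent

end

/-! ### Rellich's theorem: analytic roots of real-rooted families -/

section

namespace BlockLaurent

open Polynomial

theorem multiset_sum_sq {R : Type*} [CommRing R] (s : Multiset R) :
    (s.map (· ^ 2)).sum = s.sum ^ 2 - 2 * s.esymm 2 := by
  induction s using Multiset.induction with
  | empty =>
    rw [Multiset.esymm, show (2 : ℕ) = 1 + 1 from rfl, Multiset.powersetCard_zero_right]
    simp
  | cons a s ih =>
    have h : (a ::ₘ s).esymm 2 = s.esymm 2 + a * s.sum := by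
      have e := Multiset.sum_map_mul_left (s := s) (f := fun x => x) (a := a)
      rw [Multiset.map_id'] at e
      rw [← e]
      simp only [Multiset.esymm, Multiset.powersetCard_cons, Multiset.map_add, Multiset.sum_add,
        Multiset.map_map, Multiset.powersetCard_one, Function.comp_def, Multiset.prod_cons,
        Multiset.prod_singleton]
    rw [Multiset.map_cons, Multiset.sum_cons, Multiset.sum_cons, ih, h]
    ring

theorem sum_roots_eq {n : ℕ} {p : ℂ[X]} (hp : p.Monic) (hn : p.natDegree = n + 1) :
    p.roots.sum = - p.coeff n := by
  have h1 : p.roots.card = p.natDegree := (IsAlgClosed.splits p).natDegree_eq_card_roots.symm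
  have h2 := coeff_eq_esymm_roots_of_card h1 (k := n) (by omega)
  rw [hp.leadingCoeff, hn, Nat.add_sub_cancel_left, Multiset.esymm, Multiset.powersetCard_one,
    Multiset.map_map] at h2
  rw [h2]
  simp

/-- For centred roots the sum of squares is a multiple of one coefficient, hence analytic in the
parameter. When the roots are real it bounds all of them. -/
theorem sum_sq_roots_eq {n : ℕ} {p : ℂ[X]} (hp : p.Monic) (hn : p.natDegree = n + 2)
    (h0 : p.coeff (n + 1) = 0) : (p.roots.map (· ^ 2)).sum = -2 * p.coeff n := by
  have h1 : p.roots.card = p.natDegree := (IsAlgClosed.splits p).natDegree_eq_card_roots.symm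
  have h2 := coeff_eq_esymm_roots_of_card h1 (k := n) (by omega)
  rw [hp.leadingCoeff, hn, Nat.add_sub_cancel_left] at h2
  rw [multiset_sum_sq, sum_roots_eq (n := n + 1) hp hn, h0, h2]
  ring

theorem AnalyticFamily.comp_add {n : ℕ} {P : ℂ → ℂ[X]} (hP : AnalyticFamily n P) {s : ℂ → ℂ}
    (hs : AnalyticAt ℂ s 0) : AnalyticFamily n (fun z => (P z).comp (X + C (s z))) := by
  refine ⟨fun z => (hP.monic z).comp_X_add_C _, fun z => ?_, fun k => ?_⟩
  · rw [natDegree_comp, natDegree_X_add_C, mul_one, hP.natDegree]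
  · have : (fun z => ((P z).comp (X + C (s z))).coeff k) = fun z => ∑ i ∈ Finset.range (n + 1),
        (P z).coeff i * (s z ^ (i - k) * (i.choose k : ℂ)) := by
      funext z
      rw [comp, eval₂_eq_sum_range, finsetSum_coeff, hP.natDegree]
      refine Finset.sum_congr rfl fun i _ => ?_
      rw [coeff_C_mul, coeff_X_add_C_pow]
    rw [this]
    refine Finset.analyticAt_fun_sum _ fun i _ => ?_
    exact (hP.analytic i).mul ((hs.pow _).mul analyticAt_const)

theorem tendsto_ofReal_nhdsNE : Tendsto (fun t : ℝ => (t : ℂ)) (𝓝[≠] 0) (𝓝[≠] 0) := by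
  refine tendsto_nhdsWithin_iff.mpr ⟨?_, ?_⟩
  · exact (Complex.continuous_ofReal.tendsto' 0 0 Complex.ofReal_zero).mono_left nhdsWithin_le_nhds
  · exact eventually_mem_nhdsWithin.mono fun t ht => by simpa using ht

/-- An analytic function that is small on the real axis is divisible by a power. -/
theorem exists_eq_pow_mul_of_bound {f : ℂ → ℂ} (hf : AnalyticAt ℂ f 0) {K : ℕ} {B : ℝ}
    (h : ∀ᶠ t : ℝ in 𝓝[≠] 0, ‖f t‖ ≤ B * |t| ^ K) :
    ∃ g, AnalyticAt ℂ g 0 ∧ ∀ᶠ z in 𝓝 0, f z = z ^ K * g z := by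
  by_cases hK : (K : ℕ∞) ≤ analyticOrderAt f 0
  · obtain ⟨g, hg, h2⟩ := (natCast_le_analyticOrderAt hf).mp hK
    exact ⟨g, hg, h2.mono fun z hz => by simpa using hz⟩
  exfalso
  rw [not_le] at hK
  obtain ⟨j, hj⟩ := ENat.ne_top_iff_exists.mp (ne_top_of_lt hK)
  rw [← hj, Nat.cast_lt] at hK
  obtain ⟨g, hg, hg0, h2⟩ := (hf.analyticOrderAt_eq_natCast).mp hj.symm
  have h3 : ∀ᶠ t : ℝ in 𝓝[≠] 0, ‖g t‖ ≤ B * |t| ^ (K - j) := by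
    filter_upwards [h, tendsto_ofReal_nhdsNE.eventually (h2.filter_mono nhdsWithin_le_nhds),
      self_mem_nhdsWithin] with t h1 h2 h3
    rw [h2, sub_zero, norm_smul, norm_pow, Complex.norm_real, Real.norm_eq_abs,
      ← Nat.add_sub_cancel' hK.le, pow_add] at h1
    have h4 : 0 < |t| ^ j := pow_pos (abs_pos.mpr h3) _
    nlinarith
  have h4 : Tendsto (fun t : ℝ => ‖g t‖) (𝓝[≠] 0) (𝓝 ‖g 0‖) :=
    (hg.continuousAt.tendsto.norm.comp (tendsto_nhds_of_tendsto_nhdsWithin tendsto_ofReal_nhdsNE))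
  have h5 : Tendsto (fun t : ℝ => B * |t| ^ (K - j)) (𝓝[≠] 0) (𝓝 0) := by
    have : Tendsto (fun t : ℝ => B * |t| ^ (K - j)) (𝓝 0) (𝓝 (B * |0| ^ (K - j))) := by
      refine Continuous.tendsto ?_ 0
      fun_prop
    rw [abs_zero, zero_pow (by omega), mul_zero] at this
    exact this.mono_left nhdsWithin_le_nhds
  have h6 := le_of_tendsto_of_tendsto h4 h5 h3
  exact hg0 (norm_le_zero_iff.mp h6)

/-- An analytic function that is nonnegative on the real axis vanishes to even order. -/
theorem even_of_nonneg {g : ℂ → ℂ} {M : ℕ} (hg : ContinuousAt g 0) (hg0 : g 0 ≠ 0)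
    (h : ∀ᶠ t : ℝ in 𝓝[≠] 0, 0 ≤ ((t : ℂ) ^ M * g t).re ∧ ((t : ℂ) ^ M * g t).im = 0) : Even M := by
  by_contra hM
  rw [Nat.not_even_iff_odd] at hM
  have hre : ∀ t : ℝ, ((t : ℂ) ^ M * g t).re = t ^ M * (g t).re := fun t => by
    rw [← Complex.ofReal_pow, Complex.re_ofReal_mul]
  have him : ∀ t : ℝ, ((t : ℂ) ^ M * g t).im = t ^ M * (g t).im := fun t => by
    rw [← Complex.ofReal_pow, Complex.im_ofReal_mul]
  have ht : Tendsto (fun t : ℝ => g t) (𝓝 0) (𝓝 (g 0)) :=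
    hg.tendsto.comp (Complex.continuous_ofReal.tendsto' 0 0 Complex.ofReal_zero)
  have h1 : ∀ᶠ t : ℝ in 𝓝[>] 0, 0 ≤ (g t).re := by
    filter_upwards [h.filter_mono (nhdsWithin_mono _ (fun t ht => ne_of_gt ht)),
      self_mem_nhdsWithin] with t h1 h2
    rw [hre] at h1
    exact nonneg_of_mul_nonneg_right h1.1 (pow_pos h2 _)
  have h2 : ∀ᶠ t : ℝ in 𝓝[<] 0, (g t).re ≤ 0 := by
    filter_upwards [h.filter_mono (nhdsWithin_mono _ (fun t ht => ne_of_lt ht)),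
      self_mem_nhdsWithin] with t h1 h2
    rw [hre] at h1
    exact nonpos_of_mul_nonneg_right h1.1 (hM.pow_neg h2)
  have h3 : ∀ᶠ t : ℝ in 𝓝[>] 0, (g t).im = 0 := by
    filter_upwards [h.filter_mono (nhdsWithin_mono _ (fun t ht => ne_of_gt ht)),
      self_mem_nhdsWithin] with t h1 h2
    rw [him] at h1
    exact (mul_eq_zero.mp h1.2).resolve_left (pow_pos h2 _).ne'
  have hr := (Complex.continuous_re.tendsto _).comp ht
  have hi := (Complex.continuous_im.tendsto _).comp ht
  have e1 := ge_of_tendsto (hr.mono_left (nhdsWithin_le_nhds (s := Set.Ioi 0))) h1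
  have e2 := le_of_tendsto (hr.mono_left (nhdsWithin_le_nhds (s := Set.Iio 0))) h2
  have e3 := tendsto_nhds_unique (hi.mono_left (nhdsWithin_le_nhds (s := Set.Ioi 0)))
    ((tendsto_const_nhds (x := (0 : ℝ))).congr' (h3.mono fun t ht => ht.symm))
  exact hg0 (Complex.ext (le_antisymm e2 e1) e3)

theorem eventually_eq_of_real {f g : ℂ → ℂ} (hf : AnalyticAt ℂ f 0) (hg : AnalyticAt ℂ g 0)
    (h : ∀ᶠ t : ℝ in 𝓝[≠] 0, f t = g t) : ∀ᶠ z in 𝓝 0, f z = g z :=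
  (hf.frequently_eq_iff_eventually_eq hg).mp (tendsto_ofReal_nhdsNE.frequently h.frequently)

theorem AnalyticFamily.eventually_eq_of_real {n : ℕ} {P Q : ℂ → ℂ[X]} (hP : AnalyticFamily n P)
    (hQ : AnalyticFamily n Q) (h : ∀ᶠ t : ℝ in 𝓝[≠] 0, P t = Q t) : ∀ᶠ z in 𝓝 0, P z = Q z := by
  have h1 : ∀ i : Fin n, ∀ᶠ z in 𝓝 0, (P z).coeff i = (Q z).coeff i := fun i =>
    BlockLaurent.eventually_eq_of_real (hP.analytic i) (hQ.analytic i)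
      (h.mono fun t ht => congrArg (fun p : ℂ[X] => p.coeff i) ht)
  filter_upwards [eventually_all.mpr h1] with z hz
  exact monic_ext (hP.monic z) (hQ.monic z) (hP.natDegree z) (hQ.natDegree z) hz

/-- Centred roots with nonvanishing second coefficient cannot all coincide, so one root split off
with its full multiplicity leaves a nonconstant coprime cofactor. -/
theorem exists_coprime_factorization {n : ℕ} {p : ℂ[X]} (hp : p.Monic) (hn : p.natDegree = n + 2)
    (h1 : p.coeff (n + 1) = 0) (h2 : p.coeff n ≠ 0) :
    ∃ (a b : ℕ) (Q R : ℂ[X]), a < n + 2 ∧ b < n + 2 ∧ a + b = n + 2 ∧ Q.Monic ∧ R.Monic ∧ Q.natDegree = a ∧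
      R.natDegree = b ∧ p = Q * R ∧ IsCoprime Q R := by
  obtain ⟨α, hα⟩ := IsAlgClosed.exists_root p (by
    rw [degree_eq_natDegree hp.ne_zero, hn]
    exact_mod_cast (by omega : n + 2 ≠ 0))
  obtain ⟨R, hR, hdvd⟩ := exists_eq_pow_rootMultiplicity_mul_and_not_dvd p hp.ne_zero α
  set a := rootMultiplicity α p with ha
  have ha0 : 0 < a := (rootMultiplicity_pos hp.ne_zero).mpr hα
  have hQ : ((X - C α) ^ a).Monic := (monic_X_sub_C α).pow a
  have hRm : R.Monic := hQ.of_mul_monic_left (hR ▸ hp)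
  have hQd : ((X - C α) ^ a).natDegree = a := by simp
  have hd : a + R.natDegree = n + 2 := by
    rw [← hn, hR, hQ.natDegree_mul hRm, hQd]
  -- If `p = (X - α)^(n+2)`, vanishing of the coefficient of `X^(n+1)` gives `α = 0`, and then the
  -- coefficient of `X^n` vanishes as well.
  have hb0 : R.natDegree ≠ 0 := by
    intro h0
    have hR1 : R = 1 := hRm.natDegree_eq_zero.mp h0
    have ha2 : a = n + 2 := by omega
    rw [hR1, mul_one, ha2] at hR
    rw [hR, sub_eq_add_neg, ← C_neg, coeff_X_add_C_pow] at h1 h2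
    rw [show n + 2 - (n + 1) = 1 by omega, pow_one, mul_eq_zero, Nat.choose_succ_self_right] at h1
    rcases h1 with h1 | h1
    · rw [h1] at h2
      simp at h2
    · exact Nat.cast_ne_zero.mpr (Nat.succ_ne_zero _) h1
  refine ⟨a, R.natDegree, _, R, by omega, by omega, hd, hQ, hRm, hQd, rfl, hR, ?_⟩
  exact ((irreducible_X_sub_C α).coprime_iff_not_dvd.mpr hdvd).pow_left

theorem im_multiset_sum (s : Multiset ℂ) (h : ∀ x ∈ s, x.im = 0) : s.sum.im = 0 := by
  induction s using Multiset.induction with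
  | empty => simp
  | cons a s ih =>
    rw [Multiset.sum_cons, Complex.add_im, h a (Multiset.mem_cons_self _ _),
      ih fun x hx => h x (Multiset.mem_cons_of_mem hx), add_zero]

theorem sq_norm_le_sum_sq (s : Multiset ℂ) (h : ∀ x ∈ s, x.im = 0) :
    0 ≤ ((s.map (· ^ 2)).sum).re ∧ ((s.map (· ^ 2)).sum).im = 0 ∧
      ∀ x ∈ s, ‖x‖ ^ 2 ≤ ((s.map (· ^ 2)).sum).re := by
  induction s using Multiset.induction with
  | empty => simp
  | cons a s ih =>
    obtain ⟨h1, h2, h3⟩ := ih fun x hx => h x (Multiset.mem_cons_of_mem hx)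
    have ha := h a (Multiset.mem_cons_self _ _)
    have e1 : (a ^ 2).re = ‖a‖ ^ 2 := by
      rw [← Complex.normSq_eq_norm_sq, Complex.normSq_apply, sq, Complex.mul_re, ha]; ring
    have e2 : (a ^ 2).im = 0 := by rw [sq, Complex.mul_im, ha]; ring
    rw [Multiset.map_cons, Multiset.sum_cons, Complex.add_re, Complex.add_im, e1, e2, h2]
    refine ⟨by positivity, by ring, fun x hx => ?_⟩
    rcases Multiset.mem_cons.mp hx with rfl | hx
    · linarith
    · have := h3 x hx
      nlinarith [sq_nonneg ‖a‖]

/-- The analytic roots of a family obtained by combining the roots of two factors. -/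
theorem exists_roots_mul {a b : ℕ} {P Q R : ℂ → ℂ[X]} (h : ∀ᶠ z in 𝓝 0, P z = Q z * R z)
    (hQ : ∃ F : Fin a → ℂ → ℂ, (∀ j, AnalyticAt ℂ (F j) 0) ∧ ∀ᶠ z in 𝓝 0, Q z = ∏ j, (X - C (F j z)))
    (hR : ∃ F : Fin b → ℂ → ℂ, (∀ j, AnalyticAt ℂ (F j) 0) ∧ ∀ᶠ z in 𝓝 0, R z = ∏ j, (X - C (F j z))) :
    ∃ F : Fin (a + b) → ℂ → ℂ, (∀ j, AnalyticAt ℂ (F j) 0) ∧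
      ∀ᶠ z in 𝓝 0, P z = ∏ j, (X - C (F j z)) := by
  obtain ⟨F, hF, hF2⟩ := hQ
  obtain ⟨G, hG, hG2⟩ := hR
  refine ⟨Fin.append F G, fun j => ?_, ?_⟩
  · refine Fin.addCases (fun i => ?_) (fun i => ?_) j
    · rw [Fin.append_left]; exact hF i
    · rw [Fin.append_right]; exact hG i
  · filter_upwards [h, hF2, hG2] with z h1 h2 h3
    rw [h1, h2, h3, Fin.prod_univ_add]
    simp only [Fin.append_left, Fin.append_right]

theorem prod_scaleRoots {n : ℕ} (y : Fin n → ℂ) (r : ℂ) :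
    (∏ j, (X - C (y j))).scaleRoots r = ∏ j, (X - C (r * y j)) := by
  induction n with
  | zero => simp
  | succ n ih =>
    rw [Fin.prod_univ_succ, Fin.prod_univ_succ, mul_scaleRoots_of_noZeroDivisors, ih]
    congr 1
    refine monic_ext (n := 1) ?_ (monic_X_sub_C _)
      (by rw [natDegree_scaleRoots, natDegree_X_sub_C]) (natDegree_X_sub_C _) fun i => ?_
    · rw [monic_scaleRoots_iff]; exact monic_X_sub_C _
    · rw [coeff_scaleRoots, natDegree_X_sub_C, show (i : ℕ) = 0 by omega]
      simp [mul_comm]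

/-- Rescaling of a real rooted family with vanishing sum of roots: either it is constant, or after
dividing the roots by a power of the parameter there are distinct roots at `0`. -/
theorem AnalyticFamily.exists_rescaling {n : ℕ} {P : ℂ → ℂ[X]} (hP : AnalyticFamily (n + 2) P)
    (hreal : ∀ᶠ t : ℝ in 𝓝[≠] 0, ∀ x, (P t).IsRoot x → x.im = 0)
    (h0 : ∀ z, (P z).coeff (n + 1) = 0) :
    (∀ᶠ z in 𝓝 0, P z = X ^ (n + 2)) ∨ ∃ (m : ℕ) (Q : ℂ → ℂ[X]), AnalyticFamily (n + 2) Q ∧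
      (∀ᶠ z in 𝓝 0, P z = (Q z).scaleRoots (z ^ m)) ∧ (Q 0).coeff (n + 1) = 0 ∧ (Q 0).coeff n ≠ 0 := by
  -- `e` is the sum of the squares of the roots, nonnegative on the real axis near `0`.
  set e : ℂ → ℂ := fun z => -2 * (P z).coeff n with he
  have hean : AnalyticAt ℂ e 0 := analyticAt_const.mul (hP.analytic n)
  have hreal' : ∀ᶠ t : ℝ in 𝓝[≠] 0, 0 ≤ (e t).re ∧ (e t).im = 0 ∧
      ∀ x ∈ (P t).roots, ‖x‖ ^ 2 ≤ (e t).re := by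
    filter_upwards [hreal] with t ht
    rw [he]
    beta_reduce
    rw [← sum_sq_roots_eq (hP.monic t) (hP.natDegree t) (h0 t)]
    exact sq_norm_le_sum_sq _ fun x hx => ht x (isRoot_of_mem_roots hx)
  have hcoeff : ∀ (t : ℝ) (B : ℝ), (∀ x ∈ (P t).roots, ‖x‖ ≤ B) → ∀ i,
      ‖(P t).coeff i‖ ≤ B ^ (n + 2 - i) * (n + 2).choose i := by
    intro t B hB i
    have := coeff_le_of_roots_le (p := P t) (f := RingHom.id ℂ) (B := B) i (hP.monic t)
      (IsAlgClosed.splits _) (by rwa [Polynomial.map_id])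
    rwa [Polynomial.map_id, hP.natDegree] at this
  by_cases hez : ∀ᶠ z in 𝓝 0, e z = 0
  · left
    refine hP.eventually_eq_of_real (Q := fun _ => X ^ (n + 2))
      ⟨fun _ => monic_X_pow _, fun _ => natDegree_X_pow _, fun _ => analyticAt_const⟩ ?_
    filter_upwards [hreal', tendsto_ofReal_nhdsNE.eventually (hez.filter_mono nhdsWithin_le_nhds)]
      with t h1 h2
    refine monic_ext (hP.monic _) (monic_X_pow _) (hP.natDegree _) (natDegree_X_pow _) fun i => ?_
    have h3 := hcoeff t 0 (fun x hx => by
      have := h1.2.2 x hx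
      rw [h2, Complex.zero_re] at this
      nlinarith [norm_nonneg x]) i
    rw [zero_pow (by omega), zero_mul, norm_le_zero_iff] at h3
    rw [h3, coeff_X_pow, if_neg (by omega)]
  right
  have hord : analyticOrderAt e 0 ≠ ⊤ := by
    rwa [Ne, analyticOrderAt_eq_top]
  obtain ⟨g, hg, hg0, hge⟩ := hean.analyticOrderAt_ne_top.mp hord
  set M := analyticOrderNatAt e 0 with hM
  have hge' : ∀ᶠ z in 𝓝 0, e z = z ^ M * g z := hge.mono fun z hz => by simpa using hz
  -- Nonnegativity on both sides of `0` makes the order of vanishing even, `M = 2 m`. The roots are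
  -- thus `O(|t|^m)` with an integer exponent, and no fractional powers appear.
  obtain ⟨m, hm⟩ : Even M := by
    refine even_of_nonneg hg.continuousAt hg0 ?_
    filter_upwards [hreal', tendsto_ofReal_nhdsNE.eventually (hge'.filter_mono nhdsWithin_le_nhds)]
      with t h1 h2
    rw [← h2]
    exact ⟨h1.1, h1.2.1⟩
  have hgb : ∀ᶠ z in 𝓝 0, ‖g z‖ ≤ ‖g 0‖ + 1 :=
    (hg.continuousAt.norm.tendsto.eventually (gt_mem_nhds (lt_add_one _))).mono fun _ h => h.le
  have hbound : ∀ᶠ t : ℝ in 𝓝[≠] 0, ∀ x ∈ (P t).roots, ‖x‖ ≤ |t| ^ m * Real.sqrt (‖g 0‖ + 1) := by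
    filter_upwards [hreal', tendsto_ofReal_nhdsNE.eventually (hge'.filter_mono nhdsWithin_le_nhds),
      tendsto_ofReal_nhdsNE.eventually (hgb.filter_mono nhdsWithin_le_nhds)] with t h1 h2 h3 x hx
    refine le_of_abs_le (abs_le_of_sq_le_sq ?_ (by positivity))
    calc ‖x‖ ^ 2 ≤ (e t).re := h1.2.2 x hx
      _ ≤ ‖e t‖ := Complex.re_le_norm _
      _ = |t| ^ M * ‖g t‖ := by rw [h2, norm_mul, norm_pow, Complex.norm_real, Real.norm_eq_abs]
      _ ≤ |t| ^ M * (‖g 0‖ + 1) := by gcongr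
      _ = _ := by rw [mul_pow, Real.sq_sqrt (by positivity), hm, pow_add]; ring
  -- The coefficient of index `i` is a symmetric function of `n + 2 - i` roots, hence divisible by
  -- that power of `z ^ m`.
  have hd : ∀ i : Fin (n + 2), ∃ d, AnalyticAt ℂ d 0 ∧
      ∀ᶠ z in 𝓝 0, (P z).coeff i = z ^ (m * (n + 2 - i)) * d z := by
    intro i
    refine exists_eq_pow_mul_of_bound (hP.analytic i)
      (B := Real.sqrt (‖g 0‖ + 1) ^ (n + 2 - (i : ℕ)) * (n + 2).choose i) ?_
    filter_upwards [hbound] with t ht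
    refine (hcoeff t _ ht i).trans (le_of_eq ?_)
    rw [mul_pow, ← pow_mul]
    ring
  choose d hdan hd using hd
  set Q : ℂ → ℂ[X] := fun z => monicPoly (n + 2) (fun i => d i z) with hQ
  have hQc : ∀ z (i : Fin (n + 2)), (Q z).coeff i = d i z := fun z i => coeff_monicPoly _ _ i
  refine ⟨m, Q, analyticFamily_monicPoly (analyticAt_pi_iff.mpr hdan), ?_, ?_, ?_⟩
  · filter_upwards [eventually_all.mpr hd] with z hz
    refine monic_ext (n := n + 2) (hP.monic z) ?_ (hP.natDegree z) ?_ fun i => ?_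
    · rw [monic_scaleRoots_iff]; exact monic_monicPoly _ _
    · rw [natDegree_scaleRoots]; exact natDegree_monicPoly _ _
    · rw [coeff_scaleRoots, hQc, hz i, natDegree_monicPoly, pow_mul, mul_comm]
  · have h1 : ∀ᶠ z in 𝓝[≠] 0, d ⟨n + 1, by omega⟩ z = 0 := by
      filter_upwards [(hd ⟨n + 1, by omega⟩).filter_mono nhdsWithin_le_nhds, self_mem_nhdsWithin]
        with z h1 h2
      rw [h0] at h1
      exact (mul_eq_zero.mp h1.symm).resolve_left (pow_ne_zero _ h2)
    rw [hQc 0 ⟨n + 1, by omega⟩]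
    exact ((hdan _).frequently_zero_iff_eventually_zero.mp h1.frequently).self_of_nhds
  -- The rescaled sum of squares is `g`, nonzero at `0` since all of the vanishing of `e` has been
  -- divided out.
  · have h1 : ∀ᶠ z in 𝓝[≠] 0, -2 * d ⟨n, by omega⟩ z = g z := by
      filter_upwards [(hd ⟨n, by omega⟩).filter_mono nhdsWithin_le_nhds,
        hge'.filter_mono nhdsWithin_le_nhds, self_mem_nhdsWithin] with z h1 h2 h3
      have h4 : z ^ M ≠ 0 := pow_ne_zero _ h3
      rw [he] at h2
      simp only [h1, Nat.add_sub_cancel_left] at h2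
      rw [show m * 2 = M by omega] at h2
      refine mul_left_cancel₀ h4 ?_
      rw [← h2]; ring
    have h2 := (((analyticAt_const.mul (hdan _)).frequently_eq_iff_eventually_eq hg).mp
      h1.frequently).self_of_nhds
    rw [hQc 0 ⟨n, by omega⟩]
    intro h3
    rw [Pi.mul_apply, h3, mul_zero] at h2
    exact hg0 h2.symm

/-- Rellich's theorem for polynomials: a real rooted analytic family has analytic roots. -/
theorem AnalyticFamily.exists_roots (n : ℕ) : ∀ {P : ℂ → ℂ[X]}, AnalyticFamily n P →
    (∀ᶠ t : ℝ in 𝓝[≠] 0, ∀ x, (P t).IsRoot x → x.im = 0) →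
    ∃ F : Fin n → ℂ → ℂ, (∀ j, AnalyticAt ℂ (F j) 0) ∧
      ∀ᶠ z in 𝓝 0, P z = ∏ j, (X - C (F j z)) := by
  induction n using Nat.strong_induction_on with
  | _ n ih =>
  intro P hP hreal
  match n, ih, hP with
  | 0, _, hP =>
    refine ⟨fun _ _ => 0, fun _ => analyticAt_const, Eventually.of_forall fun z => ?_⟩
    rw [Fin.prod_univ_zero]
    exact (hP.monic z).natDegree_eq_zero.mp (hP.natDegree z)
  | 1, _, hP =>
    refine ⟨fun _ z => - (P z).coeff 0, fun _ => (hP.analytic 0).neg, Eventually.of_forall fun z => ?_⟩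
    rw [Fin.prod_univ_one, C_neg, sub_neg_eq_add]
    exact (hP.monic z).eq_X_add_C (hP.natDegree z)
  | n + 2, ih, hP =>
    -- Subtracting the mean of the roots centres them; the mean is analytic, and real on the real
    -- axis, so nothing is lost.
    set s : ℂ → ℂ := fun z => - (P z).coeff (n + 1) / (n + 2) with hs
    have hsan : AnalyticAt ℂ s 0 := (hP.analytic _).neg.div analyticAt_const
      (by exact_mod_cast (by omega : n + 2 ≠ 0))
    set P' : ℂ → ℂ[X] := fun z => (P z).comp (X + C (s z)) with hP'def
    have hP' : AnalyticFamily (n + 2) P' := hP.comp_add hsan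
    have hback : ∀ z, P z = (P' z).comp (X - C (s z)) := by
      intro z
      rw [hP'def, comp_assoc]
      simp
    have hsum : ∀ z, (P' z).coeff (n + 1) = 0 := by
      intro z
      have e1 := (hP.monic z).as_sum
      rw [hP.natDegree, Finset.sum_range_succ] at e1
      have e2 : P' z = (X + C (s z)) ^ (n + 2) + (∑ i ∈ Finset.range (n + 1),
          C ((P z).coeff i) * (X + C (s z)) ^ i + C ((P z).coeff (n + 1)) * (X + C (s z)) ^ (n + 1)) := by
        rw [hP'def]
        beta_reduce
        conv_lhs => rw [e1]
        simp [sum_comp]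
      rw [e2, coeff_add, coeff_add, finsetSum_coeff, Finset.sum_eq_zero, coeff_C_mul, coeff_X_add_C_pow,
        coeff_X_add_C_pow, show n + 2 - (n + 1) = 1 by omega, Nat.sub_self, Nat.choose_self,
        Nat.choose_succ_self_right, hs]
      · have : (n + 2 : ℂ) ≠ 0 := by exact_mod_cast (by omega : n + 2 ≠ 0)
        push_cast
        field_simp
        ring
      · intro i hi
        rw [coeff_C_mul, coeff_X_add_C_pow, Nat.choose_eq_zero_of_lt (Finset.mem_range.mp hi)]
        simp
    have hreal' : ∀ᶠ t : ℝ in 𝓝[≠] 0, ∀ x, (P' t).IsRoot x → x.im = 0 := by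
      filter_upwards [hreal] with t ht x hx
      have h1 : (s t).im = 0 := by
        have h2 := im_multiset_sum _ fun x hx => ht x (isRoot_of_mem_roots hx)
        rw [sum_roots_eq (n := n + 1) (hP.monic t) (hP.natDegree t)] at h2
        rw [hs]
        beta_reduce
        rw [show ((n : ℂ) + 2) = ((n + 2 : ℝ) : ℂ) by push_cast; rfl, Complex.div_ofReal_im, h2, zero_div]
      have h3 := ht (x + s t) (by
        rw [IsRoot, hP'def] at hx
        simpa [eval_comp] using hx)
      rw [Complex.add_im, h1, add_zero] at h3
      exact h3
    have hshift : (∃ F : Fin (n + 2) → ℂ → ℂ, (∀ j, AnalyticAt ℂ (F j) 0) ∧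
        ∀ᶠ z in 𝓝 0, P' z = ∏ j, (X - C (F j z))) → ∃ F : Fin (n + 2) → ℂ → ℂ,
        (∀ j, AnalyticAt ℂ (F j) 0) ∧ ∀ᶠ z in 𝓝 0, P z = ∏ j, (X - C (F j z)) := by
      rintro ⟨F, hF, hF2⟩
      refine ⟨fun j z => F j z + s z, fun j => (hF j).add hsan, hF2.mono fun z hz => ?_⟩
      rw [hback, hz, prod_comp]
      refine Finset.prod_congr rfl fun j _ => ?_
      rw [sub_comp, X_comp, C_comp, C_add]
      ring
    refine hshift ?_
    rcases hP'.exists_rescaling hreal' hsum with h | ⟨m, Q, hQ, hPQ, hQ1, hQ2⟩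
    · exact ⟨fun _ _ => 0, fun _ => analyticAt_const, h.mono fun z hz => by simp [hz]⟩
    have hscale : (∃ F : Fin (n + 2) → ℂ → ℂ, (∀ j, AnalyticAt ℂ (F j) 0) ∧
        ∀ᶠ z in 𝓝 0, Q z = ∏ j, (X - C (F j z))) → ∃ F : Fin (n + 2) → ℂ → ℂ,
        (∀ j, AnalyticAt ℂ (F j) 0) ∧ ∀ᶠ z in 𝓝 0, P' z = ∏ j, (X - C (F j z)) := by
      rintro ⟨F, hF, hF2⟩
      refine ⟨fun j z => z ^ m * F j z, fun j => (analyticAt_id.pow m).mul (hF j), ?_⟩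
      filter_upwards [hF2, hPQ] with z h1 h2
      rw [h2, h1, prod_scaleRoots]
    refine hscale ?_
    have hrealQ : ∀ᶠ t : ℝ in 𝓝[≠] 0, ∀ y, (Q t).IsRoot y → y.im = 0 := by
      filter_upwards [hreal', tendsto_ofReal_nhdsNE.eventually (hPQ.filter_mono nhdsWithin_le_nhds),
        self_mem_nhdsWithin] with t h1 h2 h3 y hy
      have h4 := h1 ((t : ℂ) ^ m * y) (by
        rw [h2, IsRoot, ← eval₂_id]
        have := scaleRoots_eval₂_mul (p := Q t) (RingHom.id ℂ) y ((t : ℂ) ^ m)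
        rw [RingHom.id_apply] at this
        rw [this, eval₂_id, hy, mul_zero])
      rw [← Complex.ofReal_pow, Complex.im_ofReal_mul] at h4
      exact (mul_eq_zero.mp h4).resolve_left (pow_ne_zero _ h3)
    -- After rescaling the roots at `0` are not all equal, so the family factors near `0` by
    -- Hensel's lemma into families of smaller degree, which are again real rooted.
    obtain ⟨a, b, Q₀, R₀, ha, hb, hab, hQ₀, hR₀, hda, hdb, hfac, hcop⟩ :=
      exists_coprime_factorization (hQ.monic 0) (hQ.natDegree 0) hQ1 hQ2
    rw [← hab] at hQ ⊢
    obtain ⟨Q', R', hQ', hR', hQR⟩ := hQ.exists_factorization hQ₀ hR₀ hda hdb hfac hcop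
    have hev := tendsto_ofReal_nhdsNE.eventually (hQR.filter_mono nhdsWithin_le_nhds)
    refine exists_roots_mul hQR (ih a ha hQ' ?_) (ih b hb hR' ?_)
    · filter_upwards [hrealQ, hev] with t h1 h2 x hx
      exact h1 x (h2 ▸ root_mul_right_of_isRoot _ hx)
    · filter_upwards [hrealQ, hev] with t h1 h2 x hx
      exact h1 x (h2 ▸ root_mul_left_of_isRoot _ hx)

end BlockLaurent

end

/-! ### The symbol as a Laurent series and exponential decay of its coefficients -/

section

namespace BlockLaurent

open Metric

theorem hasSum_circleIntegral {ι : Type*} [Countable ι] {F : ι → ℂ → ℂ} {f : ℂ → ℂ} {u : ι → ℝ} {ρ : ℝ} (hρ : 0 ≤ ρ)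
    (hu : Summable u) (hc : ∀ m, ContinuousOn (F m) (sphere 0 ρ))
    (hF : ∀ m, ∀ z ∈ sphere (0 : ℂ) ρ, ‖F m z‖ ≤ u m)
    (hf : ∀ z ∈ sphere (0 : ℂ) ρ, HasSum (fun m => F m z) (f z)) :
    HasSum (fun m => ∮ z in C(0, ρ), F m z) (∮ z in C(0, ρ), f z) := by
  classical
  have h1 : TendstoUniformlyOn (fun (t : Finset ι) z => ∑ m ∈ t, F m z) f atTop (sphere 0 ρ) :=
    (tendstoUniformlyOn_tsum hu hF).congr_right fun z hz => (hf z hz).tsum_eq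
  have h2 := h1.tendsto_circleIntegral_of_continuousOn hρ
    (Eventually.of_forall fun t => continuousOn_finsetSum _ fun m _ => hc m)
  refine h2.congr fun t => ?_
  rw [circleIntegral.integral_fun_sum]
  exact fun m _ => (hc m).circleIntegrable hρ

theorem circleIntegral_zpow (n : ℤ) {ρ : ℝ} (hρ : 0 < ρ) :
    (∮ z in C((0 : ℂ), ρ), z ^ n) = if n = -1 then 2 * Real.pi * Complex.I else 0 := by
  split_ifs with h
  · subst h
    have := circleIntegral.integral_sub_center_inv (0 : ℂ) hρ.ne'
    simpa [zpow_neg_one] using this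
  · simpa using circleIntegral.integral_sub_zpow_of_ne h 0 0 ρ

/-- The symbol as a function on the complex plane: `∑ₘ Aₘ zᵐ`. -/
def cSymbol {N : ℕ} (A : ℤ → Matrix (Fin N) (Fin N) ℂ) (z : ℂ) : Matrix (Fin N) (Fin N) ℂ :=
  Matrix.of fun i j => ∑' m : ℤ, A m i j * z ^ m

/-- `Aₘ` decays faster than `s^{|m|}`, by a geometric factor. -/
structure ExpDecay {N : ℕ} (A : ℤ → Matrix (Fin N) (Fin N) ℂ) (C θ s : ℝ) : Prop where
  C_nonneg : 0 ≤ C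
  theta_pos : 0 < θ
  theta_lt : θ < 1
  s_pos : 0 < s
  s_lt : s < 1
  bound : ∀ m i j, ‖A m i j‖ ≤ C * (θ * s) ^ m.natAbs

variable {N : ℕ} {A : ℤ → Matrix (Fin N) (Fin N) ℂ}

theorem norm_entry_le (M : Matrix (Fin N) (Fin N) ℂ) (i j : Fin N) : ‖M i j‖ ≤ ‖matOp M‖ := by
  have h1 : M i j = (matOp M (EuclideanSpace.single j 1)) i := by
    simp [matOp, Matrix.ofLp_toEuclideanCLM]
  rw [h1]
  refine (PiLp.norm_apply_le _ i).trans (((matOp M).le_opNorm _).trans ?_)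
  simp

theorem norm_matOp_le (M : Matrix (Fin N) (Fin N) ℂ) {B : ℝ} (hM : ∀ i j, ‖M i j‖ ≤ B) :
    ‖matOp M‖ ≤ N ^ 2 * B := by
  have h1 : M = ∑ i, ∑ j, Matrix.single i j (M i j) := Matrix.matrix_eq_sum_single M
  have hs : ∀ i j, ‖matOp (Matrix.single i j (M i j))‖ ≤ B := fun i j => by
    refine ContinuousLinearMap.opNorm_le_bound _ ((norm_nonneg _).trans (hM i j)) fun v => ?_
    have : matOp (Matrix.single i j (M i j)) v = EuclideanSpace.single i (M i j * v j) := by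
      ext k
      simp only [matOp, Matrix.ofLp_toEuclideanCLM, Matrix.single_mulVec,
        PiLp.ofLp_single]
      simp [Function.update_apply, Pi.single_apply]
    rw [this, PiLp.norm_single, norm_mul]
    exact mul_le_mul (hM i j) (PiLp.norm_apply_le _ j) (norm_nonneg _) ((norm_nonneg _).trans (hM i j))
  have h2 : matOp M = ∑ i, ∑ j, matOp (Matrix.single i j (M i j)) :=
    (congrArg (Matrix.toEuclideanCLM (n := Fin N) (𝕜 := ℂ)) h1).trans (by simp only [map_sum])
  rw [h2]
  refine (norm_sum_le _ _).trans ?_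
  refine (Finset.sum_le_sum fun i _ => ?_).trans (b := ∑ i : Fin N, (N : ℝ) * B) ?_
  · refine (norm_sum_le _ _).trans ((Finset.sum_le_sum fun j _ => hs i j).trans ?_)
    simp
  · simp [sq, mul_assoc]

theorem norm_zpow_le {s : ℝ} (hs : 0 < s) {z : ℂ} (h1 : s ≤ ‖z‖) (h2 : ‖z‖ ≤ s⁻¹) (m : ℤ) :
    ‖z ^ m‖ ≤ (s ^ m.natAbs)⁻¹ := by
  have hz : 0 < ‖z‖ := hs.trans_le h1
  rw [norm_zpow]
  rcases le_total 0 m with h | h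
  · lift m to ℕ using h
    rw [zpow_natCast, Int.natAbs_natCast, ← inv_pow]
    exact pow_le_pow_left₀ hz.le h2 _
  · obtain ⟨k, rfl⟩ : ∃ k : ℕ, m = -k := ⟨m.natAbs, by omega⟩
    rw [zpow_neg, zpow_natCast, Int.natAbs_neg, Int.natAbs_natCast]
    exact inv_anti₀ (pow_pos hs k) (pow_le_pow_left₀ hs.le h1 _)

theorem summable_pow_natAbs {θ : ℝ} (h0 : 0 ≤ θ) (h1 : θ < 1) : Summable fun m : ℤ => θ ^ m.natAbs := by
  refine Summable.of_nat_of_neg ?_ ?_ <;> simpa using summable_geometric_of_lt_one h0 h1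

theorem ExpDecay.norm_term_le {C θ s : ℝ} (h : ExpDecay A C θ s) {z : ℂ} (h1 : s ≤ ‖z‖)
    (h2 : ‖z‖ ≤ s⁻¹) (m : ℤ) (i j : Fin N) : ‖A m i j * z ^ m‖ ≤ C * θ ^ m.natAbs := by
  rw [norm_mul]
  refine (mul_le_mul (h.bound m i j) (norm_zpow_le h.s_pos h1 h2 m) (norm_nonneg _) ?_).trans_eq ?_
  · exact mul_nonneg h.C_nonneg (pow_nonneg (mul_pos h.theta_pos h.s_pos).le _)
  · rw [mul_pow, mul_assoc, mul_assoc, mul_inv_cancel₀ (pow_ne_zero _ h.s_pos.ne'), mul_one]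

theorem ExpDecay.summable {C θ s : ℝ} (h : ExpDecay A C θ s) :
    Summable fun m : ℤ => C * θ ^ m.natAbs :=
  (summable_pow_natAbs h.theta_pos.le h.theta_lt).mul_left C

theorem ExpDecay.hasSum {C θ s : ℝ} (h : ExpDecay A C θ s) {z : ℂ} (h1 : s ≤ ‖z‖)
    (h2 : ‖z‖ ≤ s⁻¹) (i j : Fin N) : HasSum (fun m : ℤ => A m i j * z ^ m) (cSymbol A z i j) :=
  (Summable.of_norm_bounded h.summable fun m => h.norm_term_le h1 h2 m i j).hasSum

/-- The open annulus `s < |z| < 1/s`. -/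
def annulus (s : ℝ) : Set ℂ := {z | s < ‖z‖ ∧ ‖z‖ < s⁻¹}

theorem isOpen_annulus (s : ℝ) : IsOpen (annulus s) :=
  (isOpen_lt continuous_const continuous_norm).inter (isOpen_lt continuous_norm continuous_const)

theorem ExpDecay.differentiableOn {C θ s : ℝ} (h : ExpDecay A C θ s) (i j : Fin N) :
    DifferentiableOn ℂ (fun z => cSymbol A z i j) (annulus s) :=
  Complex.differentiableOn_tsum_of_summable_norm h.summable (fun _ _ hz =>
      ((differentiableAt_zpow.mpr (Or.inl (norm_pos_iff.mp (h.s_pos.trans hz.1)))).const_mul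
        _).differentiableWithinAt) (isOpen_annulus s)
    fun m _ hz => h.norm_term_le hz.1.le hz.2.le m i j

theorem cSymbol_exp (A : ℤ → Matrix (Fin N) (Fin N) ℂ) (p : ℝ) :
    cSymbol A (Complex.exp (Complex.I * p)) = symbol A p := by
  ext i j
  simp only [cSymbol, symbol, Matrix.of_apply]
  refine tsum_congr fun m => ?_
  rw [← Complex.exp_int_mul]
  ring_nf

theorem exists_exp_eq {z : ℂ} (hz : ‖z‖ = 1) : ∃ p : ℝ, z = Complex.exp (Complex.I * p) := by
  refine ⟨z.arg, ?_⟩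
  have := Complex.norm_mul_exp_arg_mul_I z
  rw [hz, Complex.ofReal_one, one_mul, mul_comm] at this
  exact this.symm

theorem fourier_coeff_eq (hsum : Summable fun m : ℤ => ‖matOp (A m)‖) (i j : Fin N) (m : ℤ) :
    (∮ z in C(0, 1), z ^ (-m - 1) * cSymbol A z i j) = 2 * Real.pi * Complex.I * A m i j := by
  have hs : ∀ n : ℤ, ∀ z ∈ sphere (0 : ℂ) 1, ‖z ^ n‖ = 1 := fun n z hz => by
    rw [norm_zpow, mem_sphere_zero_iff_norm.mp hz, one_zpow]
  have hle : ∀ n : ℤ, ∀ z ∈ sphere (0 : ℂ) 1, ‖A n i j * z ^ n‖ ≤ ‖matOp (A n)‖ := fun n z hz => by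
    rw [norm_mul, hs n z hz, mul_one]; exact norm_entry_le _ _ _
  have hne : ∀ z ∈ sphere (0 : ℂ) 1, z ≠ 0 := fun z hz => ne_zero_of_mem_unit_sphere ⟨z, hz⟩
  have h := hasSum_circleIntegral (F := fun n z => z ^ (-m - 1) * (A n i j * z ^ n))
    (f := fun z => z ^ (-m - 1) * cSymbol A z i j) zero_le_one hsum (fun n => ?_) (fun n z hz => ?_)
    fun z hz => ((Summable.of_norm_bounded hsum fun n => hle n z hz).hasSum).mul_left _
  · refine h.unique ?_
    have e : ∀ n : ℤ, (∮ z in C(0, 1), z ^ (-m - 1) * (A n i j * z ^ n)) =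
        if n = m then 2 * Real.pi * Complex.I * A m i j else 0 := fun n => by
      rw [circleIntegral.integral_congr (g := fun z => A n i j * z ^ (n - m - 1)) zero_le_one,
        circleIntegral.integral_const_mul, circleIntegral_zpow _ one_pos]
      · by_cases hn : n = m
        · subst hn; rw [if_pos (by ring), if_pos rfl]; ring
        · rw [if_neg (by omega), if_neg hn, mul_zero]
      · intro z hz
        simp only
        rw [mul_left_comm, ← zpow_add₀ (hne z hz)]
        ring_nf
    simp_rw [e]
    exact hasSum_ite_eq m _
  · exact (continuousOn_id.zpow₀ _ fun z hz => Or.inl (hne z hz)).mul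
      (continuousOn_const.mul (continuousOn_id.zpow₀ _ fun z hz => Or.inl (hne z hz)))
  · rw [norm_mul, hs _ z hz, one_mul]; exact hle n z hz

theorem circleIntegral_eq_of_differentiableOn {f : ℂ → ℂ} {a b : ℝ} {U : Set ℂ} (hU : IsOpen U)
    (ha : 0 < a) (hab : a ≤ b) (hs : ∀ z : ℂ, a ≤ ‖z‖ → ‖z‖ ≤ b → z ∈ U)
    (hf : DifferentiableOn ℂ f U) : (∮ z in C(0, b), f z) = ∮ z in C(0, a), f z := by
  have hd : ∀ z : ℂ, a ≤ ‖z‖ → ‖z‖ ≤ b → DifferentiableAt ℂ f z := fun z h1 h2 =>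
    hf.differentiableAt (hU.mem_nhds (hs z h1 h2))
  refine Complex.circleIntegral_eq_of_differentiable_on_annulus_off_countable ha hab
    Set.countable_empty (fun z hz => ?_) fun z hz => ?_
  · simp only [Set.mem_sdiff, mem_closedBall_zero_iff, mem_ball_zero_iff, not_lt] at hz
    exact (hd z hz.2 hz.1).continuousAt.continuousWithinAt
  · simp only [Set.mem_sdiff, mem_closedBall_zero_iff, mem_ball_zero_iff, not_le] at hz
    exact hd z hz.1.2.le hz.1.1.le

/-- The Fourier integral for `A m` may be moved from the unit circle to radius `ρ` for `m ≥ 0` and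
to `ρ⁻¹` for `m ≤ 0`; Cauchy's estimate gives decay like `ρ^(-|m|)`. -/
theorem exists_expDecay (hsum : Summable fun m : ℤ => ‖matOp (A m)‖) (hhol : HolomorphicSymbol A) :
    ∃ C θ s, ExpDecay A C θ s := by
  obtain ⟨r, hr, g, hg, hgs⟩ := hhol
  obtain ⟨ρ, h1, h2⟩ := exists_between hr
  have hρ : 0 < ρ := one_pos.trans h1
  have hr0 : 0 < r := one_pos.trans hr
  have hinv : 1 / r < ρ⁻¹ := by rw [one_div]; exact inv_strictAnti₀ hρ h2
  set U : Set ℂ := {z : ℂ | 1 / r < ‖z‖ ∧ ‖z‖ < r} with hUdef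
  have hU : IsOpen U := (isOpen_lt continuous_const continuous_norm).inter
    (isOpen_lt continuous_norm continuous_const)
  have hU0 : ∀ z ∈ U, z ≠ 0 := fun z hz => norm_pos_iff.mp ((by positivity : 0 < 1 / r).trans hz.1)
  have hsub : ∀ z : ℂ, ρ⁻¹ ≤ ‖z‖ → ‖z‖ ≤ ρ → z ∈ U := fun z ha hb => ⟨hinv.trans_le ha, hb.trans_lt h2⟩
  have hρ1 : ρ⁻¹ < 1 := inv_lt_one_of_one_lt₀ h1
  have hK : IsCompact {z : ℂ | ρ⁻¹ ≤ ‖z‖ ∧ ‖z‖ ≤ ρ} := by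
    refine (isCompact_closedBall (0 : ℂ) ρ).of_isClosed_subset
      ((isClosed_le continuous_const continuous_norm).inter
        (isClosed_le continuous_norm continuous_const)) fun z hz => ?_
    simpa using hz.2
  have hB : ∃ B : ℝ, ∀ i j, ∀ z : ℂ, ρ⁻¹ ≤ ‖z‖ → ‖z‖ ≤ ρ → ‖g z i j‖ ≤ B := by
    have : ∀ ij : Fin N × Fin N, ∃ B : ℝ, ∀ z ∈ {z : ℂ | ρ⁻¹ ≤ ‖z‖ ∧ ‖z‖ ≤ ρ}, ‖g z ij.1 ij.2‖ ≤ B :=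
      fun ij => hK.exists_bound_of_continuousOn
        ((hg ij.1 ij.2).continuousOn.mono fun z hz => hsub z hz.1 hz.2)
    choose B hB using this
    obtain ⟨B', hB'⟩ := (Set.finite_range B).bddAbove
    exact ⟨B', fun i j z ha hb => (hB (i, j) z ⟨ha, hb⟩).trans (hB' ⟨_, rfl⟩)⟩
  obtain ⟨B, hB⟩ := hB
  have key : ∀ i j (m : ℤ), A m i j = (2 * Real.pi * Complex.I)⁻¹ *
      ∮ z in C(0, 1), z ^ (-m - 1) * g z i j := fun i j m => by
    rw [circleIntegral.integral_congr (g := fun z => z ^ (-m - 1) * cSymbol A z i j) zero_le_one,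
      fourier_coeff_eq hsum, inv_mul_cancel_left₀ Complex.two_pi_I_ne_zero]
    intro z hz
    obtain ⟨p, rfl⟩ := exists_exp_eq (mem_sphere_zero_iff_norm.mp hz)
    simp only [cSymbol_exp, hgs]
  have hdiff : ∀ i j (m : ℤ), DifferentiableOn ℂ (fun z => z ^ (-m - 1) * g z i j) U := fun i j m =>
    DifferentiableOn.mul (fun z hz =>
      (differentiableAt_zpow.mpr (Or.inl (hU0 z hz))).differentiableWithinAt) (hg i j)
  have bd : ∀ i j (m : ℤ) (t : ℝ), 0 < t → ρ⁻¹ ≤ t → t ≤ ρ →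
      (∮ z in C(0, 1), z ^ (-m - 1) * g z i j) = (∮ z in C(0, t), z ^ (-m - 1) * g z i j) →
      ‖A m i j‖ ≤ B * t ^ (-m) := fun i j m t ht ha hb he => by
    rw [key, he]
    have := circleIntegral.norm_two_pi_i_inv_smul_integral_le_of_norm_le_const
      (f := fun z => z ^ (-m - 1) * g z i j) (c := 0) (R := t) (C := t ^ (-m - 1) * B) ht.le
      fun z hz => by
        rw [mem_sphere_zero_iff_norm] at hz
        rw [norm_mul, norm_zpow, hz]
        exact mul_le_mul_of_nonneg_left (hB i j z (hz ▸ ha) (hz ▸ hb)) (by positivity)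
    rw [smul_eq_mul] at this
    refine this.trans_eq ?_
    rw [zpow_sub_one₀ ht.ne']
    field_simp
  have hdec : ∀ m i j, ‖A m i j‖ ≤ B * (ρ⁻¹) ^ m.natAbs := fun m i j => by
    rcases le_total 0 m with h | h
    · refine (bd i j m ρ hρ (hρ1.le.trans h1.le) le_rfl
        (circleIntegral_eq_of_differentiableOn hU one_pos h1.le
          (fun z ha hb => hsub z (hρ1.le.trans ha) hb) (hdiff i j m)).symm).trans_eq ?_
      lift m to ℕ using h
      simp [zpow_neg]
    · refine (bd i j m ρ⁻¹ (inv_pos.mpr hρ) le_rfl (hρ1.le.trans h1.le)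
        (circleIntegral_eq_of_differentiableOn hU (inv_pos.mpr hρ) hρ1.le
          (fun z ha hb => hsub z ha (hb.trans h1.le)) (hdiff i j m))).trans_eq ?_
      obtain ⟨k, rfl⟩ : ∃ k : ℕ, m = -k := ⟨m.natAbs, by omega⟩
      simp
  have hs1 : Real.sqrt ρ⁻¹ < 1 := by
    rw [Real.sqrt_lt' one_pos]; simpa using hρ1
  have hs0 : 0 < Real.sqrt ρ⁻¹ := Real.sqrt_pos.mpr (inv_pos.mpr hρ)
  -- The rate `ρ⁻¹` is split evenly: one factor fixes the annulus on which the Laurent series is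
  -- used, the other keeps the series geometrically convergent there.
  refine ⟨|B|, Real.sqrt ρ⁻¹, Real.sqrt ρ⁻¹, abs_nonneg _, hs0, hs1, hs0, hs1, fun m i j => ?_⟩
  rw [Real.mul_self_sqrt (inv_pos.mpr hρ).le]
  exact (hdec m i j).trans (mul_le_mul_of_nonneg_right (le_abs_self B) (by positivity))

theorem isHermitian_symbol (hherm : ∀ m : ℤ, A (-m) = (A m).conjTranspose) (p : ℝ) :
    (symbol A p).IsHermitian := by
  ext i j
  simp only [symbol, Matrix.conjTranspose_apply, Matrix.of_apply, RCLike.star_def]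
  rw [Complex.conj_tsum, ← (Equiv.neg ℤ).tsum_eq]
  refine tsum_congr fun m => ?_
  simp only [Equiv.neg_apply, hherm, map_mul, Matrix.conjTranspose_apply, RCLike.star_def,
    Complex.conj_conj, ← Complex.exp_conj, Complex.conj_I, Complex.conj_ofReal, map_intCast]
  push_cast
  ring_nf

theorem symbol_periodic (A : ℤ → Matrix (Fin N) (Fin N) ℂ) :
    Function.Periodic (symbol A) (2 * Real.pi) := fun p => by
  rw [← cSymbol_exp, ← cSymbol_exp]
  congr 1
  push_cast
  rw [mul_add, Complex.exp_add, mul_comm Complex.I (2 * _), Complex.exp_two_pi_mul_I, mul_one]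

end BlockLaurent

end

/-! ### Analytic eigenvalue branches of the symbol -/

section

namespace BlockLaurent

open Polynomial

variable {N : ℕ}

theorem exists_perm_of_map_eq {α : Type*} {f g : Fin N → α}
    (h : Finset.univ.val.map f = Finset.univ.val.map g) : ∃ σ : Equiv.Perm (Fin N), ∀ j, f j = g (σ j) := by
  classical
  have hc : ∀ c, Fintype.card {a // f a = c} = Fintype.card {b // g b = c} := fun c => by
    have := congrArg (Multiset.count c) h
    rw [Multiset.count_map, Multiset.count_map] at this
    rw [Fintype.card_subtype, Fintype.card_subtype]
    simpa [Finset.card, Finset.filter, eq_comm] using this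
  exact ⟨Equiv.ofFiberEquiv fun c => Fintype.equivOfCardEq (hc c), fun j =>
    (Equiv.ofFiberEquiv_map _ j).symm⟩

theorem analyticAt_charpoly_coeff {G : ℂ → Matrix (Fin N) (Fin N) ℂ} {z : ℂ}
    (h : ∀ i j, AnalyticAt ℂ (fun w => G w i j) z) (k : ℕ) :
    AnalyticAt ℂ (fun w => (G w).charpoly.coeff k) z := by
  have h1 := AnalyticAt.aeval_mvPolynomial (f := fun w (ij : Fin N × Fin N) => G w ij.1 ij.2)
    (fun ij => h ij.1 ij.2) ((Matrix.charpoly.univ ℂ (Fin N)).coeff k)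
  refine h1.congr (Eventually.of_forall fun w => ?_)
  exact Matrix.charpoly.univ_coeff_eval₂Hom (Fin N) (algebraMap ℂ ℂ)
    (fun ij : Fin N × Fin N => G w ij.1 ij.2) k

/-- The symbol as a function of the complexified quasimomentum. -/
def pSymbol (A : ℤ → Matrix (Fin N) (Fin N) ℂ) (w : ℂ) : Matrix (Fin N) (Fin N) ℂ :=
  cSymbol A (Complex.exp (Complex.I * w))

theorem pSymbol_ofReal (A : ℤ → Matrix (Fin N) (Fin N) ℂ) (p : ℝ) : pSymbol A p = symbol A p :=
  cSymbol_exp A p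

variable {A : ℤ → Matrix (Fin N) (Fin N) ℂ} {C θ s : ℝ}

theorem ExpDecay.mem_annulus (h : ExpDecay A C θ s) {z : ℂ} (hz : ‖z‖ = 1) : z ∈ annulus s :=
  ⟨hz ▸ h.s_lt, hz ▸ (one_lt_inv₀ h.s_pos).mpr h.s_lt⟩

theorem norm_exp_I_mul (w : ℂ) : ‖Complex.exp (Complex.I * w)‖ = Real.exp (-w.im) := by
  rw [Complex.norm_exp]; simp

theorem ExpDecay.analyticAt (h : ExpDecay A C θ s) {z : ℂ} (hz : z ∈ annulus s) (i j : Fin N) :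
    AnalyticAt ℂ (fun z => cSymbol A z i j) z :=
  (h.differentiableOn i j).analyticAt ((isOpen_annulus s).mem_nhds hz)

theorem ExpDecay.analyticAt_pSymbol (h : ExpDecay A C θ s) (p : ℝ) (i j : Fin N) :
    AnalyticAt ℂ (fun w => pSymbol A w i j) p := by
  have h1 : AnalyticAt ℂ (fun w : ℂ => Complex.exp (Complex.I * w)) p := by fun_prop
  exact (h.analyticAt (h.mem_annulus (by simp [norm_exp_I_mul])) i j).comp h1

theorem im_eq_zero_of_isRoot {M : Matrix (Fin N) (Fin N) ℂ} (hM : M.IsHermitian) {x : ℂ}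
    (hx : M.charpoly.IsRoot x) : x.im = 0 := by
  have : x ∈ M.charpoly.roots := (mem_roots M.charpoly_monic.ne_zero).mpr hx
  rw [hM.roots_charpoly_eq_eigenvalues, Multiset.mem_map] at this
  obtain ⟨i, -, rfl⟩ := this
  exact Complex.ofReal_im _

/-- Rellich's theorem applies at real `p` because the symbol is Hermitian on the real axis, so its
characteristic polynomial is real rooted there. -/
theorem exists_analytic_roots (h : ExpDecay A C θ s) (hherm : ∀ m : ℤ, A (-m) = (A m).conjTranspose)
    (p : ℝ) : ∃ F : Fin N → ℂ → ℂ, (∀ j, AnalyticAt ℂ (F j) p) ∧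
      ∀ᶠ w in 𝓝 (p : ℂ), (pSymbol A w).charpoly = ∏ j, (X - Polynomial.C (F j w)) := by
  have hP : AnalyticFamily N fun z => (pSymbol A (z + p)).charpoly := by
    refine ⟨fun z => Matrix.charpoly_monic _, fun z => ?_, fun k => ?_⟩
    · rw [Matrix.charpoly_natDegree_eq_dim, Fintype.card_fin]
    · refine analyticAt_charpoly_coeff (G := fun z => pSymbol A (z + p)) (fun i j => ?_) k
      have h1 : AnalyticAt ℂ (fun z : ℂ => z + p) 0 := by fun_prop
      exact (h.analyticAt_pSymbol p i j).comp_of_eq h1 (zero_add _)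
  obtain ⟨F, hF, hF2⟩ := AnalyticFamily.exists_roots N hP (Eventually.of_forall fun t x hx => by
    rw [← Complex.ofReal_add, pSymbol_ofReal] at hx
    exact im_eq_zero_of_isRoot (isHermitian_symbol hherm _) hx)
  have hsub : Tendsto (fun w : ℂ => w - p) (𝓝 p) (𝓝 0) := by
    have : Continuous fun w : ℂ => w - p := by fun_prop
    simpa using this.tendsto p
  refine ⟨fun j w => F j (w - p), fun j => ?_, ?_⟩
  · have h1 : AnalyticAt ℂ (fun w : ℂ => w - p) p := by fun_prop
    exact (hF j).comp_of_eq h1 (sub_self _)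
  · filter_upwards [hsub.eventually hF2] with w hw
    rwa [sub_add_cancel] at hw

/-- Near `s`, the real analytic functions `f j` list the eigenvalues of `h`. -/
structure RootsNear (h : ℝ → Matrix (Fin N) (Fin N) ℂ) (f : Fin N → ℝ → ℝ) (s : ℝ) : Prop where
  analytic : ∀ j, AnalyticAt ℝ (f j) s
  roots : ∀ᶠ t in 𝓝 s, (h t).charpoly.roots = Finset.univ.val.map fun j => (f j t : ℂ)

theorem RootsNear.eventually {h : ℝ → Matrix (Fin N) (Fin N) ℂ} {f : Fin N → ℝ → ℝ} {s : ℝ}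
    (H : RootsNear h f s) : ∀ᶠ t in 𝓝 s, RootsNear h f t := by
  filter_upwards [eventually_all.mpr fun j => (H.analytic j).eventually_analyticAt,
    eventually_eventually_nhds.mpr H.roots] with t h1 h2 using ⟨h1, h2⟩

theorem RootsNear.congr {h : ℝ → Matrix (Fin N) (Fin N) ℂ} {f g : Fin N → ℝ → ℝ} {s : ℝ}
    (H : RootsNear h f s) (e : ∀ᶠ t in 𝓝 s, ∀ j, f j t = g j t) : RootsNear h g s :=
  ⟨fun j => (H.analytic j).congr (e.mono fun t ht => ht j), by
    filter_upwards [H.roots, e] with t h1 h2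
    simp only [h1, h2]⟩

theorem RootsNear.comp_perm {h : ℝ → Matrix (Fin N) (Fin N) ℂ} {f : Fin N → ℝ → ℝ} {s : ℝ}
    (H : RootsNear h f s) (σ : Equiv.Perm (Fin N)) : RootsNear h (fun j => f (σ j)) s :=
  ⟨fun j => H.analytic (σ j), by
    filter_upwards [H.roots] with t h1
    rw [h1]
    have := Multiset.map_univ_val_equiv σ
    conv_lhs => rw [← this, Multiset.map_map]
    rfl⟩

/-- At every nearby point some permutation matches the two lists. A permutation that does not match
them identically matches at no point of some punctured neighbourhood, by the identity theorem. There
are only finitely many permutations, so one of them matches identically. -/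
theorem RootsNear.exists_perm {h : ℝ → Matrix (Fin N) (Fin N) ℂ} {f g : Fin N → ℝ → ℝ} {s : ℝ}
    (H : RootsNear h f s) (K : RootsNear h g s) :
    ∃ σ : Equiv.Perm (Fin N), ∀ᶠ t in 𝓝 s, ∀ j, f j t = g (σ j) t := by
  have h1 : ∀ᶠ t in 𝓝[≠] s, ∃ σ : Equiv.Perm (Fin N), ∀ j, f j t = g (σ j) t := by
    filter_upwards [(H.roots.and K.roots).filter_mono nhdsWithin_le_nhds] with t ht
    obtain ⟨σ, hσ⟩ := exists_perm_of_map_eq (ht.1.symm.trans ht.2)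
    exact ⟨σ, fun j => by exact_mod_cast hσ j⟩
  by_contra hcon
  push Not at hcon
  have h2 : ∀ σ : Equiv.Perm (Fin N), ∀ᶠ t in 𝓝[≠] s, ¬ ∀ j, f j t = g (σ j) t := fun σ => by
    rw [← not_frequently]
    intro hf
    refine absurd (eventually_all.mpr fun j => ?_) (not_eventually.mpr ((hcon σ).mono fun t ht => by
      push Not; exact ht))
    exact ((H.analytic j).frequently_eq_iff_eventually_eq (K.analytic (σ j))).mp
      (hf.mono fun t ht => ht j)
  obtain ⟨t, ⟨σ, hσ⟩, ht⟩ := (h1.and (eventually_all.mpr h2)).exists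
  exact ht σ hσ

/-- Subdivide the interval so that a local family exists on each piece, and glue successive pieces
after permuting the next family at the common endpoint. -/
theorem exists_rootsNear_Icc {h : ℝ → Matrix (Fin N) (Fin N) ℂ} {a b : ℝ} (hab : a ≤ b)
    (H : ∀ s, ∃ f, RootsNear h f s) : ∃ f, ∀ s ∈ Set.Icc a b, RootsNear h f s := by
  obtain ⟨t, h0, hm, ⟨n, hn⟩, hc⟩ := exists_monotone_Icc_subset_open_cover_Icc hab
    (c := fun f : Fin N → ℝ → ℝ => {u : Set.Icc a b | RootsNear h f u})
    (fun f => isOpen_iff_mem_nhds.mpr fun u hu =>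
      continuous_subtype_val.continuousAt.eventually (RootsNear.eventually hu))
    (fun u _ => Set.mem_iUnion.mpr (H u))
  suffices ∀ n, ∃ f, ∀ u ∈ Set.Icc a (t n : ℝ), RootsNear h f u by
    obtain ⟨f, hf⟩ := this n
    exact ⟨f, fun u hu => hf u ⟨hu.1, hu.2.trans_eq (hn n le_rfl).symm⟩⟩
  intro n
  induction n with
  | zero =>
    obtain ⟨f, hf⟩ := H a
    refine ⟨f, fun u hu => ?_⟩
    rw [h0, Set.Icc_self] at hu
    rwa [Set.mem_singleton_iff.mp hu]
  | succ n ih =>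
    obtain ⟨f, hf⟩ := ih
    obtain ⟨g, hg⟩ := hc n
    have hg' : ∀ u ∈ Set.Icc (t n : ℝ) (t (n + 1)), RootsNear h g u := fun u hu =>
      hg (show (⟨u, (t n).2.1.trans hu.1, hu.2.trans (t (n + 1)).2.2⟩ : Set.Icc a b) ∈
        Set.Icc (t n) (t (n + 1)) from hu)
    obtain ⟨σ, hσ⟩ := (hf (t n) ⟨(t n).2.1, le_rfl⟩).exists_perm
      (hg' (t n) ⟨le_rfl, hm n.le_succ⟩)
    refine ⟨fun j u => if u ≤ t n then f j u else g (σ j) u, fun u hu => ?_⟩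
    rcases lt_trichotomy u (t n) with hlt | heq | hgt
    · refine (hf u ⟨hu.1, hlt.le⟩).congr ?_
      filter_upwards [Iio_mem_nhds hlt] with v hv j
      rw [if_pos (le_of_lt hv)]
    · refine (hf u ⟨hu.1, heq.le⟩).congr ?_
      rw [heq]
      filter_upwards [hσ] with v hv j
      split_ifs
      · rfl
      · exact hv j
    · refine ((hg' u ⟨hgt.le, hu.2⟩).comp_perm σ).congr ?_
      filter_upwards [Ioi_mem_nhds hgt] with v hv j
      rw [if_neg (not_le.mpr hv)]

/-- Existence of the eigenvalue family, together with its local holomorphic extensions. -/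
theorem exists_eigenvalueFamily (h : ExpDecay A C θ s)
    (hherm : ∀ m : ℤ, A (-m) = (A m).conjTranspose) :
    ∃ l : Fin N → ℝ → ℝ, IsEigenvalueFamily (symbol A) l ∧
      ∀ p ∈ Set.Ico (-Real.pi) Real.pi, ∃ F : Fin N → ℂ → ℂ, (∀ j, AnalyticAt ℂ (F j) p) ∧
        (∀ᶠ w in 𝓝 (p : ℂ), (pSymbol A w).charpoly = ∏ j, (X - Polynomial.C (F j w))) ∧
        (∀ᶠ t : ℝ in 𝓝 p, ∀ j, (F j t).im = 0) ∧
        ∃ σ : Equiv.Perm (Fin N), ∀ᶠ t : ℝ in 𝓝[≥] p, ∀ j, (F j t).re = l (σ j) t := by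
  have hloc : ∀ p : ℝ, ∃ F : Fin N → ℂ → ℂ, (∀ j, AnalyticAt ℂ (F j) p) ∧
        (∀ᶠ w in 𝓝 (p : ℂ), (pSymbol A w).charpoly = ∏ j, (X - Polynomial.C (F j w))) ∧
        (∀ᶠ t : ℝ in 𝓝 p, ∀ j, (F j t).im = 0) ∧
        RootsNear (symbol A) (fun j t => (F j t).re) p := by
    intro p
    obtain ⟨F, hF, hF2⟩ := exists_analytic_roots h hherm p
    have hr := Complex.continuous_ofReal.continuousAt.eventually hF2
    have him : ∀ᶠ t : ℝ in 𝓝 p, ∀ j, (F j t).im = 0 := by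
      filter_upwards [hr] with t ht j
      rw [pSymbol_ofReal] at ht
      refine im_eq_zero_of_isRoot (isHermitian_symbol hherm t) ?_
      rw [ht, IsRoot.def, eval_prod]
      exact Finset.prod_eq_zero (Finset.mem_univ j) (by simp)
    refine ⟨F, hF, hF2, him, fun j => (hF j).re_ofReal, ?_⟩
    filter_upwards [hr, him] with t ht ht2
    rw [pSymbol_ofReal] at ht
    have e : ∏ j, (X - Polynomial.C (F j t)) =
        ((Finset.univ.val.map fun j => F j t).map fun a => X - Polynomial.C a).prod := by
      rw [Multiset.map_map]; rfl
    rw [ht, e, roots_multiset_prod_X_sub_C]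
    refine Multiset.map_congr rfl fun j _ => ?_
    exact Complex.ext (by simp) (by simp [ht2 j])
  obtain ⟨f, hf⟩ := exists_rootsNear_Icc (h := symbol A) (a := -Real.pi) (b := Real.pi)
    (by linarith [Real.pi_pos]) fun p => by
      obtain ⟨F, -, -, -, hF⟩ := hloc p
      exact ⟨_, hF⟩
  have hpi : -Real.pi + 2 * Real.pi = Real.pi := by ring
  -- The branches are continued over one period and then extended periodically. They may return
  -- permuted, so the extension can jump at odd multiples of `π`.
  set l : Fin N → ℝ → ℝ := fun j u => f j (toIcoMod Real.two_pi_pos (-Real.pi) u) with hl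
  have hlf : ∀ j, ∀ u ∈ Set.Ico (-Real.pi) Real.pi, l j u = f j u := fun j u hu => by
    simp only [hl]
    rw [(toIcoMod_eq_self Real.two_pi_pos).mpr (hpi.symm ▸ hu)]
  refine ⟨l, ⟨fun j u => ?_, fun j => ?_, fun u => ?_⟩, fun p hp => ?_⟩
  · simp only [hl, toIcoMod_periodic Real.two_pi_pos (-Real.pi) u]
  · refine AnalyticOn.congr (f := f j) (fun u hu => ?_) fun u hu => hlf j u hu
    exact ((hf u ⟨hu.1, hu.2.le⟩).analytic j).analyticWithinAt
  · have hmem := toIcoMod_mem_Ico Real.two_pi_pos (-Real.pi) u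
    rw [hpi] at hmem
    have := (hf _ ⟨hmem.1, hmem.2.le⟩).roots.self_of_nhds
    rw [← self_sub_toIcoDiv_zsmul, (symbol_periodic A).sub_zsmul_eq, self_sub_toIcoDiv_zsmul] at this
    exact this
  -- At `p = -π` the periodic branches agree with a holomorphic family only from the right, hence
  -- the one-sided neighbourhood.
  · obtain ⟨F, h1, h2, h3, h4⟩ := hloc p
    obtain ⟨σ, hσ⟩ := h4.exists_perm (hf p ⟨hp.1, hp.2.le⟩)
    refine ⟨F, h1, h2, h3, σ, ?_⟩
    filter_upwards [hσ.filter_mono nhdsWithin_le_nhds, self_mem_nhdsWithin,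
      (Iio_mem_nhds hp.2 : _ ∈ 𝓝 p) |> mem_nhdsWithin_of_mem_nhds] with t h5 h6 h7 j
    rw [h5 j, hlf _ t ⟨hp.1.trans h6, h7⟩]

end BlockLaurent

end

/-! ### Poles of the resolvent of the symbol away from the critical set -/

section

namespace BlockLaurent

open Polynomial Metric

variable {N : ℕ}

/-- A holomorphic function, real on the real axis, takes a real value `x` close to a regular value
only at real points, and linearly. -/
theorem eventually_linear_zero {F : ℂ → ℂ} {p E : ℝ} (hF : AnalyticAt ℂ F p)
    (hreal : ∀ᶠ t : ℝ in 𝓝 p, (F t).im = 0) (hd : F p = E → (deriv F p).im = 0 ∧ deriv F p ≠ 0) :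
    ∀ᶠ c in 𝓝[>] (0 : ℝ), (∀ w ∈ ball (p : ℂ) c, ContinuousAt F w) ∧ ∀ᶠ x : ℝ in 𝓝 E,
      ∀ w ∈ ball (p : ℂ) c, F w = x →
        w.im = 0 ∧ ∀ w' ∈ ball (p : ℂ) c, c * ‖w' - w‖ ≤ ‖F w' - x‖ := by
  have hcont : ∀ᶠ c in 𝓝[>] (0 : ℝ), ∀ w ∈ ball (p : ℂ) c, ContinuousAt F w := by
    obtain ⟨ε, hε, h⟩ := Metric.eventually_nhds_iff_ball.mp hF.eventually_analyticAt
    filter_upwards [Ioo_mem_nhdsGT hε] with c hc w hw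
    exact (h w (ball_subset_ball hc.2.le hw)).continuousAt
  refine hcont.and ?_
  by_cases hE : F p = E
  · obtain ⟨him, hne⟩ := hd hE
    obtain ⟨d, hd'⟩ : ∃ d : ℝ, deriv F p = d := ⟨(deriv F p).re, Complex.ext rfl (by simpa using him)⟩
    rw [hd'] at hne
    have hd0 : 0 < |d| := abs_pos.mpr (by exact_mod_cast hne)
    have hs : HasStrictDerivAt F (d : ℂ) p := hd' ▸ hF.hasStrictDerivAt
    obtain ⟨S, hS, hS2⟩ := hs.hasStrictFDerivAt.approximates_deriv_on_nhds
      (c := (|d| / 2).toNNReal) (Or.inr (Real.toNNReal_pos.mpr (half_pos hd0)))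
    have happ : ∀ w ∈ S, ∀ w' ∈ S, ‖F w' - F w - d * (w' - w)‖ ≤ |d| / 2 * ‖w' - w‖ :=
      fun w hw w' hw' => by
        have := hS2 w' hw' w hw
        rw [Real.coe_toNNReal _ (half_pos hd0).le] at this
        simpa [mul_comm] using this
    obtain ⟨ε, hε, hεS⟩ := Metric.mem_nhds_iff.mp hS
    obtain ⟨η, hη, hηr⟩ := Metric.eventually_nhds_iff_ball.mp hreal
    filter_upwards [Ioo_mem_nhdsGT hε, Ioo_mem_nhdsGT hη, Ioo_mem_nhdsGT (half_pos hd0)]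
      with c h1 h2 h3
    refine Eventually.of_forall fun x w hw hx => ⟨?_, fun w' hw' => ?_⟩
    -- Compare `w` with its real part: `F` is real at both and is `d` times the identity up to an
    -- error `|d|/2` relative to the distance, so the imaginary part of `w` must vanish.
    · have hre : ((w.re : ℝ) : ℂ) ∈ ball (p : ℂ) c := by
        rw [mem_ball, dist_eq_norm] at hw ⊢
        refine lt_of_le_of_lt ?_ hw
        have := Complex.abs_re_le_norm (w - p)
        rwa [← Complex.ofReal_sub, Complex.norm_real, Real.norm_eq_abs]
      have hreR : w.re ∈ ball p η := by
        rw [mem_ball, dist_eq_norm, ← Complex.ofReal_sub, Complex.norm_real] at hre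
        rw [mem_ball, dist_eq_norm]
        exact hre.trans h2.2
      have h4 := happ _ (hεS (ball_subset_ball h1.2.le hre)) _ (hεS (ball_subset_ball h1.2.le hw))
      have h5 : w - (w.re : ℂ) = w.im * Complex.I := by
        apply Complex.ext <;> simp
      have h6 := (Complex.abs_im_le_norm _).trans h4
      rw [hx, h5] at h6
      simp only [Complex.sub_im, Complex.ofReal_im, hηr _ hreR,
        Complex.im_ofReal_mul, Complex.I_im, norm_mul, Complex.norm_I, Complex.norm_real,
        Real.norm_eq_abs, mul_one, sub_zero, zero_sub, abs_neg, abs_mul] at h6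
      by_contra hcon
      have := mul_pos hd0 (abs_pos.mpr hcon)
      linarith
    · have h4 := happ _ (hεS (ball_subset_ball h1.2.le hw)) _ (hεS (ball_subset_ball h1.2.le hw'))
      have h5 : ‖(d : ℂ) * (w' - w)‖ = |d| * ‖w' - w‖ := by
        rw [norm_mul, Complex.norm_real, Real.norm_eq_abs]
      have h6 := norm_sub_norm_le ((d : ℂ) * (w' - w)) (F w' - F w)
      rw [norm_sub_rev ((d : ℂ) * (w' - w)), h5] at h6
      have h7 : c * ‖w' - w‖ ≤ |d| / 2 * ‖w' - w‖ :=
        mul_le_mul_of_nonneg_right h3.2.le (norm_nonneg _)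
      rw [← hx]
      linarith
  · have hE' : F p - (E : ℂ) ≠ 0 := sub_ne_zero.mpr hE
    have ht : Tendsto (fun q : ℂ × ℝ => F q.1 - (q.2 : ℂ)) (𝓝 (p : ℂ) ×ˢ 𝓝 E) (𝓝 (F p - E)) :=
      (hF.continuousAt.tendsto.comp tendsto_fst).sub
        ((Complex.continuous_ofReal.tendsto E).comp tendsto_snd)
    obtain ⟨u, hu, v, hv, huv⟩ := Filter.eventually_prod_iff.mp (ht.eventually_ne hE')
    obtain ⟨ε, hε, hεu⟩ := Metric.eventually_nhds_iff_ball.mp hu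
    filter_upwards [Ioo_mem_nhdsGT hε] with c hc
    filter_upwards [hv] with x hx w hw hwx
    exact absurd (sub_eq_zero.mpr hwx) (huv (hεu w (ball_subset_ball hc.2.le hw)) hx)

/-- Diagonalization by a unitary. The bound by the inverse distance to the spectrum keeps the
resolvent poles simple even where several branches cross the energy together. -/
theorem norm_resolvent_entry_le {H : Matrix (Fin N) (Fin N) ℂ} (hH : H.IsHermitian) {x : ℝ} {m : ℝ}
    (hm : 0 < m) (h : ∀ μ : ℂ, H.charpoly.IsRoot μ → m ≤ ‖μ - x‖) (i j : Fin N) :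
    ‖(H - Matrix.scalar (Fin N) (x : ℂ))⁻¹ i j‖ ≤ N * m⁻¹ := by
  set U : Matrix (Fin N) (Fin N) ℂ := ↑hH.eigenvectorUnitary with hU
  have hUm : U ∈ Matrix.unitaryGroup (Fin N) ℂ := hH.eigenvectorUnitary.2
  have hU1 : U * star U = 1 := Matrix.mem_unitaryGroup_iff.mp hUm
  have hU2 : star U * U = 1 := Matrix.mem_unitaryGroup_iff'.mp hUm
  have hroot : ∀ k, m ≤ ‖(hH.eigenvalues k : ℂ) - x‖ := fun k => h _ <| by
    have : (hH.eigenvalues k : ℂ) ∈ H.charpoly.roots := by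
      rw [hH.roots_charpoly_eq_eigenvalues]
      exact Multiset.mem_map.mpr ⟨k, Finset.mem_univ k, rfl⟩
    exact (mem_roots H.charpoly_monic.ne_zero).mp this
  have hne : ∀ k, (hH.eigenvalues k : ℂ) - x ≠ 0 := fun k => norm_pos_iff.mp (hm.trans_le (hroot k))
  have hspec : H - Matrix.scalar (Fin N) (x : ℂ) =
      U * Matrix.diagonal (fun k => (hH.eigenvalues k : ℂ) - x) * star U := by
    have h1 : H = U * Matrix.diagonal (fun k => (hH.eigenvalues k : ℂ)) * star U := by
      have := hH.spectral_theorem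
      rw [Unitary.conjStarAlgAut_apply] at this
      exact this
    have h2 : (Matrix.diagonal fun k => (hH.eigenvalues k : ℂ) - x) =
        Matrix.diagonal (fun k => (hH.eigenvalues k : ℂ)) - Matrix.scalar (Fin N) (x : ℂ) := by
      rw [Matrix.scalar_apply, Matrix.diagonal_sub]
    have h3 : U * Matrix.scalar (Fin N) (x : ℂ) * star U = Matrix.scalar (Fin N) (x : ℂ) := by
      rw [← (Matrix.scalar_commute (x : ℂ) (Commute.all _) U).eq, mul_assoc, hU1, mul_one]
    rw [h2, mul_sub, sub_mul, ← h1, h3]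
  have hinv : (H - Matrix.scalar (Fin N) (x : ℂ))⁻¹ =
      U * Matrix.diagonal (fun k => ((hH.eigenvalues k : ℂ) - x)⁻¹) * star U := by
    refine Matrix.inv_eq_right_inv ?_
    rw [hspec]
    have : ∀ D D' : Matrix (Fin N) (Fin N) ℂ, D * D' = 1 →
        U * D * star U * (U * D' * star U) = 1 := fun D D' hD => by
      calc U * D * star U * (U * D' * star U) = U * D * (star U * U) * D' * star U := by
            simp only [mul_assoc]
        _ = 1 := by rw [hU2, mul_one, mul_assoc U, hD, mul_one, hU1]
    refine this _ _ ?_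
    rw [Matrix.diagonal_mul_diagonal, ← Matrix.diagonal_one]
    congr 1
    funext k
    exact mul_inv_cancel₀ (hne k)
  rw [hinv, Matrix.mul_apply]
  simp only [Matrix.mul_diagonal]
  refine (norm_sum_le _ _).trans ((Finset.sum_le_sum fun k _ => ?_).trans_eq
    (b := ∑ _k : Fin N, m⁻¹) (by simp))
  rw [norm_mul, norm_mul, norm_inv, Matrix.star_apply, norm_star]
  have e1 := entry_norm_bound_of_unitary hUm i k
  have e2 := entry_norm_bound_of_unitary hUm j k
  have e3 := inv_anti₀ hm (hroot k)
  have e4 : 0 ≤ ‖(hH.eigenvalues k : ℂ) - x‖⁻¹ := inv_nonneg.mpr (norm_nonneg _)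
  calc _ ≤ 1 * ‖(hH.eigenvalues k : ℂ) - x‖⁻¹ * 1 :=
        mul_le_mul (mul_le_mul_of_nonneg_right e1 e4) e2 (norm_nonneg _) (by positivity)
    _ ≤ m⁻¹ := by simpa using e3

variable {A : ℤ → Matrix (Fin N) (Fin N) ℂ} {C θ s : ℝ}

/-- Near `p` and for energies `x` near `E`, the singular points of the symbol minus `x` are real, in
bounded number, and the resolvent has at most simple poles there, with bounded residues. -/
def RegularOn (A : ℤ → Matrix (Fin N) (Fin N) ℂ) (E : ℝ) (U : Set ℂ) : Prop :=
  ∃ (n : ℕ) (M : ℝ), ∀ᶠ x : ℝ in 𝓝 E,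
    (∀ w ∈ U, (pSymbol A w).charpoly.IsRoot x → w.im = 0 ∧ ∀ i j, ∀ᶠ t : ℝ in 𝓝[≠] w.re,
      |t - w.re| * ‖(symbol A t - Matrix.scalar (Fin N) (x : ℂ))⁻¹ i j‖ ≤ M) ∧
    {w ∈ U | (pSymbol A w).charpoly.IsRoot x}.encard ≤ n

/-- In a small disc each branch takes the value `x` at most once, at a real point, and departs from
it at speed at least `c`. Next to such a point the distance from `x` to the spectrum is at least `c
|t - w|`, giving the bound `N / c`, and at most `N` such points occur. -/
theorem exists_regularOn_nhds (hherm : ∀ m : ℤ, A (-m) = (A m).conjTranspose) {E p : ℝ}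
    {F : Fin N → ℂ → ℂ} (hF : ∀ j, AnalyticAt ℂ (F j) p)
    (hF2 : ∀ᶠ w in 𝓝 (p : ℂ), (pSymbol A w).charpoly = ∏ j, (X - Polynomial.C (F j w)))
    (hreal : ∀ᶠ t : ℝ in 𝓝 p, ∀ j, (F j t).im = 0)
    (hd : ∀ j, F j p = E → (deriv (F j) p).im = 0 ∧ deriv (F j) p ≠ 0) :
    ∃ U : Set ℂ, IsOpen U ∧ (p : ℂ) ∈ U ∧ RegularOn A E U := by
  have h1 := eventually_all.mpr fun j => eventually_linear_zero (hF j)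
    (hreal.mono fun t ht => ht j) (hd j)
  obtain ⟨ε, hε, hεF⟩ := Metric.eventually_nhds_iff_ball.mp hF2
  obtain ⟨c, h1, hc⟩ := (h1.and (Ioo_mem_nhdsGT hε)).exists
  have hc0 : 0 < c := hc.1
  have hroot : ∀ w ∈ ball (p : ℂ) c, ∀ μ : ℂ, (pSymbol A w).charpoly.IsRoot μ ↔ ∃ j, F j w = μ :=
    fun w hw μ => by
      rw [hεF w (ball_subset_ball hc.2.le hw), IsRoot.def, eval_prod, Finset.prod_eq_zero_iff]
      simp [sub_eq_zero, eq_comm]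
  refine ⟨ball p c, isOpen_ball, mem_ball_self hc0, N, N * c⁻¹, ?_⟩
  filter_upwards [eventually_all.mpr fun j => (h1 j).2] with x hx
  refine ⟨fun w hw hwx => ?_, ?_⟩
  · obtain ⟨j₀, hj₀⟩ := (hroot w hw x).mp hwx
    have him := (hx j₀ w hw hj₀).1
    refine ⟨him, fun i j => ?_⟩
    have hwre : ((w.re : ℝ) : ℂ) = w := Complex.ext rfl (by simp [him])
    have hco : Tendsto (fun t : ℝ => (t : ℂ)) (𝓝[≠] w.re) (𝓝 w) := by
      have := Complex.continuous_ofReal.tendsto w.re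
      rw [hwre] at this
      exact this.mono_left nhdsWithin_le_nhds
    have hlow : ∀ᶠ t : ℝ in 𝓝[≠] w.re, ∀ j, c * |t - w.re| ≤ ‖F j t - x‖ := by
      refine eventually_all.mpr fun j => ?_
      by_cases hj : F j w = x
      · filter_upwards [hco.eventually (isOpen_ball.mem_nhds hw)] with t ht
        have := (hx j w hw hj).2 t ht
        rwa [← hwre, ← Complex.ofReal_sub, Complex.norm_real, Real.norm_eq_abs] at this
      · have e1 : Tendsto (fun t : ℝ => c * |t - w.re|) (𝓝[≠] w.re) (𝓝 0) := by
          have : Continuous fun t : ℝ => c * |t - w.re| := by fun_prop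
          have := this.tendsto w.re
          simp only [sub_self, abs_zero, mul_zero] at this
          exact this.mono_left nhdsWithin_le_nhds
        have e2 : Tendsto (fun t : ℝ => ‖F j t - x‖) (𝓝[≠] w.re) (𝓝 ‖F j w - x‖) :=
          ((((h1 j).1 w hw).tendsto.comp hco).sub_const _).norm
        exact (e1.eventually_lt e2 (norm_pos_iff.mpr (sub_ne_zero.mpr hj))).mono fun t => le_of_lt
    filter_upwards [hlow, hco.eventually (isOpen_ball.mem_nhds hw), self_mem_nhdsWithin]
      with t ht htb htne
    have hpos : 0 < |t - w.re| := abs_pos.mpr (sub_ne_zero.mpr htne)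
    have := norm_resolvent_entry_le (isHermitian_symbol hherm t) (mul_pos hc0 hpos)
      (fun μ hμ => by
        rw [← pSymbol_ofReal, hroot _ htb] at hμ
        obtain ⟨k, rfl⟩ := hμ
        exact ht k) i j
    calc _ ≤ |t - w.re| * (N * (c * |t - w.re|)⁻¹) := mul_le_mul_of_nonneg_left this hpos.le
      _ = N * c⁻¹ := by field_simp
  -- Each singular point is labelled by a branch that reaches `x` there. Linear departure makes the
  -- labelling injective; `none` is a default elsewhere.
  · have hch : ∀ w : ℂ, ∃ j : Option (Fin N), w ∈ ball (p : ℂ) c → (pSymbol A w).charpoly.IsRoot x →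
        ∃ k, j = some k ∧ F k w = x := fun w => by
      by_cases h : w ∈ ball (p : ℂ) c ∧ (pSymbol A w).charpoly.IsRoot x
      · obtain ⟨k, hk⟩ := (hroot w h.1 x).mp h.2
        exact ⟨some k, fun _ _ => ⟨k, rfl, hk⟩⟩
      · exact ⟨none, fun h1 h2 => absurd ⟨h1, h2⟩ h⟩
    choose J hJ using hch
    have hmaps : Set.MapsTo J {w ∈ ball (p : ℂ) c | (pSymbol A w).charpoly.IsRoot x}
        (Set.range some) := fun w hw => by
      obtain ⟨k, hk, -⟩ := hJ w hw.1 hw.2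
      exact ⟨k, hk.symm⟩
    have := Set.encard_le_encard_of_injOn hmaps (fun w hw w' hw' h => by
        obtain ⟨k, hk, hk2⟩ := hJ w hw.1 hw.2
        obtain ⟨k', hk', hk2'⟩ := hJ w' hw'.1 hw'.2
        rw [hk, hk', Option.some_inj] at h
        subst h
        have := (hx k w hw.1 hk2).2 w' hw'.1
        rw [hk2', sub_self, norm_zero] at this
        have h0 : ‖w' - w‖ ≤ 0 := by
          by_contra hcon
          exact absurd this (not_le.mpr (mul_pos hc0 (not_le.mp hcon)))
        exact (sub_eq_zero.mp (norm_le_zero_iff.mp h0)).symm)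
    refine this.trans ?_
    rw [← Set.image_univ]
    refine (Set.encard_image_le _ _).trans ?_
    simp

theorem RegularOn.union {E : ℝ} {U U' : Set ℂ} (h : RegularOn A E U) (h' : RegularOn A E U') :
    RegularOn A E (U ∪ U') := by
  obtain ⟨n, M, h⟩ := h
  obtain ⟨n', M', h'⟩ := h'
  refine ⟨n + n', max M M', ?_⟩
  filter_upwards [h, h'] with x hx hx'
  refine ⟨fun w hw hr => ?_, ?_⟩
  · rcases hw with hw | hw
    · exact ⟨(hx.1 w hw hr).1, fun i j => ((hx.1 w hw hr).2 i j).mono fun t ht =>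
        ht.trans (le_max_left _ _)⟩
    · exact ⟨(hx'.1 w hw hr).1, fun i j => ((hx'.1 w hw hr).2 i j).mono fun t ht =>
        ht.trans (le_max_right _ _)⟩
  · have : {w ∈ U ∪ U' | (pSymbol A w).charpoly.IsRoot x} =
        {w ∈ U | (pSymbol A w).charpoly.IsRoot x} ∪ {w ∈ U' | (pSymbol A w).charpoly.IsRoot x} := by
      ext w; simp only [Set.mem_ofPred_eq, Set.mem_union]; tauto
    rw [this, Nat.cast_add]
    exact (Set.encard_union_le _ _).trans (add_le_add hx.2 hx'.2)

theorem exists_regularOn {E : ℝ} {K : Set ℂ}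
    (hK : IsCompact K) (h : ∀ p ∈ K, ∃ U : Set ℂ, IsOpen U ∧ p ∈ U ∧ RegularOn A E U) :
    ∃ U : Set ℂ, IsOpen U ∧ K ⊆ U ∧ RegularOn A E U := by
  refine hK.induction_on (p := fun S => ∃ U : Set ℂ, IsOpen U ∧ S ⊆ U ∧ RegularOn A E U) ?_ ?_ ?_ ?_
  · exact ⟨∅, isOpen_empty, le_rfl, 0, 0, Eventually.of_forall fun x => ⟨by simp, by simp⟩⟩
  · rintro S T hST ⟨U, h1, h2, h3⟩
    exact ⟨U, h1, hST.trans h2, h3⟩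
  · rintro S T ⟨U, h1, h2, h3⟩ ⟨U', h1', h2', h3'⟩
    exact ⟨U ∪ U', h1.union h1', Set.union_subset_union h2 h2', h3.union h3'⟩
  · intro p hp
    obtain ⟨U, h1, h2, h3⟩ := h p hp
    exact ⟨U, mem_nhdsWithin_of_mem_nhds (h1.mem_nhds h2), U, h1, le_rfl, h3⟩

theorem pSymbol_sub_two_pi (A : ℤ → Matrix (Fin N) (Fin N) ℂ) (w : ℂ) :
    pSymbol A (w - 2 * Real.pi) = pSymbol A w := by
  rw [pSymbol, mul_sub, Complex.exp_sub, mul_comm Complex.I (2 * _), Complex.exp_two_pi_mul_I, div_one,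
    pSymbol]

/-- Suppose `F` has derivative zero at `p`. Either `l` is not differentiable there, or its
derivative equals its right derivative, which is that of `F`, namely zero. In both cases the value
is critical. -/
theorem deriv_ne_zero_of_not_critical {F : ℂ → ℂ} {l : ℝ → ℝ} {E p : ℝ} (hF : AnalyticAt ℂ F p)
    (hreal : ∀ᶠ t : ℝ in 𝓝 p, (F t).im = 0) (hl : ∀ᶠ t : ℝ in 𝓝[≥] p, (F t).re = l t)
    (hE : E ∉ criticalValues l) (h : F p = E) : (deriv F p).im = 0 ∧ deriv F p ≠ 0 := by
  have hF' := hF.differentiableAt.hasDerivAt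
  have hlp : l p = E := by
    rw [← hl.self_of_nhdsWithin Set.self_mem_Ici, h, Complex.ofReal_re]
  have him : (deriv F p).im = 0 := by
    have h1 : HasDerivAt (fun t : ℝ => (F t).im) (deriv F p).im p :=
      Complex.imCLM.hasFDerivAt.comp_hasDerivAt p hF'.comp_ofReal
    have h2 : HasDerivAt (fun t : ℝ => (F t).im) 0 p :=
      (hasDerivAt_const p (0 : ℝ)).congr_of_eventuallyEq hreal
    exact h1.unique h2
  refine ⟨him, fun h0 => hE ⟨p, hlp, ?_⟩⟩
  by_contra hcon
  push Not at hcon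
  have h1 := hcon.1.hasDerivAt
  have h2 : HasDerivWithinAt l (deriv F p).re (Set.Ici p) p :=
    hF'.real_of_complex.hasDerivWithinAt.congr_of_eventuallyEq (hl.mono fun t ht => ht.symm)
      (hl.self_of_nhdsWithin Set.self_mem_Ici).symm
  have h3 := (uniqueDiffOn_Ici p p Set.self_mem_Ici).eq_deriv _ h1.hasDerivWithinAt h2
  rw [h0, Complex.zero_re] at h3
  rw [h3] at h1
  exact hcon.2 h1

theorem exists_regularOn_of_notMem_criticalSet (h : ExpDecay A C θ s)
    (hherm : ∀ m : ℤ, A (-m) = (A m).conjTranspose) {E : ℝ} (hE : E ∉ criticalSet (symbol A)) :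
    ∃ U : Set ℂ, IsOpen U ∧ (fun t : ℝ => (t : ℂ)) '' Set.Icc (-Real.pi) Real.pi ⊆ U ∧
      RegularOn A E U := by
  obtain ⟨l, hl, hloc⟩ := exists_eigenvalueFamily h hherm
  refine exists_regularOn (isCompact_Icc.image Complex.continuous_ofReal) ?_
  rintro _ ⟨p, hp, rfl⟩
  have key : ∀ p ∈ Set.Ico (-Real.pi) Real.pi, ∃ F : Fin N → ℂ → ℂ, (∀ j, AnalyticAt ℂ (F j) p) ∧
        (∀ᶠ w in 𝓝 (p : ℂ), (pSymbol A w).charpoly = ∏ j, (X - Polynomial.C (F j w))) ∧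
        (∀ᶠ t : ℝ in 𝓝 p, ∀ j, (F j t).im = 0) ∧
        ∀ j, F j p = E → (deriv (F j) p).im = 0 ∧ deriv (F j) p ≠ 0 := fun p hp => by
    obtain ⟨F, h1, h2, h3, σ, h4⟩ := hloc p hp
    refine ⟨F, h1, h2, h3, fun j => deriv_ne_zero_of_not_critical (l := l (σ j)) (h1 j)
      (h3.mono fun t ht => ht j) (h4.mono fun t ht => ht j) fun hc => hE ⟨l, hl, σ j, hc⟩⟩
  rcases hp.2.lt_or_eq with hlt | rfl
  · obtain ⟨F, h1, h2, h3, h4⟩ := key p ⟨hp.1, hlt⟩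
    exact exists_regularOn_nhds hherm h1 h2 h3 h4
  -- The right endpoint `π` is reduced to `-π` by periodicity of the symbol.
  · obtain ⟨F, h1, h2, h3, h4⟩ := key (-Real.pi) ⟨le_rfl, by linarith [Real.pi_pos]⟩
    have e : (Real.pi : ℂ) - 2 * Real.pi = ((-Real.pi : ℝ) : ℂ) := by push_cast; ring
    have e' : Real.pi - 2 * Real.pi = -Real.pi := by ring
    have c1 : Tendsto (fun w : ℂ => w - 2 * Real.pi) (𝓝 (Real.pi : ℂ)) (𝓝 ((-Real.pi : ℝ) : ℂ)) := by
      rw [← e]; exact (continuous_id.sub continuous_const).tendsto _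
    have c2 : Tendsto (fun w : ℝ => w - 2 * Real.pi) (𝓝 Real.pi) (𝓝 (-Real.pi)) := by
      have : Continuous fun w : ℝ => w - 2 * Real.pi := by fun_prop
      have := this.tendsto Real.pi
      rwa [e'] at this
    refine exists_regularOn_nhds hherm (F := fun j w => F j (w - 2 * Real.pi)) (fun j => ?_) ?_ ?_ ?_
    · exact (h1 j).comp_of_eq (f := fun w : ℂ => w - 2 * Real.pi) (by fun_prop) e
    · filter_upwards [c1.eventually h2] with w hw
      rwa [pSymbol_sub_two_pi] at hw
    · filter_upwards [c2.eventually h3] with t ht j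
      simpa using ht j
    · intro j hj
      rw [deriv_comp_sub_const, e]
      rw [e] at hj
      exact h4 j hj

/-- The resolvent of the symbol. -/
def symRes (A : ℤ → Matrix (Fin N) (Fin N) ℂ) (x : ℝ) (z : ℂ) : Matrix (Fin N) (Fin N) ℂ :=
  (cSymbol A z - Matrix.scalar (Fin N) (x : ℂ))⁻¹

/-- Under `z = e^{iw}` a thin annulus lifts to points near the real segment `[-π, π]`, with real
part `arg z`. Passing from `w` to `z` does not spoil the residue bound, since `|e^{it} - e^{it₀}| ≤
|t - t₀|`. -/
theorem exists_poles (h : ExpDecay A C θ s)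
    (hherm : ∀ m : ℤ, A (-m) = (A m).conjTranspose) {E : ℝ} (hE : E ∉ criticalSet (symbol A)) :
    ∃ ρ : ℝ, 1 < ρ ∧ ρ < s⁻¹ ∧ ∃ (n : ℕ) (M : ℝ), ∀ᶠ x : ℝ in 𝓝 E, ∃ Z : Finset ℂ, Z.card ≤ n ∧
      (∀ ζ ∈ Z, ‖ζ‖ = 1) ∧
      (∀ z : ℂ, ρ⁻¹ ≤ ‖z‖ → ‖z‖ ≤ ρ → (cSymbol A z).charpoly.IsRoot x → z ∈ Z) ∧
      ∀ ζ ∈ Z, ∀ i j, ∃ᶠ z in 𝓝[≠] ζ, ‖(z - ζ) * symRes A x z i j‖ ≤ M := by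
  classical
  obtain ⟨U, hU, hKU, n, M, hR⟩ := exists_regularOn_of_notMem_criticalSet h hherm hE
  obtain ⟨δ, hδ, hδU⟩ := (isCompact_Icc.image Complex.continuous_ofReal).exists_thickening_subset_open
    hU hKU
  have hs1 : 1 < s⁻¹ := (one_lt_inv₀ h.s_pos).mpr h.s_lt
  have hlog : 0 < Real.log s⁻¹ := Real.log_pos hs1
  obtain ⟨τ, hτ0, hτ⟩ := exists_between (lt_min hδ hlog)
  refine ⟨Real.exp τ, Real.one_lt_exp_iff.mpr hτ0, ?_, n, M, ?_⟩
  · rw [← Real.exp_log (one_pos.trans hs1)]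
    exact Real.exp_lt_exp.mpr (hτ.trans_le (min_le_right _ _))
  filter_upwards [hR] with x hx
  have hfin : {w ∈ U | (pSymbol A w).charpoly.IsRoot x}.Finite := Set.finite_of_encard_le_coe hx.2
  have hcard : hfin.toFinset.card ≤ n := by
    have := hx.2
    rw [hfin.encard_eq_coe_toFinset_card] at this
    exact_mod_cast this
  have hmem : ∀ w, w ∈ hfin.toFinset ↔ w ∈ U ∧ (pSymbol A w).charpoly.IsRoot x := fun w => by
    rw [Set.Finite.mem_toFinset]; rfl
  refine ⟨hfin.toFinset.image fun w => Complex.exp (Complex.I * w),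
    Finset.card_image_le.trans hcard, ?_, ?_, ?_⟩
  · intro ζ hζ
    obtain ⟨w, hw, rfl⟩ := Finset.mem_image.mp hζ
    rw [hmem] at hw
    rw [norm_exp_I_mul, (hx.1 w hw.1 hw.2).1, neg_zero, Real.exp_zero]
  · intro z hz1 hz2 hz
    have hz0 : 0 < ‖z‖ := (inv_pos.mpr (Real.exp_pos τ)).trans_le hz1
    have hzne : z ≠ 0 := norm_pos_iff.mp hz0
    have hIw : Complex.I * (-Complex.I * Complex.log z) = Complex.log z := by
      rw [← mul_assoc, mul_neg, Complex.I_mul_I, neg_neg, one_mul]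
    refine Finset.mem_image.mpr ⟨-Complex.I * Complex.log z, ?_, by rw [hIw, Complex.exp_log hzne]⟩
    rw [hmem]
    refine ⟨hδU ?_, by rwa [pSymbol, hIw, Complex.exp_log hzne]⟩
    refine Metric.mem_thickening_iff.mpr ⟨z.arg, ⟨z.arg, ⟨(Complex.neg_pi_lt_arg z).le,
      Complex.arg_le_pi z⟩, rfl⟩, ?_⟩
    have hsub : -Complex.I * Complex.log z - z.arg = -Complex.I * (Real.log ‖z‖ : ℝ) := by
      apply Complex.ext <;> simp [Complex.log_re, Complex.log_im]
    rw [dist_eq_norm, hsub, norm_mul, norm_neg, Complex.norm_I, one_mul, Complex.norm_real,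
      Real.norm_eq_abs]
    refine lt_of_le_of_lt (abs_le.mpr ⟨?_, ?_⟩) (hτ.trans_le (min_le_left _ _))
    · rw [← Real.exp_neg] at hz1
      exact (Real.le_log_iff_exp_le hz0).mpr hz1
    · exact (Real.log_le_iff_le_exp hz0).mpr hz2
  · intro ζ hζ i j
    obtain ⟨w, hw, rfl⟩ := Finset.mem_image.mp hζ
    rw [hmem] at hw
    obtain ⟨him, hb⟩ := hx.1 w hw.1 hw.2
    obtain ⟨t₀, rfl⟩ : ∃ t₀ : ℝ, w = t₀ := ⟨w.re, Complex.ext rfl (by simpa using him)⟩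
    have hd : HasDerivAt (fun t : ℝ => Complex.exp (Complex.I * t))
        (Complex.exp (Complex.I * t₀) * Complex.I) t₀ := by
      have : HasDerivAt (fun w : ℂ => Complex.exp (Complex.I * w))
          (Complex.exp (Complex.I * t₀) * Complex.I) t₀ := by
        simpa using ((hasDerivAt_id (t₀ : ℂ)).const_mul Complex.I).cexp
      exact this.comp_ofReal
    have ht := hd.tendsto_nhdsNE (mul_ne_zero (Complex.exp_ne_zero _) Complex.I_ne_zero)
    -- The bound is only known along the unit circle, where the symbol is Hermitian, so it holds
    -- frequently near `ζ`. Meromorphy later makes this sufficient.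
    refine ht.frequently (Eventually.frequently ?_)
    filter_upwards [hb i j] with t hbt
    rw [Complex.ofReal_re] at hbt
    rw [norm_mul, symRes, cSymbol_exp]
    refine (mul_le_mul_of_nonneg_right ?_ (norm_nonneg _)).trans hbt
    have e : Complex.exp (Complex.I * t) - Complex.exp (Complex.I * t₀) =
        Complex.exp (Complex.I * t₀) * (Complex.exp (Complex.I * (t - t₀ : ℝ)) - 1) := by
      rw [mul_sub, ← Complex.exp_add, mul_one]
      push_cast
      ring_nf
    rw [e, norm_mul, norm_exp_I_mul, Complex.ofReal_im, neg_zero, Real.exp_zero, one_mul]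
    exact Real.norm_exp_I_mul_ofReal_sub_one_le

end BlockLaurent

end

/-! ### Residues, fundamental solutions and the uniform Hardy inequality -/

section

namespace BlockLaurent

open scoped NNReal
open Metric

/-- At a pole the norm would tend to infinity on the whole punctured neighbourhood, which a bound
holding frequently excludes. -/
theorem exists_limit_of_meromorphicAt {φ : ℂ → ℂ} {ζ : ℂ} (hφ : MeromorphicAt φ ζ) {M : ℝ}
    (h : ∃ᶠ z in 𝓝[≠] ζ, ‖φ z‖ ≤ M) : ∃ c, ‖c‖ ≤ M ∧ Tendsto φ (𝓝[≠] ζ) (𝓝 c) := by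
  have h0 : 0 ≤ meromorphicOrderAt φ ζ := by
    by_contra hcon
    have h1 := (tendsto_cobounded_iff_meromorphicOrderAt_neg hφ).mpr (not_le.mp hcon)
    have h2 := (tendsto_norm_atTop_iff_cobounded.mpr h1).eventually_gt_atTop M
    exact h (h2.mono fun z hz => not_le.mpr hz)
  obtain ⟨c, hc⟩ := tendsto_nhds_of_meromorphicOrderAt_nonneg hφ h0
  exact ⟨c, le_of_tendsto_of_frequently hc.norm h, hc⟩

theorem circleIntegral_inv_of_norm_lt {ζ : ℂ} {t : ℝ} (ht : 0 < t) (h : t < ‖ζ‖) :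
    (∮ z in C(0, t), (z - ζ)⁻¹) = 0 := by
  have hne : ∀ z ∈ closedBall (0 : ℂ) t, z - ζ ≠ 0 := fun z hz h0 => by
    rw [sub_eq_zero] at h0
    subst h0
    exact absurd (mem_closedBall_zero_iff.mp hz) (not_le.mpr h)
  refine Complex.circleIntegral_eq_zero_of_differentiable_on_off_countable ht.le Set.countable_empty
    (fun z hz => ?_) fun z hz => ?_
  · exact ((continuousAt_id.sub continuousAt_const).inv₀ (hne z hz)).continuousWithinAt
  · exact (differentiableAt_id.sub (differentiableAt_const _)).inv
      (hne z (ball_subset_closedBall hz.1))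

/-- Residue estimate for functions with simple poles on the unit circle. -/
theorem norm_circleIntegral_sub_le {U : Set ℂ} (hU : IsOpen U) {ρ M : ℝ} (hρ : 1 < ρ)
    (hsub : ∀ z : ℂ, ρ⁻¹ ≤ ‖z‖ → ‖z‖ ≤ ρ → z ∈ U) (Z : Finset ℂ) : (∀ ζ ∈ Z, ‖ζ‖ = 1) →
    ∀ f : ℂ → ℂ, DifferentiableOn ℂ f (U \ Z) →
      (∀ ζ ∈ Z, ∃ c, ‖c‖ ≤ M ∧ Tendsto (fun z => (z - ζ) * f z) (𝓝[≠] ζ) (𝓝 c)) →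
      ‖(∮ z in C(0, ρ), f z) - ∮ z in C(0, ρ⁻¹), f z‖ ≤ Z.card * (2 * Real.pi * M) := by
  classical
  have hρ0 : 0 < ρ := one_pos.trans hρ
  have hρ1 : ρ⁻¹ < 1 := inv_lt_one_of_one_lt₀ hρ
  induction Z using Finset.induction with
  | empty =>
    intro _ f hf _
    rw [Finset.coe_empty, Set.sdiff_empty] at hf
    rw [circleIntegral_eq_of_differentiableOn hU (inv_pos.mpr hρ0) (hρ1.le.trans hρ.le) hsub hf]
    simp
  | insert ζ Z hζ ih =>
    intro hZ f hf hlim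
    obtain ⟨c, hcM, hc⟩ := hlim ζ (Finset.mem_insert_self ζ Z)
    have hζ1 : ‖ζ‖ = 1 := hZ ζ (Finset.mem_insert_self ζ Z)
    have hopen : IsOpen (U \ (Z : Set ℂ)) := hU.sdiff Z.finite_toSet.isClosed
    have hζU : ζ ∈ U \ (Z : Set ℂ) := ⟨hsub ζ (hζ1 ▸ hρ1.le) (hζ1 ▸ hρ.le), hζ⟩
    have hset : (U \ (Z : Set ℂ)) \ {ζ} = U \ ((insert ζ Z : Finset ℂ) : Set ℂ) := by
      rw [Finset.coe_insert, Set.sdiff_sdiff, Set.union_singleton]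
    -- Removing the principal part leaves a removable singularity at `ζ`, and the induction proceeds
    -- with the remaining poles.
    set g : ℂ → ℂ := fun z => f z - c * (z - ζ)⁻¹ with hg
    have hgd : DifferentiableOn ℂ g ((U \ (Z : Set ℂ)) \ {ζ}) := by
      refine (hset ▸ hf).sub (DifferentiableOn.const_mul (fun z hz => ?_) c)
      have : DifferentiableAt ℂ (fun z : ℂ => z - ζ) z := by fun_prop
      exact (this.fun_inv (sub_ne_zero.mpr hz.2)).differentiableWithinAt
    have hgo : (fun z => g z - g ζ) =o[𝓝[≠] ζ] fun z => (z - ζ)⁻¹ := by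
      refine (Asymptotics.isLittleO_iff_tendsto' ?_).mpr ?_
      · filter_upwards [self_mem_nhdsWithin] with z hz h0
        exact absurd (inv_eq_zero.mp h0) (sub_ne_zero.mpr hz)
      · have e1 : Tendsto (fun z : ℂ => (z - ζ) * g ζ) (𝓝[≠] ζ) (𝓝 0) := by
          have : Continuous fun z : ℂ => (z - ζ) * g ζ := by fun_prop
          have := this.tendsto ζ
          simp only [sub_self, zero_mul] at this
          exact this.mono_left nhdsWithin_le_nhds
        have e2 := (hc.sub (tendsto_const_nhds (x := c))).sub e1
        simp only [sub_self] at e2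
        refine e2.congr' ?_
        filter_upwards [self_mem_nhdsWithin] with z hz
        have hz0 : z - ζ ≠ 0 := sub_ne_zero.mpr hz
        rw [div_inv_eq_mul]
        simp only [hg]
        field_simp
    have hgd1 := Complex.differentiableOn_update_limUnder_of_isLittleO (hopen.mem_nhds hζU) hgd hgo
    set f1 := Function.update g ζ ((𝓝[≠] ζ).limUnder g) with hf1
    have hf1g : ∀ z, z ≠ ζ → f1 z = f z - c * (z - ζ)⁻¹ := fun z hz => by
      rw [hf1, Function.update_of_ne hz]
    have key := ih (fun ζ' h => hZ ζ' (Finset.mem_insert_of_mem h)) f1 hgd1 fun ζ' h => by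
      obtain ⟨c', h1, h2⟩ := hlim ζ' (Finset.mem_insert_of_mem h)
      have hne : ζ' ≠ ζ := fun e => hζ (e ▸ h)
      refine ⟨c', h1, ?_⟩
      have e1 : Tendsto (fun z : ℂ => (z - ζ') * (c * (z - ζ)⁻¹)) (𝓝[≠] ζ') (𝓝 0) := by
        have : ContinuousAt (fun z : ℂ => (z - ζ') * (c * (z - ζ)⁻¹)) ζ' :=
          (continuousAt_id.sub continuousAt_const).mul (continuousAt_const.mul
            ((continuousAt_id.sub continuousAt_const).inv₀ (sub_ne_zero.mpr hne)))
        have := this.tendsto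
        simp only [sub_self, zero_mul] at this
        exact this.mono_left nhdsWithin_le_nhds
      have e2 := h2.sub e1
      rw [sub_zero] at e2
      refine e2.congr' ?_
      filter_upwards [mem_nhdsWithin_of_mem_nhds (isOpen_ne.mem_nhds hne)] with z hz
      rw [hf1g z hz, mul_sub]
    have hsph : ∀ t : ℝ, ρ⁻¹ ≤ t → t ≤ ρ → t ≠ 1 → 0 ≤ t →
        (∮ z in C(0, t), f1 z) = (∮ z in C(0, t), f z) - c * ∮ z in C(0, t), (z - ζ)⁻¹ := by
      intro t h1 h2 h3 h4
      have hn : ∀ z ∈ sphere (0 : ℂ) t, ‖z‖ = t := fun z hz => mem_sphere_zero_iff_norm.mp hz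
      have hzζ : ∀ z ∈ sphere (0 : ℂ) t, z ≠ ζ := fun z hz e => h3 (by rw [← hn z hz, e, hζ1])
      have hcf : ContinuousOn f (sphere 0 t) := hf.continuousOn.mono fun z hz =>
        ⟨hsub z (hn z hz ▸ h1) (hn z hz ▸ h2), fun hm => h3 (by rw [← hn z hz, hZ z hm])⟩
      have hci : ContinuousOn (fun z : ℂ => c * (z - ζ)⁻¹) (sphere 0 t) :=
        continuousOn_const.mul ((continuousOn_id.sub continuousOn_const).inv₀ fun z hz =>
          sub_ne_zero.mpr (hzζ z hz))
      rw [← circleIntegral.integral_const_mul, ← circleIntegral.integral_sub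
        (hcf.circleIntegrable h4) (hci.circleIntegrable h4)]
      exact circleIntegral.integral_congr h4 fun z hz => hf1g z (hzζ z hz)
    -- The principal part contributes `2πi c` on the outer circle and nothing on the inner one.
    rw [hsph ρ (hρ1.le.trans hρ.le) le_rfl hρ.ne' hρ0.le,
      hsph ρ⁻¹ le_rfl (hρ1.le.trans hρ.le) hρ1.ne (inv_pos.mpr hρ0).le,
      circleIntegral.integral_sub_inv_of_mem_ball (by simpa [hζ1] using hρ),
      circleIntegral_inv_of_norm_lt (inv_pos.mpr hρ0) (hζ1 ▸ hρ1), mul_zero, sub_zero] at key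
    rw [Finset.card_insert_of_notMem hζ, Nat.cast_succ, add_mul, one_mul]
    have hcn : ‖c * (2 * Real.pi * Complex.I)‖ ≤ 2 * Real.pi * M := by
      simp only [norm_mul, Complex.norm_ofNat, Complex.norm_real, Complex.norm_I, Real.norm_eq_abs,
        abs_of_pos Real.pi_pos, mul_one]
      rw [mul_comm]
      exact mul_le_mul_of_nonneg_left hcM (by positivity)
    refine le_trans ?_ (add_le_add key hcn)
    refine le_trans (le_of_eq ?_) (norm_add_le _ _)
    congr 1
    ring

variable {N : ℕ} {A : ℤ → Matrix (Fin N) (Fin N) ℂ} {C θ s : ℝ}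

theorem analyticAt_det {G : ℂ → Matrix (Fin N) (Fin N) ℂ} {z : ℂ}
    (h : ∀ i j, AnalyticAt ℂ (fun w => G w i j) z) : AnalyticAt ℂ (fun w => (G w).det) z := by
  simp only [Matrix.det_eq_sign_charpoly_coeff]
  exact analyticAt_const.mul (analyticAt_charpoly_coeff h 0)

theorem analyticAt_adjugate {G : ℂ → Matrix (Fin N) (Fin N) ℂ} {z : ℂ}
    (h : ∀ i j, AnalyticAt ℂ (fun w => G w i j) z) (i j : Fin N) :
    AnalyticAt ℂ (fun w => (G w).adjugate i j) z := by
  simp only [Matrix.adjugate_apply]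
  refine analyticAt_det fun k l => ?_
  by_cases hk : k = j
  · subst hk
    simp only [Matrix.updateRow_self]
    exact analyticAt_const
  · simp only [Matrix.updateRow_ne hk]
    exact h k l

theorem symRes_apply (A : ℤ → Matrix (Fin N) (Fin N) ℂ) (x : ℝ) (z : ℂ) (i j : Fin N) :
    symRes A x z i j = ((cSymbol A z - Matrix.scalar (Fin N) (x : ℂ)).det)⁻¹ *
      (cSymbol A z - Matrix.scalar (Fin N) (x : ℂ)).adjugate i j := by
  rw [symRes, Matrix.inv_def, Matrix.smul_apply, Ring.inverse_eq_inv', smul_eq_mul]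

theorem ExpDecay.analyticAt_sub (h : ExpDecay A C θ s) (x : ℝ) {z : ℂ} (hz : z ∈ annulus s)
    (i j : Fin N) :
    AnalyticAt ℂ (fun z => (cSymbol A z - Matrix.scalar (Fin N) (x : ℂ)) i j) z := by
  simp only [Matrix.sub_apply]
  exact (h.analyticAt hz i j).sub analyticAt_const

theorem ExpDecay.meromorphicAt (h : ExpDecay A C θ s) (x : ℝ) {z : ℂ} (hz : z ∈ annulus s)
    (i j : Fin N) : MeromorphicAt (fun z => symRes A x z i j) z := by
  simp only [symRes_apply]
  exact (analyticAt_det (h.analyticAt_sub x hz)).meromorphicAt.inv.mul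
    (analyticAt_adjugate (h.analyticAt_sub x hz) i j).meromorphicAt

theorem det_ne_zero_of_not_isRoot {M : Matrix (Fin N) (Fin N) ℂ} {x : ℂ} (h : ¬ M.charpoly.IsRoot x) :
    (M - Matrix.scalar (Fin N) x).det ≠ 0 := fun h0 => h <| by
  rw [Polynomial.IsRoot.def, Matrix.eval_charpoly, ← neg_sub, Matrix.det_neg, h0, mul_zero]

theorem ExpDecay.differentiableAt_symRes (h : ExpDecay A C θ s) {x : ℝ} {z : ℂ} (hz : z ∈ annulus s)
    (hx : ¬ (cSymbol A z).charpoly.IsRoot x) (i j : Fin N) :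
    DifferentiableAt ℂ (fun z => symRes A x z i j) z := by
  simp only [symRes_apply]
  exact ((analyticAt_det (h.analyticAt_sub x hz)).differentiableAt.inv
    (det_ne_zero_of_not_isRoot hx)).mul (analyticAt_adjugate (h.analyticAt_sub x hz) i j).differentiableAt

theorem ExpDecay.exists_bound_symRes (h : ExpDecay A C θ s) {t E δ : ℝ} (h1 : s < t) (h2 : t < s⁻¹)
    (hx : ∀ x : ℝ, |x - E| ≤ δ → ∀ z : ℂ, ‖z‖ = t → ¬ (cSymbol A z).charpoly.IsRoot x) :
    ∃ B : ℝ, ∀ x : ℝ, |x - E| ≤ δ → ∀ z : ℂ, ‖z‖ = t → ∀ i j, ‖symRes A x z i j‖ ≤ B := by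
  have hK : IsCompact (closedBall E δ ×ˢ sphere (0 : ℂ) t) :=
    (isCompact_closedBall E δ).prod (isCompact_sphere 0 t)
  have hmem : ∀ q ∈ closedBall E δ ×ˢ sphere (0 : ℂ) t, |q.1 - E| ≤ δ ∧ ‖q.2‖ = t := fun q hq =>
    ⟨mem_closedBall.mp hq.1, mem_sphere_zero_iff_norm.mp hq.2⟩
  have hc : ContinuousOn (fun q : ℝ × ℂ => cSymbol A q.2 - Matrix.scalar (Fin N) (q.1 : ℂ))
      (closedBall E δ ×ˢ sphere (0 : ℂ) t) := by
    refine ContinuousOn.sub ?_ ?_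
    · refine continuousOn_pi.mpr fun i => continuousOn_pi.mpr fun j => ?_
      refine ((h.differentiableOn i j).continuousOn.comp continuousOn_snd fun q hq => ?_)
      have := (hmem q hq).2
      exact ⟨this ▸ h1, this ▸ h2⟩
    · refine Continuous.continuousOn ?_
      simp only [Matrix.scalar_apply]
      exact Continuous.matrix_diagonal (by fun_prop)
  have hb : ∀ ij : Fin N × Fin N, ∃ B : ℝ, ∀ q ∈ closedBall E δ ×ˢ sphere (0 : ℂ) t,
      ‖symRes A q.1 q.2 ij.1 ij.2‖ ≤ B := fun ij => by
    refine hK.exists_bound_of_continuousOn ?_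
    simp only [symRes_apply]
    refine ContinuousOn.mul (ContinuousOn.inv₀ ?_ fun q hq => ?_) ?_
    · exact continuous_id.matrix_det.comp_continuousOn hc
    · exact det_ne_zero_of_not_isRoot (hx _ (hmem q hq).1 _ (hmem q hq).2)
    · exact (continuous_id.matrix_adjugate.matrix_elem ij.1 ij.2).comp_continuousOn hc
  choose B hB using hb
  obtain ⟨B', hB'⟩ := (Set.finite_range B).bddAbove
  exact ⟨B', fun x hx' z hz i j => (hB (i, j) (x, z) ⟨mem_closedBall.mpr hx',
    mem_sphere_zero_iff_norm.mpr hz⟩).trans (hB' ⟨_, rfl⟩)⟩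

/-- The Laurent coefficients of the resolvent of the symbol on the circle `|z| = t`. -/
def resCoeff (A : ℤ → Matrix (Fin N) (Fin N) ℂ) (x t : ℝ) (k : ℤ) : Matrix (Fin N) (Fin N) ℂ :=
  Matrix.of fun i j => (2 * Real.pi * Complex.I)⁻¹ * ∮ z in C(0, t), z ^ (-k - 1) * symRes A x z i j

theorem norm_resCoeff_le {x t B : ℝ} (ht : 0 < t) {i j : Fin N}
    (hB : ∀ z : ℂ, ‖z‖ = t → ‖symRes A x z i j‖ ≤ B) (k : ℤ) :
    ‖resCoeff A x t k i j‖ ≤ B * t ^ (-k) := by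
  have := circleIntegral.norm_two_pi_i_inv_smul_integral_le_of_norm_le_const
    (f := fun z => z ^ (-k - 1) * symRes A x z i j) (c := 0) (R := t) (C := t ^ (-k - 1) * B) ht.le
    fun z hz => by
      rw [mem_sphere_zero_iff_norm] at hz
      rw [norm_mul, norm_zpow, hz]
      exact mul_le_mul_of_nonneg_left (hB z hz) (by positivity)
  rw [smul_eq_mul] at this
  rw [resCoeff, Matrix.of_apply]
  refine this.trans_eq ?_
  rw [zpow_sub_one₀ ht.ne']
  field_simp

/-- Comparison of Laurent coefficients on the circle in `R(z) h(z) = 1 + x R(z)`, where `R` is the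
resolvent of the symbol `h`. -/
theorem ExpDecay.hasSum_resCoeff_mul (h : ExpDecay A C θ s) {x t : ℝ} (h1 : s < t) (h2 : t < s⁻¹)
    (hx : ∀ z : ℂ, ‖z‖ = t → ¬ (cSymbol A z).charpoly.IsRoot x) (k : ℤ) :
    HasSum (fun m => resCoeff A x t (k - m) * A m)
      ((x : ℂ) • resCoeff A x t k + if k = 0 then 1 else 0) := by
  have ht : 0 < t := h.s_pos.trans h1
  have hann : ∀ z ∈ sphere (0 : ℂ) t, z ∈ annulus s := fun z hz => by
    rw [mem_sphere_zero_iff_norm] at hz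
    exact ⟨hz ▸ h1, hz ▸ h2⟩
  have hz0 : ∀ z ∈ sphere (0 : ℂ) t, z ≠ 0 := fun z hz =>
    norm_pos_iff.mp (by rw [mem_sphere_zero_iff_norm.mp hz]; exact ht)
  have hcz : ∀ n : ℤ, ContinuousOn (fun z : ℂ => z ^ n) (sphere 0 t) := fun n =>
    continuousOn_id.zpow₀ n fun z hz => Or.inl (hz0 z hz)
  have hcR : ∀ i j, ContinuousOn (fun z => symRes A x z i j) (sphere 0 t) := fun i j z hz =>
    (h.differentiableAt_symRes (hann z hz) (hx z (mem_sphere_zero_iff_norm.mp hz))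
      i j).continuousAt.continuousWithinAt
  have hcG : ∀ i j, ContinuousOn (fun z => cSymbol A z i j) (sphere 0 t) := fun i j =>
    (h.differentiableOn i j).continuousOn.mono hann
  refine Pi.hasSum.mpr fun i => Pi.hasSum.mpr fun j => ?_
  have hl : ∀ l, HasSum (fun m : ℤ => (2 * Real.pi * Complex.I)⁻¹ *
      ∮ z in C(0, t), (z ^ (-k - 1) * symRes A x z i l) * (A m l j * z ^ m))
      ((2 * Real.pi * Complex.I)⁻¹ *
        ∮ z in C(0, t), (z ^ (-k - 1) * symRes A x z i l) * cSymbol A z l j) := fun l => by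
    refine HasSum.mul_left _ ?_
    have hcφ := (hcz (-k - 1)).mul (hcR i l)
    obtain ⟨B, hB⟩ := (isCompact_sphere (0 : ℂ) t).exists_bound_of_continuousOn hcφ
    refine hasSum_circleIntegral ht.le (h.summable.mul_left |B|) (fun m => ?_) (fun m z hz => ?_)
      fun z hz => ?_
    · exact hcφ.mul (continuousOn_const.mul (hcz m))
    · rw [norm_mul]
      exact mul_le_mul ((hB z hz).trans (le_abs_self B)) (h.norm_term_le (hann z hz).1.le
        (hann z hz).2.le m l j) (norm_nonneg _) (abs_nonneg B)
    · exact (h.hasSum (hann z hz).1.le (hann z hz).2.le l j).mul_left _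
  have hs := hasSum_sum (s := Finset.univ) fun l _ => hl l
  convert hs using 1
  · funext m
    rw [Matrix.mul_apply]
    refine Finset.sum_congr rfl fun l _ => ?_
    rw [resCoeff, Matrix.of_apply, mul_assoc, mul_comm _ (A m l j),
      ← circleIntegral.integral_const_mul]
    congr 1
    refine circleIntegral.integral_congr ht.le fun z hz => ?_
    rw [show -(k - m) - 1 = (-k - 1) + m by ring, zpow_add₀ (hz0 z hz)]
    ring
  · have hint : ∀ l ∈ Finset.univ, CircleIntegrable
        (fun z => z ^ (-k - 1) * symRes A x z i l * cSymbol A z l j) 0 t := fun l _ =>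
      (((hcz (-k - 1)).mul (hcR i l)).mul (hcG l j)).circleIntegrable ht.le
    have hint1 : CircleIntegrable
        (fun z => z ^ (-k - 1) * (1 : Matrix (Fin N) (Fin N) ℂ) i j) 0 t :=
      ((hcz (-k - 1)).mul continuousOn_const).circleIntegrable ht.le
    have hint2 : CircleIntegrable (fun z => (x : ℂ) * (z ^ (-k - 1) * symRes A x z i j)) 0 t :=
      (continuousOn_const.mul ((hcz (-k - 1)).mul (hcR i j))).circleIntegrable ht.le
    rw [← Finset.mul_sum, ← circleIntegral.integral_fun_sum hint]
    have hRG : ∀ z ∈ sphere (0 : ℂ) t, ∑ l, z ^ (-k - 1) * symRes A x z i l * cSymbol A z l j =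
        z ^ (-k - 1) * (1 : Matrix (Fin N) (Fin N) ℂ) i j +
          x * (z ^ (-k - 1) * symRes A x z i j) := fun z hz => by
      have hdet : IsUnit (cSymbol A z - Matrix.scalar (Fin N) (x : ℂ)).det :=
        (det_ne_zero_of_not_isRoot (hx z (mem_sphere_zero_iff_norm.mp hz))).isUnit
      have e1 : symRes A x z * (cSymbol A z - Matrix.scalar (Fin N) (x : ℂ)) = 1 :=
        Matrix.nonsing_inv_mul _ hdet
      have e2 : symRes A x z * cSymbol A z = 1 + (x : ℂ) • symRes A x z := by
        rw [mul_sub, sub_eq_iff_eq_add] at e1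
        rw [e1, ← (Matrix.scalar_commute (x : ℂ) (Commute.all _) (symRes A x z)).eq,
          Matrix.scalar_apply, ← Matrix.smul_eq_diagonal_mul]
      have e3 := congrFun (congrFun e2 i) j
      rw [Matrix.mul_apply, Matrix.add_apply, Matrix.smul_apply, smul_eq_mul] at e3
      calc _ = z ^ (-k - 1) * ∑ l, symRes A x z i l * cSymbol A z l j := by
            rw [Finset.mul_sum]
            exact Finset.sum_congr rfl fun l _ => mul_assoc _ _ _
        _ = _ := by rw [e3]; ring
    rw [circleIntegral.integral_congr ht.le hRG, circleIntegral.integral_add hint1 hint2,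
      circleIntegral.integral_const_mul]
    have e4 : (∮ z in C(0, t), z ^ (-k - 1) * (1 : Matrix (Fin N) (Fin N) ℂ) i j) =
        (if k = 0 then 2 * Real.pi * Complex.I else 0) * (1 : Matrix (Fin N) (Fin N) ℂ) i j := by
      simp_rw [mul_comm _ ((1 : Matrix (Fin N) (Fin N) ℂ) i j)]
      rw [circleIntegral.integral_const_mul, circleIntegral_zpow _ ht]
      have : (-k - 1 = -1) ↔ k = 0 := by omega
      simp only [this]
    rw [e4, Matrix.add_apply, Matrix.smul_apply, smul_eq_mul, resCoeff, Matrix.of_apply, mul_add]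
    split_ifs
    · rw [inv_mul_cancel_left₀ Complex.two_pi_I_ne_zero]; ring
    · rw [Matrix.zero_apply]; ring

theorem continuous_matOp : Continuous (matOp : Matrix (Fin N) (Fin N) ℂ → _) :=
  LinearMap.continuous_of_finiteDimensional
    ((Matrix.toEuclideanCLM (n := Fin N) (𝕜 := ℂ)).toAlgEquiv.toLinearMap)

theorem enorm_le_of_norm_le {E : Type*} [NormedAddCommGroup E] {v : E} {c : ℝ≥0} (h : ‖v‖ ≤ c) :
    ‖v‖ₑ ≤ c := by
  rw [enorm_eq_nnnorm, ENNReal.coe_le_coe]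
  exact h

theorem isHalfKernel_resCoeff (h : ExpDecay A C θ s) {x t : ℝ} (h1 : s < t) (h2 : t < s⁻¹)
    (hx : ∀ z : ℂ, ‖z‖ = t → ¬ (cSymbol A z).charpoly.IsRoot x) {B q : ℝ≥0} {P : Set ℤ}
    (hb : ∀ k i j, ‖resCoeff A x t k i j‖ ≤ B)
    (hd : ∀ k ∈ P, ∀ i j, ‖resCoeff A x t k i j‖ ≤ B * q ^ k.natAbs) :
    IsHalfKernel (fun m => matOp (A m)) x (N ^ 2 * B) q P (fun k => matOp (resCoeff A x t k)) := by
  refine ⟨fun k => ?_, fun k hk => ?_, fun k => ?_⟩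
  · refine enorm_le_of_norm_le ((norm_matOp_le _ (hb k)).trans_eq ?_)
    push_cast; ring
  · have : ‖matOp (resCoeff A x t k)‖ ≤ ((N ^ 2 * B * q ^ k.natAbs : ℝ≥0) : ℝ) := by
      refine (norm_matOp_le _ (hd k hk)).trans_eq ?_
      push_cast; ring
    exact_mod_cast enorm_le_of_norm_le this
  · have := (h.hasSum_resCoeff_mul h1 h2 hx k).map
      (Matrix.toEuclideanCLM (n := Fin N) (𝕜 := ℂ)) continuous_matOp
    convert this using 1
    · funext m
      simp only [Function.comp, map_mul]
      rfl
    · rw [map_add, map_smul]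
      congr 1
      split_ifs
      · rw [map_one]
      · rw [map_zero]

/-- The coefficients on `|z| = ρ` decay for `k ≥ 0`, those on `|z| = ρ⁻¹` for `k ≤ 0`. Their
difference is a sum of boundedly many bounded residues, so each family is bounded on its other side
by the decay of its partner. All constants are uniform for `x` near `E`. -/
theorem exists_hardyBound (h : ExpDecay A C θ s)
    (hherm : ∀ m : ℤ, A (-m) = (A m).conjTranspose) {E : ℝ} (hE : E ∉ criticalSet (symbol A)) :
    ∃ δ : ℝ, 0 < δ ∧ ∃ C', HardyBound (fun m => matOp (A m)) E δ C' := by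
  obtain ⟨ρ₀, hρ₀, hρs, n, M, hZ⟩ := exists_poles h hherm hE
  obtain ⟨ε, hε, hZ⟩ := Metric.eventually_nhds_iff_ball.mp hZ
  -- A radius strictly below `ρ₀` puts both circles inside the open annulus where all poles are
  -- known.
  obtain ⟨ρ, hρ, hρρ⟩ := exists_between hρ₀
  have hρ0 : 0 < ρ := one_pos.trans hρ
  have hρ1 : ρ⁻¹ < 1 := inv_lt_one_of_one_lt₀ hρ
  have hρi : 0 < ρ⁻¹ := inv_pos.mpr hρ0
  have hii : ρ₀⁻¹ < ρ⁻¹ := inv_strictAnti₀ hρ0 hρρ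
  have hsi : s < ρ₀⁻¹ := (lt_inv_comm₀ (one_pos.trans hρ₀) h.s_pos).mp hρs
  have hZ' : ∀ x : ℝ, |x - E| ≤ ε / 2 → x ∈ ball E ε := fun x hx => by
    rw [mem_ball, Real.dist_eq]; linarith
  have hnr : ∀ t : ℝ, ρ₀⁻¹ ≤ t → t ≤ ρ₀ → t ≠ 1 → ∀ x : ℝ, |x - E| ≤ ε / 2 → ∀ z : ℂ, ‖z‖ = t →
      ¬ (cSymbol A z).charpoly.IsRoot x := fun t h1 h2 h3 x hx z hz hr => by
    obtain ⟨Z, -, hZ1, hZ2, -⟩ := hZ x (hZ' x hx)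
    exact h3 (by rw [← hz, hZ1 z (hZ2 z (hz ▸ h1) (hz ▸ h2) hr)])
  have hnr1 := hnr ρ (hii.le.trans (hρ1.le.trans hρ.le)) hρρ.le hρ.ne'
  have hnr2 := hnr ρ⁻¹ hii.le (hρ1.le.trans hρ₀.le) hρ1.ne
  have a1 : s < ρ := hsi.trans (hii.trans (hρ1.trans hρ))
  have a2 : ρ < s⁻¹ := hρρ.trans hρs
  have a3 : s < ρ⁻¹ := hsi.trans hii
  have a4 : ρ⁻¹ < s⁻¹ := hρ1.trans (hρ.trans a2)
  obtain ⟨B₁, hB₁⟩ := h.exists_bound_symRes a1 a2 hnr1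
  obtain ⟨B₂, hB₂⟩ := h.exists_bound_symRes a3 a4 hnr2
  set B : ℝ := max |B₁| |B₂| with hBdef
  have hB0 : 0 ≤ B := (abs_nonneg _).trans (le_max_left _ _)
  set Q : ℝ≥0 := ⟨ρ⁻¹, hρi.le⟩ with hQ
  set D : ℝ≥0 := ⟨B + n * |M|, by positivity⟩ with hD
  have hBD : B ≤ D := le_add_of_nonneg_right (by positivity)
  refine ⟨ε / 2, half_pos hε, hardyBound_of_halfKernels (C := N ^ 2 * D) (q := Q)
    (NNReal.coe_pos.mp hρi) (NNReal.coe_lt_coe.mp hρ1) fun x hx => ?_⟩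
  obtain ⟨Z, hZn, hZ1, hZ2, hZ3⟩ := hZ x (hZ' x hx)
  have hplus : ∀ k ∈ Set.Ici (0 : ℤ), ∀ i j, ‖resCoeff A x ρ k i j‖ ≤ B * ρ⁻¹ ^ k.natAbs :=
    fun k hk i j => by
      refine (norm_resCoeff_le hρ0 (fun z hz => (hB₁ x hx z hz i j).trans
        ((le_abs_self _).trans (le_max_left _ |B₂|))) k).trans_eq ?_
      obtain ⟨m, rfl⟩ : ∃ m : ℕ, k = m := ⟨k.natAbs, by simp only [Set.mem_Ici] at hk; omega⟩
      simp [hBdef]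
  have hminus : ∀ k ∈ Set.Iic (0 : ℤ), ∀ i j, ‖resCoeff A x ρ⁻¹ k i j‖ ≤ B * ρ⁻¹ ^ k.natAbs :=
    fun k hk i j => by
      refine (norm_resCoeff_le hρi (fun z hz => (hB₂ x hx z hz i j).trans
        ((le_abs_self _).trans (le_max_right |B₁| _))) k).trans_eq ?_
      obtain ⟨m, rfl⟩ : ∃ m : ℕ, k = -m := ⟨k.natAbs, by simp only [Set.mem_Iic] at hk; omega⟩
      simp [hBdef]
  have hpow : ∀ k : ℤ, B * ρ⁻¹ ^ k.natAbs ≤ B := fun k =>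
    mul_le_of_le_one_right hB0 (pow_le_one₀ hρi.le hρ1.le)
  -- The factor `z^(-k-1)` has modulus one at the poles, so the residue bound does not depend on
  -- `k`.
  have hdiff : ∀ k i j, ‖resCoeff A x ρ k i j - resCoeff A x ρ⁻¹ k i j‖ ≤ n * |M| := fun k i j => by
    have hann : ∀ z ∈ annulus ρ₀⁻¹, z ∈ annulus s := fun z hz =>
      ⟨hsi.trans hz.1, hz.2.trans (by rwa [inv_inv])⟩
    have hz0 : ∀ z ∈ annulus s, z ≠ 0 := fun z hz => norm_pos_iff.mp (h.s_pos.trans hz.1)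
    have hres := norm_circleIntegral_sub_le (M := |M|) (isOpen_annulus ρ₀⁻¹) hρ
      (fun z ha hb => ⟨hii.trans_le ha, hb.trans_lt (by rwa [inv_inv])⟩) Z hZ1
      (fun z => z ^ (-k - 1) * symRes A x z i j) (fun z hz => ?_) fun ζ hζ => ?_
    · simp only [resCoeff, Matrix.of_apply]
      rw [← mul_sub, norm_mul]
      have hn : ‖(2 * Real.pi * Complex.I : ℂ)⁻¹‖ = (2 * Real.pi)⁻¹ := by
        simp [abs_of_pos Real.pi_pos]
      rw [hn, inv_mul_le_iff₀ Real.two_pi_pos]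
      refine hres.trans ?_
      rw [mul_left_comm]
      refine mul_le_mul_of_nonneg_left ?_ Real.two_pi_pos.le
      exact mul_le_mul_of_nonneg_right (by exact_mod_cast hZn) (abs_nonneg M)
    · refine DifferentiableAt.differentiableWithinAt (DifferentiableAt.mul
        (differentiableAt_zpow.mpr (Or.inl (hz0 z (hann z hz.1))))
        (h.differentiableAt_symRes (hann z hz.1) (fun hr => hz.2 (hZ2 z hz.1.1.le ?_ hr)) i j))
      have := hz.1.2
      rw [inv_inv] at this
      exact this.le
    · have hζs : ζ ∈ annulus s := h.mem_annulus (hZ1 ζ hζ)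
      have hmero : MeromorphicAt (fun z => (z - ζ) * symRes A x z i j) ζ := by
        have : AnalyticAt ℂ (fun z : ℂ => z - ζ) ζ := by fun_prop
        exact this.meromorphicAt.mul (h.meromorphicAt x hζs i j)
      obtain ⟨c, hc1, hc2⟩ := exists_limit_of_meromorphicAt hmero (hZ3 ζ hζ i j)
      refine ⟨ζ ^ (-k - 1) * c, ?_, ?_⟩
      · rw [norm_mul, norm_zpow, hZ1 ζ hζ, one_zpow, one_mul]
        exact hc1.trans (le_abs_self M)
      · have hzp : Tendsto (fun z : ℂ => z ^ (-k - 1)) (𝓝[≠] ζ) (𝓝 (ζ ^ (-k - 1))) :=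
          ((continuousAt_zpow₀ ζ _ (Or.inl (hz0 ζ hζs))).tendsto).mono_left nhdsWithin_le_nhds
        exact (hzp.mul hc2).congr fun z => by ring
  refine ⟨_, _, isHalfKernel_resCoeff h a1 a2 (hnr1 x hx) (B := D) (q := Q) (fun k i j => ?_)
    (fun k hk i j => ?_), isHalfKernel_resCoeff h a3 a4 (hnr2 x hx) (B := D) (q := Q)
    (fun k i j => ?_) (fun k hk i j => ?_)⟩
  · rcases le_total 0 k with hk | hk
    · exact ((hplus k hk i j).trans (hpow k)).trans hBD
    · have e1 := norm_le_norm_add_norm_sub (resCoeff A x ρ⁻¹ k i j) (resCoeff A x ρ k i j)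
      have e2 := (hminus k hk i j).trans (hpow k)
      have e3 := hdiff k i j
      have e4 := norm_sub_rev (resCoeff A x ρ k i j) (resCoeff A x ρ⁻¹ k i j)
      change _ ≤ B + n * |M|
      linarith
  · exact (hplus k hk i j).trans (mul_le_mul_of_nonneg_right hBD (by positivity))
  · rcases le_total 0 k with hk | hk
    · have e1 := norm_le_norm_add_norm_sub (resCoeff A x ρ k i j) (resCoeff A x ρ⁻¹ k i j)
      have e2 := (hplus k hk i j).trans (hpow k)
      have e3 := hdiff k i j
      have e4 := norm_sub_rev (resCoeff A x ρ k i j) (resCoeff A x ρ⁻¹ k i j)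
      change _ ≤ B + n * |M|
      linarith
    · exact ((hminus k hk i j).trans (hpow k)).trans hBD
  · exact (hminus k hk i j).trans (mul_le_mul_of_nonneg_right hBD (by positivity))

end BlockLaurent

end

/-! ### Conclusion: finite multiplicity and isolation outside the critical set -/

section

namespace BlockLaurent

open scoped NNReal

variable {N : ℕ}

/-- Outside the critical set, eigenvalues have finite multiplicity and do not accumulate. -/
theorem finite_and_isolated_of_notMem_criticalSet {A : ℤ → Matrix (Fin N) (Fin N) ℂ}
    (hsum : Summable fun m : ℤ => ‖matOp (A m)‖)
    (hherm : ∀ m : ℤ, A (-m) = (A m).conjTranspose) (hhol : HolomorphicSymbol A) (ξ : Cutoff)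
    {V : Hilb N →L[ℂ] Hilb N} (hV : (V : Hilb N →ₗ[ℂ] Hilb N).IsSymmetric)
    (hdecay : Tendsto (fun r : ℝ => r * ‖(ξ.op N r).comp V‖) atTop (𝓝 0))
    {E : ℝ} (hE : E ∉ criticalSet (symbol A)) :
    FiniteDimensional ℂ (Module.End.eigenspace
      ((laurent A + V : Hilb N →L[ℂ] Hilb N) : Hilb N →ₗ[ℂ] Hilb N) (E : ℂ)) ∧
    ∃ δ : ℝ, 0 < δ ∧ ∀ l : ℝ, l ≠ 0 → |l| < δ → E + l ∉ pointSpectrum (laurent A + V) := by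
  obtain ⟨C, θ, s, h⟩ := exists_expDecay hsum hhol
  have hq0 : 0 < θ * s := mul_pos h.theta_pos h.s_pos
  have hq1 : θ * s < 1 := (mul_lt_of_lt_one_right h.theta_pos h.s_lt).trans h.theta_lt
  have hmom : mom (fun m => matOp (A m)) ≠ ⊤ := by
    refine mom_ne_top (C := ⟨N ^ 2 * C, mul_nonneg (by positivity) h.C_nonneg⟩)
      (q := ⟨θ * s, hq0.le⟩) (NNReal.coe_pos.mp hq0) (NNReal.coe_lt_coe.mp hq1) fun m => ?_
    refine (norm_matOp_le _ fun i j => h.bound m i j).trans_eq ?_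
    change _ = N ^ 2 * C * (θ * s) ^ m.natAbs
    ring
  obtain ⟨δ, hδ, C', hH⟩ := exists_hardyBound h hherm hE
  obtain ⟨k₀, h1⟩ := exists_VBound ξ hV hdecay (ε := 1) one_pos
  obtain ⟨B, h0⟩ := h1.exists_zero hV
  exact finite_and_isolated hsum hherm hmom hV h0 (fun ε hε => exists_VBound ξ hV hdecay hε) hδ hH

end BlockLaurent

end

end

theorem mainTheorem12 (N : ℕ) (hN : 1 ≤ N) (A : ℤ → Matrix (Fin N) (Fin N) ℂ)
    (hsum : Summable fun m : ℤ => ‖BlockLaurent.matOp (A m)‖)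
    (hherm : ∀ m : ℤ, A (-m) = (A m).conjTranspose)
    (hhol : BlockLaurent.HolomorphicSymbol A)
    (ξ : BlockLaurent.Cutoff)
    (V : BlockLaurent.Hilb N →L[ℂ] BlockLaurent.Hilb N)
    (hV : (V : BlockLaurent.Hilb N →ₗ[ℂ] BlockLaurent.Hilb N).IsSymmetric)
    (hdecay : Tendsto (fun r : ℝ => r * ‖(ξ.op N r).comp V‖) atTop (𝓝 0)) :
    (∀ E : ℝ, E ∉ BlockLaurent.criticalSet (BlockLaurent.symbol A) →
      FiniteDimensional ℂ
        (Module.End.eigenspace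
          ((BlockLaurent.laurent A + V : BlockLaurent.Hilb N →L[ℂ] BlockLaurent.Hilb N) :
            BlockLaurent.Hilb N →ₗ[ℂ] BlockLaurent.Hilb N) (E : ℂ))) ∧
    (∀ x : ℝ, AccPt x (𝓟 (BlockLaurent.pointSpectrum (BlockLaurent.laurent A + V))) →
      x ∈ BlockLaurent.criticalSet (BlockLaurent.symbol A)) := by
  have key : ∀ E : ℝ, E ∉ BlockLaurent.criticalSet (BlockLaurent.symbol A) → _ := fun E hE =>
    BlockLaurent.finite_and_isolated_of_notMem_criticalSet hsum hherm hhol ξ hV hdecay hE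
  refine ⟨fun E hE => (key E hE).1, fun x hx => ?_⟩
  by_contra hcon
  obtain ⟨-, δ, hδ, hgap⟩ := key x hcon
  obtain ⟨y, ⟨hyδ, hy⟩, hyx⟩ := accPt_iff_nhds.mp hx (Metric.ball x δ) (Metric.ball_mem_nhds x hδ)
  refine hgap (y - x) (sub_ne_zero.mpr hyx) ?_ (by rwa [add_sub_cancel])
  rwa [Metric.mem_ball, Real.dist_eq] at hyδ
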